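/- Let $n\ge 1$, $1\le k\le d$, $\alpha<-d/2$. Consider the harmonic crystal $$\ddot u(x,t)=-\sum_{y\in\mathbb Z^d}V(x-y)u(y,t),\qquad x\in\mathbb Z^d,\ u(x,t)\in\mathbb R^n,$$ in the phase space $\mathcal H_\alpha$ of pairs $Y=(u,v)$ with $\|Y\|_\alpha^2=\sum_x(1+|x|^2)^{\alpha}(|u(x)|^2+|v(x)|^2)<\infty$, where $v=\dot u$, and let $U(t)$ be its solution operator on $\mathcal H_\alpha$. Put $\hat V(\theta)=\sum_x e^{i(x,\theta)}V(x)$ for $\theta\in\mathbb T^d=\mathbb R^d/(2\pi\mathbb Z)^d$ and assume: $|V(x)|\le Ce^{-\gamma|x|}$ for some $C,\gamma>0$; $V$ is real with $V(-x)=V(x)^T$; $\hat V(\theta)\ge 0$ and $\det\hat V(\theta)\ne 0$ for all $\theta$. Let $\omega_1(\theta)\le\dots\le\omega_n(\theta)$ be the eigenvalues of $\hat V(\theta)^{1/2}$ counted with multiplicity, and let $\mathcal C_*$ be the closed null set of those $\theta$ at which the number of distinct eigenvalues is not maximal; the $\omega_j$ are real-analytic off $\mathcal C_*$. Assume that no $\partial_{\theta_l}\omega_j$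 ($1\le l\le d$, $1\le j\le n$) vanishes identically on a connected component of the complement of $\mathcal C_*$. The Gibbs measure at temperature $T>0$ is the centred Gaussian measure on $\mathcal H_\alpha$ whose correlation functions have the Fourier transforms $\hat q^{00}=T\hat V^{-1}$, $\hat q^{11}=T I$, $\hat q^{01}=\hat q^{10}=0$. For $\mathbf n=(n_1,\dots,n_k)\in\{1,2\}^k$ let $T_{\mathbf n}>0$ and let $Y_{\mathbf n}$ be independent random elements of $\mathcal H_\alpha$, $Y_{\mathbf n}$ being distributed according to the Gibbs measure at temperature $T_{\mathbf n}$. Let $a>0$ and let $\zeta_1,\zeta_2:\mathbb Z\to\mathbb R$ satisfy $\zeta_1(x)=1$, $\zeta_2(x)=0$ for $x<-a$ and $\zeta_1(x)=0$, $\zeta_2(x)=1$ for $x>a$. The initial state is $Y_0(x)=\sum_{\mathbf n}\zeta_{n_1}(x_1)\cdots\zeta_{n_k}(x_k)\,Y_{\mathbf n}(x)$, and $Y(t)=U(t)Y_0=(u(\cdot,t),\dot u(\cdot,t))$. For $x'\in\mathbb Z^d$ with $x'_l=0$ the energy current density in the direction $e_l$ of a phase point $(u,v)$ is $$J^l(x')=\tfrac12\sum_{y'\in\mathbb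 Z^d,\ y'_l=0}\Big\{\sum_{m\le -1,\,p\ge 0}-\sum_{m\ge 0,\,p\le -1}\Big\}\big(v(x'+me_l),\,V(x'+me_l-y'-pe_l)\,u(y'+pe_l)\big),$$ and $J^l(x',t)$ is its value at $Y(t)$. For $\{p_1<\dots<p_m\}\subset\{1,\dots,k\}$ put $$c^l_{p_1\dots p_m}=\frac1{(2\pi)^d}\sum_{j=1}^n\int_{\mathbb T^d}\operatorname{sgn}(\partial_{\theta_{p_1}}\omega_j)\cdots\operatorname{sgn}(\partial_{\theta_{p_m}}\omega_j)\,\partial_{\theta_l}\omega_j\,d\theta ,$$ $$J^l_\infty=-\frac1{2^k}\sum_{\mathbf n\in\{1,2\}^k}T_{\mathbf n}\sum_{m\ \mathrm{odd}}\ \sum_{1\le p_1<\dots<p_m\le k}c^l_{p_1\dots p_m}(-1)^{n_{p_1}+\dots+n_{p_m}},\qquad l=1,\dots,d.$$ (i) For every $l$ and every $x'$ with $x'_l=0$, $J^l(x',t)$ is integrable for all $t$, and $\mathbb E\,J^l(x',t)\to J^l_\infty$ as $t\to+\infty$ (the limit does not depend on $x'$). (ii) As $t\to+\infty$ the distribution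 of $Y(t)$ converges weakly on $\mathcal H_\alpha$ to a Gaussian measure $\mu_\infty$, which is stationary, i.e. invariant under $U(t)$ for all $t\in\mathbb R$, and $J^l(x')$ is $\mu_\infty$-integrable with mean $J^l_\infty$, for all $l$ and all $x'$ with $x'_l=0$. (iii) Assume in addition that one of the following conditions SC holds: (a) each $\omega_j$ is even in every variable $\theta_{k+1},\dots,\theta_d$ and, if $k\ge2$, even in some $k-1$ of the variables $\theta_1,\dots,\theta_k$; (b) each $\omega_j$ is even in every variable $\theta_1,\dots,\theta_k$; (c) off $\mathcal C_*$, for every $p\le k$ and every $j$, $\operatorname{sgn}(\partial_{\theta_p}\omega_j(\theta))$ depends only on $\theta_p$ and, if $k\ge3$, each $\omega_j$ is even in some $k-1$ of the variables $\theta_1,\dots,\theta_k$. Then for $l\le k$ $$J^l_\infty=-c_l\,\frac1{2^k}\,{\sum}'\big(T_{\mathbf n}|_{n_l=2}-T_{\mathbf n}|_{n_l=1}\big),\qquad c_l=\frac1{(2\pi)^d}\sum_{j=1}^n\int_{\mathbb T^d}|\partial_{\theta_l}\omega_j|\,d\theta>0,$$ where $\sum'$ runs over all $n_i\in\{1,2\}$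 with $i\ne l$, and $J^l_\infty=0$ for $l>k$. In particular, for $l\le k$ the current $J^l_\infty$ is nonzero and directed from the hotter to the colder side as soon as $\sum'T_{\mathbf n}|_{n_l=1}\ne\sum'T_{\mathbf n}|_{n_l=2}$: it is negative if $\sum'T_{\mathbf n}|_{n_l=1}<\sum'T_{\mathbf n}|_{n_l=2}$ and positive if $\sum'T_{\mathbf n}|_{n_l=1}>\sum'T_{\mathbf n}|_{n_l=2}$. -/

import Mathlib

open MeasureTheory ProbabilityTheory Filter Topology

open scoped ComplexOrder

noncomputable section

namespace HarmonicCrystal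

/-! ### The phase space -/

/-- The lattice `ℤ^d`. -/
abbrev Lattice (d : ℕ) : Type := Fin d → ℤ

/-- The space `ℝ^n` (Euclidean) of displacements, respectively velocities, at one site. -/
abbrev Site (n : ℕ) : Type := EuclideanSpace ℝ (Fin n)

/-- Euclidean length `|x|` of a lattice point. -/
def len {d : ℕ} (x : Lattice d) : ℝ := √(∑ i, (x i : ℝ) ^ 2)

/-- The weight `⟨x⟩ = √(1 + |x|²)`. -/
def jap {d : ℕ} (x : Lattice d) : ℝ := √(1 + ∑ i, (x i : ℝ) ^ 2)

lemma jap_pos {d : ℕ} (x : Lattice d) : 0 < jap x :=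
  Real.sqrt_pos.mpr (by positivity)

/-- The configuration `Y = (u, v)` multiplied by `⟨x⟩^α`, with values in the Hilbert space
`ℝ^n ⊕ ℝ^n`. -/
def weighted {d n : ℕ} (α : ℝ) (Y : Lattice d → Site n × Site n) (x : Lattice d) :
    WithLp 2 (Site n × Site n) :=
  jap x ^ α • WithLp.toLp 2 (Y x)

lemma norm_weighted_sq {d n : ℕ} (α : ℝ) (Y : Lattice d → Site n × Site n) (x : Lattice d) :
    ‖weighted α Y x‖ ^ 2 = jap x ^ (2 * α) * (‖(Y x).1‖ ^ 2 + ‖(Y x).2‖ ^ 2) := by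
  rw [weighted, norm_smul, mul_pow, WithLp.prod_norm_sq_eq_of_L2, Real.norm_eq_abs, sq_abs,
    mul_comm 2 α, Real.rpow_mul (jap_pos x).le]
  norm_num

lemma memLp_weighted_iff {d n : ℕ} (α : ℝ) (Y : Lattice d → Site n × Site n) :
    Memℓp (weighted α Y) 2 ↔
      Summable fun x => jap x ^ (2 * α) * (‖(Y x).1‖ ^ 2 + ‖(Y x).2‖ ^ 2) := by
  rw [memℓp_gen_iff (by norm_num)]
  simp [← norm_weighted_sq]

/-- The linear space of the pairs `Y = (u, v)` of `ℝ^n`-valued functions on `ℤ^d` with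
`∑ ⟨x⟩^{2α} (|u(x)|² + |v(x)|²) < ∞`. -/
def phaseSubmodule (d n : ℕ) (α : ℝ) : Submodule ℝ (Lattice d → Site n × Site n) where
  carrier := {Y | Summable fun x => jap x ^ (2 * α) * (‖(Y x).1‖ ^ 2 + ‖(Y x).2‖ ^ 2)}
  add_mem' := by
    intro Y Z hY hZ
    rw [Set.mem_ofPred_eq, ← memLp_weighted_iff] at hY hZ ⊢
    have h : weighted α (Y + Z) = weighted α Y + weighted α Z := by
      funext x; simp [weighted]
    rw [h]; exact hY.add hZ
  zero_mem' := by simp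
  smul_mem' := by
    intro c Y hY
    rw [Set.mem_ofPred_eq, ← memLp_weighted_iff] at hY ⊢
    have h : weighted α (c • Y) = c • weighted α Y := by
      funext x; simp [weighted, smul_comm c]
    rw [h]; exact hY.const_smul c

/-- The phase space `H_α`; a type of its own, so that it carries the weighted `ℓ²` norm below and
not the topology of pointwise convergence. -/
def PhaseSpace (d n : ℕ) (α : ℝ) : Type := ↥(phaseSubmodule d n α)

variable {d n : ℕ} {α : ℝ}

instance : AddCommGroup (PhaseSpace d n α) := inferInstanceAs (AddCommGroup ↥(phaseSubmodule d n α))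

instance : Module ℝ (PhaseSpace d n α) := inferInstanceAs (Module ℝ ↥(phaseSubmodule d n α))

/-- The displacement `u(x)` of a phase point `Y = (u, v)`. -/
def PhaseSpace.u (Y : PhaseSpace d n α) (x : Lattice d) : Site n := (Y.1 x).1

/-- The velocity `v(x)` of a phase point `Y = (u, v)`. -/
def PhaseSpace.v (Y : PhaseSpace d n α) (x : Lattice d) : Site n := (Y.1 x).2

/-- The embedding `Y ↦ ⟨x⟩^α Y(x)` of `H_α` into `ℓ²`. -/
def PhaseSpace.toL2 :
    PhaseSpace d n α →ₗ[ℝ] lp (fun _ : Lattice d => WithLp 2 (Site n × Site n)) 2 where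
  toFun Y := ⟨weighted α Y.1, (memLp_weighted_iff α Y.1).mpr Y.2⟩
  map_add' Y Z := by
    apply Subtype.ext; funext x
    exact smul_add (jap x ^ α) (WithLp.toLp 2 (Y.1 x)) (WithLp.toLp 2 (Z.1 x))
  map_smul' c Y := by
    apply Subtype.ext; funext x
    exact smul_comm (jap x ^ α) c (WithLp.toLp 2 (Y.1 x))

lemma PhaseSpace.toL2_injective :
    Function.Injective (PhaseSpace.toL2 : PhaseSpace d n α →ₗ[ℝ] _) := by
  intro Y Z h
  apply Subtype.ext; funext x
  have hx : weighted α Y.1 x = weighted α Z.1 x := congrFun (congrArg Subtype.val h) x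
  have hne : jap x ^ α ≠ 0 := (Real.rpow_pos_of_pos (jap_pos x) α).ne'
  exact WithLp.toLp_injective 2 (smul_right_injective _ hne hx)

instance : NormedAddCommGroup (PhaseSpace d n α) :=
  NormedAddCommGroup.induced _ _ PhaseSpace.toL2 PhaseSpace.toL2_injective

instance : NormedSpace ℝ (PhaseSpace d n α) :=
  NormedSpace.induced ℝ _ _ PhaseSpace.toL2

instance : MeasurableSpace (PhaseSpace d n α) := borel _

instance : BorelSpace (PhaseSpace d n α) := ⟨rfl⟩

/-- The norm of `H_α` is the weighted `ℓ²` norm. -/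
lemma PhaseSpace.norm_sq (Y : PhaseSpace d n α) :
    ‖Y‖ ^ 2 = ∑' x, jap x ^ (2 * α) * (‖Y.u x‖ ^ 2 + ‖Y.v x‖ ^ 2) := by
  have h := lp.norm_rpow_eq_tsum (p := 2) (by norm_num) (PhaseSpace.toL2 Y)
  have h' : ‖PhaseSpace.toL2 Y‖ ^ 2 = ∑' x, ‖weighted α Y.1 x‖ ^ 2 := by
    simp only [ENNReal.toReal_ofNat, Real.rpow_ofNat] at h
    exact h
  rw [show ‖Y‖ = ‖PhaseSpace.toL2 Y‖ from rfl, h']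
  exact tsum_congr fun x => norm_weighted_sq α Y.1 x

/-! ### The dynamics -/

/-- `Y ∈ C(ℝ, H_α)` solves `u̇ = v`, `v̇(x) = -∑_y V(x - y) u(y)`, `Y(0) = Y₀`. -/
def IsSolution (V : Lattice d → Matrix (Fin n) (Fin n) ℝ) (Y₀ : PhaseSpace d n α)
    (Y : ℝ → PhaseSpace d n α) : Prop :=
  Continuous Y ∧ Y 0 = Y₀ ∧ ∀ t x,
    HasDerivAt (fun s => (Y s).u x) ((Y t).v x) t ∧
    HasDerivAt (fun s => (Y s).v x)
      (-∑' y, Matrix.toEuclideanLin (V (x - y)) ((Y t).u y)) t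

open Classical in
/-- The solution operator `U(t) : Y₀ ↦ Y(t)` on `H_α`. -/
def flow (V : Lattice d → Matrix (Fin n) (Fin n) ℝ) (t : ℝ) (Y₀ : PhaseSpace d n α) :
    PhaseSpace d n α :=
  if h : ∃ Y, IsSolution V Y₀ Y then h.choose t else 0

/-! ### The interaction matrix and its dispersion relations -/

/-- The dual variable times a lattice point, `(x, θ)`. -/
def pair (x : Lattice d) (θ : Fin d → ℝ) : ℝ := ∑ i, (x i : ℝ) * θ i

/-- `V̂(θ) = ∑_x e^{i(x,θ)} V(x)`. -/
def Vhat (V : Lattice d → Matrix (Fin n) (Fin n) ℝ) (θ : Fin d → ℝ) :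
    Matrix (Fin n) (Fin n) ℂ :=
  Matrix.of fun a b => ∑' x, Complex.exp (Complex.I * (pair x θ : ℂ)) * (V x a b : ℂ)

/-- A fundamental domain of the torus `ℝ^d / (2πℤ)^d`; functions on the torus are
`2π`-periodic functions on `ℝ^d`. -/
def torus (d : ℕ) : Set (Fin d → ℝ) := Set.univ.pi fun _ => Set.Ioc (-Real.pi) Real.pi

open Classical in
/-- The dispersion relations `ω_1(θ) ≤ … ≤ ω_n(θ)`: the eigenvalues of `Ω(θ) = V̂(θ)^{1/2}` in
increasing order, each repeated according to its multiplicity. -/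
def freq (V : Lattice d → Matrix (Fin n) (Fin n) ℝ) (j : Fin n) (θ : Fin d → ℝ) : ℝ :=
  if h : (Vhat V θ).IsHermitian then
    √(h.eigenvalues₀ (Fin.rev (Fin.cast (Fintype.card_fin n).symm j)))
  else 0

/-- The partial derivative `∂f/∂θ_l`. -/
def pderiv (l : Fin d) (f : (Fin d → ℝ) → ℝ) (θ : Fin d → ℝ) : ℝ :=
  deriv (fun s => f (Function.update θ l s)) (θ l)

/-- The number of distinct eigenvalues of `Ω(θ)`. -/
def numBands (V : Lattice d → Matrix (Fin n) (Fin n) ℝ) (θ : Fin d → ℝ) : ℕ :=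
  (Finset.univ.image fun j => freq V j θ).card

/-- The crossing set `C_*`: the points where the number of distinct eigenvalues of `Ω(θ)` is not
maximal. -/
def crossingSet (V : Lattice d → Matrix (Fin n) (Fin n) ℝ) : Set (Fin d → ℝ) :=
  {θ | ∃ θ', numBands V θ < numBands V θ'}

/-- The conditions on the interaction matrix. -/
structure Admissible (V : Lattice d → Matrix (Fin n) (Fin n) ℝ) : Prop where
  /-- E1 -/
  decay : ∃ C > 0, ∃ γ > 0, ∀ x a b, |V x a b| ≤ C * Real.exp (-γ * len x)
  /-- E2 -/
  symm : ∀ x, V (-x) = (V x).transpose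
  /-- E3 -/
  nonneg : ∀ θ, (Vhat V θ).PosSemidef
  /-- E4: no `∂ω_j/∂θ_l` vanishes identically on a connected component of the complement of the
  crossing set (the `ω_j` are real-analytic there). -/
  dispersive : ∀ l j, ∀ θ₀ ∈ (crossingSet V)ᶜ,
    ∃ θ ∈ connectedComponentIn (crossingSet V)ᶜ θ₀, pderiv l (freq V j) θ ≠ 0
  /-- `det V̂(θ) ≠ 0` everywhere. -/
  det_ne_zero : ∀ θ, (Vhat V θ).det ≠ 0

/-! ### Gibbs measures and the initial state -/

/-- `F^{-1}[V̂^{-1}](z) = (2π)^{-d} ∫ e^{-i(z,θ)} V̂(θ)^{-1} dθ`. -/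
def invVhatKernel (V : Lattice d → Matrix (Fin n) (Fin n) ℝ) (z : Lattice d) (a b : Fin n) : ℂ :=
  ((2 * Real.pi) ^ d : ℂ)⁻¹ *
    ∫ θ in torus d, Complex.exp (-(Complex.I * (pair z θ : ℂ))) * (Vhat V θ)⁻¹ a b

/-- The Gibbs measure at temperature `T`: the Gaussian probability measure on `H_α` with zero mean
whose correlation matrices have the Fourier transforms `q̂^{00} = T V̂^{-1}`, `q̂^{11} = T I`,
`q̂^{01} = q̂^{10} = 0`. -/
structure IsGibbs (V : Lattice d → Matrix (Fin n) (Fin n) ℝ) (T : ℝ)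
    (μ : Measure (PhaseSpace d n α)) : Prop where
  isProb : IsProbabilityMeasure μ
  gaussian : IsGaussian μ
  mean_u : ∀ x a, ∫ Y, Y.u x a ∂μ = 0
  mean_v : ∀ x a, ∫ Y, Y.v x a ∂μ = 0
  corr_uu : ∀ x y a b, ((∫ Y, Y.u x a * Y.u y b ∂μ : ℝ) : ℂ) = T * invVhatKernel V (x - y) a b
  corr_vv : ∀ x y a b, ∫ Y, Y.v x a * Y.v y b ∂μ = if x = y ∧ a = b then T else 0
  corr_uv : ∀ x y a b, ∫ Y, Y.u x a * Y.v y b ∂μ = 0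

/-- The index set `N^k` of the reservoirs; the values `0` and `1` of a component stand for
`n_j = 1` and `n_j = 2`. -/
abbrev Corner (k : ℕ) : Type := Fin k → Fin 2

/-- `(-1)^{n_j}` for `n_j ∈ {1, 2}`. -/
def cornerSign (i : Fin 2) : ℝ := (-1) ^ ((i : ℕ) + 1)

/-- The cut-off sequences `ζ_1, ζ_2` on `ℤ` (indexed by `0, 1`). -/
structure IsCutoff (a : ℝ) (ζ : Fin 2 → ℤ → ℝ) : Prop where
  left_one : ∀ x : ℤ, (x : ℝ) < -a → ζ 0 x = 1
  left_zero : ∀ x : ℤ, a < (x : ℝ) → ζ 0 x = 0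
  right_one : ∀ x : ℤ, a < (x : ℝ) → ζ 1 x = 1
  right_zero : ∀ x : ℤ, (x : ℝ) < -a → ζ 1 x = 0

/-- `ζ_n(x_1, …, x_k) = ζ_{n_1}(x_1) ⋯ ζ_{n_k}(x_k)`. -/
def cutoffProd {k : ℕ} (hk : k ≤ d) (ζ : Fin 2 → ℤ → ℝ) (c : Corner k) (x : Lattice d) : ℝ :=
  ∏ i, ζ (c i) (x (Fin.castLE hk i))

/-! ### The energy current -/

open Classical in
/-- The energy current density `J^l(x')` in the direction `e_l` at a point `x'` with `x'_l = 0`: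
half of the sum over `y ∈ ℤ^d` and `m ∈ ℤ` of `(v(x'+m e_l), V(x'+m e_l-y) u(y))` over
`m ≤ -1, y_l ≥ 0`, minus the same sum over `m ≥ 0, y_l ≤ -1`. -/
def current (V : Lattice d → Matrix (Fin n) (Fin n) ℝ) (l : Fin d) (x' : Lattice d)
    (Y : PhaseSpace d n α) : ℝ :=
  let term : ℤ × Lattice d → ℝ := fun q =>
    inner ℝ (Y.v (x' + Pi.single l q.1))
      (Matrix.toEuclideanLin (V (x' + Pi.single l q.1 - q.2)) (Y.u q.2))
  1 / 2 * ((∑' q : ℤ × Lattice d, if q.1 ≤ -1 ∧ 0 ≤ q.2 l then term q else 0) -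
    ∑' q : ℤ × Lattice d, if 0 ≤ q.1 ∧ q.2 l ≤ -1 then term q else 0)

/-- The coefficient `c^l_{p_1 … p_m}` for the combination `P = {p_1, …, p_m}` of `{1, …, k}`. -/
def coeff {k : ℕ} (hk : k ≤ d) (V : Lattice d → Matrix (Fin n) (Fin n) ℝ) (l : Fin d)
    (P : Finset (Fin k)) : ℝ :=
  ((2 * Real.pi) ^ d)⁻¹ * ∑ j, ∫ θ in torus d,
    (∏ p ∈ P, Real.sign (pderiv (Fin.castLE hk p) (freq V j) θ)) * pderiv l (freq V j) θ

/-- The limiting current `J^l_∞ = -2^{-k} ∑_n T_n ∑_{m odd} ∑_{p_1 < … < p_m}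
c^l_{p_1 … p_m} (-1)^{n_{p_1} + … + n_{p_m}}`. -/
def limitCurrent {k : ℕ} (hk : k ≤ d) (V : Lattice d → Matrix (Fin n) (Fin n) ℝ)
    (T : Corner k → ℝ) (l : Fin d) : ℝ :=
  -((2 : ℝ) ^ k)⁻¹ * ∑ c : Corner k, T c *
    ∑ P : Finset (Fin k) with Odd P.card, coeff hk V l P * ∏ p ∈ P, cornerSign (c p)

/-- `c_l = (2π)^{-d} ∑_j ∫ |∂ω_j/∂θ_l| dθ`. -/
def coeffDiag (V : Lattice d → Matrix (Fin n) (Fin n) ℝ) (l : Fin d) : ℝ :=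
  ((2 * Real.pi) ^ d)⁻¹ * ∑ j, ∫ θ in torus d, |pderiv l (freq V j) θ|

/-- `∑' T_n|_{n_l = i}`: the sum over all `n_j ∈ {1, 2}` with `j ≠ l`, while `n_l` is fixed. -/
def faceSum {k : ℕ} (T : Corner k → ℝ) (l : Fin k) (i : Fin 2) : ℝ :=
  ∑ c : Corner k with c l = i, T c

/-! ### The symmetry conditions -/

/-- `f` is even in the variable `θ_i`. -/
def EvenIn (f : (Fin d → ℝ) → ℝ) (i : Fin d) : Prop :=
  ∀ θ, f (Function.update θ i (-θ i)) = f θ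

/-- `f` is even in some `k - 1` of the variables `θ_1, …, θ_k`. -/
def EvenInAllButOne {k : ℕ} (hk : k ≤ d) (f : (Fin d → ℝ) → ℝ) : Prop :=
  ∃ i₀ : Fin k, ∀ i : Fin k, i ≠ i₀ → EvenIn f (Fin.castLE hk i)

/-- The symmetry conditions SC: one of (a), (b), (c) holds. -/
def SymmetryConditions {k : ℕ} (hk : k ≤ d) (V : Lattice d → Matrix (Fin n) (Fin n) ℝ) : Prop :=
  (∀ j, (∀ i : Fin d, k ≤ (i : ℕ) → EvenIn (freq V j) i) ∧
    (2 ≤ k → EvenInAllButOne hk (freq V j))) ∨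
  (∀ j, ∀ i : Fin k, EvenIn (freq V j) (Fin.castLE hk i)) ∨
  (∀ j, (∀ p : Fin k, ∃ g : ℝ → ℝ, ∀ θ ∈ (crossingSet V)ᶜ,
      Real.sign (pderiv (Fin.castLE hk p) (freq V j) θ) = g (θ (Fin.castLE hk p))) ∧
    (3 ≤ k → EvenInAllButOne hk (freq V j)))

end HarmonicCrystal

end

/-! Everything is decided by second moments. The dynamics is linear with a bounded generator and the
reservoirs are independent centred Gaussians, so the evolved state is centred Gaussian and is
described by the numbers E[L(U(t)Y₀) L'(U(t)Y₀)] for continuous functionals L, L'. Since α < -d/2,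
bounded configurations lie in H_α; hence a functional has ℓ¹ coefficients and a continuous Fourier
transform, and testing L ∘ U(t) on plane waves shows that this transform splits into normal modes
which are merely multiplied by e^{±itω_j(θ)} (`hat_propagator`). The mechanism is ballistic
transport. For a packet with Fourier transform e^{itω}g, the law of z_i/t under the squared
coefficients tends to the law of -∂_iω under |g|²: by Parseval its characteristic function is an
integral whose phase is a difference quotient of ω. So the cut-off to a corner acts asymptotically,
in L², as the indicator of the quasi-momenta whose velocity points into the corner
(`tendsto_cutoffProd`). No stationary phase estimate is needed, only differentiability of ω almost
everywhere. Moreover, distinct modes are orthogonal for the Gibbs form V̂⁻¹ ⊕ 1, so the selected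
modes have no oscillating cross terms at all (`gibbsForm_bandPart`, `gibbsForm_wavePart`) and the
covariance converges (`tendsto_integral_gibbsForm`). The spectral input is that ω_j is analytic off
a closed null set. The number of distinct eigenvalues is read off from Hankel determinants of the
power sums tr V̂(θ)^m, which are analytic. Where that number is maximal, multiplicities are locally
constant, and ω_j² is a simple root of a suitable derivative of the characteristic polynomial
(`Admissible.analyticAt_freq_sq`). Hence each ∂_lω_j vanishes only on a null set. Weak convergence
follows from pointwise convergence of the Gaussian characteristic functionals together with
tightness, which comes from uniform second moments and the compact embedding of H_β into H_α for α <
β < -d/2. The mean current is a sum over bonds of V against the velocity-displacement covariance.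
Bonds with displacement z, counted with the direction of crossing, number -z_l; the factor z_l turns
V̂ into ∂_lV̂, and the Hellmann–Feynman identity `Admissible.trace_dVhat_mul_bandProj` converts the
trace against the spectral projection into ∂_lω_j. The difference of the velocity indicators of the
modes +ω_j and -ω_j expands into the odd products of signs that appear in J_∞. Under SC only the set
{l} contributes: another odd set gives an integrand that is odd under a reflection, or one in which
a factor independent of θ_l multiplies a pure θ_l-derivative. -/

noncomputable section

namespace HarmonicCrystal

section

/-! ### Zero sets of real-analytic functions -/

section AnalyticNull

variable {F : Type*} [NormedAddCommGroup F] [NormedSpace ℝ F] [FiniteDimensional ℝ F]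
  [MeasurableSpace F] [BorelSpace F] (μ : Measure F) [μ.IsAddHaarMeasure]

/-- A set which meets every ray through the origin in a null set of parameters is null. -/
lemma measure_eq_zero_of_rays {E : Set F} (hE : MeasurableSet E)
    (h : ∀ x : F, volume {r : ℝ | r • x ∈ E} = 0) : μ E = 0 := by
  have hS : MeasurableSet {q : F × ℝ | q.2 • q.1 ∈ E} :=
    hE.preimage (by fun_prop : Measurable fun q : F × ℝ => q.2 • q.1)
  -- Fubini in both orders: the pairs `(x, r)` with `r • x ∈ E` form a null set, so some single `r ≠
  -- 0` has `r • x ∉ E` for almost all `x`, and dilation by `r` only rescales the measure.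
  have h1 : (μ.prod volume) {q : F × ℝ | q.2 • q.1 ∈ E} = 0 :=
    (Measure.measure_prod_null hS).2 (ae_of_all _ fun x => h x)
  rw [← Measure.prod_swap, Measure.map_apply measurable_swap hS] at h1
  have h2 := Measure.ae_ae_of_ae_prod (measure_eq_zero_iff_ae_notMem.1 h1)
  have h3 : ∀ᵐ r : ℝ ∂volume, r ≠ 0 := by simp [ae_iff]
  obtain ⟨r, hr, hr0⟩ := (h2.and h3).exists
  have h4 : μ ((fun x => r • x) ⁻¹' E) = 0 := by
    rw [measure_eq_zero_iff_ae_notMem]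
    filter_upwards [hr] with x hx using hx
  rw [Measure.addHaar_preimage_smul μ hr0] at h4
  have h5 : ENNReal.ofReal |(r ^ Module.finrank ℝ F)⁻¹| ≠ 0 := by
    rw [ne_eq, ENNReal.ofReal_eq_zero, not_le]; positivity
  exact (mul_eq_zero.1 h4).resolve_left h5

lemma measurableSet_inter_zero {F : Type*} [TopologicalSpace F] [MeasurableSpace F] [BorelSpace F]
    {f : F → ℝ} {U : Set F} (hU : IsOpen U) (hf : ContinuousOn f U) :
    MeasurableSet (U ∩ f ⁻¹' {0}) := by
  have h : U ∩ f ⁻¹' {0} = U \ (U ∩ f ⁻¹' {0}ᶜ) := by ext; simp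
  rw [h]
  exact hU.measurableSet.diff (hf.isOpen_inter_preimage hU isOpen_compl_singleton).measurableSet

/-- On each line through `p` the function is analytic in one variable, on an interval by convexity,
and nonzero at `p`; its zeros there are isolated, hence null. Moving `p` to the origin turns these
lines into the rays of `measure_eq_zero_of_rays`. -/
lemma measure_zeros_of_convex {f : F → ℝ} {B : Set F} (hB : IsOpen B) (hc : Convex ℝ B)
    (hf : AnalyticOnNhd ℝ f B) {p : F} (hp : p ∈ B) (hfp : f p ≠ 0) :
    μ (B ∩ f ⁻¹' {0}) = 0 := by
  have hm := measurableSet_inter_zero hB hf.continuousOn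
  rw [← measure_preimage_add μ p]
  refine measure_eq_zero_of_rays μ (hm.preimage (by fun_prop)) fun x => ?_
  let J : Set ℝ := (fun s : ℝ => p + s • x) ⁻¹' B
  have hJ : IsPreconnected J := by
    have : Convex ℝ J := by
      intro a ha b hb s t hs ht hst
      have := hc ha hb hs ht hst
      show p + (s • a + t • b) • x ∈ B
      convert! this using 1
      rw [smul_add, smul_add, add_add_add_comm, ← add_smul, hst, one_smul, add_smul, smul_assoc,
        smul_assoc]
    exact this.isPreconnected
  have hg : AnalyticOnNhd ℝ (fun s : ℝ => f (p + s • x)) J := fun s hs =>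
    (hf _ hs).comp (f := fun s : ℝ => p + s • x) (by fun_prop)
  have h0 : (0 : ℝ) ∈ J := by simpa [J] using hp
  refine measure_null_of_locally_null _ fun s hs => ?_
  have hsJ : s ∈ J := hs.1
  refine ⟨{s}, ?_, by simp⟩
  rcases (hg s hsJ).eventually_eq_zero_or_eventually_ne_zero with h | h
  · exact absurd (hg.eqOn_zero_of_preconnected_of_eventuallyEq_zero hJ hsJ h h0)
      (by simpa using hfp)
  · rw [eventually_nhdsWithin_iff] at h
    rw [mem_nhdsWithin_iff_eventually]
    filter_upwards [h] with r hr hr'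
    by_contra hne
    exact hr hne hr'.2

/-- The zero set of a real-analytic function, which is not identically zero, is null. -/
theorem measure_zeros_of_analyticOnNhd {f : F → ℝ} {U : Set F} (hU : IsOpen U)
    (hc : IsPreconnected U) (hf : AnalyticOnNhd ℝ f U) {p : F} (hp : p ∈ U) (hfp : f p ≠ 0) :
    μ (U ∩ f ⁻¹' {0}) = 0 := by
  refine measure_null_of_locally_null _ fun q hq => ?_
  obtain ⟨r, hr, hrU⟩ := Metric.isOpen_iff.1 hU q hq.1
  -- By the identity theorem `f` is not identically zero on any ball inside the connected set `U`,
  -- so the convex case applies ball by ball.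
  have hne : ∃ p' ∈ Metric.ball q r, f p' ≠ 0 := by
    by_contra! hcon
    exact hfp (hf.eqOn_zero_of_preconnected_of_eventuallyEq_zero hc hq.1
      (Filter.eventually_of_mem (Metric.ball_mem_nhds q hr) hcon) hp)
  obtain ⟨p', hp', hfp'⟩ := hne
  refine ⟨Metric.ball q r ∩ f ⁻¹' {0}, ?_, measure_zeros_of_convex μ Metric.isOpen_ball
    (convex_ball q r) (hf.mono hrU) hp' hfp'⟩
  rw [mem_nhdsWithin_iff_eventually]
  filter_upwards [Metric.ball_mem_nhds q hr] with y hy hyU using ⟨hy, hyU.2⟩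

end AnalyticNull

end

section

/-! ### Eigenvalues and spectral projections of Hermitian matrices -/

section Hermitian

open Matrix

variable {n : ℕ}

/-- The eigenvalues of a Hermitian matrix in increasing order. -/
def sortedEig {H : Matrix (Fin n) (Fin n) ℂ} (hH : H.IsHermitian) (j : Fin n) : ℝ :=
  hH.eigenvalues₀ (Fin.rev (Fin.cast (Fintype.card_fin n).symm j))

lemma sortedEig_monotone {H : Matrix (Fin n) (Fin n) ℂ} (hH : H.IsHermitian) :
    Monotone (sortedEig hH) := fun i j hij =>
  hH.eigenvalues₀_antitone (Fin.rev_le_rev.2 (by simpa using hij))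

/-- `U` is unitary and `H = U diag(μ) U*`. -/
structure Diagonalizes (U H : Matrix (Fin n) (Fin n) ℂ) (μ : Fin n → ℝ) : Prop where
  left : Uᴴ * U = 1
  right : U * Uᴴ = 1
  eq : H = U * diagonal (fun i => (μ i : ℂ)) * Uᴴ

/-- The spectral theorem with the eigenvector columns permuted by `σ`, so that the diagonal is
increasing and independent of how the eigenvectors happen to be indexed. -/
lemma exists_diagonalizes {H : Matrix (Fin n) (Fin n) ℂ} (hH : H.IsHermitian) :
    ∃ U, Diagonalizes U H (sortedEig hH) := by
  let σ : Fin n ≃ Fin n := (finCongr (Fintype.card_fin n).symm).trans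
    (Fin.revPerm.trans (Fintype.equivOfCardEq (Fintype.card_fin _)))
  have hσ : ∀ j, hH.eigenvalues (σ j) = sortedEig hH j := fun j => by
    simp [σ, IsHermitian.eigenvalues, sortedEig]
  let W : Matrix (Fin n) (Fin n) ℂ := hH.eigenvectorUnitary
  have hW1 : Wᴴ * W = 1 := Unitary.coe_star_mul_self hH.eigenvectorUnitary
  have hW2 : W * Wᴴ = 1 := Unitary.coe_mul_star_self hH.eigenvectorUnitary
  refine ⟨W.submatrix id σ, ?_, ?_, ?_⟩
  · rw [conjTranspose_submatrix, ← submatrix_mul _ _ σ id σ Function.bijective_id, hW1,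
      submatrix_one_equiv]
  · rw [conjTranspose_submatrix, submatrix_mul_equiv, hW2, submatrix_id_id]
  · have h1 := hH.spectral_theorem
    rw [Unitary.conjStarAlgAut_apply] at h1
    have h2 : diagonal (fun i => (sortedEig hH i : ℂ)) =
        (diagonal (RCLike.ofReal ∘ hH.eigenvalues : Fin n → ℂ)).submatrix σ σ := by
      rw [submatrix_diagonal_equiv]
      congr 1; funext i; simp [hσ]
    rw [h2, conjTranspose_submatrix, submatrix_mul_equiv, submatrix_mul_equiv, submatrix_id_id]
    exact h1

lemma star_vecMul_eq (U : Matrix (Fin n) (Fin n) ℂ) (w : Fin n → ℂ) :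
    star w ᵥ* U = star (Uᴴ *ᵥ w) := by
  rw [star_mulVec, conjTranspose_conjTranspose]

namespace Diagonalizes

variable {U H : Matrix (Fin n) (Fin n) ℂ} {μ : Fin n → ℝ}

lemma conj_mul_conj (h : Diagonalizes U H μ) (A B : Matrix (Fin n) (Fin n) ℂ) :
    (U * A * Uᴴ) * (U * B * Uᴴ) = U * (A * B) * Uᴴ := by
  calc _ = U * A * (Uᴴ * U) * B * Uᴴ := by simp only [Matrix.mul_assoc]
    _ = _ := by rw [h.left]; simp only [Matrix.mul_assoc, Matrix.mul_one]

lemma quadratic (h : Diagonalizes U H μ) (w : Fin n → ℂ) :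
    (star w ⬝ᵥ (H *ᵥ w)).re = ∑ l, μ l * ‖(Uᴴ *ᵥ w) l‖ ^ 2 := by
  rw [h.eq, ← mulVec_mulVec, ← mulVec_mulVec, dotProduct_mulVec, star_vecMul_eq,
    dotProduct, Complex.re_sum]
  refine Finset.sum_congr rfl fun l _ => ?_
  rw [mulVec_diagonal, Pi.star_apply, mul_left_comm, Complex.star_def, ← Complex.normSq_eq_conj_mul_self,
    Complex.normSq_eq_norm_sq, ← Complex.ofReal_mul, Complex.ofReal_re]

lemma norm_sq (h : Diagonalizes U H μ) (w : Fin n → ℂ) :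
    ∑ l, ‖(Uᴴ *ᵥ w) l‖ ^ 2 = ∑ l, ‖w l‖ ^ 2 := by
  have h1 : ∀ v : Fin n → ℂ, ((∑ l, ‖v l‖ ^ 2 : ℝ) : ℂ) = star v ⬝ᵥ v := fun v => by
    rw [dotProduct, Complex.ofReal_sum]
    refine Finset.sum_congr rfl fun l _ => ?_
    rw [Pi.star_apply, Complex.star_def, ← Complex.normSq_eq_conj_mul_self, Complex.normSq_eq_norm_sq]
  have h2 : ((∑ l, ‖(Uᴴ *ᵥ w) l‖ ^ 2 : ℝ) : ℂ) = ((∑ l, ‖w l‖ ^ 2 : ℝ) : ℂ) := by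
    rw [h1, h1, ← star_vecMul_eq, ← dotProduct_mulVec, mulVec_mulVec, h.right, one_mulVec]
  exact_mod_cast h2

end Diagonalizes

/-- Weyl's perturbation inequality. -/
lemma sortedEig_le_add {A B : Matrix (Fin n) (Fin n) ℂ} (hA : A.IsHermitian) (hB : B.IsHermitian)
    {ε : ℝ} (h : ∀ w : Fin n → ℂ, (star w ⬝ᵥ ((A - B) *ᵥ w)).re ≤ ε * ∑ l, ‖w l‖ ^ 2)
    (j : Fin n) : sortedEig hA j ≤ sortedEig hB j + ε := by
  obtain ⟨U, hU⟩ := exists_diagonalizes hA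
  obtain ⟨W, hW⟩ := exists_diagonalizes hB
  -- The rows of `M` encode orthogonality to the eigenvectors of `A` below `j` and to those of `B`
  -- above `j`. These are `n - 1` conditions, the row `j` being zero, so `M` is singular and a
  -- nonzero `w` satisfies them all; on it the two quadratic forms are comparable with the `j`-th
  -- eigenvalues.
  let M : Matrix (Fin n) (Fin n) ℂ := fun l =>
    if l < j then Uᴴ l else if j < l then Wᴴ l else 0
  have hM : M.det = 0 := det_eq_zero_of_row_eq_zero j fun a => by simp [M]
  obtain ⟨w, hw0, hw⟩ := exists_mulVec_eq_zero_iff.2 hM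
  have hwU : ∀ l < j, (Uᴴ *ᵥ w) l = 0 := fun l hl => by
    have := congrFun hw l
    simpa [M, mulVec, hl] using this
  have hwW : ∀ l, j < l → (Wᴴ *ᵥ w) l = 0 := fun l hl => by
    have := congrFun hw l
    simpa [M, mulVec, hl, hl.le, not_lt.2 hl.le] using this
  have h1 : sortedEig hA j * ∑ l, ‖w l‖ ^ 2 ≤ (star w ⬝ᵥ (A *ᵥ w)).re := by
    rw [hU.quadratic, ← hU.norm_sq, Finset.mul_sum]
    refine Finset.sum_le_sum fun l _ => ?_
    rcases lt_or_ge l j with hl | hl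
    · simp [hwU l hl]
    · exact mul_le_mul_of_nonneg_right (sortedEig_monotone hA hl) (by positivity)
  have h2 : (star w ⬝ᵥ (B *ᵥ w)).re ≤ sortedEig hB j * ∑ l, ‖w l‖ ^ 2 := by
    rw [hW.quadratic, ← hW.norm_sq, Finset.mul_sum]
    refine Finset.sum_le_sum fun l _ => ?_
    rcases lt_or_ge j l with hl | hl
    · simp [hwW l hl]
    · exact mul_le_mul_of_nonneg_right (sortedEig_monotone hB hl) (by positivity)
  have h3 := h w
  rw [sub_mulVec, dotProduct_sub, Complex.sub_re] at h3
  have hpos : 0 < ∑ l, ‖w l‖ ^ 2 := by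
    obtain ⟨l, hl⟩ := Function.ne_iff.1 hw0
    exact Finset.sum_pos' (fun _ _ => by positivity) ⟨l, Finset.mem_univ _, by
      have : w l ≠ 0 := hl
      positivity⟩
  nlinarith

/-- By Cauchy–Schwarz, `δ (∑ ‖w l‖)² ≤ n δ ∑ ‖w l‖²`. This turns Weyl's inequality into Lipschitz
dependence of the eigenvalues on the matrix entries. -/
lemma quadratic_le_of_entries {A : Matrix (Fin n) (Fin n) ℂ} {δ : ℝ} (h : ∀ a b, ‖A a b‖ ≤ δ)
    (w : Fin n → ℂ) : (star w ⬝ᵥ (A *ᵥ w)).re ≤ (n * δ) * ∑ l, ‖w l‖ ^ 2 := by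
  refine (Complex.re_le_norm _).trans ?_
  calc ‖star w ⬝ᵥ (A *ᵥ w)‖ ≤ ∑ a, ∑ b, ‖w a‖ * (δ * ‖w b‖) := by
        rw [dotProduct]
        refine (norm_sum_le _ _).trans (Finset.sum_le_sum fun a _ => ?_)
        rw [norm_mul, Pi.star_apply, norm_star, ← Finset.mul_sum (a := ‖w a‖)]
        refine mul_le_mul_of_nonneg_left ?_ (norm_nonneg _)
        change ‖∑ b, A a b * w b‖ ≤ _
        refine (norm_sum_le _ _).trans (Finset.sum_le_sum fun b _ => ?_)
        rw [norm_mul]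
        exact mul_le_mul_of_nonneg_right (h a b) (norm_nonneg _)
    _ = δ * (∑ a, ‖w a‖) ^ 2 := by
        rw [sq, Finset.sum_mul_sum, Finset.mul_sum]
        refine Finset.sum_congr rfl fun a _ => ?_
        rw [Finset.mul_sum]
        exact Finset.sum_congr rfl fun b _ => by ring
    _ ≤ (n * δ) * ∑ l, ‖w l‖ ^ 2 := by
        rcases Nat.eq_zero_or_pos n with rfl | hn
        · simp
        have hδ : 0 ≤ δ := (norm_nonneg _).trans (h ⟨0, hn⟩ ⟨0, hn⟩)
        have := sq_sum_le_card_mul_sum_sq (s := Finset.univ) (f := fun a : Fin n => ‖w a‖)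
        rw [Finset.card_univ, Fintype.card_fin] at this
        calc δ * (∑ a, ‖w a‖) ^ 2 ≤ δ * (n * ∑ l, ‖w l‖ ^ 2) := by gcongr
          _ = _ := by ring

lemma abs_sortedEig_sub_le {A B : Matrix (Fin n) (Fin n) ℂ} (hA : A.IsHermitian)
    (hB : B.IsHermitian) {δ : ℝ} (h : ∀ a b, ‖A a b - B a b‖ ≤ δ) (j : Fin n) :
    |sortedEig hA j - sortedEig hB j| ≤ n * δ := by
  rw [abs_sub_le_iff]
  constructor
  · have := sortedEig_le_add hA hB (quadratic_le_of_entries (A := A - B) h) j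
    linarith
  · have := sortedEig_le_add hB hA (quadratic_le_of_entries (A := B - A)
      fun a b => by rw [Matrix.sub_apply, norm_sub_rev]; exact h a b) j
    linarith

/-- The number of indices with the same eigenvalue as `j`. -/
def multiplicity' (μ : Fin n → ℝ) (j : Fin n) : ℕ := (Finset.univ.filter fun l => μ l = μ j).card

lemma multiplicity'_pos (μ : Fin n → ℝ) (j : Fin n) : 0 < multiplicity' μ j :=
  Finset.card_pos.2 ⟨j, by simp⟩

/-- The spectral projection of a matrix with eigenvalues `μ` onto the eigenspace of `μ j`. -/
def specProj (H : Matrix (Fin n) (Fin n) ℂ) (μ : Fin n → ℝ) (j : Fin n) :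
    Matrix (Fin n) (Fin n) ℂ :=
  ((List.finRange n).map fun i =>
    if μ i = μ j then 1 else ((μ j - μ i : ℝ) : ℂ)⁻¹ • (H - (μ i : ℂ) • 1)).prod

namespace Diagonalizes

variable {U H : Matrix (Fin n) (Fin n) ℂ} {μ : Fin n → ℝ}

lemma list_prod_conj (h : Diagonalizes U H μ) (L : List (Fin n)) (f : Fin n → Fin n → ℂ) :
    (L.map fun i => U * diagonal (f i) * Uᴴ).prod =
      U * diagonal (fun l => (L.map fun i => f i l).prod) * Uᴴ := by
  induction L with
  | nil => simp [h.right]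
  | cons i L ih =>
    simp only [List.map_cons, List.prod_cons, ih, h.conj_mul_conj, diagonal_mul_diagonal]

/-- In the eigenbasis the Lagrange product is diagonal: its entry at `l` contains a vanishing
factor, namely the one for `i = l`, unless `μ l = μ j`, and then every factor is one. Since the
projection is an explicit polynomial in `H`, its continuity and measurability in a parameter need no
choice of eigenvectors. -/
lemma specProj_eq (h : Diagonalizes U H μ) (j : Fin n) :
    specProj H μ j = U * diagonal (fun l => if μ l = μ j then 1 else 0) * Uᴴ := by
  let f : Fin n → Fin n → ℂ := fun i l =>
    if μ i = μ j then 1 else ((μ j - μ i : ℝ) : ℂ)⁻¹ * (μ l - μ i)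
  have hf : ∀ i, (if μ i = μ j then 1 else ((μ j - μ i : ℝ) : ℂ)⁻¹ • (H - (μ i : ℂ) • 1)) =
      U * diagonal (f i) * Uᴴ := fun i => by
    by_cases hi : μ i = μ j
    · have : f i = fun _ => 1 := by funext l; simp [f, hi]
      rw [if_pos hi, this, diagonal_one, Matrix.mul_one, h.right]
    · have : diagonal (f i) = ((μ j - μ i : ℝ) : ℂ)⁻¹ •
          (diagonal (fun l => (μ l : ℂ)) - (μ i : ℂ) • 1) := by
        ext a b
        by_cases hab : a = b
        · subst hab; simp [f, hi]
        · simp [hab]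
      rw [if_neg hi, this, h.eq]
      simp only [Matrix.mul_smul, Matrix.smul_mul, Matrix.mul_sub, Matrix.sub_mul, Matrix.mul_one,
        h.right]
  simp only [specProj, hf]
  rw [h.list_prod_conj]
  congr 3
  funext l
  split_ifs with hl
  · refine List.prod_eq_one fun x hx => ?_
    obtain ⟨i, -, rfl⟩ := List.mem_map.1 hx
    by_cases hi : μ i = μ j
    · simp [f, hi]
    · have : ((μ j - μ i : ℝ) : ℂ) ≠ 0 := by
        exact_mod_cast sub_ne_zero.2 (Ne.symm hi)
      simp only [f, hi, if_false, hl]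
      rw [← Complex.ofReal_sub, inv_mul_cancel₀ this]
  · refine List.prod_eq_zero (List.mem_map.2 ⟨l, List.mem_finRange l, ?_⟩)
    simp [f, hl]

lemma specProj_mul (h : Diagonalizes U H μ) (i j : Fin n) :
    specProj H μ i * specProj H μ j = if μ i = μ j then specProj H μ j else 0 := by
  rw [h.specProj_eq, h.specProj_eq, h.conj_mul_conj, diagonal_mul_diagonal]
  split_ifs with hij
  · congr 3; funext l; rw [hij]; split_ifs <;> simp
  · have : (fun l => (if μ l = μ i then (1 : ℂ) else 0) * if μ l = μ j then 1 else 0) =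
        fun _ => 0 := by
      funext l; split_ifs with h1 h2 <;> simp
      exact hij (h1.symm.trans h2)
    rw [this, diagonal_zero, Matrix.mul_zero, Matrix.zero_mul]

lemma specProj_conjTranspose (h : Diagonalizes U H μ) (j : Fin n) :
    (specProj H μ j)ᴴ = specProj H μ j := by
  rw [h.specProj_eq, conjTranspose_mul, conjTranspose_mul, conjTranspose_conjTranspose,
    diagonal_conjTranspose, Matrix.mul_assoc]
  congr 3
  funext l
  simp only [Pi.star_apply]
  split_ifs <;> simp

lemma specProj_congr (H : Matrix (Fin n) (Fin n) ℂ) {i j : Fin n} (hij : μ i = μ j) :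
    specProj H μ i = specProj H μ j := by
  simp only [specProj, hij]

lemma mul_specProj (h : Diagonalizes U H μ) (j : Fin n) :
    H * specProj H μ j = (μ j : ℂ) • specProj H μ j := by
  rw [h.specProj_eq]
  nth_rewrite 1 [h.eq]
  rw [h.conj_mul_conj, diagonal_mul_diagonal, ← Matrix.smul_mul, ← Matrix.mul_smul,
    ← diagonal_smul]
  congr 3; funext l
  by_cases hl : μ l = μ j <;> simp [hl]

lemma specProj_mul_self (h : Diagonalizes U H μ) (j : Fin n) :
    specProj H μ j * H = (μ j : ℂ) • specProj H μ j := by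
  rw [h.specProj_eq]
  conv_lhs => rw [h.eq]
  rw [← h.specProj_eq, h.specProj_eq, h.conj_mul_conj, diagonal_mul_diagonal, ← Matrix.smul_mul, ← Matrix.mul_smul,
    ← diagonal_smul]
  congr 3; funext l
  by_cases hl : μ l = μ j <;> simp [hl]

lemma trace_specProj (h : Diagonalizes U H μ) (j : Fin n) :
    (specProj H μ j).trace = multiplicity' μ j := by
  rw [h.specProj_eq, trace_mul_comm, ← Matrix.mul_assoc, h.left, Matrix.one_mul, trace_diagonal,
    Finset.sum_boole, multiplicity']

/-- The sum runs over indices, not over distinct eigenvalues, so each projection occurs as often as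
its eigenvalue; dividing by the multiplicity restores the resolution of the identity. -/
lemma sum_specProj (h : Diagonalizes U H μ) :
    ∑ j, (multiplicity' μ j : ℂ)⁻¹ • specProj H μ j = 1 := by
  have h1 : ∀ j, (multiplicity' μ j : ℂ)⁻¹ • specProj H μ j =
      U * diagonal (fun l => (multiplicity' μ l : ℂ)⁻¹ * if μ j = μ l then 1 else 0) * Uᴴ := by
    intro j
    rw [h.specProj_eq, ← Matrix.smul_mul, ← Matrix.mul_smul, ← diagonal_smul]
    congr 3; funext l
    by_cases hl : μ l = μ j
    · simp [hl, multiplicity']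
    · simp [hl, Ne.symm hl]
  simp only [h1]
  rw [← Finset.sum_mul, ← Finset.mul_sum]
  have h2 : ∑ j, diagonal (fun l => (multiplicity' μ l : ℂ)⁻¹ * if μ j = μ l then 1 else 0) =
      (1 : Matrix (Fin n) (Fin n) ℂ) := by
    ext a b
    rw [Matrix.sum_apply]
    by_cases hab : a = b
    · subst hab
      simp only [diagonal_apply_eq, one_apply_eq]
      rw [← Finset.mul_sum, Finset.sum_boole, ← multiplicity']
      exact inv_mul_cancel₀ (by exact_mod_cast (multiplicity'_pos μ a).ne')
    · simp [hab]
  rw [h2, Matrix.mul_one, h.right]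

lemma inv_mul_specProj (h : Diagonalizes U H μ) (hdet : H.det ≠ 0) (j : Fin n) (hμ : μ j ≠ 0) :
    H⁻¹ * specProj H μ j = ((μ j : ℂ))⁻¹ • specProj H μ j := by
  have hμ' : (μ j : ℂ) ≠ 0 := by exact_mod_cast hμ
  have h1 : specProj H μ j = (μ j : ℂ)⁻¹ • (H * specProj H μ j) := by
    rw [h.mul_specProj, smul_smul, inv_mul_cancel₀ hμ', one_smul]
  conv_lhs => rw [h1]
  rw [Matrix.mul_smul, ← Matrix.mul_assoc, Matrix.nonsing_inv_mul _ (isUnit_iff_ne_zero.2 hdet),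
    Matrix.one_mul]

end Diagonalizes

lemma sortedEig_pos {H : Matrix (Fin n) (Fin n) ℂ} (hH : H.PosSemidef) (hdet : H.det ≠ 0)
    (j : Fin n) : 0 < sortedEig hH.isHermitian j := by
  have h1 := (hH.posDef_iff_det_ne_zero.2 hdet).eigenvalues_pos
    ((Fintype.equivOfCardEq (Fintype.card_fin _)) (Fin.rev (Fin.cast (Fintype.card_fin n).symm j)))
  simpa [IsHermitian.eigenvalues, sortedEig] using h1

end Hermitian

end

section

/-! ### Sums over the lattice -/

variable {d n : ℕ}

/-- The `ℓ¹` length of a lattice point. -/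
def len1 (x : Lattice d) : ℝ := ∑ i, |(x i : ℝ)|

lemma len1_nonneg (x : Lattice d) : 0 ≤ len1 x := Finset.sum_nonneg fun _ _ => abs_nonneg _

lemma abs_le_len1 (x : Lattice d) (i : Fin d) : |(x i : ℝ)| ≤ len1 x :=
  Finset.single_le_sum (f := fun i => |(x i : ℝ)|) (fun _ _ => abs_nonneg _) (Finset.mem_univ i)

lemma abs_le_len (x : Lattice d) (i : Fin d) : |(x i : ℝ)| ≤ len x := by
  rw [← Real.sqrt_sq_eq_abs]
  exact Real.sqrt_le_sqrt (Finset.single_le_sum (f := fun i => (x i : ℝ) ^ 2)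
    (fun _ _ => sq_nonneg _) (Finset.mem_univ i))

/-- The factor `d + 1`, not optimal, is never zero, so that decay rates may be divided by it. -/
lemma len1_le_len (x : Lattice d) : len1 x ≤ (d + 1) * len x := by
  have h : len1 x ≤ ∑ _i : Fin d, len x := Finset.sum_le_sum fun i _ => abs_le_len x i
  rw [Finset.sum_const, Finset.card_univ, Fintype.card_fin, nsmul_eq_mul] at h
  nlinarith [Real.sqrt_nonneg (∑ i, (x i : ℝ) ^ 2), show len x = √(∑ i, (x i : ℝ) ^ 2) from rfl]

lemma len_le_jap (x : Lattice d) : len x ≤ jap x := Real.sqrt_le_sqrt (by linarith)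

lemma one_le_jap (x : Lattice d) : 1 ≤ jap x := by
  rw [jap, Real.one_le_sqrt]
  have : 0 ≤ ∑ i, (x i : ℝ) ^ 2 := Finset.sum_nonneg fun _ _ => sq_nonneg _
  linarith

lemma sum_sq_le_len1_sq (x : Lattice d) : ∑ i, (x i : ℝ) ^ 2 ≤ len1 x ^ 2 := by
  have := Finset.sum_sq_le_sq_sum_of_nonneg (s := Finset.univ) (f := fun i => |(x i : ℝ)|)
    fun _ _ => abs_nonneg _
  simpa [len1, sq_abs] using this

lemma jap_le_one_add_len1 (x : Lattice d) : jap x ≤ 1 + len1 x := by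
  rw [jap, Real.sqrt_le_left (by linarith [len1_nonneg x])]
  nlinarith [sum_sq_le_len1_sq x, len1_nonneg x]

lemma pair_add (x : Lattice d) (θ η : Fin d → ℝ) : pair x (θ + η) = pair x θ + pair x η := by
  simp [pair, mul_add, Finset.sum_add_distrib]

lemma pair_sub (x : Lattice d) (θ η : Fin d → ℝ) : pair x (θ - η) = pair x θ - pair x η := by
  simp [pair, mul_sub, Finset.sum_sub_distrib]

lemma sub_pair (x y : Lattice d) (θ : Fin d → ℝ) : pair (x - y) θ = pair x θ - pair y θ := by
  simp [pair, sub_mul, Finset.sum_sub_distrib]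

lemma neg_pair (x : Lattice d) (θ : Fin d → ℝ) : pair (-x) θ = -pair x θ := by
  simp [pair]

lemma abs_pair_le (x : Lattice d) (θ : Fin d → ℝ) : |pair x θ| ≤ len1 x * ‖θ‖ := by
  rw [pair, len1, Finset.sum_mul]
  refine (Finset.abs_sum_le_sum_abs _ _).trans (Finset.sum_le_sum fun i _ => ?_)
  rw [abs_mul]
  exact mul_le_mul_of_nonneg_left (norm_le_pi_norm θ i) (abs_nonneg _)

lemma continuous_pair (x : Lattice d) : Continuous fun θ => pair x θ := by
  unfold pair; fun_prop

/-- Comparison with the sum of powers of the sup norm over the `ℤ`-span of the standard basis, a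
lattice of rank `d`. The origin is excluded because the exponent is negative. -/
lemma summable_jap_rpow {s : ℝ} (hs : s < -(d : ℝ)) :
    Summable fun x : Lattice d => jap x ^ s := by
  let b := Pi.basisFun ℝ (Fin d)
  let L : Submodule ℤ (Fin d → ℝ) := Submodule.span ℤ (Set.range b)
  have hmem : ∀ x : Lattice d, (fun i => (x i : ℝ)) ∈ L := fun x => by
    rw [(Pi.basisFun ℝ (Fin d)).mem_span_iff_repr_mem ℤ]
    intro i
    exact ⟨x i, by simp⟩
  have hrank : Module.finrank ℤ L = d := by
    rw [ZLattice.rank ℝ L, Module.finrank_fin_fun]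
  have h1 := ZLattice.summable_norm_rpow L s (by rw [hrank]; exact hs)
  let e : Lattice d → L := fun x => ⟨_, hmem x⟩
  have he : Function.Injective e := fun x y hxy => by
    funext i
    have : (x i : ℝ) = (y i : ℝ) := congrFun (congrArg Subtype.val hxy) i
    exact_mod_cast this
  have h2 := h1.comp_injective he
  refine Summable.of_norm_bounded_eventually h2 ?_
  have h3 : ∀ᶠ x : Lattice d in cofinite, x ≠ 0 := by
    rw [Filter.eventually_cofinite]; simp
  filter_upwards [h3] with x hx
  have hpos : 0 < ‖e x‖ := by
    rw [norm_pos_iff]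
    intro h0
    exact hx (he (h0.trans (by ext; simp [e])))
  rw [Real.norm_of_nonneg (Real.rpow_nonneg (jap_pos x).le _)]
  refine Real.rpow_le_rpow_of_nonpos hpos ?_ (by have : (0 : ℝ) ≤ d := by positivity
                                                 linarith)
  refine le_trans ?_ (len_le_jap x)
  change ‖(fun i => (x i : ℝ))‖ ≤ _
  exact (pi_norm_le_iff_of_nonneg (Real.sqrt_nonneg _)).2 fun i => abs_le_len x i

/-- With `m = ⌈s⌉₊` one has `r ^ s ≤ r ^ m` for `r ≥ 1`, and `(c r)^m / m!` is a single term of the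
series of `exp (c r)`. -/
lemma exists_rpow_mul_exp_le (s : ℝ) {c : ℝ} (hc : 0 < c) :
    ∃ K : ℝ, ∀ r : ℝ, 1 ≤ r → r ^ s * Real.exp (-c * r) ≤ K := by
  refine ⟨(⌈s⌉₊).factorial / c ^ ⌈s⌉₊, fun r hr => ?_⟩
  have hr0 : 0 < r := by linarith
  have h1 : r ^ s ≤ r ^ ⌈s⌉₊ := by
    rw [← Real.rpow_natCast]
    exact Real.rpow_le_rpow_of_exponent_le hr (Nat.le_ceil s)
  have h2 := Real.pow_div_factorial_le_exp (x := c * r) (by positivity) ⌈s⌉₊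
  rw [neg_mul, Real.exp_neg, ← div_eq_mul_inv, div_le_div_iff₀ (Real.exp_pos _) (by positivity)]
  rw [div_le_iff₀ (by positivity), mul_pow] at h2
  calc r ^ s * c ^ ⌈s⌉₊ ≤ r ^ ⌈s⌉₊ * c ^ ⌈s⌉₊ := by gcongr
    _ ≤ _ := by linarith

lemma summable_jap_mul_exp (s : ℝ) {c : ℝ} (hc : 0 < c) :
    Summable fun x : Lattice d => jap x ^ s * Real.exp (-c * len1 x) := by
  obtain ⟨K, hK⟩ := exists_rpow_mul_exp_le (s + (d + 1)) hc
  have h := (summable_jap_rpow (d := d) (s := -((d : ℝ) + 1)) (by linarith)).mul_left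
    (Real.exp c * K)
  refine h.of_nonneg_of_le (fun x => by have := jap_pos x; positivity) fun x => ?_
  have hp := jap_pos x
  have h1 : Real.exp (-c * len1 x) ≤ Real.exp c * Real.exp (-c * jap x) := by
    rw [← Real.exp_add, Real.exp_le_exp]
    nlinarith [jap_le_one_add_len1 x]
  have h2 : jap x ^ s = jap x ^ (s + (d + 1)) * jap x ^ (-((d : ℝ) + 1)) := by
    rw [← Real.rpow_add hp]; congr 1; ring
  calc jap x ^ s * Real.exp (-c * len1 x)
      ≤ jap x ^ s * (Real.exp c * Real.exp (-c * jap x)) := by gcongr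
    _ = Real.exp c * (jap x ^ (s + (d + 1)) * Real.exp (-c * jap x)) *
        jap x ^ (-((d : ℝ) + 1)) := by rw [h2]; ring
    _ ≤ Real.exp c * K * jap x ^ (-((d : ℝ) + 1)) := by
        gcongr; exact hK _ (one_le_jap x)

lemma summable_exp_len1 {c : ℝ} (hc : 0 < c) :
    Summable fun x : Lattice d => Real.exp (-c * len1 x) := by
  simpa using summable_jap_mul_exp (d := d) 0 hc

/-- Half of the exponential rate pays for the linear factor. Thus differentiating an exponentially
decaying Fourier series stays in the same class. -/
lemma len1_mul_exp_le {c : ℝ} (hc : 0 < c) (x : Lattice d) :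
    len1 x * Real.exp (-c * len1 x) ≤ (2 / c) * Real.exp (-(c / 2) * len1 x) := by
  have h1 : c / 2 * len1 x ≤ Real.exp (c / 2 * len1 x) := by
    linarith [Real.add_one_le_exp (c / 2 * len1 x)]
  have h2 : Real.exp (-c * len1 x) = Real.exp (-(c / 2) * len1 x) * Real.exp (-(c / 2) * len1 x) := by
    rw [← Real.exp_add]; congr 1; ring
  have h3 : Real.exp (c / 2 * len1 x) * Real.exp (-(c / 2) * len1 x) = 1 := by
    rw [← Real.exp_add]; simp
  have h4 := Real.exp_pos (-(c / 2) * len1 x)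
  rw [h2]
  calc len1 x * (Real.exp (-(c / 2) * len1 x) * Real.exp (-(c / 2) * len1 x))
      = (2 / c) * ((c / 2 * len1 x) * Real.exp (-(c / 2) * len1 x)) *
          Real.exp (-(c / 2) * len1 x) := by field_simp
    _ ≤ (2 / c) * (Real.exp (c / 2 * len1 x) * Real.exp (-(c / 2) * len1 x)) *
          Real.exp (-(c / 2) * len1 x) := by gcongr
    _ = _ := by rw [h3, mul_one]

/-! ### Exponentially decaying Fourier series -/

lemma norm_exp_I_mul (r : ℝ) : ‖Complex.exp (Complex.I * (r : ℂ))‖ = 1 := by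
  rw [mul_comm, Complex.norm_exp_ofReal_mul_I]

lemma norm_exp_I_sub_le (r s : ℝ) :
    ‖Complex.exp (Complex.I * (r : ℂ)) - Complex.exp (Complex.I * (s : ℂ))‖ ≤ |r - s| := by
  have h : Complex.exp (Complex.I * (r : ℂ)) - Complex.exp (Complex.I * (s : ℂ)) =
      Complex.exp (Complex.I * (s : ℂ)) * (Complex.exp (Complex.I * ((r - s : ℝ) : ℂ)) - 1) := by
    rw [mul_sub, ← Complex.exp_add, mul_one]; congr 2; push_cast; ring
  rw [h, norm_mul, norm_exp_I_mul, one_mul]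
  exact Real.norm_exp_I_mul_ofReal_sub_one_le

/-- The Fourier series `∑ₓ cₓ e^{i(x,θ)}`. -/
def expSeries (c : Lattice d → ℂ) (θ : Fin d → ℝ) : ℂ :=
  ∑' x, Complex.exp (Complex.I * (pair x θ : ℂ)) * c x

/-- `|cₓ| ≤ C e^{-γ |x|₁}` for some `C` and some `γ > 0`. -/
def ExpDecay (c : Lattice d → ℂ) : Prop :=
  ∃ C : ℝ, ∃ γ > 0, ∀ x, ‖c x‖ ≤ C * Real.exp (-γ * len1 x)

lemma ExpDecay.summable_norm {c : Lattice d → ℂ} (hc : ExpDecay c) : Summable fun x => ‖c x‖ := by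
  obtain ⟨C, γ, hγ, h⟩ := hc
  exact ((summable_exp_len1 hγ).mul_left C).of_nonneg_of_le (fun _ => norm_nonneg _) h

lemma ExpDecay.mul_bounded {c : Lattice d → ℂ} (hc : ExpDecay c) {m : Lattice d → ℂ}
    (hm : ∀ x, ‖m x‖ ≤ 1) : ExpDecay fun x => m x * c x := by
  obtain ⟨C, γ, hγ, h⟩ := hc
  refine ⟨C, γ, hγ, fun x => le_trans ?_ (h x)⟩
  rw [norm_mul]
  exact mul_le_of_le_one_left (norm_nonneg _) (hm x)

lemma ExpDecay.mul_coord {c : Lattice d → ℂ} (hc : ExpDecay c) (l : Fin d) :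
    ExpDecay fun x => Complex.I * (x l : ℂ) * c x := by
  obtain ⟨C, γ, hγ, h⟩ := hc
  have hC : 0 ≤ C := by simpa [len1] using (norm_nonneg _).trans (h 0)
  refine ⟨C * (2 / γ), γ / 2, by positivity, fun x => ?_⟩
  have h1 : ‖Complex.I * (x l : ℂ)‖ ≤ len1 x := by
    rw [norm_mul, Complex.norm_I, one_mul, Complex.norm_intCast]
    exact_mod_cast abs_le_len1 x l
  rw [norm_mul]
  calc ‖Complex.I * (x l : ℂ)‖ * ‖c x‖ ≤ len1 x * (C * Real.exp (-γ * len1 x)) := by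
        gcongr; exacts [len1_nonneg x, h x]
    _ = C * (len1 x * Real.exp (-γ * len1 x)) := by ring
    _ ≤ C * ((2 / γ) * Real.exp (-(γ / 2) * len1 x)) :=
        mul_le_mul_of_nonneg_left (len1_mul_exp_le hγ x) hC
    _ = _ := by ring

lemma ExpDecay.summable_len1 {c : Lattice d → ℂ} (hc : ExpDecay c) :
    Summable fun x => len1 x * ‖c x‖ := by
  obtain ⟨C, γ, hγ, h⟩ := hc
  have hC : 0 ≤ C := by simpa [len1] using (norm_nonneg _).trans (h 0)
  refine ((summable_exp_len1 (d := d) (c := γ / 2) (by positivity)).mul_left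
    (C * (2 / γ))).of_nonneg_of_le (fun x => mul_nonneg (len1_nonneg x) (norm_nonneg _)) fun x => ?_
  calc len1 x * ‖c x‖ ≤ len1 x * (C * Real.exp (-γ * len1 x)) := by
        gcongr; exacts [len1_nonneg x, h x]
    _ = C * (len1 x * Real.exp (-γ * len1 x)) := by ring
    _ ≤ C * ((2 / γ) * Real.exp (-(γ / 2) * len1 x)) :=
        mul_le_mul_of_nonneg_left (len1_mul_exp_le hγ x) hC
    _ = _ := by ring

lemma summable_expSeries {c : Lattice d → ℂ} (hc : Summable fun x => ‖c x‖) (θ : Fin d → ℝ) :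
    Summable fun x => Complex.exp (Complex.I * (pair x θ : ℂ)) * c x :=
  Summable.of_norm (by simpa [norm_mul, norm_exp_I_mul] using hc)

lemma continuous_expSeries {c : Lattice d → ℂ} (hc : Summable fun x => ‖c x‖) :
    Continuous (expSeries c) := by
  refine continuous_tsum (fun x => ?_) hc fun x θ => by rw [norm_mul, norm_exp_I_mul, one_mul]
  have := continuous_pair x
  fun_prop

lemma norm_expSeries_sub_le {c : Lattice d → ℂ} (hc : ExpDecay c) (θ η : Fin d → ℝ) :
    ‖expSeries c θ - expSeries c η‖ ≤ (∑' x, len1 x * ‖c x‖) * ‖θ - η‖ := by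
  have h1 := hc.summable_norm
  rw [expSeries, expSeries, ← (summable_expSeries h1 θ).tsum_sub (summable_expSeries h1 η),
    ← tsum_mul_right]
  refine tsum_of_norm_bounded (hc.summable_len1.mul_right _).hasSum fun x => ?_
  rw [← sub_mul, norm_mul]
  calc _ ≤ |pair x θ - pair x η| * ‖c x‖ := by gcongr; exact norm_exp_I_sub_le _ _
    _ ≤ (len1 x * ‖θ - η‖) * ‖c x‖ := by
        gcongr; rw [← pair_sub]; exact abs_pair_le _ _
    _ = _ := by ring

lemma pair_update (x : Lattice d) (θ : Fin d → ℝ) (l : Fin d) (s : ℝ) :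
    pair x (Function.update θ l s) = pair x θ + x l * (s - θ l) := by
  have h : Function.update θ l s = θ + Pi.single l (s - θ l) := by
    funext i
    by_cases hi : i = l
    · subst hi; simp
    · simp [hi]
  rw [h, pair_add]
  congr 1
  rw [pair, Finset.sum_eq_single l (fun b _ hb => by simp [hb]) (by simp)]
  simp

lemma hasDerivAt_expSeries {c : Lattice d → ℂ} (hc : ExpDecay c) (θ : Fin d → ℝ) (l : Fin d)
    (s : ℝ) : HasDerivAt (fun s => expSeries c (Function.update θ l s))
      (expSeries (fun x => Complex.I * (x l : ℂ) * c x) (Function.update θ l s)) s := by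
  have h0 : Summable fun x => Complex.exp (Complex.I * (pair x (Function.update θ l 0) : ℂ)) * c x :=
    summable_expSeries hc.summable_norm (Function.update θ l 0)
  refine hasDerivAt_tsum (𝕜 := ℝ) (y₀ := 0)
    (g := fun x s => Complex.exp (Complex.I * (pair x (Function.update θ l s) : ℂ)) * c x)
    (g' := fun x s => Complex.exp (Complex.I * (pair x (Function.update θ l s) : ℂ)) *
      (Complex.I * (x l : ℂ) * c x))
    (hc.mul_coord l).summable_norm (fun x s => ?_)
    (fun x s => by rw [norm_mul (Complex.exp _), norm_exp_I_mul, one_mul]) h0 s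
  have h2 : HasDerivAt (fun s : ℝ => pair x (Function.update θ l s)) (x l : ℝ) s := by
    have h0 := (((hasDerivAt_id s).sub_const (θ l)).const_mul (x l : ℝ)).const_add (pair x θ)
    rw [mul_one] at h0
    exact h0.congr_of_eventuallyEq (Eventually.of_forall fun r => pair_update x θ l r)
  have h1 := h2.ofReal_comp
  have h3 := ((h1.const_mul Complex.I).cexp).mul_const (c x)
  convert! h3 using 1
  push_cast
  ring

/-- Translation of the argument multiplies the coefficients by unimodular numbers, which preserves
`ExpDecay`; analyticity need therefore be proved only at the origin. -/
lemma expSeries_add (c : Lattice d → ℂ) (θ η : Fin d → ℝ) :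
    expSeries c (θ + η) =
      expSeries (fun x => Complex.exp (Complex.I * (pair x θ : ℂ)) * c x) η := by
  refine tsum_congr fun x => ?_
  rw [← mul_assoc, ← Complex.exp_add, pair_add]
  congr 2; push_cast; ring

lemma ExpDecay.shift {c : Lattice d → ℂ} (hc : ExpDecay c) (θ : Fin d → ℝ) :
    ExpDecay fun x => Complex.exp (Complex.I * (pair x θ : ℂ)) * c x :=
  hc.mul_bounded fun _ => (norm_exp_I_mul _).le

lemma expSeries_periodic (c : Lattice d → ℂ) (θ : Fin d → ℝ) (k : Lattice d) :
    expSeries c (θ + fun i => 2 * Real.pi * k i) = expSeries c θ := by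
  refine tsum_congr fun x => ?_
  congr 1
  rw [Complex.exp_eq_exp_iff_exists_int]
  refine ⟨∑ i, x i * k i, ?_⟩
  rw [pair_add]
  have : pair x (fun i => 2 * Real.pi * k i) = ((∑ i, x i * k i : ℤ) : ℝ) * (2 * Real.pi) := by
    rw [pair]; push_cast; rw [Finset.sum_mul]
    exact Finset.sum_congr rfl fun i _ => by ring
  rw [this]; push_cast; ring

end

section

/-! ### Analyticity of exponentially decaying Fourier series -/

variable {d n : ℕ}

/-- The functional `θ ↦ i (x, θ)`. -/
def pairCLM (x : Lattice d) : (Fin d → ℝ) →L[ℝ] ℂ :=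
  ∑ i, (Complex.I * (x i : ℂ)) • (Complex.ofRealCLM.comp (ContinuousLinearMap.proj i))

lemma pairCLM_apply (x : Lattice d) (θ : Fin d → ℝ) :
    pairCLM x θ = Complex.I * (pair x θ : ℂ) := by
  simp [pairCLM, pair, Finset.mul_sum, mul_assoc]

lemma norm_pairCLM_apply_le (x : Lattice d) (θ : Fin d → ℝ) : ‖pairCLM x θ‖ ≤ len1 x * ‖θ‖ := by
  rw [pairCLM_apply, norm_mul, Complex.norm_I, one_mul, Complex.norm_real]
  exact abs_pair_le x θ

lemma norm_pairCLM_le (x : Lattice d) : ‖pairCLM x‖ ≤ len1 x :=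
  ContinuousLinearMap.opNorm_le_bound _ (len1_nonneg x) (norm_pairCLM_apply_le x)

/-- The terms of the Taylor series of `∑ₓ cₓ e^{i(x,θ)}` at `0`. -/
def expSeriesTerm (c : Lattice d → ℂ) (m : ℕ) (x : Lattice d) :
    ContinuousMultilinearMap ℝ (fun _ : Fin m => Fin d → ℝ) ℂ :=
  ((m.factorial : ℂ)⁻¹ * c x) •
    (ContinuousMultilinearMap.mkPiAlgebraFin ℝ m ℂ).compContinuousLinearMap fun _ => pairCLM x

lemma expSeriesTerm_apply (c : Lattice d → ℂ) (m : ℕ) (x : Lattice d) (y : Fin d → ℝ) :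
    expSeriesTerm c m x (fun _ => y) = (m.factorial : ℂ)⁻¹ * c x * pairCLM x y ^ m := by
  simp [expSeriesTerm]

lemma norm_expSeriesTerm_le (c : Lattice d → ℂ) (m : ℕ) (x : Lattice d) :
    ‖expSeriesTerm c m x‖ ≤ ‖c x‖ * (len1 x ^ m / m.factorial) := by
  have h1 := ContinuousMultilinearMap.norm_compContinuousLinearMap_le
    (ContinuousMultilinearMap.mkPiAlgebraFin ℝ m ℂ) fun _ => pairCLM x
  rw [ContinuousMultilinearMap.norm_mkPiAlgebraFin, one_mul, Finset.prod_const, Finset.card_univ,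
    Fintype.card_fin] at h1
  rw [expSeriesTerm, norm_smul, norm_mul, norm_inv, Complex.norm_natCast]
  calc _ ≤ (m.factorial : ℝ)⁻¹ * ‖c x‖ * len1 x ^ m := by
        gcongr
        exact h1.trans (pow_le_pow_left₀ (norm_nonneg _) (norm_pairCLM_le x) m)
    _ = _ := by ring

/-- Each exponential is expanded in powers of `(x, y)`. For `‖y‖ < γ/2` half of the decay rate
dominates `e^{‖y‖ |x|₁}`, so the double series over sites and degrees converges absolutely and may
be regrouped by degree. -/
lemma analyticAt_expSeries_zero {c : Lattice d → ℂ} (hc : ExpDecay c) :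
    AnalyticAt ℝ (expSeries c) 0 := by
  obtain ⟨C, γ, hγ, hC⟩ := hc
  have hr : (0 : ℝ) < γ / 2 := by positivity
  let r : NNReal := ⟨γ / 2, hr.le⟩
  have hS : Summable fun x => ‖c x‖ * Real.exp (γ / 2 * len1 x) := by
    refine ((summable_exp_len1 (d := d) hr).mul_left C).of_nonneg_of_le
      (fun x => by positivity) fun x => ?_
    calc ‖c x‖ * Real.exp (γ / 2 * len1 x)
        ≤ (C * Real.exp (-γ * len1 x)) * Real.exp (γ / 2 * len1 x) := by gcongr; exact hC x
      _ = _ := by rw [mul_assoc, ← Real.exp_add]; congr 2; ring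
  have hb : ∀ (m : ℕ) x, ‖c x‖ * (len1 x ^ m / m.factorial) * (γ / 2) ^ m ≤
      ‖c x‖ * Real.exp (γ / 2 * len1 x) := fun m x => by
    have := Real.pow_div_factorial_le_exp (x := γ / 2 * len1 x)
      (mul_nonneg hr.le (len1_nonneg x)) m
    rw [mul_assoc]
    refine mul_le_mul_of_nonneg_left (le_trans (le_of_eq ?_) this) (norm_nonneg _)
    rw [mul_pow]; ring
  have hsum : ∀ m, Summable fun x => ‖c x‖ * (len1 x ^ m / m.factorial) := fun m => by
    refine (hS.mul_left ((γ / 2) ^ m)⁻¹).of_nonneg_of_le (fun x => by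
      have := len1_nonneg x; positivity) fun x => ?_
    rw [le_inv_mul_iff₀ (by positivity), mul_comm]
    exact hb m x
  have hsT : ∀ m, Summable fun x => expSeriesTerm c m x := fun m =>
    Summable.of_norm_bounded (hsum m) fun x => norm_expSeriesTerm_le c m x
  refine ⟨fun m => ∑' x, expSeriesTerm c m x, (r : ENNReal), ?_, ?_, ?_⟩
  · refine FormalMultilinearSeries.le_radius_of_bound _ (∑' x, ‖c x‖ * Real.exp (γ / 2 * len1 x))
      fun m => ?_
    have h1 : ‖∑' x, expSeriesTerm c m x‖ ≤ ∑' x, ‖c x‖ * (len1 x ^ m / m.factorial) :=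
      tsum_of_norm_bounded (hsum m).hasSum fun x => norm_expSeriesTerm_le c m x
    calc _ ≤ (∑' x, ‖c x‖ * (len1 x ^ m / m.factorial)) * (γ / 2) ^ m :=
          mul_le_mul_of_nonneg_right h1 (by positivity)
      _ ≤ _ := by
          rw [← tsum_mul_right]
          exact ((hsum m).mul_right _).tsum_le_tsum (hb m) hS
  · exact_mod_cast hr
  · intro y hy
    rw [zero_add]
    have hy' : ‖y‖ < γ / 2 := by
      rw [mem_eball_zero_iff, enorm_lt_coe] at hy
      exact hy
    -- The double series: summing over the degree first gives `expSeries c y`, summing over the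
    -- sites first gives the homogeneous terms of the power series.
    let f : Lattice d × ℕ → ℂ := fun q => (q.2.factorial : ℂ)⁻¹ * c q.1 * pairCLM q.1 y ^ q.2
    have hfx : ∀ x, HasSum (fun m => f (x, m)) (Complex.exp (Complex.I * (pair x y : ℂ)) * c x) := by
      intro x
      have h1 := (NormedSpace.expSeries_div_hasSum_exp (pairCLM x y)).mul_right (c x)
      rw [← Complex.exp_eq_exp_ℂ, pairCLM_apply] at h1
      refine h1.congr_fun fun m => ?_
      simp only [f, pairCLM_apply]
      ring
    have hnx : ∀ x, HasSum (fun m => ‖f (x, m)‖) (‖c x‖ * Real.exp ‖pairCLM x y‖) := by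
      intro x
      have h1 := (NormedSpace.expSeries_div_hasSum_exp (‖pairCLM x y‖)).mul_left ‖c x‖
      rw [← Real.exp_eq_exp_ℝ] at h1
      refine h1.congr_fun fun m => ?_
      simp only [f, norm_mul, norm_inv, norm_pow, Complex.norm_natCast]
      ring
    have hf : Summable f := by
      refine Summable.of_norm ((summable_prod_of_nonneg fun _ => norm_nonneg _).2
        ⟨fun x => (hnx x).summable, ?_⟩)
      simp only [fun x => (hnx x).tsum_eq]
      refine hS.of_nonneg_of_le (fun x => by positivity) fun x => ?_
      gcongr
      refine (norm_pairCLM_apply_le x y).trans ?_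
      rw [mul_comm]
      exact mul_le_mul_of_nonneg_right hy'.le (len1_nonneg x)
    have htot : ∑' q : ℕ × Lattice d, f q.swap = expSeries c y := by
      refine ((Equiv.prodComm ℕ (Lattice d)).tsum_eq f).trans ?_
      rw [hf.tsum_prod]
      exact tsum_congr fun x => (hfx x).tsum_eq
    rw [← htot]
    refine hf.prod_symm.hasSum.prod_fiberwise fun m => ?_
    have h1 := ContinuousMultilinearMap.hasSum_eval (hsT m).hasSum fun _ => y
    exact h1.congr_fun fun x => by rw [expSeriesTerm_apply]; rfl

lemma analyticAt_expSeries {c : Lattice d → ℂ} (hc : ExpDecay c) (θ : Fin d → ℝ) :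
    AnalyticAt ℝ (expSeries c) θ := by
  have h1 := analyticAt_expSeries_zero (hc.shift θ)
  have h2 : expSeries c = (expSeries fun x => Complex.exp (Complex.I * (pair x θ : ℂ)) * c x) ∘
      fun η => η - θ := by
    funext η
    rw [Function.comp_apply, ← expSeries_add, add_sub_cancel]
  rw [h2]
  refine AnalyticAt.comp ?_ (by fun_prop)
  rwa [sub_self]

/-! ### The interaction matrix -/

/-- The lattice translate `θ + 2πk`. -/
def shift2pi (θ : Fin d → ℝ) (k : Lattice d) : Fin d → ℝ := θ + fun i => 2 * Real.pi * k i

lemma exists_shift2pi_mem_torus (θ : Fin d → ℝ) : ∃ k : Lattice d, shift2pi θ k ∈ torus d := by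
  refine ⟨fun i => -toIocDiv Real.two_pi_pos (-Real.pi) (θ i), fun i _ => ?_⟩
  have h := sub_toIocDiv_zsmul_mem_Ioc Real.two_pi_pos (-Real.pi) (θ i)
  rw [show -Real.pi + 2 * Real.pi = Real.pi by ring] at h
  convert! h using 1
  simp only [shift2pi, Pi.add_apply, zsmul_eq_mul]
  push_cast; ring

lemma exists_forall_le_of_periodic {f : (Fin d → ℝ) → ℝ} (hf : Continuous f)
    (hp : ∀ θ k, f (shift2pi θ k) = f θ) : ∃ θ₀, ∀ θ, f θ₀ ≤ f θ := by
  have hK : IsCompact (Set.univ.pi fun _ : Fin d => Set.Icc (-Real.pi) Real.pi) :=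
    isCompact_univ_pi fun _ => isCompact_Icc
  obtain ⟨θ₀, -, h⟩ := hK.exists_isMinOn ⟨fun _ => 0, fun i _ => by
    simp [Real.pi_pos.le]⟩ hf.continuousOn
  refine ⟨θ₀, fun θ => ?_⟩
  obtain ⟨k, hk⟩ := exists_shift2pi_mem_torus θ
  rw [← hp θ k]
  exact h fun i hi => Set.Ioc_subset_Icc_self (hk i hi)

variable {V : Lattice d → Matrix (Fin n) (Fin n) ℝ}

lemma Admissible.expDecay (hV : Admissible V) (a b : Fin n) :
    ExpDecay fun x => (V x a b : ℂ) := by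
  obtain ⟨C, hC, γ, hγ, h⟩ := hV.decay
  refine ⟨C, γ / (d + 1), by positivity, fun x => ?_⟩
  rw [Complex.norm_real, Real.norm_eq_abs]
  refine (h x a b).trans ?_
  refine mul_le_mul_of_nonneg_left (Real.exp_le_exp.2 ?_) hC.le
  rw [neg_mul, neg_mul, neg_le_neg_iff, div_mul_eq_mul_div, div_le_iff₀ (by positivity)]
  nlinarith [len1_le_len x]

/-- The partial derivative `∂V̂/∂θ_l`. -/
def dVhat (V : Lattice d → Matrix (Fin n) (Fin n) ℝ) (l : Fin d) (θ : Fin d → ℝ) :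
    Matrix (Fin n) (Fin n) ℂ :=
  Matrix.of fun a b => expSeries (fun x => Complex.I * (x l : ℂ) * (V x a b : ℂ)) θ

lemma Admissible.hasDerivAt_Vhat (hV : Admissible V) (θ : Fin d → ℝ) (l : Fin d) (a b : Fin n) :
    HasDerivAt (fun s => Vhat V (Function.update θ l s) a b) (dVhat V l θ a b) (θ l) := by
  have h := hasDerivAt_expSeries (hV.expDecay a b) θ l (θ l)
  rw [Function.update_eq_self] at h
  exact h

lemma Admissible.continuous_Vhat (hV : Admissible V) : Continuous (Vhat V) :=
  continuous_matrix fun a b => continuous_expSeries (hV.expDecay a b).summable_norm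

lemma Vhat_periodic (V : Lattice d → Matrix (Fin n) (Fin n) ℝ) (θ : Fin d → ℝ) (k : Lattice d) :
    Vhat V (shift2pi θ k) = Vhat V θ := by
  ext a b; exact expSeries_periodic _ θ k

lemma Admissible.isHermitian (hV : Admissible V) (θ : Fin d → ℝ) : (Vhat V θ).IsHermitian :=
  (hV.nonneg θ).isHermitian

lemma Admissible.freq_eq (hV : Admissible V) (j : Fin n) (θ : Fin d → ℝ) :
    freq V j θ = √(sortedEig (hV.isHermitian θ) j) := by
  rw [freq, dif_pos (hV.isHermitian θ)]; rfl

lemma Admissible.freq_sq (hV : Admissible V) (j : Fin n) (θ : Fin d → ℝ) :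
    freq V j θ ^ 2 = sortedEig (hV.isHermitian θ) j := by
  rw [hV.freq_eq, Real.sq_sqrt (sortedEig_pos (hV.nonneg θ) (hV.det_ne_zero θ) j).le]

lemma Admissible.freq_pos (hV : Admissible V) (j : Fin n) (θ : Fin d → ℝ) : 0 < freq V j θ := by
  rw [hV.freq_eq]
  exact Real.sqrt_pos.2 (sortedEig_pos (hV.nonneg θ) (hV.det_ne_zero θ) j)

lemma freq_periodic (V : Lattice d → Matrix (Fin n) (Fin n) ℝ) (j : Fin n) (θ : Fin d → ℝ)
    (k : Lattice d) : freq V j (shift2pi θ k) = freq V j θ := by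
  unfold freq
  simp only [Vhat_periodic]

lemma Admissible.diagonalizes (hV : Admissible V) (θ : Fin d → ℝ) :
    ∃ U, Diagonalizes U (Vhat V θ) fun j => freq V j θ ^ 2 := by
  simp only [hV.freq_sq]
  exact exists_diagonalizes (hV.isHermitian θ)

/-- Weyl's inequality applied to `V̂(θ)` and `V̂(η)`, whose entries are Lipschitz because `|x|₁
|V(x)|` is summable. -/
lemma Admissible.exists_lipschitz_sq (hV : Admissible V) :
    ∃ K : ℝ, 0 ≤ K ∧ ∀ j θ η, |freq V j θ ^ 2 - freq V j η ^ 2| ≤ K * ‖θ - η‖ := by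
  let K : ℝ := ∑ a, ∑ b, ∑' x, len1 x * ‖(V x a b : ℂ)‖
  have hK : ∀ a b, 0 ≤ ∑' x, len1 x * ‖(V x a b : ℂ)‖ := fun a b =>
    tsum_nonneg fun x => mul_nonneg (len1_nonneg x) (norm_nonneg _)
  have hK0 : 0 ≤ K := Finset.sum_nonneg fun a _ => Finset.sum_nonneg fun b _ => hK a b
  refine ⟨n * K, by positivity, fun j θ η => ?_⟩
  rw [hV.freq_sq, hV.freq_sq, mul_assoc]
  refine abs_sortedEig_sub_le _ _ (fun a b => ?_) j
  refine (norm_expSeries_sub_le (hV.expDecay a b) θ η).trans ?_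
  refine mul_le_mul_of_nonneg_right ?_ (norm_nonneg _)
  exact (Finset.single_le_sum (f := fun b => ∑' x, len1 x * ‖(V x a b : ℂ)‖)
    (fun b _ => hK a b) (Finset.mem_univ b)).trans
    (Finset.single_le_sum (f := fun a => ∑ b, ∑' x, len1 x * ‖(V x a b : ℂ)‖)
      (fun a _ => Finset.sum_nonneg fun b _ => hK a b) (Finset.mem_univ a))

lemma Admissible.continuous_freq (hV : Admissible V) (j : Fin n) : Continuous (freq V j) := by
  obtain ⟨K, hK0, hK⟩ := hV.exists_lipschitz_sq
  have h1 : Continuous fun θ => freq V j θ ^ 2 :=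
    (LipschitzWith.of_dist_le_mul (K := ⟨K, hK0⟩) fun θ η => by
      rw [Real.dist_eq, dist_eq_norm]; exact hK j θ η).continuous
  have h2 : freq V j = fun θ => √(freq V j θ ^ 2) := by
    funext θ; rw [Real.sqrt_sq (hV.freq_pos j θ).le]
  rw [h2]
  exact h1.sqrt

lemma Admissible.exists_freq_lower (hV : Admissible V) :
    ∃ δ > 0, ∀ j θ, δ ≤ freq V j θ := by
  have h : ∀ j, ∃ θ₀, ∀ θ, freq V j θ₀ ≤ freq V j θ := fun j =>
    exists_forall_le_of_periodic (hV.continuous_freq j) (freq_periodic V j)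
  choose θ₀ hθ₀ using h
  rcases isEmpty_or_nonempty (Fin n) with hn | hn
  · exact ⟨1, one_pos, fun j => hn.elim j⟩
  · refine ⟨Finset.univ.inf' Finset.univ_nonempty fun j => freq V j (θ₀ j), ?_, fun j θ => ?_⟩
    · exact (Finset.lt_inf'_iff _).2 fun j _ => hV.freq_pos j _
    · exact (Finset.inf'_le _ (Finset.mem_univ j)).trans (hθ₀ j θ)

lemma Admissible.exists_freq_upper (hV : Admissible V) :
    ∃ M > 0, ∀ j θ, freq V j θ ≤ M := by
  have h : ∀ j, ∃ θ₀, ∀ θ, -freq V j θ₀ ≤ -freq V j θ := fun j =>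
    exists_forall_le_of_periodic (hV.continuous_freq j).neg
      fun θ k => by rw [freq_periodic]
  choose θ₀ hθ₀ using h
  refine ⟨1 + ∑ j, freq V j (θ₀ j), ?_, fun j θ => ?_⟩
  · have := Finset.sum_nonneg fun j (_ : j ∈ Finset.univ) => (hV.freq_pos j (θ₀ j)).le
    linarith
  · have h1 := hθ₀ j θ
    have h2 := Finset.single_le_sum (f := fun j => freq V j (θ₀ j))
      (fun j _ => (hV.freq_pos j (θ₀ j)).le) (Finset.mem_univ j)
    linarith

/-- Division of the estimate for the squares by `ω_j(θ) + ω_j(η) ≥ 2δ`. The lower bound `δ` comes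
from the invertibility of `V̂` and compactness of the torus. -/
lemma Admissible.exists_lipschitz (hV : Admissible V) :
    ∃ K : ℝ, 0 ≤ K ∧ ∀ j θ η, |freq V j θ - freq V j η| ≤ K * ‖θ - η‖ := by
  obtain ⟨K, hK0, hK⟩ := hV.exists_lipschitz_sq
  obtain ⟨δ, hδ, hlow⟩ := hV.exists_freq_lower
  refine ⟨K / (2 * δ), by positivity, fun j θ η => ?_⟩
  have h1 : |freq V j θ ^ 2 - freq V j η ^ 2| =
      |freq V j θ - freq V j η| * (freq V j θ + freq V j η) := by
    rw [sq_sub_sq, abs_mul, abs_of_pos (add_pos (hV.freq_pos j θ) (hV.freq_pos j η)), mul_comm]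
  have h2 := hK j θ η
  rw [h1] at h2
  rw [div_mul_eq_mul_div, le_div_iff₀ (by positivity)]
  refine le_trans ?_ h2
  refine mul_le_mul_of_nonneg_left ?_ (abs_nonneg _)
  linarith [hlow j θ, hlow j η]

end

section

/-! ### Power sums and the number of distinct eigenvalues -/

variable {d n : ℕ}

/-- The Hankel determinant of the power sums of `μ`. -/
def hankelDet (N : ℕ) (p : ℕ → ℝ) : ℝ :=
  (Matrix.of fun i j : Fin N => p (i + j)).det

lemma hankel_mulVec_dot (N : ℕ) (μ : Fin n → ℝ) (c : Fin N → ℝ) :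
    ∑ i : Fin N, c i * ∑ j : Fin N, (∑ l, μ l ^ ((i : ℕ) + j)) * c j =
      ∑ l, (∑ i : Fin N, c i * μ l ^ (i : ℕ)) ^ 2 := by
  simp only [sq, Finset.sum_mul, Finset.mul_sum]
  rw [Finset.sum_comm_cycle]
  refine Finset.sum_congr rfl fun l _ => Finset.sum_congr rfl fun i _ =>
    Finset.sum_congr rfl fun j _ => by rw [pow_add]; ring

/-- The quadratic form of the Hankel matrix at `c` is the sum over `l` of the squares of the
polynomial with coefficients `c` at `μ l`. A null vector is therefore a nonzero polynomial of degree
less than `N` vanishing at every `μ l`, and one exists exactly when there are fewer than `N`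
distinct values. -/
lemma hankelDet_ne_zero_iff (N : ℕ) (μ : Fin n → ℝ) :
    hankelDet N (fun m => ∑ l, μ l ^ m) ≠ 0 ↔ N ≤ (Finset.univ.image μ).card := by
  rw [← not_iff_not, not_not, not_le, hankelDet, ← Matrix.exists_mulVec_eq_zero_iff]
  constructor
  · rintro ⟨c, hc0, hc⟩
    by_contra hcard
    rw [not_lt] at hcard
    have h1 : ∑ l, (∑ i : Fin N, c i * μ l ^ (i : ℕ)) ^ 2 = 0 := by
      rw [← hankel_mulVec_dot]
      refine Finset.sum_eq_zero fun i _ => ?_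
      have := congrFun hc i
      simp only [Matrix.mulVec, dotProduct, Matrix.of_apply, Pi.zero_apply] at this
      rw [this, mul_zero]
    rw [Finset.sum_eq_zero_iff_of_nonneg fun _ _ => sq_nonneg _] at h1
    let p : Polynomial ℝ := ∑ i : Fin N, Polynomial.C (c i) * Polynomial.X ^ (i : ℕ)
    have hcoeff : ∀ i : Fin N, p.coeff i = c i := fun i => by
      simp only [p, Polynomial.finsetSum_coeff, Polynomial.coeff_C_mul_X_pow]
      rw [Finset.sum_eq_single i (fun j _ hj => if_neg fun h => hj (Fin.ext h.symm))
        (by simp), if_pos rfl]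
    have hN : 0 < N := by
      rcases Nat.eq_zero_or_pos N with rfl | h
      · exact absurd (Subsingleton.elim c 0) hc0
      · exact h
    have hdeg : p.natDegree < N := by
      refine lt_of_le_of_lt (Polynomial.natDegree_sum_le_of_forall_le (n := N - 1) _ _
        fun i _ => ?_) (Nat.sub_lt hN one_pos)
      exact (Polynomial.natDegree_C_mul_X_pow_le _ _).trans (by omega)
    have hp : p = 0 := by
      refine Polynomial.eq_zero_of_natDegree_lt_card_of_eval_eq_zero' p (Finset.univ.image μ)
        (fun x hx => ?_) (hdeg.trans_le hcard)
      obtain ⟨l, -, rfl⟩ := Finset.mem_image.1 hx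
      have := pow_eq_zero_iff (two_ne_zero) |>.1 (h1 l (Finset.mem_univ l))
      simpa [p, Polynomial.eval_finsetSum] using this
    exact hc0 (funext fun i => by rw [← hcoeff i, hp]; simp)
  · intro hcard
    let p : Polynomial ℝ := ∏ x ∈ Finset.univ.image μ, (Polynomial.X - Polynomial.C x)
    have hdeg : p.natDegree = (Finset.univ.image μ).card := by
      simp [p]
    have hmonic : p.Monic := Polynomial.monic_prod_of_monic _ _ fun x _ => Polynomial.monic_X_sub_C x
    refine ⟨fun i => p.coeff i, fun h0 => ?_, ?_⟩
    · have := congrFun h0 ⟨_, hcard⟩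
      simp only [Pi.zero_apply] at this
      rw [← hdeg, hmonic.coeff_natDegree] at this
      exact one_ne_zero this
    · have hl : ∀ l, ∑ i : Fin N, p.coeff i * μ l ^ (i : ℕ) = 0 := fun l => by
        rw [Fin.sum_univ_eq_sum_range (fun i => p.coeff i * μ l ^ i) N,
          ← Polynomial.eval_eq_sum_range' (by rw [hdeg]; exact hcard)]
        simp only [p, Polynomial.eval_prod]
        exact Finset.prod_eq_zero (Finset.mem_image_of_mem μ (Finset.mem_univ l)) (by simp)
      funext i
      simp only [Matrix.mulVec, dotProduct, Matrix.of_apply, Pi.zero_apply, Finset.sum_mul]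
      rw [Finset.sum_comm]
      refine Finset.sum_eq_zero fun l _ => ?_
      have := congrArg (μ l ^ (i : ℕ) * ·) (hl l)
      simp only [Finset.mul_sum, mul_zero] at this
      rw [← this]
      exact Finset.sum_congr rfl fun j _ => by rw [pow_add]; ring

lemma Diagonalizes.trace_pow {U H : Matrix (Fin n) (Fin n) ℂ} {μ : Fin n → ℝ}
    (h : Diagonalizes U H μ) (m : ℕ) : (H ^ m).trace = ((∑ l, μ l ^ m : ℝ) : ℂ) := by
  have h1 : H ^ m = U * Matrix.diagonal (fun l => ((μ l : ℂ)) ^ m) * U.conjTranspose := by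
    induction m with
    | zero => simp [h.right]
    | succ m ih =>
      rw [pow_succ, ih]
      conv_lhs => rw [h.eq]
      rw [h.conj_mul_conj, Matrix.diagonal_mul_diagonal]
      simp only [pow_succ]
  rw [h1, Matrix.trace_mul_comm, ← Matrix.mul_assoc, h.left, Matrix.one_mul, Matrix.trace_diagonal]
  push_cast; rfl

lemma Diagonalizes.det_sub {U H : Matrix (Fin n) (Fin n) ℂ} {μ : Fin n → ℝ}
    (h : Diagonalizes U H μ) (x : ℝ) :
    ((x : ℂ) • (1 : Matrix (Fin n) (Fin n) ℂ) - H).det = ((∏ l, (x - μ l) : ℝ) : ℂ) := by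
  have h1 : (x : ℂ) • (1 : Matrix (Fin n) (Fin n) ℂ) - H =
      U * Matrix.diagonal (fun l => (x : ℂ) - μ l) * U.conjTranspose := by
    have : Matrix.diagonal (fun l => (x : ℂ) - μ l) =
        (x : ℂ) • (1 : Matrix (Fin n) (Fin n) ℂ) - Matrix.diagonal (fun l => (μ l : ℂ)) := by
      rw [← Matrix.diagonal_one, ← Matrix.diagonal_smul, Matrix.diagonal_sub]
      congr 1; funext l; simp
    rw [this, Matrix.mul_sub, Matrix.sub_mul, ← h.eq, Matrix.mul_smul, Matrix.smul_mul,
      Matrix.mul_one, h.right]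
  rw [h1, Matrix.det_mul, Matrix.det_mul, mul_right_comm, ← Matrix.det_mul, h.right,
    Matrix.det_one, one_mul, Matrix.det_diagonal]
  push_cast; rfl

lemma rootMultiplicity_prod_X_sub_C (μ : Fin n → ℝ) (j : Fin n) :
    (∏ l, (Polynomial.X - Polynomial.C (μ l))).rootMultiplicity (μ j) = multiplicity' μ j := by
  rw [← Polynomial.count_roots]
  have h : (∏ l, (Polynomial.X - Polynomial.C (μ l))) =
      ((Finset.univ.val.map μ).map fun a => Polynomial.X - Polynomial.C a).prod := by
    rw [Multiset.map_map]; rfl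
  rw [h, Polynomial.roots_multiset_prod_X_sub_C, Multiset.count_map, multiplicity',
    Finset.card_def, Finset.filter_val]
  congr 1
  exact Multiset.filter_congr fun _ _ => eq_comm

/-! ### The crossing set -/

variable {V : Lattice d → Matrix (Fin n) (Fin n) ℝ}

lemma numBands_le (θ : Fin d → ℝ) : numBands V θ ≤ n :=
  Finset.card_image_le.trans (by simp)

lemma exists_numBands_max (V : Lattice d → Matrix (Fin n) (Fin n) ℝ) :
    ∃ θ₁, ∀ θ, numBands V θ ≤ numBands V θ₁ := by
  obtain ⟨N, ⟨θ₁, h1⟩, hN⟩ : ∃ N ∈ Set.range (numBands V), ∀ m ∈ Set.range (numBands V), m ≤ N :=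
    ((Set.finite_Iic n).subset (by rintro _ ⟨θ, rfl⟩; exact numBands_le θ)).exists_maximal
      ⟨_, Set.mem_range_self 0⟩ |>.imp fun N hN => ⟨hN.prop, fun m hm =>
        (le_total m N).elim id fun h => hN.le_of_ge hm h⟩
  exact ⟨θ₁, fun θ => h1 ▸ hN _ ⟨θ, rfl⟩⟩

lemma notMem_crossingSet_iff {θ : Fin d → ℝ} :
    θ ∉ crossingSet V ↔ ∀ θ', numBands V θ' ≤ numBands V θ := by
  simp [crossingSet]

lemma Admissible.numBands_eq (hV : Admissible V) (θ : Fin d → ℝ) :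
    numBands V θ = (Finset.univ.image fun j => freq V j θ ^ 2).card := by
  classical
  have h : (Finset.univ.image fun j => freq V j θ ^ 2) =
      (Finset.univ.image fun j => freq V j θ).image fun x => x ^ 2 := by
    rw [Finset.image_image]; rfl
  rw [h, Finset.card_image_of_injOn]
  · rfl
  · intro x hx y hy hxy
    simp only [Finset.coe_image, Finset.coe_univ, Set.image_univ, Set.mem_range] at hx hy
    obtain ⟨i, rfl⟩ := hx
    obtain ⟨j, rfl⟩ := hy
    exact (pow_left_inj₀ (hV.freq_pos i θ).le (hV.freq_pos j θ).le two_ne_zero).1 hxy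

lemma Admissible.freq_sq_inj (hV : Admissible V) {i j : Fin n} {θ : Fin d → ℝ} :
    freq V i θ ^ 2 = freq V j θ ^ 2 ↔ freq V i θ = freq V j θ :=
  pow_left_inj₀ (hV.freq_pos i θ).le (hV.freq_pos j θ).le two_ne_zero

/-- Off the crossing set, the coincidences among the dispersion relations are locally constant. -/
lemma Admissible.eventually_coincidence (hV : Admissible V) {θ₀ : Fin d → ℝ}
    (h0 : θ₀ ∉ crossingSet V) :
    ∀ᶠ θ in 𝓝 θ₀, θ ∉ crossingSet V ∧
      ∀ i j, freq V i θ = freq V j θ ↔ freq V i θ₀ = freq V j θ₀ := by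
  classical
  -- Continuity keeps distinct values distinct. Conversely, the maximality of their number at `θ₀`
  -- prevents coinciding values from separating.
  have h1 : ∀ᶠ θ in 𝓝 θ₀, ∀ i j, freq V i θ₀ ≠ freq V j θ₀ → freq V i θ ≠ freq V j θ := by
    rw [eventually_all]; intro i
    rw [eventually_all]; intro j
    by_cases hij : freq V i θ₀ = freq V j θ₀
    · exact Eventually.of_forall fun θ h => absurd hij h
    · filter_upwards [((hV.continuous_freq i).sub (hV.continuous_freq j)).continuousAt.eventually_ne
        (sub_ne_zero.2 hij)] with θ hθ _ using sub_ne_zero.1 hθ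
  filter_upwards [h1] with θ hθ
  rw [notMem_crossingSet_iff] at h0
  let S := Finset.univ.image fun j => freq V j θ
  let S₀ := Finset.univ.image fun j => freq V j θ₀
  have hφ : ∀ x ∈ S, ∃ i, freq V i θ = x := fun x hx => by
    obtain ⟨i, -, hi⟩ := Finset.mem_image.1 hx
    exact ⟨i, hi⟩
  -- By `h1`, equal values near `θ₀` have equal values at `θ₀`, so `φ` maps the spectrum at `θ` onto
  -- the spectrum at `θ₀`. The latter is at least as large, hence `φ` is injective; its default
  -- value 0 is never used on the spectrum.
  let φ : ℝ → ℝ := fun x => if h : ∃ i, freq V i θ = x then freq V h.choose θ₀ else 0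
  have hφi : ∀ i, φ (freq V i θ) = freq V i θ₀ := fun i => by
    have h : ∃ i', freq V i' θ = freq V i θ := ⟨i, rfl⟩
    simp only [φ, dif_pos h]
    by_contra hne
    exact hθ _ _ hne h.choose_spec
  have himg : S.image φ = S₀ := by
    simp only [S, S₀, Finset.image_image]
    exact Finset.image_congr fun i _ => hφi i
  have hle : S.card ≤ S₀.card := h0 θ
  have hcard : (S.image φ).card = S.card :=
    le_antisymm Finset.card_image_le (by rw [himg]; exact hle)
  have hinj := Finset.card_image_iff.1 hcard
  refine ⟨notMem_crossingSet_iff.2 fun θ' => (h0 θ').trans ?_, fun i j => ⟨fun h => ?_, fun h => ?_⟩⟩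
  · change S₀.card ≤ S.card
    rw [← himg, hcard]
  · by_contra hne
    exact hθ i j hne h
  · refine hinj ?_ ?_ (by rw [hφi, hφi, h]) <;> simp [S]

lemma Admissible.isOpen_compl_crossingSet (hV : Admissible V) : IsOpen (crossingSet V)ᶜ :=
  isOpen_iff_mem_nhds.2 fun _ h0 => (hV.eventually_coincidence h0).mono fun _ h => h.1

end

section

/-! ### Analyticity of the dispersion relations off the crossing set -/

open scoped ContDiff

variable {d n : ℕ} {V : Lattice d → Matrix (Fin n) (Fin n) ℝ}

lemma Admissible.analyticAt_Vhat (hV : Admissible V) (θ : Fin d → ℝ) (a b : Fin n) :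
    AnalyticAt ℝ (fun θ => Vhat V θ a b) θ :=
  analyticAt_expSeries (hV.expDecay a b) θ

lemma analyticAt_re {F : Type*} [NormedAddCommGroup F] [NormedSpace ℝ F] {f : F → ℂ} {x : F}
    (hf : AnalyticAt ℝ f x) : AnalyticAt ℝ (fun y => (f y).re) x :=
  (Complex.reCLM.analyticAt _).comp hf

lemma analyticAt_det {F 𝕜 : Type*} [NormedAddCommGroup F] [NormedSpace ℝ F] [NormedField 𝕜]
    [NormedAlgebra ℝ 𝕜] {N : ℕ} {M : F → Matrix (Fin N) (Fin N) 𝕜} {x : F}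
    (h : ∀ i j, AnalyticAt ℝ (fun y => M y i j) x) : AnalyticAt ℝ (fun y => (M y).det) x := by
  simp only [Matrix.det_apply]
  refine Finset.analyticAt_fun_sum _ fun σ _ => ?_
  simp only [Units.smul_def, zsmul_eq_mul]
  exact analyticAt_const.mul (Finset.analyticAt_fun_prod _ fun i _ => h _ _)

lemma Admissible.analyticAt_Vhat_pow (hV : Admissible V) (m : ℕ) (θ : Fin d → ℝ) (a b : Fin n) :
    AnalyticAt ℝ (fun θ => (Vhat V θ ^ m) a b) θ := by
  induction m generalizing a b with
  | zero => simp only [pow_zero]; exact analyticAt_const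
  | succ m ih =>
    simp only [pow_succ, Matrix.mul_apply]
    exact Finset.analyticAt_fun_sum _ fun c _ => (ih a c).mul (hV.analyticAt_Vhat θ c b)

lemma Admissible.sum_freq_pow (hV : Admissible V) (θ : Fin d → ℝ) (m : ℕ) :
    ∑ l, (freq V l θ ^ 2) ^ m = ((Vhat V θ ^ m).trace).re := by
  obtain ⟨U, hU⟩ := hV.diagonalizes θ
  rw [hU.trace_pow, Complex.ofReal_re]

lemma Admissible.analyticAt_hankelDet (hV : Admissible V) (N : ℕ) (θ : Fin d → ℝ) :
    AnalyticAt ℝ (fun θ => hankelDet N fun m => ∑ l, (freq V l θ ^ 2) ^ m) θ := by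
  simp only [hV.sum_freq_pow, hankelDet]
  refine analyticAt_det fun i j => ?_
  simp only [Matrix.of_apply, Matrix.trace, Matrix.diag]
  exact analyticAt_re (Finset.analyticAt_fun_sum _ fun c _ => hV.analyticAt_Vhat_pow _ θ c c)

/-- The crossing set is null. -/
lemma Admissible.volume_crossingSet (hV : Admissible V) : volume (crossingSet V) = 0 := by
  obtain ⟨θ₁, h1⟩ := exists_numBands_max V
  -- With `N` the maximal number of bands, the analytic function `G` vanishes exactly where the
  -- number of bands is smaller, and it is nonzero at `θ₁`.
  let G := fun θ => hankelDet (numBands V θ₁) fun m => ∑ l, (freq V l θ ^ 2) ^ m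
  have hG : ∀ θ, G θ ≠ 0 ↔ numBands V θ₁ ≤ numBands V θ := fun θ => by
    rw [hV.numBands_eq θ]; exact hankelDet_ne_zero_iff _ _
  have h2 := measure_zeros_of_analyticOnNhd (volume : Measure (Fin d → ℝ)) isOpen_univ
    isPreconnected_univ (f := G) (fun θ _ => hV.analyticAt_hankelDet _ θ) (Set.mem_univ θ₁)
    ((hG θ₁).2 le_rfl)
  have h3 : crossingSet V ⊆ Set.univ ∩ G ⁻¹' {0} := by
    rintro θ ⟨θ', h'⟩
    refine ⟨Set.mem_univ _, ?_⟩
    by_contra hne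
    exact absurd ((hG θ).1 hne) (not_le.2 (h'.trans_le (h1 θ')))
  exact measure_mono_null h3 h2

/-- Differentiation in the last variable. -/
def lastDeriv (g : (Fin d → ℝ) × ℝ → ℝ) : (Fin d → ℝ) × ℝ → ℝ := fun q => fderiv ℝ g q (0, 1)

lemma analyticAt_lastDeriv {g : (Fin d → ℝ) × ℝ → ℝ} (hg : ∀ q, AnalyticAt ℝ g q)
    (q : (Fin d → ℝ) × ℝ) : AnalyticAt ℝ (lastDeriv g) q :=
  ((ContinuousLinearMap.apply ℝ ℝ ((0 : Fin d → ℝ), (1 : ℝ))).analyticAt _).comp (hg q).fderiv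

lemma lastDeriv_eq {g : (Fin d → ℝ) × ℝ → ℝ} (hg : ∀ q, AnalyticAt ℝ g q) (θ : Fin d → ℝ)
    {q : Polynomial ℝ} (h : ∀ x, g (θ, x) = q.eval x) (x : ℝ) :
    lastDeriv g (θ, x) = q.derivative.eval x := by
  have h1 : HasDerivAt (fun y : ℝ => (θ, y)) ((0 : Fin d → ℝ), (1 : ℝ)) x :=
    (hasDerivAt_const x θ).prodMk (hasDerivAt_id x)
  have h2 := (hg (θ, x)).differentiableAt.hasFDerivAt.comp_hasDerivAt x h1
  have h3 : HasDerivAt (g ∘ fun y : ℝ => (θ, y)) (q.derivative.eval x) x :=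
    (q.hasDerivAt x).congr_of_eventuallyEq (Eventually.of_forall fun y => h y)
  exact h2.unique h3

/-- The characteristic polynomial of `V̂(θ)`. -/
def charPol (V : Lattice d → Matrix (Fin n) (Fin n) ℝ) (θ : Fin d → ℝ) : Polynomial ℝ :=
  ∏ l, (Polynomial.X - Polynomial.C (freq V l θ ^ 2))

/-- Joint analyticity in `θ` and `x` is the point: the coefficients of the characteristic polynomial
are analytic although its roots need not be. The determinant is real, so taking its real part loses
nothing. -/
lemma Admissible.exists_iterate_derivative (hV : Admissible V) (m : ℕ) :
    ∃ g : (Fin d → ℝ) × ℝ → ℝ, (∀ q, AnalyticAt ℝ g q) ∧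
      ∀ θ x, g (θ, x) = ((Polynomial.derivative^[m]) (charPol V θ)).eval x := by
  induction m with
  | zero =>
    refine ⟨fun q => (((q.2 : ℂ) • (1 : Matrix (Fin n) (Fin n) ℂ) - Vhat V q.1).det).re,
      fun q => analyticAt_re (analyticAt_det fun i j => ?_), fun θ x => ?_⟩
    · simp only [Matrix.sub_apply, Matrix.smul_apply, smul_eq_mul]
      refine AnalyticAt.sub (AnalyticAt.mul ?_ analyticAt_const) ?_
      · exact (Complex.ofRealCLM.analyticAt _).comp analyticAt_snd
      · exact (hV.analyticAt_Vhat q.1 i j).comp analyticAt_fst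
    · obtain ⟨U, hU⟩ := hV.diagonalizes θ
      change (((x : ℂ) • (1 : Matrix (Fin n) (Fin n) ℂ) - Vhat V θ).det).re = _
      rw [hU.det_sub, Complex.ofReal_re]
      simp [charPol, Polynomial.eval_prod]
  | succ m ih =>
    obtain ⟨g, hg, h⟩ := ih
    refine ⟨lastDeriv g, analyticAt_lastDeriv hg, fun θ x => ?_⟩
    rw [lastDeriv_eq hg θ (h θ), Function.iterate_succ_apply']

lemma rootMultiplicity_charPol (θ : Fin d → ℝ) (j : Fin n) :
    (charPol V θ).rootMultiplicity (freq V j θ ^ 2) =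
      multiplicity' (fun l => freq V l θ ^ 2) j :=
  rootMultiplicity_prod_X_sub_C _ j

lemma charPol_ne_zero (θ : Fin d → ℝ) : charPol V θ ≠ 0 :=
  Finset.prod_ne_zero_iff.2 fun _ _ => Polynomial.X_sub_C_ne_zero _

/-- Off the crossing set the multiplicity `r` of `ω_j²` is locally constant, so `ω_j²` is a simple
root of the derivative of order `r - 1` of the characteristic polynomial. The analytic implicit
function theorem gives an analytic root branch, and continuity of `ω_j` identifies the two. -/
lemma Admissible.analyticAt_freq_sq (hV : Admissible V) {θ₀ : Fin d → ℝ}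
    (h0 : θ₀ ∉ crossingSet V) (j : Fin n) : AnalyticAt ℝ (fun θ => freq V j θ ^ 2) θ₀ := by
  let mult := fun θ => multiplicity' (fun l => freq V l θ ^ 2) j
  have hmult : ∀ᶠ θ in 𝓝 θ₀, mult θ = mult θ₀ := by
    filter_upwards [hV.eventually_coincidence h0] with θ hθ
    simp only [mult, multiplicity']
    congr 1
    refine Finset.filter_congr fun l _ => ?_
    rw [hV.freq_sq_inj, hV.freq_sq_inj]
    exact hθ.2 l j
  have hpos : 0 < mult θ₀ := multiplicity'_pos _ j
  obtain ⟨F, hF, hFe⟩ := hV.exists_iterate_derivative (mult θ₀ - 1)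
  let u : (Fin d → ℝ) × ℝ := (θ₀, freq V j θ₀ ^ 2)
  have hzero : ∀ θ, mult θ = mult θ₀ → F (θ, freq V j θ ^ 2) = 0 := fun θ hθ => by
    rw [hFe]
    refine Polynomial.isRoot_iterate_derivative_of_lt_rootMultiplicity ?_
    rw [rootMultiplicity_charPol]
    change _ < mult θ
    omega
  -- The derivative of order equal to the root multiplicity is a factorial times the cofactor of the
  -- root, which does not vanish.
  have hder : lastDeriv F u ≠ 0 := by
    rw [lastDeriv_eq hF θ₀ (hFe θ₀), ← Function.iterate_succ_apply' (f := Polynomial.derivative),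
      Nat.succ_eq_add_one, Nat.sub_add_cancel hpos]
    have h1 : mult θ₀ = (charPol V θ₀).rootMultiplicity (freq V j θ₀ ^ 2) :=
      (rootMultiplicity_charPol θ₀ j).symm
    rw [h1, Polynomial.eval_iterate_derivative_rootMultiplicity]
    exact smul_ne_zero (Nat.factorial_ne_zero _)
      (Polynomial.eval_divByMonic_pow_rootMultiplicity_ne_zero _ (charPol_ne_zero θ₀))
  have cdf : ContDiffAt ℝ ω F u := (hF u).contDiffAt
  have inv : (fderiv ℝ F u ∘L .inr ℝ (Fin d → ℝ) ℝ).IsInvertible := by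
    refine ⟨ContinuousLinearEquiv.unitsEquivAut ℝ (Units.mk0 _ hder), ?_⟩
    ext
    simp [lastDeriv]
  have hloc := cdf.eventually_apply_eq_iff_implicitFunction (by simp) inv
  have hcont : Tendsto (fun θ => (θ, freq V j θ ^ 2)) (𝓝 θ₀) (𝓝 u) :=
    (continuous_id.prodMk ((hV.continuous_freq j).pow 2)).tendsto θ₀
  have heq : (fun θ => freq V j θ ^ 2) =ᶠ[𝓝 θ₀] cdf.implicitFunction (by simp) inv := by
    filter_upwards [hcont.eventually hloc, hmult] with θ h1 h2
    exact ((h1.1 ((hzero θ h2).trans (hzero θ₀ rfl).symm))).symm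
  have han : AnalyticAt ℝ (cdf.implicitFunction (by simp) inv) θ₀ :=
    (cdf.contDiffAt_implicitFunction (by simp) inv).analyticAt
  exact han.congr heq.symm

lemma Admissible.analyticAt_freq (hV : Admissible V) {θ₀ : Fin d → ℝ}
    (h0 : θ₀ ∉ crossingSet V) (j : Fin n) : AnalyticAt ℝ (freq V j) θ₀ := by
  have h1 : freq V j = fun θ => √(freq V j θ ^ 2) := by
    funext θ; rw [Real.sqrt_sq (hV.freq_pos j θ).le]
  rw [h1]
  have h2 : ContDiffAt ℝ ω (fun θ => freq V j θ ^ 2) θ₀ := (hV.analyticAt_freq_sq h0 j).contDiffAt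
  exact (h2.sqrt (pow_pos (hV.freq_pos j θ₀) 2).ne').analyticAt

lemma hasDerivAt_update (θ : Fin d → ℝ) (l : Fin d) (s : ℝ) :
    HasDerivAt (fun s => Function.update θ l s) (Pi.single l 1) s := by
  rw [hasDerivAt_pi]
  intro i
  by_cases hi : i = l
  · subst hi
    simp only [Function.update_self, Pi.single_eq_same]
    exact hasDerivAt_id' s
  · simpa [hi] using hasDerivAt_const s (θ i)

lemma pderiv_eq_fderiv {f : (Fin d → ℝ) → ℝ} {θ : Fin d → ℝ} (hf : DifferentiableAt ℝ f θ)
    (l : Fin d) : pderiv l f θ = fderiv ℝ f θ (Pi.single l 1) := by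
  have h1 := hasDerivAt_update θ l (θ l)
  have h2 : HasFDerivAt f (fderiv ℝ f θ) (Function.update θ l (θ l)) := by
    rw [Function.update_eq_self]; exact hf.hasFDerivAt
  exact (h2.comp_hasDerivAt (θ l) h1).deriv

lemma hasDerivAt_pderiv {f : (Fin d → ℝ) → ℝ} {θ : Fin d → ℝ} (hf : DifferentiableAt ℝ f θ)
    (l : Fin d) : HasDerivAt (fun s => f (Function.update θ l s)) (pderiv l f θ) (θ l) := by
  have h2 : DifferentiableAt ℝ f (Function.update θ l (θ l)) := by
    rw [Function.update_eq_self]; exact hf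
  exact (h2.comp (θ l) (hasDerivAt_update θ l (θ l)).differentiableAt).hasDerivAt

lemma Admissible.analyticAt_pderiv_freq (hV : Admissible V) {θ₀ : Fin d → ℝ}
    (h0 : θ₀ ∉ crossingSet V) (l : Fin d) (j : Fin n) :
    AnalyticAt ℝ (pderiv l (freq V j)) θ₀ := by
  have h1 : AnalyticAt ℝ (fun θ => fderiv ℝ (freq V j) θ (Pi.single l 1)) θ₀ :=
    ((ContinuousLinearMap.apply ℝ ℝ (Pi.single l (1 : ℝ) : Fin d → ℝ)).analyticAt _).comp
      (hV.analyticAt_freq h0 j).fderiv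
  refine h1.congr ?_
  filter_upwards [hV.isOpen_compl_crossingSet.mem_nhds h0] with θ hθ
  exact (pderiv_eq_fderiv (hV.analyticAt_freq hθ j).differentiableAt l).symm

lemma Admissible.hasDerivAt_freq (hV : Admissible V) {θ : Fin d → ℝ} (h : θ ∉ crossingSet V)
    (l : Fin d) (j : Fin n) :
    HasDerivAt (fun s => freq V j (Function.update θ l s)) (pderiv l (freq V j) θ) (θ l) :=
  hasDerivAt_pderiv (hV.analyticAt_freq h j).differentiableAt l

lemma Admissible.ae_notMem_crossingSet (hV : Admissible V) :
    ∀ᵐ θ : Fin d → ℝ, θ ∉ crossingSet V :=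
  measure_eq_zero_iff_ae_notMem.1 hV.volume_crossingSet

/-- The partial derivatives of the dispersion relations vanish on a null set only. -/
lemma Admissible.ae_pderiv_ne_zero (hV : Admissible V) (l : Fin d) (j : Fin n) :
    ∀ᵐ θ : Fin d → ℝ, pderiv l (freq V j) θ ≠ 0 := by
  have h1 : volume ((crossingSet V)ᶜ ∩ pderiv l (freq V j) ⁻¹' {0}) = 0 := by
    refine measure_null_of_locally_null _ fun q hq => ?_
    -- On this open connected component the derivative is analytic and, by the dispersion
    -- hypothesis, somewhere nonzero. Being null is a local property, so one component at a time
    -- suffices.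
    let U := connectedComponentIn (crossingSet V)ᶜ q
    have hU : IsOpen U := hV.isOpen_compl_crossingSet.connectedComponentIn
    have hqU : q ∈ U := mem_connectedComponentIn hq.1
    obtain ⟨p, hp, hpne⟩ := hV.dispersive l j q hq.1
    refine ⟨U ∩ pderiv l (freq V j) ⁻¹' {0}, ?_, measure_zeros_of_analyticOnNhd volume hU
      isPreconnected_connectedComponentIn (fun θ hθ => hV.analyticAt_pderiv_freq
        (connectedComponentIn_subset _ _ hθ) l j) hp hpne⟩
    rw [mem_nhdsWithin_iff_eventually]
    filter_upwards [hU.mem_nhds hqU] with y hy hyU using ⟨hy, hyU.2⟩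
  filter_upwards [measure_eq_zero_iff_ae_notMem.1 h1, hV.ae_notMem_crossingSet] with θ h2 h3 h4
  exact h2 ⟨h3, h4⟩

lemma Admissible.tendsto_update (θ : Fin d → ℝ) (l : Fin d) :
    Tendsto (fun s => Function.update θ l s) (𝓝 (θ l)) (𝓝 θ) := by
  have h : Continuous fun s => Function.update θ l s := continuous_const.update l continuous_id
  simpa using h.tendsto (θ l)

/-- The coincidence `ω_i = ω_j` persists in a neighbourhood, so both functions agree on a segment
through `θ`. Degenerate indices thus share one group velocity. -/
lemma Admissible.pderiv_congr (hV : Admissible V) {θ : Fin d → ℝ} (h : θ ∉ crossingSet V)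
    {i j : Fin n} (hij : freq V i θ = freq V j θ) (l : Fin d) :
    pderiv l (freq V i) θ = pderiv l (freq V j) θ := by
  have h1 := (Admissible.tendsto_update θ l).eventually (hV.eventually_coincidence h)
  exact Filter.EventuallyEq.deriv_eq (h1.mono fun s hs => (hs.2 i j).2 hij)

/-! ### The derivative of the eigenvalues -/

/-- The spectral projection of `V̂(θ)` onto the eigenspace of `ω_j(θ)²`. -/
def bandProj (V : Lattice d → Matrix (Fin n) (Fin n) ℝ) (j : Fin n) (θ : Fin d → ℝ) :
    Matrix (Fin n) (Fin n) ℂ :=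
  specProj (Vhat V θ) (fun l => freq V l θ ^ 2) j

/-- The multiplicity of the eigenvalue `ω_j(θ)`. -/
def bandMult (V : Lattice d → Matrix (Fin n) (Fin n) ℝ) (j : Fin n) (θ : Fin d → ℝ) : ℕ :=
  multiplicity' (fun l => freq V l θ ^ 2) j

/-- Off the crossing set the case distinctions in the Lagrange product are locally constant, so the
product is locally one fixed expression with continuous factors and nonvanishing denominators. -/
lemma Admissible.continuousAt_bandProj (hV : Admissible V) {θ₀ : Fin d → ℝ}
    (h0 : θ₀ ∉ crossingSet V) (j : Fin n) : ContinuousAt (bandProj V j) θ₀ := by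
  let f : Fin n → (Fin d → ℝ) → Matrix (Fin n) (Fin n) ℂ := fun i θ =>
    if freq V i θ₀ ^ 2 = freq V j θ₀ ^ 2 then 1 else
      ((freq V j θ ^ 2 - freq V i θ ^ 2 : ℝ) : ℂ)⁻¹ • (Vhat V θ - ((freq V i θ ^ 2 : ℝ) : ℂ) • 1)
  have h1 : bandProj V j =ᶠ[𝓝 θ₀] fun θ => ((List.finRange n).map fun i => f i θ).prod := by
    filter_upwards [hV.eventually_coincidence h0] with θ hθ
    simp only [bandProj, specProj, f]
    congr 2
    funext i
    have : freq V i θ ^ 2 = freq V j θ ^ 2 ↔ freq V i θ₀ ^ 2 = freq V j θ₀ ^ 2 := by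
      rw [hV.freq_sq_inj, hV.freq_sq_inj]; exact hθ.2 i j
    simp only [this]
  refine ContinuousAt.congr ?_ h1.symm
  refine tendsto_list_prod _ fun i _ => ?_
  by_cases hi : freq V i θ₀ ^ 2 = freq V j θ₀ ^ 2
  · simp only [f, if_pos hi]; exact tendsto_const_nhds
  · simp only [f, if_neg hi]
    have hc : ∀ l, Continuous fun θ => ((freq V l θ ^ 2 : ℝ) : ℂ) := fun l =>
      Complex.continuous_ofReal.comp ((hV.continuous_freq l).pow 2)
    have h2 : ContinuousAt (fun θ => ((freq V j θ ^ 2 - freq V i θ ^ 2 : ℝ) : ℂ)⁻¹) θ₀ := by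
      refine ContinuousAt.inv₀ ?_ (by exact_mod_cast sub_ne_zero.2 (Ne.symm hi))
      exact (Complex.continuous_ofReal.comp (((hV.continuous_freq j).pow 2).sub
        ((hV.continuous_freq i).pow 2))).continuousAt
    exact (h2.smul (hV.continuous_Vhat.sub ((hc i).smul continuous_const)).continuousAt).tendsto

/-- The derivative of an eigenvalue is the trace of the derivative of the matrix over the
eigenspace (Hellmann–Feynman). -/
lemma Admissible.trace_dVhat_mul_bandProj (hV : Admissible V) {θ : Fin d → ℝ}
    (h : θ ∉ crossingSet V) (l : Fin d) (j : Fin n) :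
    (dVhat V l θ * bandProj V j θ).trace =
      ((bandMult V j θ * (2 * freq V j θ * pderiv l (freq V j) θ) : ℝ) : ℂ) := by
  let γ : ℝ → Fin d → ℝ := fun s => Function.update θ l s
  have hγ : Tendsto γ (𝓝 (θ l)) (𝓝 θ) := Admissible.tendsto_update θ l
  have hγ0 : γ (θ l) = θ := Function.update_eq_self l θ
  let Q := bandProj V j θ
  obtain ⟨U₀, hU₀⟩ := hV.diagonalizes θ
  have hQQ : Q * Q = Q := by
    have := hU₀.specProj_mul j j
    rwa [if_pos rfl] at this
  have hP : Tendsto (fun s => bandProj V j (γ s)) (𝓝[≠] (θ l)) (𝓝 Q) :=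
    ((hV.continuousAt_bandProj h j).tendsto.comp hγ).mono_left nhdsWithin_le_nhds
  have hlam : HasDerivAt (fun s => freq V j (γ s) ^ 2)
      (2 * freq V j θ * pderiv l (freq V j) θ) (θ l) := by
    have := (hV.hasDerivAt_freq h l j).pow 2
    convert! this using 1
    simp
  rw [hasDerivAt_iff_tendsto_slope] at hlam
  have hVs : Tendsto (fun s => (((s - θ l : ℝ) : ℂ)⁻¹) • (Vhat V (γ s) - Vhat V θ))
      (𝓝[≠] (θ l)) (𝓝 (dVhat V l θ)) := by
    refine tendsto_pi_nhds.2 fun a => tendsto_pi_nhds.2 fun b => ?_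
    have := hasDerivAt_iff_tendsto_slope.1 (hV.hasDerivAt_Vhat θ l a b)
    refine this.congr fun s => ?_
    simp only [slope, vsub_eq_sub, Function.update_eq_self, Matrix.smul_apply, Matrix.sub_apply,
      smul_eq_mul, Complex.real_smul, γ]
    push_cast; rfl
  -- With `V̂(s)P(s) = λ(s)P(s)` on one side and `Q V̂(0) = λ(0)Q` on the other, tracing the
  -- difference quotient of `V̂` against `P(s)Q` gives exactly the slope of `λ` times `tr P(s)Q`.
  -- Only continuity of `P`, not differentiability, is used in the limit.
  have hid : ∀ s, ((((s - θ l : ℝ) : ℂ)⁻¹ • (Vhat V (γ s) - Vhat V θ)) *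
      (bandProj V j (γ s) * Q)).trace =
      ((slope (fun s => freq V j (γ s) ^ 2) (θ l) s : ℝ) : ℂ) * (bandProj V j (γ s) * Q).trace := by
    intro s
    obtain ⟨U, hU⟩ := hV.diagonalizes (γ s)
    have e1 : Vhat V (γ s) * bandProj V j (γ s) =
        ((freq V j (γ s) ^ 2 : ℝ) : ℂ) • bandProj V j (γ s) := hU.mul_specProj j
    have e2 : Q * Vhat V θ = ((freq V j θ ^ 2 : ℝ) : ℂ) • Q := hU₀.specProj_mul_self j
    have e3 : (Vhat V (γ s) * (bandProj V j (γ s) * Q)).trace =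
        ((freq V j (γ s) ^ 2 : ℝ) : ℂ) * (bandProj V j (γ s) * Q).trace := by
      rw [← Matrix.mul_assoc, e1, Matrix.smul_mul, Matrix.trace_smul, smul_eq_mul]
    have e4 : (Vhat V θ * (bandProj V j (γ s) * Q)).trace =
        ((freq V j θ ^ 2 : ℝ) : ℂ) * (bandProj V j (γ s) * Q).trace := by
      rw [Matrix.trace_mul_comm, Matrix.mul_assoc, e2, Matrix.mul_smul, Matrix.trace_smul,
        smul_eq_mul]
    rw [Matrix.smul_mul, Matrix.trace_smul, Matrix.sub_mul, Matrix.trace_sub, e3, e4, slope,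
      smul_eq_mul, vsub_eq_sub, smul_eq_mul, hγ0]
    push_cast; ring
  have htr : ∀ {f : ℝ → Matrix (Fin n) (Fin n) ℂ} {A : Matrix (Fin n) (Fin n) ℂ},
      Tendsto f (𝓝[≠] (θ l)) (𝓝 A) → Tendsto (fun s => (f s).trace) (𝓝[≠] (θ l)) (𝓝 A.trace) :=
    fun hf => ((continuous_id.matrix_trace).tendsto _).comp hf
  have l1 := htr (hVs.mul (hP.mul_const Q))
  have l2 := ((Complex.continuous_ofReal.tendsto _).comp hlam).mul (htr (hP.mul_const Q))
  have l3 := tendsto_nhds_unique (l1.congr hid) l2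
  have htrQ : Q.trace = bandMult V j θ := hU₀.trace_specProj j
  rw [hQQ, htrQ] at l3
  rw [l3]
  push_cast; ring

end

section

/-! ### Fourier coefficients on the torus -/

variable {d n : ℕ}

/-- The Haar probability measure on `ℝ^d / ℤ^d`. -/
def unitHaar (d : ℕ) : Measure (UnitAddTorus (Fin d)) :=
  Measure.pi fun _ => AddCircle.haarAddCircle

instance : IsProbabilityMeasure (unitHaar d) := by unfold unitHaar; infer_instance

instance : (unitHaar d).IsAddRightInvariant := by unfold unitHaar; infer_instance

/-- The representative in `(-π, π]^d` of a point of the torus. -/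
def toAngle (x : UnitAddTorus (Fin d)) : Fin d → ℝ :=
  fun i => 2 * Real.pi * (AddCircle.equivIoc 1 (-1 / 2) (x i)).1

/-- The normalized Lebesgue measure on the torus. -/
def haarTorus (d : ℕ) : Measure (Fin d → ℝ) :=
  (ENNReal.ofReal ((2 * Real.pi) ^ d))⁻¹ • volume.restrict (torus d)

/-- The representative is taken in `(-1/2, 1/2]` and scaled by `2π`. Through this map the Fourier
analysis of `UnitAddTorus` becomes available for functions on the cube `(-π, π]^d`. -/
lemma measurePreserving_toAngle :
    MeasurePreserving (toAngle (d := d)) (unitHaar d) (haarTorus d) := by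
  have h1 := UnitAddTorus.measurePreserving_equivPiIoc (d := Fin d) (fun _ => (-1 / 2 : ℝ))
  set S : Set (Fin d → ℝ) := {x | ∀ i, x i ∈ Set.Ioc (-1 / 2 : ℝ) (-1 / 2 + 1)} with hS
  have hSm : MeasurableSet S := MeasurableSet.univ_pi' fun i => measurableSet_Ioc
  have h2 : MeasurePreserving (Subtype.val : S → Fin d → ℝ)
      (Measure.comap Subtype.val volume) (volume.restrict S) :=
    ⟨measurable_subtype_coe, map_comap_subtype_coe hSm volume⟩
  have hpi : (2 * Real.pi) ≠ 0 := by positivity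
  have h3 : MeasurePreserving (fun x : Fin d → ℝ => (2 * Real.pi) • x) (volume.restrict S)
      (haarTorus d) := by
    refine ⟨measurable_const_smul _, ?_⟩
    have hpre : S = (fun x : Fin d → ℝ => (2 * Real.pi) • x) ⁻¹' torus d := by
      ext x
      simp only [hS, torus, Set.mem_ofPred_eq, Set.mem_preimage, Set.mem_pi, Set.mem_univ,
        true_imp_iff, Pi.smul_apply, smul_eq_mul, Set.mem_Ioc]
      refine forall_congr' fun i => and_congr ?_ ?_ <;>
      · constructor <;> intro h <;> nlinarith [Real.pi_pos]
    have htm : MeasurableSet (torus d) := MeasurableSet.univ_pi fun i => measurableSet_Ioc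
    rw [hpre, ← Measure.restrict_map (measurable_const_smul _) htm,
      Measure.map_addHaar_smul volume hpi, haarTorus, Measure.restrict_smul]
    congr 1
    rw [Module.finrank_fin_fun, abs_of_pos (by positivity), ENNReal.ofReal_inv_of_pos (by positivity)]
  exact h3.comp (h2.comp h1)

instance : IsProbabilityMeasure (haarTorus d) :=
  measurePreserving_toAngle.map_eq ▸
    Measure.isProbabilityMeasure_map measurePreserving_toAngle.aemeasurable

lemma integral_haarTorus {E : Type*} [NormedAddCommGroup E] [NormedSpace ℝ E]
    (f : (Fin d → ℝ) → E) :
    ∫ θ, f θ ∂haarTorus d = ((2 * Real.pi) ^ d)⁻¹ • ∫ θ in torus d, f θ := by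
  rw [haarTorus, integral_smul_measure, ENNReal.toReal_inv, ENNReal.toReal_ofReal (by positivity)]

lemma haarTorus_absolutelyContinuous : haarTorus d ≪ volume :=
  (Measure.smul_absolutelyContinuous).trans Measure.restrict_le_self.absolutelyContinuous

lemma aemeasurable_toAngle_comp {f : (Fin d → ℝ) → ℂ} (hf : MemLp f 2 (haarTorus d)) :
    MemLp (f ∘ toAngle) 2 (unitHaar d) := hf.comp_measurePreserving measurePreserving_toAngle

lemma coe_toAngle (x : UnitAddTorus (Fin d)) (i : Fin d) :
    ((toAngle x i / (2 * Real.pi) : ℝ) : UnitAddCircle) = x i := by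
  rw [toAngle, mul_div_cancel_left₀ _ (by positivity)]
  exact (AddCircle.equivIoc 1 (-1 / 2)).symm_apply_apply (x i)

lemma exp_pair_toAngle (z : Lattice d) (x : UnitAddTorus (Fin d)) :
    Complex.exp (Complex.I * (pair z (toAngle x) : ℂ)) = UnitAddTorus.mFourier z x := by
  rw [UnitAddTorus.mFourier, ContinuousMap.coe_mk, pair]
  push_cast
  rw [Finset.mul_sum, Complex.exp_sum]
  refine Finset.prod_congr rfl fun i _ => ?_
  conv_rhs => rw [← coe_toAngle x i]
  rw [fourier_coe_apply]
  congr 1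
  have : (Real.pi : ℂ) ≠ 0 := Complex.ofReal_ne_zero.mpr Real.pi_ne_zero
  push_cast
  field_simp

/-- The coefficients `(2π)^{-d} ∫ e^{i(z,θ)} f(θ) dθ`. -/
def fourierCoef (f : (Fin d → ℝ) → ℂ) (z : Lattice d) : ℂ :=
  ∫ θ, Complex.exp (Complex.I * (pair z θ : ℂ)) * f θ ∂haarTorus d

lemma integral_unitHaar_comp {E : Type*} [NormedAddCommGroup E] [NormedSpace ℝ E]
    {f : (Fin d → ℝ) → E} (hf : AEStronglyMeasurable f (haarTorus d)) :
    ∫ x, f (toAngle x) ∂unitHaar d = ∫ θ, f θ ∂haarTorus d := by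
  rw [← measurePreserving_toAngle.map_eq] at hf ⊢
  rw [integral_map measurePreserving_toAngle.aemeasurable hf]

lemma continuous_exp_pair (z : Lattice d) :
    Continuous fun θ : Fin d → ℝ => Complex.exp (Complex.I * (pair z θ : ℂ)) :=
  Complex.continuous_exp.comp
    (continuous_const.mul (Complex.continuous_ofReal.comp (continuous_pair z)))

lemma fourierCoef_eq {f : (Fin d → ℝ) → ℂ} (hf : AEStronglyMeasurable f (haarTorus d))
    (z : Lattice d) :
    fourierCoef f z = ∫ x, UnitAddTorus.mFourier z x * f (toAngle x) ∂unitHaar d := by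
  refine (integral_unitHaar_comp ((continuous_exp_pair z).aestronglyMeasurable.mul hf)).symm.trans ?_
  simp only [Pi.mul_apply, exp_pair_toAngle]

/-- Parseval's identity. `fourierCoef` carries `e^{+i(z,θ)}`, so its value at `z` is the usual
coefficient at `-z`; the sum is reindexed by negation. -/
lemma hasSum_fourierCoef_mul {f g : (Fin d → ℝ) → ℂ} (hf : MemLp f 2 (haarTorus d))
    (hg : MemLp g 2 (haarTorus d)) :
    HasSum (fun z => starRingEnd ℂ (fourierCoef f z) * fourierCoef g z)
      (∫ θ, starRingEnd ℂ (f θ) * g θ ∂haarTorus d) := by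
  have hF := aemeasurable_toAngle_comp hf
  have hG := aemeasurable_toAngle_comp hg
  have key := UnitAddTorus.hasSum_prod_mFourierCoeff (d := Fin d) (hF.toLp _) (hG.toLp _)
  have e : ∀ {h : (Fin d → ℝ) → ℂ} (hh : MemLp h 2 (haarTorus d))
      (hH : MemLp (h ∘ toAngle) 2 (unitHaar d)) (z : Lattice d),
      UnitAddTorus.mFourierCoeff (hH.toLp _) (-z) = fourierCoef h z := by
    intro h hh hH z
    rw [fourierCoef_eq hh.1]
    refine integral_congr_ae ?_
    filter_upwards [hH.coeFn_toLp] with x hx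
    rw [neg_neg, smul_eq_mul]
    exact congrArg _ hx
  have key2 := (Equiv.neg (Lattice d)).hasSum_iff.mpr key
  have e3 : ∫ θ, starRingEnd ℂ (f θ) * g θ ∂haarTorus d
      = ∫ x, starRingEnd ℂ (hF.toLp _ x) * hG.toLp _ x ∂unitHaar d := by
    refine (integral_unitHaar_comp
      ((Complex.continuous_conj.comp_aestronglyMeasurable hf.1).mul hg.1)).symm.trans ?_
    refine integral_congr_ae ?_
    filter_upwards [hF.coeFn_toLp, hG.coeFn_toLp] with x hx hx'
    rw [hx, hx']; rfl
  rw [e3]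
  refine key2.congr_fun fun z => ?_
  simp only [Function.comp_apply, Equiv.neg_apply]
  rw [← e hf hF, ← e hg hG]
  rfl

lemma tsum_enorm_fourierCoef_sq {f : (Fin d → ℝ) → ℂ} (hf : MemLp f 2 (haarTorus d)) :
    ∑' z, ‖fourierCoef f z‖ₑ ^ 2 = ∫⁻ θ, ‖f θ‖ₑ ^ 2 ∂haarTorus d := by
  have h := hasSum_fourierCoef_mul hf hf
  have h1 : HasSum (fun z => ‖fourierCoef f z‖ ^ 2) (∫ θ, ‖f θ‖ ^ 2 ∂haarTorus d) := by
    rw [← Complex.hasSum_ofReal, ← integral_complex_ofReal]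
    simpa only [Complex.conj_mul', Complex.ofReal_pow] using h
  have h2 := congrArg ENNReal.ofReal h1.tsum_eq
  rw [ENNReal.ofReal_tsum_of_nonneg (fun z => by positivity) h1.summable,
    ofReal_integral_eq_lintegral_ofReal ((memLp_two_iff_integrable_sq_norm hf.1).mp hf)
      (ae_of_all _ fun θ => by positivity)] at h2
  simpa only [ENNReal.ofReal_pow (norm_nonneg _), ofReal_norm] using h2

lemma integral_exp_pair (z : Lattice d) :
    ∫ θ, Complex.exp (Complex.I * (pair z θ : ℂ)) ∂haarTorus d = if z = 0 then 1 else 0 := by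
  rw [← integral_unitHaar_comp (continuous_exp_pair z).aestronglyMeasurable]
  simp_rw [exp_pair_toAngle]
  have h := orthonormal_iff_ite.mp (UnitAddTorus.orthonormal_mFourier (d := Fin d)) 0 z
  simp only [UnitAddTorus.mFourierLp, ContinuousMap.inner_toLp, UnitAddTorus.mFourier_zero,
    ContinuousMap.one_apply, map_one, mul_one] at h
  simp only [eq_comm (a := z)]
  exact h

end

section

/-! ### Translations, reflections and Fourier series on the torus -/

variable {d n : ℕ}

/-- `f` is `2π`-periodic in every variable. -/
def TorusPeriodic {β : Type*} (f : (Fin d → ℝ) → β) : Prop := ∀ θ k, f (shift2pi θ k) = f θ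

lemma TorusPeriodic.eq_of_coe_eq {β : Type*} {f : (Fin d → ℝ) → β} (hf : TorusPeriodic f)
    {θ η : Fin d → ℝ}
    (h : ∀ i, ((θ i / (2 * Real.pi) : ℝ) : UnitAddCircle) = ((η i / (2 * Real.pi) : ℝ) : UnitAddCircle)) :
    f θ = f η := by
  have h' : ∀ i, ∃ k : ℤ, θ i = η i + 2 * Real.pi * k := by
    intro i
    obtain ⟨k, hk⟩ := AddSubgroup.mem_zmultiples_iff.mp (QuotientAddGroup.eq.mp (h i).symm)
    refine ⟨k, ?_⟩
    rw [zsmul_one] at hk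
    rw [hk]
    field_simp
    ring
  choose k hk using h'
  rw [← hf η k]
  congr 1
  funext i
  simp [shift2pi, hk]

/-- The map `A` need not preserve the cube, but it descends to the measure preserving map `B` of the
quotient, and a periodic function sees only residue classes. Translations and reflections of single
coordinates are obtained from this. -/
lemma integral_haarTorus_comp {E : Type*} [NormedAddCommGroup E] [NormedSpace ℝ E]
    {f : (Fin d → ℝ) → E} (hf : TorusPeriodic f) (hfm : StronglyMeasurable f)
    {A : (Fin d → ℝ) → (Fin d → ℝ)} (hA : Measurable A)
    {B : UnitAddTorus (Fin d) → UnitAddTorus (Fin d)}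
    (hB : MeasurePreserving B (unitHaar d) (unitHaar d))
    (hAB : ∀ x i, ((A (toAngle x) i / (2 * Real.pi) : ℝ) : UnitAddCircle) = B x i) :
    ∫ θ, f (A θ) ∂haarTorus d = ∫ θ, f θ ∂haarTorus d := by
  rw [← integral_unitHaar_comp (f := fun θ => f (A θ)) (hfm.comp_measurable hA).aestronglyMeasurable,
    ← integral_unitHaar_comp hfm.aestronglyMeasurable]
  have h : ∀ x, f (A (toAngle x)) = f (toAngle (B x)) := fun x =>
    hf.eq_of_coe_eq fun i => by rw [hAB, coe_toAngle]
  simp_rw [h]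
  have hm : AEStronglyMeasurable (fun x => f (toAngle x)) (Measure.map B (unitHaar d)) :=
    (hfm.comp_measurable measurePreserving_toAngle.measurable).aestronglyMeasurable
  rw [← integral_map hB.aemeasurable hm, hB.map_eq]

lemma integral_haarTorus_add {E : Type*} [NormedAddCommGroup E] [NormedSpace ℝ E]
    {f : (Fin d → ℝ) → E} (hf : TorusPeriodic f) (hfm : StronglyMeasurable f) (η : Fin d → ℝ) :
    ∫ θ, f (θ + η) ∂haarTorus d = ∫ θ, f θ ∂haarTorus d := by
  refine integral_haarTorus_comp hf hfm (measurable_add_const η)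
    (measurePreserving_add_right (unitHaar d)
      (fun i => ((η i / (2 * Real.pi) : ℝ) : UnitAddCircle))) fun x i => ?_
  rw [Pi.add_apply, add_div, AddCircle.coe_add, coe_toAngle]
  rfl

lemma integral_haarTorus_neg_coord {E : Type*} [NormedAddCommGroup E] [NormedSpace ℝ E]
    {f : (Fin d → ℝ) → E} (hf : TorusPeriodic f) (hfm : StronglyMeasurable f) (i : Fin d) :
    ∫ θ, f (Function.update θ i (-θ i)) ∂haarTorus d = ∫ θ, f θ ∂haarTorus d := by
  classical
  have hB : MeasurePreserving
      (fun (x : UnitAddTorus (Fin d)) l => (if l = i then Neg.neg else id) (x l))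
      (unitHaar d) (unitHaar d) := by
    refine measurePreserving_pi (fun _ => AddCircle.haarAddCircle)
      (fun _ => AddCircle.haarAddCircle) (f := fun l => if l = i then Neg.neg else id) fun l => ?_
    by_cases h : l = i
    · simp only [h, if_true]
      exact Measure.measurePreserving_neg _
    · simp only [h, if_false]
      exact MeasurePreserving.id _
  refine integral_haarTorus_comp hf hfm
    (A := fun θ : Fin d → ℝ => Function.update θ i (-θ i)) (measurable_pi_lambda _ fun l => by
      by_cases h : l = i
      · subst h
        simp only [Function.update_self]
        exact (measurable_pi_apply l).neg
      · simpa [h] using measurable_pi_apply (X := fun _ : Fin d => ℝ) l) hB fun x l => ?_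
  by_cases h : l = i
  · subst h
    simp [neg_div, coe_toAngle]
  · simp [h, coe_toAngle]

/-- The Fourier series `∑_z e^{-i(z,θ)} φ(z)`. -/
def fourierSum (φ : Lattice d → ℂ) (θ : Fin d → ℝ) : ℂ := expSeries φ (-θ)

lemma continuous_fourierSum {φ : Lattice d → ℂ} (hφ : Summable fun z => ‖φ z‖) :
    Continuous (fourierSum φ) := (continuous_expSeries hφ).comp continuous_neg

lemma torusPeriodic_fourierSum (φ : Lattice d → ℂ) : TorusPeriodic (fourierSum φ) := by
  intro θ k
  have : -shift2pi θ k = shift2pi (-θ) (-k) := by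
    funext i; simp [shift2pi]; ring
  rw [fourierSum, this, shift2pi, expSeries_periodic, fourierSum]

lemma norm_fourierSum_le {φ : Lattice d → ℂ} (hφ : Summable fun z => ‖φ z‖) (θ : Fin d → ℝ) :
    ‖fourierSum φ θ‖ ≤ ∑' z, ‖φ z‖ := by
  refine tsum_of_norm_bounded hφ.hasSum fun z => ?_
  rw [norm_mul, norm_exp_I_mul, one_mul]

lemma fourierCoef_fourierSum {φ : Lattice d → ℂ} (hφ : Summable fun z => ‖φ z‖) (z : Lattice d) :
    fourierCoef (fourierSum φ) z = φ z := by
  have h1 : ∀ θ, Complex.exp (Complex.I * (pair z θ : ℂ)) * fourierSum φ θ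
      = ∑' y, Complex.exp (Complex.I * (pair (z - y) θ : ℂ)) * φ y := by
    intro θ
    rw [fourierSum, expSeries, ← tsum_mul_left]
    refine tsum_congr fun y => ?_
    rw [← mul_assoc, ← Complex.exp_add, sub_pair]
    congr 2
    simp [pair]
    ring
  have hn : ∀ (y : Lattice d) (θ : Fin d → ℝ),
      ‖Complex.exp (Complex.I * (pair (z - y) θ : ℂ)) * φ y‖ = ‖φ y‖ := fun y θ => by
    rw [norm_mul, norm_exp_I_mul, one_mul]
  rw [fourierCoef]
  simp_rw [h1]
  rw [← integral_tsum_of_summable_integral_norm]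
  · simp_rw [integral_mul_const, integral_exp_pair, sub_eq_zero]
    rw [tsum_eq_single z]
    · simp
    · intro y hy
      simp [hy.symm]
  · intro y
    exact Integrable.of_bound ((continuous_exp_pair _).aestronglyMeasurable.mul_const _) ‖φ y‖
      (ae_of_all _ fun θ => (hn y θ).le)
  · simpa only [hn, integral_const, probReal_univ, one_smul] using hφ

lemma memLp_of_bound {f : (Fin d → ℝ) → ℂ} (hf : AEStronglyMeasurable f (haarTorus d)) {C : ℝ}
    (hC : ∀ θ, ‖f θ‖ ≤ C) : MemLp f 2 (haarTorus d) :=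
  MemLp.of_bound hf C (ae_of_all _ hC)

lemma memLp_fourierSum {φ : Lattice d → ℂ} (hφ : Summable fun z => ‖φ z‖) :
    MemLp (fourierSum φ) 2 (haarTorus d) :=
  memLp_of_bound (continuous_fourierSum hφ).aestronglyMeasurable (norm_fourierSum_le hφ)

lemma fourierCoef_sub {f g : (Fin d → ℝ) → ℂ} (hf : MemLp f 2 (haarTorus d))
    (hg : MemLp g 2 (haarTorus d)) (z : Lattice d) :
    fourierCoef (f - g) z = fourierCoef f z - fourierCoef g z := by
  have h : ∀ {f : (Fin d → ℝ) → ℂ}, MemLp f 2 (haarTorus d) → Integrable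
      (fun θ => Complex.exp (Complex.I * (pair z θ : ℂ)) * f θ) (haarTorus d) := fun hf =>
    (hf.integrable one_le_two).bdd_mul (c := 1) (continuous_exp_pair z).aestronglyMeasurable
      (ae_of_all _ fun θ => (norm_exp_I_mul _).le)
  rw [fourierCoef, fourierCoef, fourierCoef, ← integral_sub (h hf) (h hg)]
  simp [mul_sub]

/-- Trigonometric polynomials are dense in `L²` of the torus. -/
lemma exists_fourierSum_near {f : (Fin d → ℝ) → ℂ} (hf : MemLp f 2 (haarTorus d)) {ε : ENNReal}
    (hε : ε ≠ 0) : ∃ φ : Lattice d → ℂ, (Summable fun z => ‖φ z‖) ∧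
      ∫⁻ θ, ‖f θ - fourierSum φ θ‖ₑ ^ 2 ∂haarTorus d ≤ ε := by
  classical
  have hfin : ∑' z, ‖fourierCoef f z‖ₑ ^ 2 ≠ ⊤ := by
    rw [tsum_enorm_fourierCoef_sq hf]
    have := hf.2
    rw [eLpNorm_lt_top_iff_lintegral_rpow_enorm_lt_top (by norm_num) (by norm_num)] at this
    simpa using this.ne
  -- The squared coefficients are summable, so truncation to a large finite set has small tail;
  -- Parseval makes that tail the squared `L²` error.
  obtain ⟨S, hS⟩ : ∃ S : Finset (Lattice d), ∑' z : {z // z ∉ S}, ‖fourierCoef f z‖ₑ ^ 2 ≤ ε := by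
    have := ENNReal.tendsto_tsum_compl_atTop_zero hfin
    exact ((ENNReal.tendsto_nhds_zero.mp this) ε (pos_iff_ne_zero.mpr hε)).exists
  set φ : Lattice d → ℂ := fun z => if z ∈ S then fourierCoef f z else 0 with hφ
  have hs : Summable fun z => ‖φ z‖ := summable_of_ne_finset_zero (s := S) fun z hz => by simp [hφ, hz]
  refine ⟨φ, hs, ?_⟩
  have h := tsum_enorm_fourierCoef_sq (hf.sub (memLp_fourierSum hs))
  simp only [fourierCoef_sub hf (memLp_fourierSum hs), fourierCoef_fourierSum hs,
    Pi.sub_apply] at h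
  rw [← h]
  refine le_trans (le_of_eq ?_) hS
  refine Eq.trans (tsum_congr fun z => ?_)
    (tsum_subtype {z | z ∉ S} fun z => ‖fourierCoef f z‖ₑ ^ 2).symm
  by_cases hz : z ∈ S <;> simp [hφ, hz]

/-- Modulation of the coefficients by `e^{i(z,η)}` is what produces the characteristic function of
`z_i / t` when `η` points along `e_i` with length `s / t`. -/
lemma fourierCoef_translate {f : (Fin d → ℝ) → ℂ} (hf : TorusPeriodic f) (hfm : StronglyMeasurable f)
    (η : Fin d → ℝ) (z : Lattice d) :
    fourierCoef (fun θ => f (θ - η)) z = Complex.exp (Complex.I * (pair z η : ℂ)) * fourierCoef f z := by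
  have hp : TorusPeriodic fun θ : Fin d → ℝ => Complex.exp (Complex.I * (pair z θ : ℂ)) * f (θ - η) := by
    intro θ k
    have h1 : shift2pi θ k - η = shift2pi (θ - η) k := by simp only [shift2pi]; abel
    have h2 : Complex.exp (Complex.I * (pair z (shift2pi θ k) : ℂ))
        = Complex.exp (Complex.I * (pair z θ : ℂ)) := by
      have : pair z (shift2pi θ k) = pair z θ + 2 * Real.pi * ((∑ i, z i * k i : ℤ) : ℝ) := by
        rw [shift2pi, pair_add]
        congr 1
        push_cast
        rw [pair, Finset.mul_sum]
        exact Finset.sum_congr rfl fun i _ => by ring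
      rw [this, Complex.exp_eq_exp_iff_exists_int]
      exact ⟨∑ i, z i * k i, by push_cast; ring⟩
    simp only [h1, h2, hf (θ - η) k]
  have h := integral_haarTorus_add hp
    ((continuous_exp_pair z).stronglyMeasurable.mul
      (hfm.comp_measurable (measurable_sub_const η))) η
  rw [fourierCoef, ← h, fourierCoef, ← integral_const_mul]
  refine integral_congr_ae (ae_of_all _ fun θ => ?_)
  simp only [add_sub_cancel_right, pair_add]
  rw [← mul_assoc, ← Complex.exp_add]
  push_cast
  congr 2
  ring

end

section

/-! ### Asymptotic velocities -/

variable {d n : ℕ}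

/-- `ω` is a continuous function on the torus with the partial derivative `p` in the direction `i`
at almost every point. -/
structure HasVelocity (ω : (Fin d → ℝ) → ℝ) (i : Fin d) (p : (Fin d → ℝ) → ℝ) : Prop where
  continuous : Continuous ω
  periodic : TorusPeriodic ω
  measurable : Measurable p
  hasDerivAt : ∀ᵐ θ ∂haarTorus d, HasDerivAt (fun s => ω (Function.update θ i s)) (p θ) (θ i)

/-- The oscillating function `e^{itω} g`. -/
def osc (ω : (Fin d → ℝ) → ℝ) (t : ℝ) (g : (Fin d → ℝ) → ℂ) (θ : Fin d → ℝ) : ℂ :=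
  Complex.exp (Complex.I * ((t * ω θ : ℝ) : ℂ)) * g θ

lemma norm_osc (ω : (Fin d → ℝ) → ℝ) (t : ℝ) (g : (Fin d → ℝ) → ℂ) (θ : Fin d → ℝ) :
    ‖osc ω t g θ‖ = ‖g θ‖ := by
  rw [osc, norm_mul, norm_exp_I_mul, one_mul]

lemma enorm_osc (ω : (Fin d → ℝ) → ℝ) (t : ℝ) (g : (Fin d → ℝ) → ℂ) (θ : Fin d → ℝ) :
    ‖osc ω t g θ‖ₑ = ‖g θ‖ₑ := by
  rw [← ofReal_norm, norm_osc, ofReal_norm]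

lemma continuous_phase {ω : (Fin d → ℝ) → ℝ} (hω : Continuous ω) (t : ℝ) :
    Continuous fun θ => Complex.exp (Complex.I * ((t * ω θ : ℝ) : ℂ)) := by fun_prop

lemma memLp_osc {ω : (Fin d → ℝ) → ℝ} (hω : Continuous ω) (t : ℝ) {g : (Fin d → ℝ) → ℂ}
    (hg : MemLp g 2 (haarTorus d)) : MemLp (osc ω t g) 2 (haarTorus d) :=
  hg.of_le ((continuous_phase hω t).aestronglyMeasurable.mul hg.1)
    (ae_of_all _ fun θ => (norm_osc ω t g θ).le)

lemma osc_sub (ω : (Fin d → ℝ) → ℝ) (t : ℝ) (g h : (Fin d → ℝ) → ℂ) :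
    osc ω t (g - h) = osc ω t g - osc ω t h := by
  funext θ; simp [osc, mul_sub]

lemma torusPeriodic_osc {ω : (Fin d → ℝ) → ℝ} (hω : TorusPeriodic ω) (t : ℝ) {g : (Fin d → ℝ) → ℂ}
    (hg : TorusPeriodic g) : TorusPeriodic (osc ω t g) := fun θ k => by
  rw [osc, osc, hω, hg]

lemma sub_single_eq_update (θ : Fin d → ℝ) (i : Fin d) (s : ℝ) :
    θ - Pi.single i s = Function.update θ i (θ i - s) := by
  funext l
  by_cases h : l = i
  · subst h; simp
  · simp [h]

lemma pair_single (z : Lattice d) (i : Fin d) (s : ℝ) : pair z (Pi.single i s) = z i * s := by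
  rw [pair, Finset.sum_eq_single i] <;> simp +contextual

/-- Convergence of the characteristic functions of the distributions of `z_i / t`. -/
lemma HasVelocity.tendsto_integral {ω p : (Fin d → ℝ) → ℝ} {i : Fin d} (h : HasVelocity ω i p)
    {g : (Fin d → ℝ) → ℂ} (hg : Continuous g) {C : ℝ} (hC : ∀ θ, ‖g θ‖ ≤ C)
    {t : ℕ → ℝ} (ht : Tendsto t atTop atTop) (s : ℝ) :
    Tendsto (fun m => ∫ θ, starRingEnd ℂ (osc ω (t m) g θ) *
        osc ω (t m) g (θ - Pi.single i (s / t m)) ∂haarTorus d) atTop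
      (𝓝 (∫ θ, Complex.exp (s * (-p θ : ℝ) * Complex.I) * (‖g θ‖ ^ 2 : ℝ) ∂haarTorus d)) := by
  have hosc : ∀ m, Continuous (osc ω (t m) g) := fun m => (continuous_phase h.continuous _).mul hg
  have hs0 : Tendsto (fun m => s / t m) atTop (𝓝 0) := tendsto_const_nhds.div_atTop ht
  refine tendsto_integral_of_dominated_convergence (fun _ => C * C) (fun m => ?_)
    (integrable_const _) (fun m => ae_of_all _ fun θ => ?_) ?_
  · exact ((Complex.continuous_conj.comp (hosc m)).mul
      ((hosc m).comp (continuous_id.sub continuous_const))).aestronglyMeasurable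
  · rw [norm_mul, RCLike.norm_conj, norm_osc, norm_osc]
    exact mul_le_mul (hC _) (hC _) (norm_nonneg _) ((norm_nonneg _).trans (hC θ))
  · filter_upwards [h.hasDerivAt] with θ hθ
    have hshift : Tendsto (fun m => θ - Pi.single i (s / t m)) atTop (𝓝 θ) := by
      have h1 : Tendsto (fun m => θ - Pi.single i (s / t m)) atTop (𝓝 (θ - Pi.single i 0)) :=
        tendsto_const_nhds.sub (((continuous_single i).tendsto 0).comp hs0)
      simpa using h1
    -- The phase is a difference quotient of `ω` with step `-s / t`, multiplied by `-s`; existence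
    -- of the partial derivative at `θ` is all that is needed.
    have hphase : Tendsto (fun m => t m * (ω (θ - Pi.single i (s / t m)) - ω θ)) atTop
        (𝓝 (s * -p θ)) := by
      have hc : HasDerivAt (fun r : ℝ => θ i - s * r) (-s) 0 := by
        simpa using ((hasDerivAt_id (0 : ℝ)).const_mul s).const_sub (θ i)
      have hd : HasDerivAt (fun r : ℝ => ω (Function.update θ i (θ i - s * r))) (p θ * -s) 0 :=
        HasDerivAt.comp (h₂ := fun r => ω (Function.update θ i r)) 0 (by simpa using hθ) hc
      have hlim := (hasDerivAt_iff_tendsto_slope_zero.mp hd).comp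
        ((tendsto_inv_atTop_nhdsGT_zero.comp ht).mono_right
          (nhdsWithin_mono 0 fun x (hx : 0 < x) => hx.ne'))
      rw [show s * -p θ = p θ * -s by ring]
      refine hlim.congr fun m => ?_
      simp [sub_single_eq_update, div_eq_mul_inv]
    have hform : ∀ m, starRingEnd ℂ (osc ω (t m) g θ) * osc ω (t m) g (θ - Pi.single i (s / t m))
        = Complex.exp ((t m * (ω (θ - Pi.single i (s / t m)) - ω θ) : ℝ) * Complex.I) *
          (starRingEnd ℂ (g θ) * g (θ - Pi.single i (s / t m))) := by
      intro m
      rw [osc, osc, map_mul, ← Complex.exp_conj]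
      simp only [map_mul, Complex.conj_I, Complex.conj_ofReal]
      rw [mul_mul_mul_comm, ← Complex.exp_add]
      congr 2
      push_cast
      ring
    simp_rw [hform]
    have hlim : starRingEnd ℂ (g θ) * g θ = ((‖g θ‖ ^ 2 : ℝ) : ℂ) := by
      rw [Complex.conj_mul']; push_cast; rfl
    rw [← hlim]
    refine Tendsto.mul ?_ (tendsto_const_nhds.mul ((hg.tendsto θ).comp hshift))
    have := ((Complex.continuous_exp.comp
      (Complex.continuous_ofReal.mul continuous_const (f := fun r : ℝ => (r : ℂ))
        (g := fun _ => Complex.I))).tendsto _).comp hphase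
    simpa [Function.comp_def] using this

/-- The distribution of `z_i / t` under the weights `|φ(z)|²`. -/
def spread (φ : Lattice d → ℂ) (i : Fin d) (t : ℝ) : Measure ℝ :=
  Measure.sum fun z => ‖φ z‖ₑ ^ 2 • Measure.dirac ((z i : ℝ) / t)

lemma spread_apply (φ : Lattice d → ℂ) (i : Fin d) (t : ℝ) {S : Set ℝ} (hS : MeasurableSet S) :
    spread φ i t S = ∑' z, ‖φ z‖ₑ ^ 2 * S.indicator 1 ((z i : ℝ) / t) := by
  rw [spread, Measure.sum_apply _ hS]
  simp [Measure.dirac_apply' _ hS]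

lemma charFun_spread {φ : Lattice d → ℂ} (hφ : ∑' z, ‖φ z‖ₑ ^ 2 ≠ ⊤) (i : Fin d) (t s : ℝ) :
    HasSum (fun z => Complex.exp (s * ((z i : ℝ) / t : ℝ) * Complex.I) * (‖φ z‖ ^ 2 : ℝ))
      (charFun (spread φ i t) s) := by
  have hfin : IsFiniteMeasure (spread φ i t) := ⟨by
    rw [spread_apply _ _ _ MeasurableSet.univ]
    simpa using hφ.lt_top⟩
  rw [charFun_apply_real]
  have hint : Integrable (fun x : ℝ => Complex.exp (s * x * Complex.I)) (spread φ i t) := by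
    refine Integrable.of_bound (by fun_prop) 1 (ae_of_all _ fun x => ?_)
    rw [← Complex.ofReal_mul, Complex.norm_exp_ofReal_mul_I]
  refine (hasSum_integral_measure hint).congr_fun fun z => ?_
  rw [integral_smul_measure, integral_dirac]
  simp [mul_comm]

end

section

/-! ### Localization of wave packets -/

variable {d n k : ℕ}

lemma enorm_add_sq_le (x y : ℂ) : ‖x + y‖ₑ ^ 2 ≤ 2 * ‖x‖ₑ ^ 2 + 2 * ‖y‖ₑ ^ 2 := by
  simp only [← ofReal_norm, ← ENNReal.ofReal_pow (norm_nonneg _)]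
  rw [show (2 : ENNReal) = ENNReal.ofReal 2 by simp, ← ENNReal.ofReal_mul (by norm_num),
    ← ENNReal.ofReal_mul (by norm_num), ← ENNReal.ofReal_add (by positivity) (by positivity)]
  refine ENNReal.ofReal_le_ofReal ?_
  have := norm_add_le x y
  nlinarith [norm_nonneg (x + y), sq_nonneg (‖x‖ - ‖y‖)]

/-- The factor `e^{itω}` is unimodular, so the total mass of the packet does not depend on time. -/
lemma tsum_spread {ω : (Fin d → ℝ) → ℝ} (hω : Continuous ω) {g : (Fin d → ℝ) → ℂ}
    (hg : MemLp g 2 (haarTorus d)) (t : ℝ) :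
    ∑' z, ‖fourierCoef (osc ω t g) z‖ₑ ^ 2 = ∫⁻ θ, ‖g θ‖ₑ ^ 2 ∂haarTorus d := by
  rw [tsum_enorm_fourierCoef_sq (memLp_osc hω t hg)]
  simp_rw [enorm_osc]

lemma lintegral_enorm_sq_ne_top {g : (Fin d → ℝ) → ℂ} (hg : MemLp g 2 (haarTorus d)) :
    ∫⁻ θ, ‖g θ‖ₑ ^ 2 ∂haarTorus d ≠ ⊤ := by
  have := hg.2
  rw [eLpNorm_lt_top_iff_lintegral_rpow_enorm_lt_top (by norm_num) (by norm_num)] at this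
  simpa using this.ne

/-- The distributions of `z_i / t` concentrate on the values of `-p`. -/
lemma HasVelocity.eventually_spread_le {ω p : (Fin d → ℝ) → ℝ} {i : Fin d} (h : HasVelocity ω i p)
    {g : (Fin d → ℝ) → ℂ} (hg : Continuous g) (hgp : TorusPeriodic g) {C : ℝ} (hC : ∀ θ, ‖g θ‖ ≤ C)
    {t : ℕ → ℝ} (ht : Tendsto t atTop atTop) {S : Set ℝ} (hS : IsClosed S) {ε : ENNReal}
    (hε : ε ≠ 0) :
    ∀ᶠ m in atTop, spread (fourierCoef (osc ω (t m) g)) i (t m) S ≤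
      ∫⁻ θ in {θ | -p θ ∈ S}, ‖g θ‖ₑ ^ 2 ∂haarTorus d + ε := by
  have hg2 : MemLp g 2 (haarTorus d) := memLp_of_bound hg.aestronglyMeasurable hC
  set M := ∫⁻ θ, ‖g θ‖ₑ ^ 2 ∂haarTorus d with hM
  have hMtop : M ≠ ⊤ := lintegral_enorm_sq_ne_top hg2
  have htot : ∀ m, spread (fourierCoef (osc ω (t m) g)) i (t m) Set.univ = M := fun m => by
    rw [spread_apply _ _ _ MeasurableSet.univ]
    simpa using tsum_spread h.continuous hg2 (t m)
  by_cases hM0 : M = 0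
  -- A packet of mass zero cannot be normalized to a probability measure and is treated separately.
  · refine Eventually.of_forall fun m => ?_
    refine (measure_mono (Set.subset_univ S)).trans ?_
    rw [htot, hM0]
    exact bot_le
  have hpm : Measurable fun θ => -p θ := h.measurable.neg
  have hdm : Measurable fun θ => ‖g θ‖ₑ ^ 2 := by have := hg.measurable; fun_prop
  set ν : Measure ℝ := Measure.map (fun θ => -p θ) ((haarTorus d).withDensity fun θ => ‖g θ‖ₑ ^ 2)
    with hν
  have hνapp : ∀ {S : Set ℝ}, MeasurableSet S →
      ν S = ∫⁻ θ in {θ | -p θ ∈ S}, ‖g θ‖ₑ ^ 2 ∂haarTorus d := fun {S} hS => by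
    rw [hν, Measure.map_apply hpm hS, withDensity_apply _ (hpm hS)]
    rfl
  have hνtot : ν Set.univ = M := by
    rw [hνapp MeasurableSet.univ]; simp [hM]
  have hprob : ∀ {κ : Measure ℝ}, κ Set.univ = M → IsProbabilityMeasure (M⁻¹ • κ) := fun hκ =>
    ⟨by rw [Measure.smul_apply, hκ, smul_eq_mul, ENNReal.inv_mul_cancel hM0 hMtop]⟩
  let κ : ℕ → ProbabilityMeasure ℝ := fun m =>
    ⟨M⁻¹ • spread (fourierCoef (osc ω (t m) g)) i (t m), hprob (htot m)⟩
  let κ₀ : ProbabilityMeasure ℝ := ⟨M⁻¹ • ν, hprob hνtot⟩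
  have hconv : Tendsto κ atTop (𝓝 κ₀) := by
    -- Lévy's continuity theorem reduces convergence in law to the limit of characteristic functions
    -- supplied by `HasVelocity.tendsto_integral`.
    refine ProbabilityMeasure.tendsto_of_tendsto_charFun fun s => ?_
    have hsm : ∀ μ : Measure ℝ, charFun (M⁻¹ • μ) s = (M⁻¹).toReal • charFun μ s := fun μ => by
      rw [charFun_apply, integral_smul_measure, charFun_apply]
    change Tendsto (fun m => charFun (M⁻¹ • spread (fourierCoef (osc ω (t m) g)) i (t m)) s) atTop
      (𝓝 (charFun (M⁻¹ • ν) s))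
    simp_rw [hsm]
    refine Tendsto.const_smul ?_ _
    have h0 : charFun ν s
        = ∫ θ, Complex.exp (s * (-p θ : ℝ) * Complex.I) * (‖g θ‖ ^ 2 : ℝ) ∂haarTorus d := by
      rw [charFun_apply_real, hν, integral_map hpm.aemeasurable (by fun_prop),
        integral_withDensity_eq_integral_toReal_smul hdm (ae_of_all _ fun θ => by
          exact ENNReal.pow_lt_top enorm_lt_top)]
      refine integral_congr_ae (ae_of_all _ fun θ => ?_)
      simp [mul_comm]
    rw [h0]
    refine (h.tendsto_integral hg hC ht s).congr fun m => ?_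
    have hosc := memLp_osc h.continuous (t m) hg2
    have hoc : Continuous (osc ω (t m) g) := (continuous_phase h.continuous _).mul hg
    have hop := torusPeriodic_osc h.periodic (t m) hgp
    have hshift : MemLp (fun θ => osc ω (t m) g (θ - Pi.single i (s / t m))) 2 (haarTorus d) :=
      memLp_of_bound (hoc.comp (continuous_id.sub continuous_const)).aestronglyMeasurable
        (C := C) fun θ => by rw [norm_osc]; exact hC _
    have h1 := hasSum_fourierCoef_mul hosc hshift
    have h2 := charFun_spread (φ := fourierCoef (osc ω (t m) g))
      (by rw [tsum_spread h.continuous hg2]; exact hMtop) i (t m) s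
    -- Parseval: pairing the packet with its translate by `(s / t) e_i` weights the squared
    -- coefficient at `z` by `e^{i s z_i / t}`.
    refine h1.unique (h2.congr_fun fun z => ?_)
    rw [fourierCoef_translate hop hoc.stronglyMeasurable, mul_left_comm, Complex.conj_mul', pair_single]
    congr 1
    · congr 1
      push_cast
      ring
    · push_cast; rfl
  -- The portmanteau theorem bounds the limsup of the masses of a closed set; the room `ε` turns it
  -- into an eventual inequality.
  have hls := ProbabilityMeasure.limsup_measure_closed_le_of_tendsto hconv hS
  have hε' : M⁻¹ * ε ≠ 0 := mul_ne_zero (ENNReal.inv_ne_zero.mpr hMtop) hε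
  have hfin : (κ₀ : Measure ℝ) S ≠ ⊤ := measure_ne_top _ _
  have hlt : (κ₀ : Measure ℝ) S < (κ₀ : Measure ℝ) S + M⁻¹ * ε := ENNReal.lt_add_right hfin hε'
  filter_upwards [eventually_lt_of_limsup_lt (lt_of_le_of_lt hls hlt)] with m hm
  have hm' : M⁻¹ * spread (fourierCoef (osc ω (t m) g)) i (t m) S < M⁻¹ * ν S + M⁻¹ * ε := hm
  rw [← mul_add] at hm'
  rw [← hνapp hS.measurableSet]
  exact ((ENNReal.mul_le_mul_iff_right (ENNReal.inv_ne_zero.mpr hMtop)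
    (ENNReal.inv_ne_top.mpr hM0)).mp hm'.le)

/-- The mass of `φ` at the points with `σ z_i ≥ -a`. -/
def tailMass (φ : Lattice d → ℂ) (i : Fin d) (σ a : ℝ) : ENNReal :=
  ∑' z, Set.indicator {z : Lattice d | -a ≤ σ * z i} (fun z => ‖φ z‖ₑ ^ 2) z

lemma tailMass_le (φ : Lattice d → ℂ) (i : Fin d) (σ a : ℝ) :
    tailMass φ i σ a ≤ ∑' z, ‖φ z‖ₑ ^ 2 :=
  ENNReal.tsum_le_tsum fun z => Set.indicator_le_self _ _ z

lemma tailMass_add_le (φ ψ : Lattice d → ℂ) (i : Fin d) (σ a : ℝ) :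
    tailMass (φ + ψ) i σ a ≤ 2 * tailMass φ i σ a + 2 * tailMass ψ i σ a := by
  rw [tailMass, tailMass, tailMass, ← ENNReal.tsum_mul_left, ← ENNReal.tsum_mul_left,
    ← ENNReal.tsum_add]
  refine ENNReal.tsum_le_tsum fun z => ?_
  by_cases hz : -a ≤ σ * z i
  · simpa [Set.indicator, hz] using enorm_add_sq_le (φ z) (ψ z)
  · simp [Set.indicator, hz]

/-- Once `a ≤ δ t`, a fixed strip of width `a` has width at most `δ` on the scale `z / t`; this is
why the details of the cut-off near the hyperplane do not matter. -/
lemma tailMass_le_spread (φ : Lattice d → ℂ) (i : Fin d) {σ a δ t : ℝ} (ht : 0 < t)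
    (hδ : a ≤ δ * t) : tailMass φ i σ a ≤ spread φ i t {r | -δ ≤ σ * r} := by
  rw [spread_apply _ _ _ (measurableSet_le measurable_const (by fun_prop)), tailMass]
  refine ENNReal.tsum_le_tsum fun z => ?_
  by_cases hz : -a ≤ σ * z i
  · have h2 : -δ ≤ σ * ((z i : ℝ) / t) := by
      rw [← mul_div_assoc, le_div_iff₀ ht]; linarith
    simp [Set.indicator, hz, h2]
  · simp [Set.indicator, hz]

/-- A wave packet with velocities `-p`, `σ p > 0`, leaves the half space `σ z_i ≥ -a`. -/
lemma HasVelocity.tendsto_tailMass {ω p : (Fin d → ℝ) → ℝ} {i : Fin d} (h : HasVelocity ω i p)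
    {g : (Fin d → ℝ) → ℂ} (hg : MemLp g 2 (haarTorus d)) {σ : ℝ}
    (hgσ : ∀ θ, σ * p θ ≤ 0 → g θ = 0) (a : ℝ) :
    Tendsto (fun t => tailMass (fourierCoef (osc ω t g)) i σ a) atTop (𝓝 0) := by
  refine tendsto_of_seq_tendsto fun t ht => ?_
  rw [ENNReal.tendsto_nhds_zero]
  intro ε hε
  -- The budget is `2 (2η + η) + 2η = 8η`. The minimum with 1 keeps `η` finite, as the strict
  -- inequality below requires.
  set η := min (ε / 8) 1 with hη
  have hη0 : η ≠ 0 := by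
    have : 0 < η := lt_min (ENNReal.div_pos hε.ne' (by norm_num)) one_pos
    exact this.ne'
  have hηε : 8 * η ≤ ε := by
    calc 8 * η ≤ 8 * (ε / 8) := by gcongr; exact min_le_left _ _
      _ = ε := ENNReal.mul_div_cancel (by norm_num) (by norm_num)
  -- The amplitude `g` will contain indicators, while the concentration estimate needs a continuous
  -- periodic amplitude; mass conservation makes the `L²` replacement uniform in time.
  obtain ⟨φ, hφ, hnear⟩ := exists_fourierSum_near hg hη0
  set G := fourierSum φ with hG
  have hGc : Continuous G := continuous_fourierSum hφ
  have hG2 : MemLp G 2 (haarTorus d) := memLp_fourierSum hφ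
  have hmeas : ∀ δ : ℝ, MeasurableSet {θ | σ * p θ ≤ δ} := fun δ =>
    measurableSet_le (h.measurable.const_mul σ) measurable_const
  have h0 : ∫⁻ θ in {θ | σ * p θ ≤ 0}, ‖G θ‖ₑ ^ 2 ∂haarTorus d ≤ η := by
    refine le_trans ?_ hnear
    refine le_trans (le_of_eq ?_) (setLIntegral_le_lintegral {θ | σ * p θ ≤ 0} _)
    refine setLIntegral_congr_fun (hmeas 0) fun θ hθ => ?_
    simp only [hgσ θ hθ, zero_sub, enorm_neg]
  -- `G` has mass at most `η` where `σ p ≤ 0`, and continuity from above of the measure `|G|²` gives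
  -- mass at most `2η` on a slightly larger set. The gap `δ` later absorbs the shift `a`.
  obtain ⟨δ, hδ, hGδ⟩ : ∃ δ > 0, ∫⁻ θ in {θ | σ * p θ ≤ δ}, ‖G θ‖ₑ ^ 2 ∂haarTorus d ≤ 2 * η := by
    have hanti : Antitone fun m : ℕ => {θ | σ * p θ ≤ 1 / ((m : ℝ) + 1)} := fun m m' hm θ hθ =>
      le_trans (Set.mem_ofPred_eq ▸ hθ) (one_div_le_one_div_of_le (by positivity) (by
        have : (m : ℝ) ≤ m' := by exact_mod_cast hm
        linarith))
    have hInter : ⋂ m : ℕ, {θ | σ * p θ ≤ 1 / ((m : ℝ) + 1)} = {θ | σ * p θ ≤ 0} := by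
      ext θ
      simp only [Set.mem_iInter, Set.mem_ofPred_eq]
      refine ⟨fun hm => ge_of_tendsto' tendsto_one_div_add_atTop_nhds_zero_nat hm, fun hm m =>
        hm.trans (by positivity)⟩
    have hconv := tendsto_measure_iInter_atTop
      (μ := (haarTorus d).withDensity fun θ => ‖G θ‖ₑ ^ 2)
      (fun m : ℕ => (hmeas (1 / ((m : ℝ) + 1))).nullMeasurableSet) hanti ⟨0, by
        rw [withDensity_apply _ (hmeas _)]
        exact ((setLIntegral_le_lintegral _ _).trans_lt
          (lintegral_enorm_sq_ne_top hG2).lt_top).ne⟩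
    rw [hInter] at hconv
    have hlt : (haarTorus d).withDensity (fun θ => ‖G θ‖ₑ ^ 2) {θ | σ * p θ ≤ 0} < 2 * η := by
      rw [withDensity_apply _ (hmeas _)]
      refine h0.trans_lt ?_
      rw [two_mul]
      exact ENNReal.lt_add_right (ne_top_of_le_ne_top ENNReal.one_ne_top (min_le_right _ _)) hη0
    obtain ⟨m, hm⟩ := (hconv.eventually_lt_const hlt).exists
    refine ⟨1 / ((m : ℝ) + 1), by positivity, ?_⟩
    rw [Function.comp_apply, withDensity_apply _ (hmeas _)] at hm
    exact hm.le
  have hclosed : IsClosed {r : ℝ | -δ ≤ σ * r} :=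
    isClosed_le continuous_const (continuous_const.mul continuous_id)
  filter_upwards [h.eventually_spread_le hGc (torusPeriodic_fourierSum φ) (norm_fourierSum_le hφ) ht
    hclosed hη0, ht.eventually_gt_atTop 0, ht.eventually_ge_atTop (a / δ)] with m hm hm0 hma
  have hset : {θ | -δ ≤ σ * -p θ} = {θ | σ * p θ ≤ δ} := by
    ext θ
    simp only [Set.mem_ofPred_eq]
    constructor <;> intro h <;> linarith
  simp only [hset] at hm
  have hsplit : fourierCoef (osc ω (t m) g)
      = fourierCoef (osc ω (t m) G) + fourierCoef (osc ω (t m) (g - G)) := by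
    funext z
    rw [osc_sub, Pi.add_apply, fourierCoef_sub (memLp_osc h.continuous _ hg)
      (memLp_osc h.continuous _ hG2)]
    ring
  have hdiff : tailMass (fourierCoef (osc ω (t m) (g - G))) i σ a ≤ η :=
    (tailMass_le _ _ _ _).trans ((tsum_spread h.continuous (hg.sub hG2) _).trans_le hnear)
  have hmain : tailMass (fourierCoef (osc ω (t m) G)) i σ a ≤ 2 * η + η :=
    (tailMass_le_spread _ _ hm0 (by rwa [div_le_iff₀ hδ, mul_comm] at hma)).trans
      (hm.trans (by gcongr))
  calc tailMass (fourierCoef (osc ω (t m) g)) i σ a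
      ≤ 2 * (2 * η + η) + 2 * η := by
        rw [hsplit]
        exact (tailMass_add_le _ _ _ _ _).trans (by gcongr)
    _ = 8 * η := by ring
    _ ≤ ε := hηε

end

section

/-! ### Cut-off wave packets -/

variable {d n k : ℕ}

lemma cornerSign_eq (c : Fin 2) : cornerSign c = 1 ∨ cornerSign c = -1 := by
  fin_cases c <;> simp [cornerSign]

/-- The square of the `ℓ²` norm, with values in `[0, ∞]`. -/
def sqMass (φ : Lattice d → ℂ) : ENNReal := ∑' z, ‖φ z‖ₑ ^ 2

lemma sqMass_add_le (φ ψ : Lattice d → ℂ) : sqMass (φ + ψ) ≤ 2 * sqMass φ + 2 * sqMass ψ := by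
  rw [sqMass, sqMass, sqMass, ← ENNReal.tsum_mul_left, ← ENNReal.tsum_mul_left, ← ENNReal.tsum_add]
  exact ENNReal.tsum_le_tsum fun z => enorm_add_sq_le (φ z) (ψ z)

lemma enorm_mul_sq_le {r Z : ℝ} (hr : |r| ≤ Z) (w : ℂ) :
    ‖(r : ℂ) * w‖ₑ ^ 2 ≤ ENNReal.ofReal (Z ^ 2) * ‖w‖ₑ ^ 2 := by
  rw [enorm_mul, mul_pow]
  gcongr
  rw [← ofReal_norm, Complex.norm_real, ← ENNReal.ofReal_pow (norm_nonneg _)]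
  exact ENNReal.ofReal_le_ofReal (pow_le_pow_left₀ (norm_nonneg _) hr 2)

lemma sqMass_mul_le {m : Lattice d → ℝ} {Z : ℝ} (hm : ∀ z, |m z| ≤ Z) (φ : Lattice d → ℂ) :
    sqMass (fun z => (m z : ℂ) * φ z) ≤ ENNReal.ofReal (Z ^ 2) * sqMass φ := by
  rw [sqMass, sqMass, ← ENNReal.tsum_mul_left]
  exact ENNReal.tsum_le_tsum fun z => enorm_mul_sq_le (hm z) _

lemma sqMass_mul_le_tailMass {m : Lattice d → ℝ} {Z : ℝ} (hm : ∀ z, |m z| ≤ Z) {i : Fin d} {σ a : ℝ}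
    (h0 : ∀ z : Lattice d, σ * z i < -a → m z = 0) (φ : Lattice d → ℂ) :
    sqMass (fun z => (m z : ℂ) * φ z) ≤ ENNReal.ofReal (Z ^ 2) * tailMass φ i σ a := by
  rw [sqMass, tailMass, ← ENNReal.tsum_mul_left]
  refine ENNReal.tsum_le_tsum fun z => ?_
  by_cases hz : -a ≤ σ * z i
  · simpa [Set.indicator, hz] using enorm_mul_sq_le (hm z) (φ z)
  · simp [h0 z (not_le.mp hz)]

/-- The values of `ζ` between `-a` and `a` are arbitrary, but there are only finitely many of them.
-/
lemma IsCutoff.exists_bound {a : ℝ} {ζ : Fin 2 → ℤ → ℝ} (hζ : IsCutoff a ζ) :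
    ∃ Z, 1 ≤ Z ∧ ∀ c x, |ζ c x| ≤ Z := by
  set B := ∑ c, ∑ x ∈ Finset.Icc ⌊-a⌋ ⌈a⌉, |ζ c x| with hB
  have hB0 : 0 ≤ B := Finset.sum_nonneg fun c _ => Finset.sum_nonneg fun x _ => abs_nonneg _
  refine ⟨1 + B, by linarith, fun c x => ?_⟩
  by_cases h1 : (x : ℝ) < -a
  · have : |ζ c x| ≤ 1 := by
      fin_cases c
      · simp [hζ.left_one x h1]
      · simp [hζ.right_zero x h1]
    linarith
  by_cases h2 : a < (x : ℝ)
  · have : |ζ c x| ≤ 1 := by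
      fin_cases c
      · simp [hζ.left_zero x h2]
      · simp [hζ.right_one x h2]
    linarith
  have hx : x ∈ Finset.Icc ⌊-a⌋ ⌈a⌉ := by
    rw [Finset.mem_Icc]
    push Not at h1 h2
    refine ⟨?_, ?_⟩
    · have := (Int.floor_le (-a)).trans h1
      exact_mod_cast this
    · have := h2.trans (Int.le_ceil a)
      exact_mod_cast this
  have h3 : |ζ c x| ≤ ∑ x ∈ Finset.Icc ⌊-a⌋ ⌈a⌉, |ζ c x| :=
    Finset.single_le_sum (f := fun x => |ζ c x|) (fun _ _ => abs_nonneg _) hx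
  have h4 : ∑ x ∈ Finset.Icc ⌊-a⌋ ⌈a⌉, |ζ c x| ≤ B :=
    Finset.single_le_sum (f := fun c => ∑ x ∈ Finset.Icc ⌊-a⌋ ⌈a⌉, |ζ c x|)
      (fun _ _ => Finset.sum_nonneg fun x _ => abs_nonneg _) (Finset.mem_univ c)
  linarith

lemma IsCutoff.eq_zero_of {a : ℝ} {ζ : Fin 2 → ℤ → ℝ} (hζ : IsCutoff a ζ) (c : Fin 2) {x : ℤ}
    (h : cornerSign c * x < -a) : ζ c x = 0 := by
  fin_cases c
  · exact hζ.left_zero x (by simp [cornerSign] at h; linarith)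
  · exact hζ.right_zero x (by simp [cornerSign] at h; linarith)

lemma IsCutoff.eq_one_of {a : ℝ} {ζ : Fin 2 → ℤ → ℝ} (hζ : IsCutoff a ζ) (c : Fin 2) {x : ℤ}
    (h : -cornerSign c * x < -a) : ζ c x = 1 := by
  fin_cases c
  · exact hζ.left_one x (by simp [cornerSign] at h; linarith)
  · exact hζ.right_one x (by simp [cornerSign] at h; linarith)

lemma fourierCoef_congr_ae {f g : (Fin d → ℝ) → ℂ} (h : f =ᵐ[haarTorus d] g) :
    fourierCoef f = fourierCoef g := by
  funext z
  refine integral_congr_ae ?_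
  filter_upwards [h] with θ hθ
  simp only [hθ]

/-- A cut-off in one direction acts on a wave packet as a restriction of the quasi-momenta. -/
lemma HasVelocity.tendsto_cutoff {ω p : (Fin d → ℝ) → ℝ} {i : Fin d} (h : HasVelocity ω i p)
    (hp : ∀ᵐ θ ∂haarTorus d, p θ ≠ 0) {a : ℝ} {ζ : Fin 2 → ℤ → ℝ} (hζ : IsCutoff a ζ) (c : Fin 2)
    {g : (Fin d → ℝ) → ℂ} (hg : MemLp g 2 (haarTorus d)) {φ : ℝ → Lattice d → ℂ}
    (hφ : Tendsto (fun t => sqMass (φ t - fourierCoef (osc ω t g))) atTop (𝓝 0)) :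
    Tendsto (fun t => sqMass ((fun z => (ζ c (z i) : ℂ) * φ t z) -
      fourierCoef (osc ω t ({θ | cornerSign c * p θ < 0}.indicator g)))) atTop (𝓝 0) := by
  obtain ⟨Z, hZ1, hZ⟩ := hζ.exists_bound
  set s := cornerSign c with hs
  have hm1 : MeasurableSet {θ | s * p θ < 0} :=
    measurableSet_lt (h.measurable.const_mul s) measurable_const
  have hm2 : MeasurableSet {θ | 0 < s * p θ} :=
    measurableSet_lt measurable_const (h.measurable.const_mul s)
  -- The packet `g1` moves into the half-space kept by the cut-off and `g2` out of it; the
  -- velocities are `-p`, whence the sign of the inequality. Zero velocities are excluded almost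
  -- everywhere.
  set g1 := {θ | s * p θ < 0}.indicator g with hg1
  set g2 := {θ | 0 < s * p θ}.indicator g with hg2
  have hg1L : MemLp g1 2 (haarTorus d) := hg.indicator hm1
  have hg2L : MemLp g2 2 (haarTorus d) := hg.indicator hm2
  have hsum : ∀ t, fourierCoef (osc ω t g) = fourierCoef (osc ω t g1) + fourierCoef (osc ω t g2) := by
    intro t
    have : fourierCoef (osc ω t g2) = fourierCoef (osc ω t g) - fourierCoef (osc ω t g1) := by
      rw [← show fourierCoef (osc ω t (g - g1)) = fourierCoef (osc ω t g) - fourierCoef (osc ω t g1)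
        from funext fun z => by
          rw [osc_sub, fourierCoef_sub (memLp_osc h.continuous _ hg)
            (memLp_osc h.continuous _ hg1L), Pi.sub_apply]]
      refine fourierCoef_congr_ae ?_
      filter_upwards [hp] with θ hθ
      have hsp : s * p θ ≠ 0 := mul_ne_zero (by
        rcases cornerSign_eq c with h | h <;> simp [hs, h]) hθ
      rcases lt_or_gt_of_ne hsp with h1 | h1
      · simp [osc, hg1, hg2, Set.indicator, h1, not_lt.mpr h1.le]
      · simp [osc, hg1, hg2, Set.indicator, h1, not_lt.mpr h1.le]
    rw [this]; abel
  have ht1 := h.tendsto_tailMass hg1L (σ := -s) (fun θ hθ => by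
    simp only [hg1, Set.indicator, Set.mem_ofPred_eq]
    rw [if_neg]; linarith) a
  have ht2 := h.tendsto_tailMass hg2L (σ := s) (fun θ hθ => by
    simp only [hg2, Set.indicator, Set.mem_ofPred_eq]
    rw [if_neg]; linarith) a
  have hb : ∀ t, sqMass ((fun z => (ζ c (z i) : ℂ) * φ t z) - fourierCoef (osc ω t g1)) ≤
      2 * (ENNReal.ofReal (Z ^ 2) * sqMass (φ t - fourierCoef (osc ω t g))) +
      2 * (2 * (ENNReal.ofReal ((1 + Z) ^ 2) * tailMass (fourierCoef (osc ω t g1)) i (-s) a) +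
        2 * (ENNReal.ofReal (Z ^ 2) * tailMass (fourierCoef (osc ω t g2)) i s a)) := by
    intro t
    -- With hats for coefficients, the error is ζ(φ − ĝ) + (ζ − 1)ĝ₁ + ζĝ₂: the first term is small
    -- by hypothesis, and in the others each packet leaves the region where its cut-off factor is
    -- nonzero.
    have hd : ((fun z => (ζ c (z i) : ℂ) * φ t z) - fourierCoef (osc ω t g1)) =
        (fun z => (ζ c (z i) : ℂ) * (φ t - fourierCoef (osc ω t g)) z) +
        ((fun z => ((ζ c (z i) - 1 : ℝ) : ℂ) * fourierCoef (osc ω t g1) z) +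
          fun z => (ζ c (z i) : ℂ) * fourierCoef (osc ω t g2) z) := by
      funext z
      have := congrFun (hsum t) z
      simp only [Pi.add_apply, Pi.sub_apply] at this ⊢
      rw [this]
      push_cast
      ring
    rw [hd]
    refine (sqMass_add_le _ _).trans ?_
    gcongr
    · exact sqMass_mul_le (fun z => hZ c (z i)) _
    refine (sqMass_add_le _ _).trans ?_
    gcongr
    · refine sqMass_mul_le_tailMass (fun z => ?_) (fun z hz => ?_) _
      · have := abs_sub (ζ c (z i)) 1
        have h2 := hZ c (z i)
        simp only [abs_one] at this
        linarith
      · rw [hζ.eq_one_of c hz, sub_self]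
    · exact sqMass_mul_le_tailMass (fun z => hZ c (z i)) (fun z hz => hζ.eq_zero_of c hz) _
  refine tendsto_of_tendsto_of_tendsto_of_le_of_le tendsto_const_nhds ?_ (fun _ => bot_le) hb
  have e : ∀ {f : ℝ → ENNReal} (r : ENNReal), r ≠ ⊤ → Tendsto f atTop (𝓝 0) →
      Tendsto (fun t => r * f t) atTop (𝓝 0) := fun r hr hf => by
    simpa using ENNReal.Tendsto.const_mul hf (Or.inr hr)
  have h2 : (2 : ENNReal) ≠ ⊤ := ENNReal.ofNat_ne_top
  have hA := e 2 h2 (e (ENNReal.ofReal (Z ^ 2)) ENNReal.ofReal_ne_top hφ)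
  have hB := e 2 h2 (e (ENNReal.ofReal ((1 + Z) ^ 2)) ENNReal.ofReal_ne_top ht1)
  have hC := e 2 h2 (e (ENNReal.ofReal (Z ^ 2)) ENNReal.ofReal_ne_top ht2)
  simpa using hA.add (e 2 h2 (by simpa using hB.add hC))

/-- The indicator of the quasi-momenta `θ` with `s_i p_i(θ) < 0`, `i = 1, …, k`, where `s_i` are
the signs of the corner. -/
def quadrant (c : Corner k) (p : Fin k → (Fin d → ℝ) → ℝ) (θ : Fin d → ℝ) : ℝ :=
  ∏ i, if cornerSign (c i) * p i θ < 0 then 1 else 0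

/-- The cut-off to a corner acts on a wave packet as a restriction to the quasi-momenta whose
group velocity points into the corner. -/
lemma tendsto_cutoffProd (hk : k ≤ d) {ω : (Fin d → ℝ) → ℝ} {p : Fin k → (Fin d → ℝ) → ℝ}
    (h : ∀ i, HasVelocity ω (Fin.castLE hk i) (p i)) (hp : ∀ i, ∀ᵐ θ ∂haarTorus d, p i θ ≠ 0)
    {a : ℝ} {ζ : Fin 2 → ℤ → ℝ} (hζ : IsCutoff a ζ) (c : Corner k)
    {g : (Fin d → ℝ) → ℂ} (hg : MemLp g 2 (haarTorus d)) :
    Tendsto (fun t => sqMass ((fun z => (cutoffProd hk ζ c z : ℂ) * fourierCoef (osc ω t g) z) -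
      fourierCoef (osc ω t fun θ => (quadrant c p θ : ℂ) * g θ))) atTop (𝓝 0) := by
  classical
  -- The coordinates are cut off one after another. The one-direction lemma accepts any family
  -- asymptotic to a packet, so its output can be used as the next input.
  have key : ∀ S : Finset (Fin k), MemLp (fun θ => ((∏ i ∈ S,
        if cornerSign (c i) * p i θ < 0 then 1 else 0 : ℝ) : ℂ) * g θ) 2 (haarTorus d) ∧
      Tendsto (fun t => sqMass ((fun z => ((∏ i ∈ S, ζ (c i) (z (Fin.castLE hk i)) : ℝ) : ℂ) *
        fourierCoef (osc ω t g) z) - fourierCoef (osc ω t fun θ => ((∏ i ∈ S,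
        if cornerSign (c i) * p i θ < 0 then 1 else 0 : ℝ) : ℂ) * g θ))) atTop (𝓝 0) := by
    intro S
    induction S using Finset.induction_on with
    | empty => simpa [sqMass] using hg
    | insert i S hi ih =>
      have hind : ({θ | cornerSign (c i) * p i θ < 0}.indicator fun θ => ((∏ i ∈ S,
          if cornerSign (c i) * p i θ < 0 then 1 else 0 : ℝ) : ℂ) * g θ) =
          fun θ => ((∏ i ∈ insert i S,
            if cornerSign (c i) * p i θ < 0 then 1 else 0 : ℝ) : ℂ) * g θ := by
        funext θ
        rw [Finset.prod_insert hi]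
        by_cases hθ : cornerSign (c i) * p i θ < 0 <;> simp [Set.indicator, hθ]
      have hm : MeasurableSet {θ | cornerSign (c i) * p i θ < 0} :=
        measurableSet_lt ((h i).measurable.const_mul _) measurable_const
      refine ⟨hind ▸ ih.1.indicator hm, ?_⟩
      have := (h i).tendsto_cutoff (hp i) hζ (c i) ih.1 ih.2
      rw [hind] at this
      refine this.congr fun t => ?_
      congr 1
      funext z
      simp only [Pi.sub_apply]
      rw [Finset.prod_insert hi]
      push_cast
      ring
  exact (key Finset.univ).2

end

section

/-! ### Operators on the phase space -/

variable {d n k : ℕ} {α : ℝ}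

namespace PhaseSpace

/-- The phase point with a given configuration. -/
def mk (Y : Lattice d → Site n × Site n)
    (h : Summable fun x => jap x ^ (2 * α) * (‖(Y x).1‖ ^ 2 + ‖(Y x).2‖ ^ 2)) :
    PhaseSpace d n α := ⟨Y, h⟩

@[simp] lemma mk_u (Y : Lattice d → Site n × Site n) (h) (x : Lattice d) :
    (mk (α := α) Y h).u x = (Y x).1 := rfl

@[simp] lemma mk_v (Y : Lattice d → Site n × Site n) (h) (x : Lattice d) :
    (mk (α := α) Y h).v x = (Y x).2 := rfl

lemma ext {Y Z : PhaseSpace d n α} (hu : ∀ x, Y.u x = Z.u x) (hv : ∀ x, Y.v x = Z.v x) : Y = Z :=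
  Subtype.ext (funext fun x => Prod.ext (hu x) (hv x))

@[simp] lemma add_u (Y Z : PhaseSpace d n α) (x : Lattice d) : (Y + Z).u x = Y.u x + Z.u x := rfl
@[simp] lemma add_v (Y Z : PhaseSpace d n α) (x : Lattice d) : (Y + Z).v x = Y.v x + Z.v x := rfl
@[simp] lemma smul_u (r : ℝ) (Y : PhaseSpace d n α) (x : Lattice d) : (r • Y).u x = r • Y.u x := rfl
@[simp] lemma smul_v (r : ℝ) (Y : PhaseSpace d n α) (x : Lattice d) : (r • Y).v x = r • Y.v x := rfl

lemma summable_norm_sq (Y : PhaseSpace d n α) :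
    Summable fun x => jap x ^ (2 * α) * (‖Y.u x‖ ^ 2 + ‖Y.v x‖ ^ 2) := Y.2

lemma term_nonneg (Y : PhaseSpace d n α) (x : Lattice d) :
    0 ≤ jap x ^ (2 * α) * (‖Y.u x‖ ^ 2 + ‖Y.v x‖ ^ 2) := by
  have := Real.rpow_nonneg (jap_pos x).le (2 * α)
  positivity

lemma term_le_norm_sq (Y : PhaseSpace d n α) (x : Lattice d) :
    jap x ^ (2 * α) * (‖Y.u x‖ ^ 2 + ‖Y.v x‖ ^ 2) ≤ ‖Y‖ ^ 2 := by
  rw [norm_sq]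
  exact Y.summable_norm_sq.le_tsum x fun y _ => Y.term_nonneg y

/-- `H_α` is isometric to `ℓ²`. -/
def toL2Isometry : PhaseSpace d n α ≃ₗᵢ[ℝ] lp (fun _ : Lattice d => WithLp 2 (Site n × Site n)) 2 :=
  LinearIsometryEquiv.ofSurjective ⟨toL2, fun _ => rfl⟩ <| by
    intro f
    have hne : ∀ x : Lattice d, jap x ^ α ≠ 0 := fun x => (Real.rpow_pos_of_pos (jap_pos x) α).ne'
    have hw : weighted α (fun x => WithLp.ofLp ((jap x ^ α)⁻¹ • f x)) = fun x => f x := by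
      funext x
      rw [weighted, WithLp.toLp_ofLp, smul_inv_smul₀ (hne x)]
    refine ⟨⟨fun x => WithLp.ofLp ((jap x ^ α)⁻¹ • f x), ?_⟩, ?_⟩
    · refine (memLp_weighted_iff α _).mp ?_
      rw [hw]
      exact lp.memℓp f
    · exact Subtype.ext hw

instance : CompleteSpace (PhaseSpace d n α) :=
  (toL2Isometry (d := d) (n := n) (α := α)).toIsometryEquiv.completeSpace

/-- The configuration with the value `w` at the point `z` and zero elsewhere. -/
def point (z : Lattice d) (w : Site n × Site n) : PhaseSpace d n α :=
  mk (Pi.single z w) <| summable_of_ne_finset_zero (s := {z}) fun x hx => by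
    simp [Pi.single_eq_of_ne (Finset.notMem_singleton.mp hx)]

lemma hasSum_point (Y : PhaseSpace d n α) :
    HasSum (fun z => point (α := α) z (Y.u z, Y.v z)) Y := by
  have h := lp.hasSum_single (p := 2) (by norm_num) (toL2Isometry Y)
  have h2 := (toL2Isometry (d := d) (n := n) (α := α)).symm.toContinuousLinearEquiv.hasSum.mpr h
  simp only [LinearIsometryEquiv.coe_toContinuousLinearEquiv] at h2
  refine h2.congr_fun fun z => ?_
  rw [LinearIsometryEquiv.eq_symm_apply]
  refine Subtype.ext (funext fun x => ?_)
  by_cases hx : x = z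
  · subst hx
    rw [lp.coeFn_single, Pi.single_eq_same]
    change jap x ^ α • WithLp.toLp 2 ((Pi.single x (Y.u x, Y.v x) : Lattice d → Site n × Site n) x) = _
    rw [Pi.single_eq_same]
    rfl
  · rw [lp.coeFn_single, Pi.single_eq_of_ne hx]
    change jap x ^ α • WithLp.toLp 2 ((Pi.single z (Y.u z, Y.v z) : Lattice d → Site n × Site n) x) = _
    rw [Pi.single_eq_of_ne hx]
    simp

lemma summable_of_pointwise {Y Z : Lattice d → Site n × Site n} (σ : Equiv.Perm (Lattice d)) {C : ℝ}
    (hY : Summable fun x => jap x ^ (2 * α) * (‖(Y x).1‖ ^ 2 + ‖(Y x).2‖ ^ 2))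
    (h : ∀ x, jap x ^ (2 * α) * (‖(Z x).1‖ ^ 2 + ‖(Z x).2‖ ^ 2) ≤
      C ^ 2 * (jap (σ x) ^ (2 * α) * (‖(Y (σ x)).1‖ ^ 2 + ‖(Y (σ x)).2‖ ^ 2))) :
    Summable fun x => jap x ^ (2 * α) * (‖(Z x).1‖ ^ 2 + ‖(Z x).2‖ ^ 2) :=
  Summable.of_nonneg_of_le (fun x => by
    have := Real.rpow_nonneg (jap_pos x).le (2 * α)
    positivity) h ((σ.summable_iff.mpr hY).mul_left (C ^ 2))

/-- The permutation `σ` lets the same estimate serve multiplication operators, with `σ` the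
identity, and lattice translations. -/
lemma norm_le_of_pointwise {Y Z : PhaseSpace d n α} (σ : Equiv.Perm (Lattice d)) {C : ℝ} (hC : 0 ≤ C)
    (h : ∀ x, jap x ^ (2 * α) * (‖Z.u x‖ ^ 2 + ‖Z.v x‖ ^ 2) ≤
      C ^ 2 * (jap (σ x) ^ (2 * α) * (‖Y.u (σ x)‖ ^ 2 + ‖Y.v (σ x)‖ ^ 2))) :
    ‖Z‖ ≤ C * ‖Y‖ := by
  rw [← pow_le_pow_iff_left₀ (norm_nonneg _) (by positivity) two_ne_zero, mul_pow, norm_sq, norm_sq]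
  have e := σ.tsum_eq fun x => jap x ^ (2 * α) * (‖Y.u x‖ ^ 2 + ‖Y.v x‖ ^ 2)
  rw [← e, ← tsum_mul_left]
  exact Summable.tsum_le_tsum h Z.summable_norm_sq
    ((σ.summable_iff.mpr Y.summable_norm_sq).mul_left (C ^ 2))

/-- A linear operator on configurations that satisfies a pointwise estimate is bounded on `H_α`. -/
def ofPointwise (f : (Lattice d → Site n × Site n) →ₗ[ℝ] (Lattice d → Site n × Site n))
    (σ : Equiv.Perm (Lattice d)) (C : ℝ) (hC : 0 ≤ C)
    (h : ∀ Y x, jap x ^ (2 * α) * (‖(f Y x).1‖ ^ 2 + ‖(f Y x).2‖ ^ 2) ≤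
      C ^ 2 * (jap (σ x) ^ (2 * α) * (‖(Y (σ x)).1‖ ^ 2 + ‖(Y (σ x)).2‖ ^ 2))) :
    PhaseSpace d n α →L[ℝ] PhaseSpace d n α :=
  LinearMap.mkContinuous
    { toFun := fun Y => mk (f Y.1) (summable_of_pointwise σ Y.2 (h Y.1))
      map_add' := fun Y Z => Subtype.ext (f.map_add Y.1 Z.1)
      map_smul' := fun r Y => Subtype.ext (f.map_smul r Y.1) } C
    fun Y => norm_le_of_pointwise σ hC (h Y.1)

lemma norm_ofPointwise_le (f : (Lattice d → Site n × Site n) →ₗ[ℝ] (Lattice d → Site n × Site n))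
    (σ : Equiv.Perm (Lattice d)) (C : ℝ) (hC : 0 ≤ C) (h) :
    ‖ofPointwise (α := α) f σ C hC h‖ ≤ C := LinearMap.mkContinuous_norm_le _ hC _

/-- The operator of multiplication by a bounded function. -/
def mulOp (m : Lattice d → ℝ) (Z : ℝ) (hm : ∀ x, |m x| ≤ Z) :
    PhaseSpace d n α →L[ℝ] PhaseSpace d n α :=
  ofPointwise
    { toFun := fun Y x => m x • Y x
      map_add' := fun Y Y' => by funext x; simp
      map_smul' := fun r Y => by funext x; exact smul_comm (m x) r (Y x) } (Equiv.refl _) Z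
    ((abs_nonneg _).trans (hm 0)) fun Y x => by
      have h1 : m x ^ 2 ≤ Z ^ 2 := sq_le_sq' (abs_le.mp (hm x)).1 (abs_le.mp (hm x)).2
      have h2 := Real.rpow_nonneg (jap_pos x).le (2 * α)
      simp only [LinearMap.coe_mk, AddHom.coe_mk, Prod.smul_fst, Prod.smul_snd, norm_smul,
        Real.norm_eq_abs, mul_pow, sq_abs, Equiv.refl_apply]
      rw [← mul_add, mul_left_comm]
      gcongr

@[simp] lemma mulOp_u (m : Lattice d → ℝ) (Z : ℝ) (hm : ∀ x, |m x| ≤ Z) (Y : PhaseSpace d n α)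
    (x : Lattice d) : (mulOp m Z hm Y).u x = m x • Y.u x := rfl

@[simp] lemma mulOp_v (m : Lattice d → ℝ) (Z : ℝ) (hm : ∀ x, |m x| ≤ Z) (Y : PhaseSpace d n α)
    (x : Lattice d) : (mulOp m Z hm Y).v x = m x • Y.v x := rfl

lemma norm_mulOp_le (m : Lattice d → ℝ) (Z : ℝ) (hm : ∀ x, |m x| ≤ Z) :
    ‖mulOp (n := n) (α := α) m Z hm‖ ≤ Z := norm_ofPointwise_le _ _ _ _ _

/-- The `i`-th coordinate of `(u(x), v(x))`. -/
def coord (x : Lattice d) (i : Fin n ⊕ Fin n) : PhaseSpace d n α →L[ℝ] ℝ :=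
  LinearMap.mkContinuous
    { toFun := fun Y => Sum.elim (Y.u x) (Y.v x) i
      map_add' := fun Y Z => by cases i <;> simp
      map_smul' := fun r Y => by cases i <;> simp } (jap x ^ (-α)) <| by
    intro Y
    have h := Y.term_le_norm_sq x
    have hp := Real.rpow_pos_of_pos (jap_pos x) α
    have hsq : jap x ^ (2 * α) = (jap x ^ α) ^ 2 := by
      rw [mul_comm, Real.rpow_mul (jap_pos x).le]; norm_num
    rw [Real.rpow_neg (jap_pos x).le, inv_mul_eq_div, le_div_iff₀ hp]
    refine le_of_sq_le_sq ?_ (norm_nonneg _)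
    have h2 : ‖Sum.elim (Y.u x) (Y.v x) i‖ ^ 2 ≤ ‖Y.u x‖ ^ 2 + ‖Y.v x‖ ^ 2 := by
      rcases i with a | a
      · have := pow_le_pow_left₀ (norm_nonneg _) (PiLp.norm_apply_le (Y.u x) a) 2
        simp only [Sum.elim_inl]
        nlinarith [sq_nonneg ‖Y.v x‖]
      · have := pow_le_pow_left₀ (norm_nonneg _) (PiLp.norm_apply_le (Y.v x) a) 2
        simp only [Sum.elim_inr]
        nlinarith [sq_nonneg ‖Y.u x‖]
    rw [hsq] at h
    refine le_trans ?_ h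
    rw [mul_pow, mul_comm]
    exact mul_le_mul_of_nonneg_left h2 (sq_nonneg _)

@[simp] lemma coord_inl (x : Lattice d) (a : Fin n) (Y : PhaseSpace d n α) :
    coord x (Sum.inl a) Y = Y.u x a := rfl

@[simp] lemma coord_inr (x : Lattice d) (a : Fin n) (Y : PhaseSpace d n α) :
    coord x (Sum.inr a) Y = Y.v x a := rfl

lemma ext_coord {Y Z : PhaseSpace d n α} (h : ∀ x i, coord x i Y = coord x i Z) : Y = Z :=
  ext (fun x => by ext a; exact h x (Sum.inl a)) (fun x => by ext a; exact h x (Sum.inr a))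

/-- This is where `α < -d/2` enters: bounded configurations, in particular plane waves, belong to
the phase space. -/
lemma summable_of_bounded (hα : α < -(d : ℝ) / 2) {f : Lattice d → Site n × Site n} {C : ℝ}
    (hC : ∀ x, ‖(f x).1‖ ^ 2 + ‖(f x).2‖ ^ 2 ≤ C) :
    Summable fun x => jap x ^ (2 * α) * (‖(f x).1‖ ^ 2 + ‖(f x).2‖ ^ 2) := by
  refine Summable.of_nonneg_of_le (fun x => ?_) (fun x => ?_)
    ((summable_jap_rpow (d := d) (s := 2 * α) (by linarith)).mul_right C)
  · have := Real.rpow_nonneg (jap_pos x).le (2 * α)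
    positivity
  · have := Real.rpow_nonneg (jap_pos x).le (2 * α)
    gcongr
    exact hC x

/-- The unit vectors of `ℝ^n ⊕ ℝ^n`. -/
def siteBasis (i : Fin n ⊕ Fin n) : Site n × Site n :=
  Sum.elim (fun a => (EuclideanSpace.single a 1, 0)) (fun a => (0, EuclideanSpace.single a 1)) i

/-- The value of a functional on the unit configuration at the site `z` in the direction `i`. -/
def coef (L : PhaseSpace d n α →L[ℝ] ℝ) (z : Lattice d) (i : Fin n ⊕ Fin n) : ℝ :=
  L (point z (siteBasis i))

lemma point_eq_sum (z : Lattice d) (w : Site n × Site n) :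
    point (α := α) z w = ∑ i, (Sum.elim w.1 w.2 i : ℝ) • point z (siteBasis i) := by
  let e : Site n × Site n →ₗ[ℝ] PhaseSpace d n α :=
    { toFun := point z
      map_add' := fun a b => Subtype.ext
        (Pi.single_add (f := fun _ : Lattice d => Site n × Site n) z a b)
      map_smul' := fun r a => Subtype.ext
        (Pi.single_smul (f := fun _ : Lattice d => Site n × Site n) z r a) }
  have hw : w = ∑ i, (Sum.elim w.1 w.2 i : ℝ) • siteBasis i := by
    rw [Fintype.sum_sum_type]
    refine Prod.ext ?_ ?_
    · ext a
      simp [siteBasis, Prod.fst_sum, Finset.sum_apply, Pi.single_apply]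
    · ext a
      simp [siteBasis, Prod.snd_sum, Finset.sum_apply, Pi.single_apply]
  change e w = ∑ i, (Sum.elim w.1 w.2 i : ℝ) • e (siteBasis i)
  conv_lhs => rw [hw]
  rw [map_sum]
  simp_rw [map_smul]

lemma hasSum_coef (L : PhaseSpace d n α →L[ℝ] ℝ) (Y : PhaseSpace d n α) :
    HasSum (fun z => ∑ i, coef L z i * coord z i Y) (L Y) := by
  refine (L.hasSum (hasSum_point Y)).congr_fun fun z => ?_
  rw [point_eq_sum, map_sum]
  refine Finset.sum_congr rfl fun i _ => ?_
  rw [map_smul, smul_eq_mul, mul_comm]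
  rcases i with a | a <;> rfl

/-- Changing signs of individual coordinates does not leave H_α. Applied to the configuration whose
signs make every term nonnegative, the convergent expansion of `L` becomes the series of absolute
values. -/
lemma summable_coef_mul (L : PhaseSpace d n α →L[ℝ] ℝ) (Y : PhaseSpace d n α) :
    Summable fun z => ∑ i, |coef L z i * coord z i Y| := by
  set W : PhaseSpace d n α := mk
    (fun x => (WithLp.toLp 2 fun a => (SignType.sign (coef L x (Sum.inl a) * Y.u x a) : ℝ) * Y.u x a,
      WithLp.toLp 2 fun a => (SignType.sign (coef L x (Sum.inr a) * Y.v x a) : ℝ) * Y.v x a)) <| by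
    have hs : ∀ r s : ℝ, ((SignType.sign r : ℝ) * s) ^ 2 ≤ s ^ 2 := fun r s => by
      rcases lt_trichotomy r 0 with h | h | h <;> simp [h, sign_neg, sign_pos, sq_nonneg]
    refine Summable.of_nonneg_of_le (fun x => ?_) (fun x => ?_) Y.summable_norm_sq
    · have := Real.rpow_nonneg (jap_pos x).le (2 * α)
      positivity
    · have := Real.rpow_nonneg (jap_pos x).le (2 * α)
      simp only [EuclideanSpace.norm_sq_eq, Real.norm_eq_abs, sq_abs]
      refine mul_le_mul_of_nonneg_left (add_le_add (Finset.sum_le_sum fun a _ => hs _ _)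
        (Finset.sum_le_sum fun a _ => hs _ _)) this with hW
  refine (hasSum_coef L W).summable.congr fun z => Finset.sum_congr rfl fun i _ => ?_
  rw [← sign_mul_self]
  rcases i with a | a
  · simp only [hW, coord_inl, mk_u]
    ring
  · simp only [hW, coord_inr, mk_v]
    ring

/-- The configuration constantly equal to one lies in H_α, so the previous estimate at this point
bounds the coefficients in `ℓ¹`. The Fourier transform of a continuous functional is therefore
continuous and bounded. -/
lemma summable_coef (hα : α < -(d : ℝ) / 2) (L : PhaseSpace d n α →L[ℝ] ℝ) (i : Fin n ⊕ Fin n) :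
    Summable fun z => |coef L z i| := by
  set Y : PhaseSpace d n α := mk (fun _ => (WithLp.toLp 2 fun _ => 1, WithLp.toLp 2 fun _ => 1))
    (summable_of_bounded hα fun x => le_rfl) with hY
  have h1 : ∀ z i, coord z i Y = 1 := fun z i => by rcases i with a | a <;> rfl
  refine Summable.of_nonneg_of_le (fun z => abs_nonneg _) (fun z => ?_) (summable_coef_mul L Y)
  simp only [h1, mul_one]
  exact Finset.single_le_sum (f := fun i => |coef L z i|) (fun _ _ => abs_nonneg _) (Finset.mem_univ i)

lemma coef_mulOp (L : PhaseSpace d n α →L[ℝ] ℝ) (m : Lattice d → ℝ) (Z : ℝ) (hm : ∀ x, |m x| ≤ Z)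
    (z : Lattice d) (i : Fin n ⊕ Fin n) :
    coef (L.comp (mulOp m Z hm)) z i = m z * coef L z i := by
  have : mulOp m Z hm (point z (siteBasis i) : PhaseSpace d n α) = m z • point z (siteBasis i) := by
    refine Subtype.ext (funext fun x => ?_)
    change m x • (Pi.single z (siteBasis i) : Lattice d → Site n × Site n) x =
      m z • (Pi.single z (siteBasis i) : Lattice d → Site n × Site n) x
    by_cases h : x = z
    · rw [h]
    · simp [Pi.single_eq_of_ne h]
  rw [coef, ContinuousLinearMap.comp_apply, this, map_smul, smul_eq_mul, coef]

/-- Finite combinations of the unit configurations are dense. The resulting second countability is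
used for measurability of sums of random phase points and for determining laws by characteristic
functionals. -/
instance : TopologicalSpace.SeparableSpace (PhaseSpace d n α) := by
  have hs : TopologicalSpace.IsSeparable (Submodule.span ℝ (Set.range
      fun q : Lattice d × (Fin n ⊕ Fin n) => (point q.1 (siteBasis q.2) : PhaseSpace d n α)) :
        Set (PhaseSpace d n α)) := (Set.countable_range _).isSeparable.span
  rw [← TopologicalSpace.isSeparable_univ_iff]
  refine hs.closure.mono fun Y _ => ?_
  refine mem_closure_of_tendsto (hasSum_point Y) (Eventually.of_forall fun S => ?_)
  refine Submodule.sum_mem _ fun z _ => ?_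
  rw [point_eq_sum]
  exact Submodule.sum_mem _ fun i _ => Submodule.smul_mem _ _
    (Submodule.subset_span ⟨(z, i), rfl⟩)

instance : SecondCountableTopology (PhaseSpace d n α) :=
  UniformSpace.secondCountable_of_separable _

end PhaseSpace

end

section

/-! ### The generator of the dynamics -/

variable {d n k : ℕ} {α : ℝ} {V : Lattice d → Matrix (Fin n) (Fin n) ℝ}

lemma jap_sub_le (x y : Lattice d) : jap (x - y) ≤ √2 * jap x * jap y := by
  rw [jap, jap, jap, mul_assoc, ← Real.sqrt_mul (by positivity), ← Real.sqrt_mul (by norm_num)]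
  refine Real.sqrt_le_sqrt ?_
  have h : ∑ i, (((x - y) i : ℤ) : ℝ) ^ 2 ≤ 2 * ∑ i, (x i : ℝ) ^ 2 + 2 * ∑ i, (y i : ℝ) ^ 2 := by
    rw [Finset.mul_sum, Finset.mul_sum, ← Finset.sum_add_distrib]
    refine Finset.sum_le_sum fun i _ => ?_
    rw [Pi.sub_apply]
    push_cast
    nlinarith [sq_nonneg ((x i : ℝ) + y i)]
  have h1 : 0 ≤ ∑ i, (x i : ℝ) ^ 2 := by positivity
  have h2 : 0 ≤ ∑ i, (y i : ℝ) ^ 2 := by positivity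
  nlinarith [mul_nonneg h1 h2]

/-- Peetre's inequality: translation by `y` costs only a power of `⟨y⟩` in the weighted norm. -/
lemma jap_rpow_le (hα : α < 0) (x y : Lattice d) :
    jap x ^ (2 * α) ≤ (√2 * jap y) ^ (-(2 * α)) * jap (x - y) ^ (2 * α) := by
  have hs : 0 < √2 * jap y := mul_pos (by positivity) (jap_pos y)
  have h1 : (√2 * jap y * jap x) ^ (2 * α) ≤ jap (x - y) ^ (2 * α) :=
    Real.rpow_le_rpow_of_nonpos (jap_pos _) (by
      have := jap_sub_le x y
      linarith [mul_right_comm (√2) (jap x) (jap y)]) (by linarith)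
  rw [Real.mul_rpow hs.le (jap_pos x).le] at h1
  calc jap x ^ (2 * α)
      = (√2 * jap y) ^ (-(2 * α)) * ((√2 * jap y) ^ (2 * α) * jap x ^ (2 * α)) := by
        rw [← mul_assoc, ← Real.rpow_add hs, neg_add_cancel, Real.rpow_zero, one_mul]
    _ ≤ _ := by gcongr

lemma norm_toEuclideanLin_le {M : Matrix (Fin n) (Fin n) ℝ} {B : ℝ} (hM : ∀ a b, |M a b| ≤ B)
    (w : Site n) : ‖Matrix.toEuclideanLin M w‖ ≤ B * n * n * ‖w‖ := by
  have hsum : ∀ v : Site n, ‖v‖ ≤ ∑ a, |v a| := fun v => by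
    rw [EuclideanSpace.norm_eq]
    refine Real.sqrt_le_iff.mpr ⟨Finset.sum_nonneg fun _ _ => abs_nonneg _, ?_⟩
    exact Finset.sum_sq_le_sq_sum_of_nonneg (f := fun a => ‖v a‖) fun _ _ => norm_nonneg _
  refine (hsum _).trans ?_
  have h1 : ∀ a, |Matrix.toEuclideanLin M w a| ≤ n * (B * ‖w‖) := fun a => by
    rw [Matrix.toLpLin_apply]
    refine (Finset.abs_sum_le_sum_abs (fun b => M a b * w b) Finset.univ).trans ?_
    refine (Finset.sum_le_card_nsmul Finset.univ _ (B * ‖w‖) fun b _ => ?_).trans (by simp)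
    rw [abs_mul]
    exact mul_le_mul (hM a b) (PiLp.norm_apply_le w b) (abs_nonneg _)
      ((abs_nonneg _).trans (hM a b))
  refine (Finset.sum_le_card_nsmul _ _ _ fun a _ => h1 a).trans (le_of_eq ?_)
  simp
  ring

namespace PhaseSpace

/-- The operator `(u, v) ↦ (0, -M u(· - y))`. -/
def hop (hα : α < 0) (M : Matrix (Fin n) (Fin n) ℝ) (B : ℝ) (hB : 0 ≤ B)
    (hM : ∀ a b, |M a b| ≤ B) (y : Lattice d) : PhaseSpace d n α →L[ℝ] PhaseSpace d n α :=
  ofPointwise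
    { toFun := fun Y x => (0, -Matrix.toEuclideanLin M (Y (x - y)).1)
      map_add' := fun Y Z => by funext x; simp; abel
      map_smul' := fun r Y => by funext x; simp } (Equiv.subRight y)
    ((√2 * jap y) ^ (-α) * (B * n * n))
    (mul_nonneg (Real.rpow_nonneg (mul_nonneg (by positivity) (jap_pos y).le) _) (by positivity))
    fun Y x => by
      have h1 := norm_toEuclideanLin_le hM (Y (x - y)).1
      have h2 := jap_rpow_le hα x y
      have hs : 0 ≤ √2 * jap y := mul_nonneg (by positivity) (jap_pos y).le
      have h3 : (√2 * jap y) ^ (-(2 * α)) = ((√2 * jap y) ^ (-α)) ^ 2 := by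
        rw [← Real.rpow_natCast, ← Real.rpow_mul hs]; congr 1; push_cast; ring
      simp only [LinearMap.coe_mk, AddHom.coe_mk, norm_zero, norm_neg, Equiv.subRight_apply]
      rw [h3] at h2
      have h4 := pow_le_pow_left₀ (norm_nonneg _) h1 2
      have h5 := Real.rpow_nonneg (jap_pos (x - y)).le (2 * α)
      have h6 : ((B * n * n) * ‖(Y (x - y)).1‖) ^ 2 ≤
          (B * n * n) ^ 2 * (‖(Y (x - y)).1‖ ^ 2 + ‖(Y (x - y)).2‖ ^ 2) := by
        rw [mul_pow]
        gcongr
        nlinarith [sq_nonneg ‖(Y (x - y)).2‖]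
      calc jap x ^ (2 * α) * (0 ^ 2 + ‖Matrix.toEuclideanLin M (Y (x - y)).1‖ ^ 2)
          ≤ (((√2 * jap y) ^ (-α)) ^ 2 * jap (x - y) ^ (2 * α)) *
              ((B * n * n) ^ 2 * (‖(Y (x - y)).1‖ ^ 2 + ‖(Y (x - y)).2‖ ^ 2)) := by
            refine mul_le_mul h2 ?_ (by positivity) (by positivity)
            linarith
        _ = _ := by ring

lemma norm_hop_le (hα : α < 0) (M : Matrix (Fin n) (Fin n) ℝ) (B : ℝ) (hB : 0 ≤ B)
    (hM : ∀ a b, |M a b| ≤ B) (y : Lattice d) :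
    ‖hop hα M B hB hM y‖ ≤ (√2 * jap y) ^ (-α) * (B * n * n) := norm_ofPointwise_le _ _ _ _ _

/-- The operator `(u, v) ↦ (v, 0)`. -/
def velocityOp : PhaseSpace d n α →L[ℝ] PhaseSpace d n α :=
  ofPointwise
    { toFun := fun Y x => ((Y x).2, 0)
      map_add' := fun Y Z => by funext x; simp
      map_smul' := fun r Y => by funext x; simp } (Equiv.refl _) 1 zero_le_one fun Y x => by
      have h := Real.rpow_nonneg (jap_pos x).le (2 * α)
      simp only [LinearMap.coe_mk, AddHom.coe_mk, Equiv.refl_apply, one_pow, one_mul]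
      refine mul_le_mul_of_nonneg_left ?_ h
      rw [norm_zero]
      nlinarith [sq_nonneg ‖(Y x).1‖]

@[simp] lemma velocityOp_u (Y : PhaseSpace d n α) (x : Lattice d) : (velocityOp Y).u x = Y.v x := rfl
@[simp] lemma velocityOp_v (Y : PhaseSpace d n α) (x : Lattice d) : (velocityOp Y).v x = 0 := rfl

/-- The continuous linear map `Y ↦ u(x)`. -/
def uCLM (x : Lattice d) : PhaseSpace d n α →L[ℝ] Site n :=
  (EuclideanSpace.equiv (Fin n) ℝ).symm.toContinuousLinearMap.comp
    (ContinuousLinearMap.pi fun a => coord x (Sum.inl a))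

/-- The continuous linear map `Y ↦ v(x)`. -/
def vCLM (x : Lattice d) : PhaseSpace d n α →L[ℝ] Site n :=
  (EuclideanSpace.equiv (Fin n) ℝ).symm.toContinuousLinearMap.comp
    (ContinuousLinearMap.pi fun a => coord x (Sum.inr a))

lemma uCLM_apply (x : Lattice d) (Y : PhaseSpace d n α) : uCLM x Y = Y.u x := by ext a; rfl

lemma vCLM_apply (x : Lattice d) (Y : PhaseSpace d n α) : vCLM x Y = Y.v x := by ext a; rfl

end PhaseSpace

open PhaseSpace in
-- Convolution with `V` is a sum of translates weighted by `V(y)`. The norms of the translations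
-- grow polynomially in `y` and the exponential decay of `V` makes the series converge in operator
-- norm.
lemma Admissible.exists_generator (hα : α < 0) (hV : Admissible V) :
    ∃ A : PhaseSpace d n α →L[ℝ] PhaseSpace d n α, ∀ Y x, (A Y).u x = Y.v x ∧
      HasSum (fun y => -Matrix.toEuclideanLin (V (x - y)) (Y.u y)) ((A Y).v x) := by
  obtain ⟨C, hC, γ, hγ, hdec⟩ := hV.decay
  set B : Lattice d → ℝ := fun y => C * Real.exp (-γ * len y) with hB
  have hB0 : ∀ y, 0 ≤ B y := fun y => by positivity
  obtain ⟨T, hTu, hTv, hTn⟩ : ∃ T : Lattice d → (PhaseSpace d n α →L[ℝ] PhaseSpace d n α),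
      (∀ y Y x, (T y Y).u x = 0) ∧
      (∀ y Y x, (T y Y).v x = -Matrix.toEuclideanLin (V y) (Y.u (x - y))) ∧
      ∀ y, ‖T y‖ ≤ (√2 * jap y) ^ (-α) * (B y * n * n) :=
    ⟨fun y => hop hα (V y) (B y) (hB0 y) (hdec y) y, fun _ _ _ => rfl, fun _ _ _ => rfl,
      fun y => norm_hop_le _ _ _ _ _ _⟩
  have hsum : Summable T := by
    refine Summable.of_norm_bounded (g := fun y => (√2 ^ (-α) * C * n * n) *
      (jap y ^ (-α) * Real.exp (-(γ / (d + 1)) * len1 y)))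
      ((summable_jap_mul_exp _ (by positivity)).mul_left _) fun y => ?_
    refine (hTn y).trans ?_
    rw [Real.mul_rpow (by positivity) (jap_pos y).le]
    have h1 : Real.exp (-γ * len y) ≤ Real.exp (-(γ / (d + 1)) * len1 y) := by
      refine Real.exp_le_exp.mpr ?_
      have := len1_le_len y
      have h3 : γ / (d + 1) * len1 y ≤ γ / (d + 1) * ((d + 1) * len y) := by gcongr
      rw [← mul_assoc, div_mul_cancel₀ _ (by positivity)] at h3
      linarith
    have h2 := Real.rpow_nonneg (jap_pos y).le (-α)
    calc √2 ^ (-α) * jap y ^ (-α) * (C * Real.exp (-γ * len y) * n * n)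
        ≤ √2 ^ (-α) * jap y ^ (-α) * (C * Real.exp (-(γ / (d + 1)) * len1 y) * n * n) := by gcongr
      _ = _ := by ring
  have hT : ∀ Y, HasSum (fun y => T y Y) ((∑' y, T y) Y) := fun Y =>
    (ContinuousLinearMap.apply ℝ (PhaseSpace d n α) Y).hasSum hsum.hasSum
  refine ⟨velocityOp + ∑' y, T y, fun Y x => ⟨?_, ?_⟩⟩
  · have h := (uCLM x).hasSum (hT Y)
    have h0 : ((∑' y, T y) Y).u x = 0 := by
      rw [← uCLM_apply]
      refine h.unique (hasSum_zero.congr_fun fun y => ?_)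
      rw [uCLM_apply, hTu]
    rw [add_apply, add_u, velocityOp_u, h0, add_zero]
  · have h := (vCLM x).hasSum (hT Y)
    rw [add_apply, add_v, velocityOp_v, zero_add, ← vCLM_apply,
      ← (Equiv.subLeft x).hasSum_iff]
    refine h.congr_fun fun y => ?_
    rw [vCLM_apply, Function.comp_apply, Equiv.subLeft_apply, sub_sub_cancel, hTv]

open Classical in
/-- The generator of the dynamics, `(u, v) ↦ (v, -V * u)`. -/
def generator (V : Lattice d → Matrix (Fin n) (Fin n) ℝ) (α : ℝ) :
    PhaseSpace d n α →L[ℝ] PhaseSpace d n α :=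
  if h : α < 0 ∧ Admissible V then (h.2.exists_generator h.1).choose else 0

lemma Admissible.generator_u (hV : Admissible V) (hα : α < 0) (Y : PhaseSpace d n α) (x : Lattice d) :
    (generator V α Y).u x = Y.v x := by
  rw [generator, dif_pos ⟨hα, hV⟩]
  exact ((hV.exists_generator hα).choose_spec Y x).1

lemma Admissible.hasSum_generator_v (hV : Admissible V) (hα : α < 0) (Y : PhaseSpace d n α)
    (x : Lattice d) :
    HasSum (fun y => -Matrix.toEuclideanLin (V (x - y)) (Y.u y)) ((generator V α Y).v x) := by
  rw [generator, dif_pos ⟨hα, hV⟩]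
  exact ((hV.exists_generator hα).choose_spec Y x).2

/-- The group generated by `generator V α`. -/
def propagator (V : Lattice d → Matrix (Fin n) (Fin n) ℝ) (α : ℝ) (t : ℝ) :
    PhaseSpace d n α →L[ℝ] PhaseSpace d n α := NormedSpace.exp (t • generator V α)

lemma hasDerivAt_propagator (V : Lattice d → Matrix (Fin n) (Fin n) ℝ) (t : ℝ) (Y : PhaseSpace d n α) :
    HasDerivAt (fun s => propagator V α s Y) (generator V α (propagator V α t Y)) t := by
  have h := hasDerivAt_exp_smul_const' (𝕂 := ℝ) (generator V α) t
  exact ((ContinuousLinearMap.apply ℝ (PhaseSpace d n α) Y).hasFDerivAt.comp_hasDerivAt t h)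

lemma propagator_zero (V : Lattice d → Matrix (Fin n) (Fin n) ℝ) (Y : PhaseSpace d n α) :
    propagator V α 0 Y = Y := by simp [propagator]

/-- A differentiable curve in `H_α` that satisfies the equation of motion. -/
lemma eq_propagator {V : Lattice d → Matrix (Fin n) (Fin n) ℝ} {Z : ℝ → PhaseSpace d n α}
    (hZ : ∀ t, HasDerivAt Z (generator V α (Z t)) t) (t : ℝ) :
    Z t = propagator V α t (Z 0) := by
  have h := ODE_solution_unique_univ (v := fun _ Y => generator V α Y) (s := fun _ => Set.univ)
    (K := ‖generator V α‖₊) (t₀ := 0) (f := Z) (g := fun s => propagator V α s (Z 0))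
    (fun _ => (generator V α).lipschitz.lipschitzOnWith) (fun t => ⟨hZ t, trivial⟩)
    (fun t => ⟨hasDerivAt_propagator V t (Z 0), trivial⟩) (propagator_zero V _).symm
  exact congrFun h t

lemma propagator_add (V : Lattice d → Matrix (Fin n) (Fin n) ℝ) (s t : ℝ) :
    propagator V α (s + t) = (propagator V α s).comp (propagator V α t) := by
  ext1 Y
  have h := eq_propagator (V := V) (Z := fun r => propagator V α (r + t) Y) (fun r => by
    have := (hasDerivAt_propagator V (r + t) Y).comp_add_const r t
    exact this) s
  simpa using h

open PhaseSpace in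
lemma Admissible.isSolution_propagator (hV : Admissible V) (hα : α < 0) (Y : PhaseSpace d n α) :
    IsSolution V Y fun t => propagator V α t Y := by
  have hd := fun t => hasDerivAt_propagator V t Y
  refine ⟨continuous_iff_continuousAt.mpr fun t => (hd t).continuousAt, propagator_zero V Y,
    fun t x => ⟨?_, ?_⟩⟩
  · have h := (uCLM x).hasFDerivAt.comp_hasDerivAt t (hd t)
    simpa only [Function.comp_def, uCLM_apply, hV.generator_u hα] using h
  · have h := (vCLM x).hasFDerivAt.comp_hasDerivAt t (hd t)
    rw [← tsum_neg, (hV.hasSum_generator_v hα _ x).tsum_eq]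
    simpa only [Function.comp_def, vCLM_apply] using h

lemma eq_of_hasDerivAt {E : Type*} [NormedAddCommGroup E] [NormedSpace ℝ E] {f g f' : ℝ → E}
    (hf : ∀ t, HasDerivAt f (f' t) t) (hg : ∀ t, HasDerivAt g (f' t) t) (h0 : f 0 = g 0) : f = g := by
  have hd : ∀ t, HasDerivAt (f - g) 0 t := fun t => by simpa using (hf t).sub (hg t)
  funext t
  have h := is_const_of_deriv_eq_zero (fun t => (hd t).differentiableAt) (fun t => (hd t).deriv) t 0
  simp only [Pi.sub_apply, h0, sub_self] at h
  exact sub_eq_zero.mp h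

open PhaseSpace in
-- A solution is differentiable only site by site, while uniqueness for the linear equation needs a
-- derivative in norm. The curve `Y₀ + ∫ A Y` has one, since `Y` is continuous, and it has the same
-- coordinate derivatives as `Y`; hence the two coincide.
lemma IsSolution.eq_propagator (hV : Admissible V) (hα : α < 0) {Y₀ : PhaseSpace d n α}
    {Y : ℝ → PhaseSpace d n α} (h : IsSolution V Y₀ Y) (t : ℝ) : Y t = propagator V α t Y₀ := by
  obtain ⟨hc, h0, hd⟩ := h
  have hgc : Continuous fun s => generator V α (Y s) := (generator V α).continuous.comp hc
  set W : ℝ → PhaseSpace d n α := fun t => Y₀ + ∫ s in (0 : ℝ)..t, generator V α (Y s) with hW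
  have hWd : ∀ t, HasDerivAt W (generator V α (Y t)) t := fun t =>
    (intervalIntegral.integral_hasDerivAt_right (hgc.intervalIntegrable _ _)
      (hgc.stronglyMeasurableAtFilter _ _) hgc.continuousAt).const_add _
  have hYW : Y = W := by
    have hW0 : W 0 = Y 0 := by simp [hW, h0]
    have hWu := fun x t => (uCLM x).hasFDerivAt.comp_hasDerivAt t (hWd t)
    have hWv := fun x t => (vCLM x).hasFDerivAt.comp_hasDerivAt t (hWd t)
    simp only [Function.comp_def, uCLM_apply, vCLM_apply, hV.generator_u hα] at hWu hWv
    have hu : ∀ x, (fun t => (Y t).u x) = fun t => (W t).u x := fun x =>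
      eq_of_hasDerivAt (fun t => (hd t x).1) (hWu x) (by simp only [hW0])
    have hv : ∀ x, (fun t => (Y t).v x) = fun t => (W t).v x := fun x =>
      eq_of_hasDerivAt (fun t => (hd t x).2) (fun t => by
        rw [← tsum_neg, (hV.hasSum_generator_v hα _ x).tsum_eq]
        exact hWv x t) (by simp only [hW0])
    funext t
    exact ext (fun x => congrFun (hu x) t) fun x => congrFun (hv x) t
  have := HarmonicCrystal.eq_propagator (V := V) (Z := Y) (fun t => by
    have := hWd t; rw [← hYW] at this; exact this) t
  rw [this, h0]

/-- The solution operator is the group generated by `generator V α`. -/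
lemma Admissible.flow_eq (hV : Admissible V) (hα : α < 0) (t : ℝ) :
    flow (α := α) V t = propagator V α t := by
  funext Y₀
  have h : ∃ Y, IsSolution V Y₀ Y := ⟨_, hV.isSolution_propagator hα Y₀⟩
  rw [flow, dif_pos h]
  exact h.choose_spec.eq_propagator hV hα t

end

section

/-! ### Spectral projections and plane waves -/

variable {d n k : ℕ} {α : ℝ} {V : Lattice d → Matrix (Fin n) (Fin n) ℝ}

lemma bandMult_pos (j : Fin n) (θ : Fin d → ℝ) : 0 < bandMult V j θ := multiplicity'_pos _ _

lemma Admissible.Vhat_mul_bandProj (hV : Admissible V) (j : Fin n) (θ : Fin d → ℝ) :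
    Vhat V θ * bandProj V j θ = ((freq V j θ ^ 2 : ℝ) : ℂ) • bandProj V j θ := by
  obtain ⟨U, hU⟩ := hV.diagonalizes θ
  exact hU.mul_specProj j

lemma Admissible.inv_mul_bandProj (hV : Admissible V) (j : Fin n) (θ : Fin d → ℝ) :
    (Vhat V θ)⁻¹ * bandProj V j θ = ((freq V j θ ^ 2 : ℝ) : ℂ)⁻¹ • bandProj V j θ := by
  obtain ⟨U, hU⟩ := hV.diagonalizes θ
  exact hU.inv_mul_specProj (hV.det_ne_zero θ) j (pow_pos (hV.freq_pos j θ) 2).ne'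

lemma Admissible.bandProj_mul (hV : Admissible V) (i j : Fin n) (θ : Fin d → ℝ) :
    bandProj V i θ * bandProj V j θ = if freq V i θ = freq V j θ then bandProj V j θ else 0 := by
  obtain ⟨U, hU⟩ := hV.diagonalizes θ
  have h := hU.specProj_mul i j
  simp only [hV.freq_sq_inj] at h
  rw [bandProj, bandProj, h]

lemma Admissible.bandProj_conjTranspose (hV : Admissible V) (j : Fin n) (θ : Fin d → ℝ) :
    (bandProj V j θ).conjTranspose = bandProj V j θ := by
  obtain ⟨U, hU⟩ := hV.diagonalizes θ
  exact hU.specProj_conjTranspose j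

lemma Admissible.conj_bandProj (hV : Admissible V) (j : Fin n) (θ : Fin d → ℝ) (a b : Fin n) :
    starRingEnd ℂ (bandProj V j θ a b) = bandProj V j θ b a := by
  conv_rhs => rw [← hV.bandProj_conjTranspose j θ]
  rfl

lemma Admissible.sum_bandProj (hV : Admissible V) (θ : Fin d → ℝ) :
    ∑ j, (bandMult V j θ : ℂ)⁻¹ • bandProj V j θ = 1 := by
  obtain ⟨U, hU⟩ := hV.diagonalizes θ
  exact hU.sum_specProj

/-- For an orthogonal projection the diagonal entry is the squared norm of its column, `P_bb = ∑_c
|P_cb|²`. Hence `|P_bb| ≤ 1`, and the same identity bounds the other entries of the column. -/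
lemma Admissible.norm_bandProj_le (hV : Admissible V) (j : Fin n) (θ : Fin d → ℝ) (a b : Fin n) :
    ‖bandProj V j θ a b‖ ≤ 1 := by
  have h := congrFun (congrFun (hV.bandProj_mul j j θ) b) b
  rw [if_pos rfl, Matrix.mul_apply] at h
  have h1 : ∀ c, bandProj V j θ b c * bandProj V j θ c b = ((‖bandProj V j θ c b‖ ^ 2 : ℝ) : ℂ) := by
    intro c
    rw [← hV.conj_bandProj j θ c b, Complex.conj_mul']
    push_cast; rfl
  simp_rw [h1] at h
  rw [← Complex.ofReal_sum] at h
  set S := ∑ c, ‖bandProj V j θ c b‖ ^ 2 with hS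
  have hle : ∀ c, ‖bandProj V j θ c b‖ ^ 2 ≤ S := fun c =>
    Finset.single_le_sum (f := fun c => ‖bandProj V j θ c b‖ ^ 2) (fun _ _ => sq_nonneg _)
      (Finset.mem_univ c)
  have hb := hle b
  rw [← h, Complex.norm_real, Real.norm_eq_abs, sq_abs] at hb
  have ha := hle a
  have hS0 : 0 ≤ S := Finset.sum_nonneg fun _ _ => sq_nonneg _
  have : S ≤ 1 := by nlinarith
  nlinarith [norm_nonneg (bandProj V j θ a b)]

lemma Admissible.measurable_freq (hV : Admissible V) (j : Fin n) : Measurable (freq V j) :=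
  (hV.continuous_freq j).measurable

/-- The projections may jump on the crossing set, but the sets that select the branches of the
Lagrange product are measurable, so they are measurable everywhere. -/
lemma Admissible.measurable_bandProj (hV : Admissible V) (j : Fin n) (a b : Fin n) :
    Measurable fun θ => bandProj V j θ a b := by
  have key : ∀ L : List (Fin n), ∀ a b, Measurable fun θ => (L.map fun i =>
      if freq V i θ ^ 2 = freq V j θ ^ 2 then (1 : Matrix (Fin n) (Fin n) ℂ) else
        ((freq V j θ ^ 2 - freq V i θ ^ 2 : ℝ) : ℂ)⁻¹ •
          (Vhat V θ - ((freq V i θ ^ 2 : ℝ) : ℂ) • 1)).prod a b := by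
    intro L
    induction L with
    | nil => intro a b; simp
    | cons i L ih =>
      intro a b
      simp only [List.map_cons, List.prod_cons, Matrix.mul_apply]
      refine Finset.measurable_sum _ fun c _ => Measurable.mul ?_ (ih c b)
      have hs : MeasurableSet {θ | freq V i θ ^ 2 = freq V j θ ^ 2} :=
        measurableSet_eq_fun ((hV.measurable_freq i).pow_const 2) ((hV.measurable_freq j).pow_const 2)
      have he : (fun θ => (if freq V i θ ^ 2 = freq V j θ ^ 2 then (1 : Matrix (Fin n) (Fin n) ℂ) else
          ((freq V j θ ^ 2 - freq V i θ ^ 2 : ℝ) : ℂ)⁻¹ •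
          (Vhat V θ - ((freq V i θ ^ 2 : ℝ) : ℂ) • 1)) a c) = fun θ =>
          if freq V i θ ^ 2 = freq V j θ ^ 2 then (1 : Matrix (Fin n) (Fin n) ℂ) a c else
          ((freq V j θ ^ 2 - freq V i θ ^ 2 : ℝ) : ℂ)⁻¹ *
          (Vhat V θ a c - ((freq V i θ ^ 2 : ℝ) : ℂ) * (1 : Matrix (Fin n) (Fin n) ℂ) a c) := by
        funext θ
        split_ifs <;> rfl
      rw [he]
      have hf := hV.measurable_freq
      have hVm : Measurable fun θ => Vhat V θ a c :=
        (continuous_apply_apply a c |>.comp hV.continuous_Vhat).measurable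
      exact Measurable.ite hs measurable_const (by fun_prop)
  exact key _ a b

lemma Admissible.measurable_bandMult (hV : Admissible V) (j : Fin n) :
    Measurable fun θ => ((bandMult V j θ : ℕ) : ℂ) := by
  have h : (fun θ => ((bandMult V j θ : ℕ) : ℂ)) = fun θ => ∑ i,
      {θ | freq V i θ ^ 2 = freq V j θ ^ 2}.indicator (fun _ => (1 : ℂ)) θ := by
    funext θ
    rw [bandMult, multiplicity', Finset.card_filter]
    push_cast
    refine Finset.sum_congr rfl fun i _ => ?_
    simp [Set.indicator]
  rw [h]
  exact Finset.measurable_sum _ fun i _ => measurable_const.indicator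
    (measurableSet_eq_fun ((hV.measurable_freq i).pow_const 2) ((hV.measurable_freq j).pow_const 2))

/-! ### Plane waves and the normal modes of a continuous functional. -/

namespace PhaseSpace

lemma norm_exp_neg_I_mul (r : ℝ) : ‖Complex.exp (-(Complex.I * (r : ℂ)))‖ = 1 := by
  rw [← mul_neg, ← Complex.ofReal_neg, norm_exp_I_mul]

/-- The real part of the plane wave `x ↦ e^{-i(x,θ)} W`. -/
def planeWave (hα : α < -(d : ℝ) / 2) (θ : Fin d → ℝ) (W : Fin n ⊕ Fin n → ℂ) : PhaseSpace d n α :=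
  mk (fun x =>
    (WithLp.toLp 2 fun a => (Complex.exp (-(Complex.I * (pair x θ : ℂ))) * W (Sum.inl a)).re,
     WithLp.toLp 2 fun a => (Complex.exp (-(Complex.I * (pair x θ : ℂ))) * W (Sum.inr a)).re)) <| by
    refine summable_of_bounded hα (C := ∑ a, ‖W (Sum.inl a)‖ ^ 2 + ∑ a, ‖W (Sum.inr a)‖ ^ 2)
      fun x => ?_
    have h : ∀ w : ℂ, (Complex.exp (-(Complex.I * (pair x θ : ℂ))) * w).re ^ 2 ≤ ‖w‖ ^ 2 := fun w => by
      rw [← sq_abs]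
      refine pow_le_pow_left₀ (abs_nonneg _) ((Complex.abs_re_le_norm _).trans ?_) 2
      rw [norm_mul, norm_exp_neg_I_mul, one_mul]
    simp only [EuclideanSpace.norm_sq_eq, Real.norm_eq_abs, sq_abs]
    exact add_le_add (Finset.sum_le_sum fun a _ => h _) (Finset.sum_le_sum fun a _ => h _)

lemma coord_planeWave (hα : α < -(d : ℝ) / 2) (θ : Fin d → ℝ) (W : Fin n ⊕ Fin n → ℂ)
    (x : Lattice d) (i : Fin n ⊕ Fin n) :
    coord x i (planeWave hα θ W) = (Complex.exp (-(Complex.I * (pair x θ : ℂ))) * W i).re := by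
  rcases i with a | a <;> rfl

/-- The Fourier series of the coefficients of a functional. -/
def hat (L : PhaseSpace d n α →L[ℝ] ℝ) (i : Fin n ⊕ Fin n) (θ : Fin d → ℝ) : ℂ :=
  fourierSum (fun z => (coef L z i : ℂ)) θ

lemma summable_norm_coef (hα : α < -(d : ℝ) / 2) (L : PhaseSpace d n α →L[ℝ] ℝ) (i : Fin n ⊕ Fin n) :
    Summable fun z => ‖(coef L z i : ℂ)‖ := by
  simpa only [Complex.norm_real, Real.norm_eq_abs] using summable_coef hα L i

/-- Testing a functional on plane waves gives pointwise access to its Fourier transform, so the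
evolution of that transform can be computed without solving the lattice equations for general data.
-/
lemma apply_planeWave (hα : α < -(d : ℝ) / 2) (L : PhaseSpace d n α →L[ℝ] ℝ) (θ : Fin d → ℝ)
    (W : Fin n ⊕ Fin n → ℂ) : L (planeWave hα θ W) = (∑ i, hat L i θ * W i).re := by
  have h1 : ∀ i, HasSum (fun z => Complex.exp (-(Complex.I * (pair z θ : ℂ))) * (coef L z i : ℂ))
      (hat L i θ) := fun i => by
    have h := (summable_expSeries (summable_norm_coef hα L i) (-θ)).hasSum
    refine h.congr_fun fun z => ?_
    congr 2
    simp [pair]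
  have h2 := hasSum_sum (s := Finset.univ) fun i _ => (h1 i).mul_right (W i)
  have h3 := Complex.hasSum_re h2
  refine (hasSum_coef L _).unique (h3.congr_fun fun z => ?_)
  rw [Complex.re_sum]
  refine Finset.sum_congr rfl fun i _ => ?_
  rw [coord_planeWave, mul_right_comm, mul_comm _ (coef L z i : ℂ), Complex.re_ofReal_mul]

/-- `planeWave` as a linear map in the amplitude. -/
def planeWaveCLM (hα : α < -(d : ℝ) / 2) (θ : Fin d → ℝ) :
    (Fin n ⊕ Fin n → ℂ) →L[ℝ] PhaseSpace d n α :=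
  LinearMap.toContinuousLinearMap
    { toFun := planeWave hα θ
      map_add' := fun W W' => ext_coord fun x i => by
        rw [map_add, coord_planeWave, coord_planeWave, coord_planeWave, Pi.add_apply, mul_add,
          Complex.add_re]
      map_smul' := fun r W => ext_coord fun x i => by
        rw [map_smul, coord_planeWave, coord_planeWave, Pi.smul_apply, Complex.real_smul,
          mul_left_comm, Complex.re_ofReal_mul]
        rfl }

/-- The amplitude `(w, i r w)`. -/
def amplitude (r : ℝ) (w : Fin n → ℂ) : Fin n ⊕ Fin n → ℂ :=
  Sum.elim w fun a => Complex.I * r * w a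

/-- Convolution by `V` acts on `e^{-i(x,θ)} w` as the matrix `V̂(θ)`. For `V̂ w = r² w` the
amplitude `(w, i r w)` is then multiplied by `i r`, the sign of `r` being free. -/
lemma generator_planeWave (hV : Admissible V) (hα : α < -(d : ℝ) / 2) (θ : Fin d → ℝ) {r : ℝ}
    {w : Fin n → ℂ} (hw : (Vhat V θ).mulVec w = ((r ^ 2 : ℝ) : ℂ) • w) (c : ℂ) :
    generator V α (planeWave hα θ (c • amplitude r w)) =
      planeWave hα θ ((Complex.I * r * c) • amplitude r w) := by
  have hα0 : α < 0 := by
    have : (0 : ℝ) ≤ d := Nat.cast_nonneg d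
    linarith
  refine ext_coord fun x i => ?_
  rw [coord_planeWave]
  rcases i with a | a
  · rw [coord_inl, hV.generator_u hα0, ← coord_inr, coord_planeWave]
    congr 1
    simp only [Pi.smul_apply, amplitude, Sum.elim_inl, Sum.elim_inr, smul_eq_mul]
    ring
  · rw [coord_inr]
    have h := ((EuclideanSpace.proj a : Site n →L[ℝ] ℝ)).hasSum (hV.hasSum_generator_v hα0
      (planeWave hα θ (c • amplitude r w)) x)
    refine h.unique ?_
    have h1 : ∀ b, HasSum (fun y => Complex.exp (Complex.I * (pair y θ : ℂ)) * (V y a b : ℂ))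
        (Vhat V θ a b) := fun b => (summable_expSeries (hV.expDecay a b).summable_norm θ).hasSum
    have h2 := hasSum_sum (s := Finset.univ) fun b _ => (h1 b).mul_right (w b)
    have h3 : ∑ b, Vhat V θ a b * w b = ((r ^ 2 : ℝ) : ℂ) * w a := congrFun hw a
    rw [h3, ← (Equiv.subLeft x).hasSum_iff] at h2
    have h4 := Complex.hasSum_re (h2.mul_left (-(Complex.exp (-(Complex.I * (pair x θ : ℂ))) * c)))
    convert! h4.congr_fun fun y => ?_ using 1
    · congr 1
      simp only [Pi.smul_apply, amplitude, Sum.elim_inr, smul_eq_mul]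
      push_cast
      linear_combination (Complex.exp (-(Complex.I * (pair x θ : ℂ))) * c * r ^ 2 * w a) * Complex.I_sq
    · simp only [Function.comp_apply, Equiv.subLeft_apply, Finset.mul_sum, Complex.re_sum]
      have h5 : ∀ b, ((planeWave hα θ (c • amplitude r w)).u y) b
          = (Complex.exp (-(Complex.I * (pair y θ : ℂ))) * (c * w b)).re := fun b => by
        rw [← coord_inl, coord_planeWave]; rfl
      have h6 : (EuclideanSpace.proj a : Site n →L[ℝ] ℝ) (-Matrix.toEuclideanLin (V (x - y))
          ((planeWave hα θ (c • amplitude r w)).u y)) =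
          -∑ b, V (x - y) a b * ((planeWave hα θ (c • amplitude r w)).u y) b := rfl
      rw [h6, ← Finset.sum_neg_distrib]
      refine Finset.sum_congr rfl fun b _ => ?_
      rw [h5, ← mul_neg, ← Complex.neg_re, ← Complex.re_ofReal_mul]
      congr 1
      have h7 : Complex.exp (-(Complex.I * (pair x θ : ℂ))) *
          Complex.exp (Complex.I * (pair (x - y) θ : ℂ)) = Complex.exp (-(Complex.I * (pair y θ : ℂ))) := by
        rw [← Complex.exp_add, sub_pair]
        congr 1
        push_cast
        ring
      rw [← h7]
      ring

lemma propagator_planeWave (hV : Admissible V) (hα : α < -(d : ℝ) / 2) (θ : Fin d → ℝ) {r : ℝ}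
    {w : Fin n → ℂ} (hw : (Vhat V θ).mulVec w = ((r ^ 2 : ℝ) : ℂ) • w) (c : ℂ) (t : ℝ) :
    propagator V α t (planeWave hα θ (c • amplitude r w)) =
      planeWave hα θ ((Complex.exp (Complex.I * ((t * r : ℝ) : ℂ)) * c) • amplitude r w) := by
  have h := eq_propagator (V := V) (Z := fun t => planeWave hα θ
    ((Complex.exp (Complex.I * ((t * r : ℝ) : ℂ)) * c) • amplitude r w)) (fun t => by
      rw [generator_planeWave hV hα θ hw]
      have h1 : HasDerivAt (fun t : ℝ => Complex.exp (Complex.I * ((t * r : ℝ) : ℂ)) * c)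
          (Complex.I * r * (Complex.exp (Complex.I * ((t * r : ℝ) : ℂ)) * c)) t := by
        have h2 : HasDerivAt (fun t : ℝ => Complex.I * ((t * r : ℝ) : ℂ)) (Complex.I * r) t := by
          have := (((hasDerivAt_id t).mul_const r).ofReal_comp).const_mul Complex.I
          simpa using this
        have := h2.cexp.mul_const c
        convert! this using 1
        ring
      have h3 := (planeWaveCLM hα θ).hasFDerivAt.comp_hasDerivAt t (h1.smul_const (amplitude r w))
      exact h3) t
  simpa using h.symm

/-- The Fourier transform of a functional evolves by a phase on the eigenvectors of `V̂(θ)`. -/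
lemma sum_hat_propagator (hV : Admissible V) (hα : α < -(d : ℝ) / 2) (θ : Fin d → ℝ) {r : ℝ}
    {w : Fin n → ℂ} (hw : (Vhat V θ).mulVec w = ((r ^ 2 : ℝ) : ℂ) • w) (t : ℝ)
    (L : PhaseSpace d n α →L[ℝ] ℝ) :
    ∑ i, hat (L.comp (propagator V α t)) i θ * amplitude r w i =
      Complex.exp (Complex.I * ((t * r : ℝ) : ℂ)) * ∑ i, hat L i θ * amplitude r w i := by
  -- The phase space is real, so only real parts can be tested; the scalars `1` and `-i` recover the
  -- complex identity.
  have key : ∀ c : ℂ, (c * ∑ i, hat (L.comp (propagator V α t)) i θ * amplitude r w i).re =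
      (c * (Complex.exp (Complex.I * ((t * r : ℝ) : ℂ)) * ∑ i, hat L i θ * amplitude r w i)).re := by
    intro c
    have h := apply_planeWave hα (L.comp (propagator V α t)) θ (c • amplitude r w)
    rw [ContinuousLinearMap.comp_apply, propagator_planeWave hV hα θ hw, apply_planeWave] at h
    simp only [Pi.smul_apply, smul_eq_mul] at h
    rw [Finset.mul_sum, Finset.mul_sum, Finset.mul_sum]
    simp only [mul_left_comm _ c] at h ⊢
    rw [← h]
    congr 1
    refine Finset.sum_congr rfl fun i _ => ?_
    ring
  refine Complex.ext ?_ ?_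
  · simpa using key 1
  · simpa using key (-Complex.I)

/-- The component of `L̂(θ)` that oscillates with the frequency `±ω_j(θ)`. -/
def bandRow (V : Lattice d → Matrix (Fin n) (Fin n) ℝ) (L : PhaseSpace d n α →L[ℝ] ℝ) (j : Fin n)
    (e : Fin 2) (b : Fin n) (θ : Fin d → ℝ) : ℂ :=
  ∑ a, (hat L (Sum.inl a) θ + Complex.I * ((cornerSign e * freq V j θ : ℝ) : ℂ) *
    hat L (Sum.inr a) θ) * bandProj V j θ a b

/-- The columns of the spectral projection are eigenvectors of `V̂(θ)`, to which the plane wave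
computation applies with `r = ω_j` and with `r = -ω_j`. -/
lemma bandRow_propagator (hV : Admissible V) (hα : α < -(d : ℝ) / 2) (t : ℝ)
    (L : PhaseSpace d n α →L[ℝ] ℝ) (j : Fin n) (e : Fin 2) (b : Fin n) (θ : Fin d → ℝ) :
    bandRow V (L.comp (propagator V α t)) j e b θ =
      Complex.exp (Complex.I * ((t * (cornerSign e * freq V j θ) : ℝ) : ℂ)) * bandRow V L j e b θ := by
  have hw : (Vhat V θ).mulVec (fun a => bandProj V j θ a b) =
      (((cornerSign e * freq V j θ) ^ 2 : ℝ) : ℂ) • fun a => bandProj V j θ a b := by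
    have h := hV.Vhat_mul_bandProj j θ
    have hs : cornerSign e ^ 2 = 1 := by rcases cornerSign_eq e with h | h <;> simp [h]
    rw [mul_pow, hs, one_mul]
    funext a
    exact congrFun (congrFun h a) b
  have h := sum_hat_propagator hV hα θ hw t L
  have hform : ∀ L : PhaseSpace d n α →L[ℝ] ℝ, bandRow V L j e b θ = ∑ i, hat L i θ *
      amplitude (cornerSign e * freq V j θ) (fun a => bandProj V j θ a b) i := fun L => by
    rw [Fintype.sum_sum_type, ← Finset.sum_add_distrib]
    refine Finset.sum_congr rfl fun a _ => ?_
    simp only [amplitude, Sum.elim_inl, Sum.elim_inr]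
    ring
  rw [hform, hform, h]

/-- The amplitudes of the decomposition of `L̂` into normal modes. -/
def bandPart (V : Lattice d → Matrix (Fin n) (Fin n) ℝ) (L : PhaseSpace d n α →L[ℝ] ℝ) (j : Fin n)
    (e : Fin 2) (i : Fin n ⊕ Fin n) (θ : Fin d → ℝ) : ℂ :=
  Sum.elim (fun b => (bandMult V j θ : ℂ)⁻¹ * (1 / 2) * bandRow V L j e b θ)
    (fun b => (bandMult V j θ : ℂ)⁻¹ * (1 / (2 * Complex.I * ((cornerSign e * freq V j θ : ℝ) : ℂ))) *
      bandRow V L j e b θ) i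

/-- For fixed `j` the rows with signs `±` are `(û ± iω_j v̂)P_j`. Their half-sum recovers the
displacement part, their difference over `2iω_j` the velocity part, and the weights by multiplicity
make the projections sum to the identity. -/
lemma sum_bandPart (hV : Admissible V) (L : PhaseSpace d n α →L[ℝ] ℝ) (i : Fin n ⊕ Fin n)
    (θ : Fin d → ℝ) : ∑ j, ∑ e, bandPart V L j e i θ = hat L i θ := by
  have hsum : ∀ f : Fin n → ℂ, ∀ b, ∑ j, (bandMult V j θ : ℂ)⁻¹ * ∑ a, f a * bandProj V j θ a b = f b := by
    intro f b
    have h := fun a => congrFun (congrFun (hV.sum_bandProj θ) a) b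
    simp only [Matrix.sum_apply, Matrix.smul_apply, smul_eq_mul] at h
    simp_rw [Finset.mul_sum]
    rw [Finset.sum_comm]
    have h2 : ∀ a, ∑ j, (bandMult V j θ : ℂ)⁻¹ * (f a * bandProj V j θ a b) =
        f a * (1 : Matrix (Fin n) (Fin n) ℂ) a b := fun a => by
      rw [← h a, Finset.mul_sum]
      exact Finset.sum_congr rfl fun j _ => by ring
    simp_rw [h2, Matrix.one_apply]
    simp
  rcases i with b | b
  · rw [← hsum (fun a => hat L (Sum.inl a) θ) b]
    refine Finset.sum_congr rfl fun j _ => ?_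
    simp only [bandPart, Sum.elim_inl, bandRow, Fin.sum_univ_two, ← mul_add, ← Finset.sum_add_distrib]
    rw [mul_assoc]
    congr 1
    rw [Finset.mul_sum]
    refine Finset.sum_congr rfl fun a _ => ?_
    simp [cornerSign]
    ring
  · rw [← hsum (fun a => hat L (Sum.inr a) θ) b]
    refine Finset.sum_congr rfl fun j _ => ?_
    have hω : (freq V j θ : ℂ) ≠ 0 := Complex.ofReal_ne_zero.mpr (hV.freq_pos j θ).ne'
    simp only [bandPart, Sum.elim_inr, bandRow, Fin.sum_univ_two, mul_assoc, ← mul_add]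
    congr 1
    rw [Finset.mul_sum, Finset.mul_sum, ← Finset.sum_add_distrib]
    refine Finset.sum_congr rfl fun a _ => ?_
    simp [cornerSign]
    field_simp
    linear_combination (-2 * freq V j θ * hat L (Sum.inr a) θ * bandProj V j θ a b) * Complex.I_sq

/-- The normal modes of the Fourier transform of an evolved functional. -/
lemma hat_propagator (hV : Admissible V) (hα : α < -(d : ℝ) / 2) (t : ℝ)
    (L : PhaseSpace d n α →L[ℝ] ℝ) (i : Fin n ⊕ Fin n) (θ : Fin d → ℝ) :
    hat (L.comp (propagator V α t)) i θ =
      ∑ j, ∑ e, osc (fun θ => cornerSign e * freq V j θ) t (bandPart V L j e i) θ := by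
  rw [← sum_bandPart hV]
  refine Finset.sum_congr rfl fun j _ => Finset.sum_congr rfl fun e _ => ?_
  rw [osc]
  rcases i with b | b
  · simp only [bandPart, Sum.elim_inl, bandRow_propagator hV hα]
    ring
  · simp only [bandPart, Sum.elim_inr, bandRow_propagator hV hα]
    ring

lemma continuous_hat (hα : α < -(d : ℝ) / 2) (L : PhaseSpace d n α →L[ℝ] ℝ) (i : Fin n ⊕ Fin n) :
    Continuous (hat L i) := continuous_fourierSum (summable_norm_coef hα L i)

lemma measurable_bandRow (hV : Admissible V) (hα : α < -(d : ℝ) / 2) (L : PhaseSpace d n α →L[ℝ] ℝ)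
    (j : Fin n) (e : Fin 2) (b : Fin n) : Measurable (bandRow V L j e b) := by
  have h1 := fun i => (continuous_hat hα L i).measurable
  have h2 := fun a => hV.measurable_bandProj j a b
  have h3 := hV.measurable_freq j
  unfold bandRow
  fun_prop

lemma measurable_bandPart (hV : Admissible V) (hα : α < -(d : ℝ) / 2) (L : PhaseSpace d n α →L[ℝ] ℝ)
    (j : Fin n) (e : Fin 2) (i : Fin n ⊕ Fin n) : Measurable (bandPart V L j e i) := by
  have h1 := hV.measurable_bandMult j
  have h3 := hV.measurable_freq j
  rcases i with b | b
  · have h2 := measurable_bandRow hV hα L j e b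
    change Measurable fun θ => (bandMult V j θ : ℂ)⁻¹ * (1 / 2) * bandRow V L j e b θ
    fun_prop
  · have h2 := measurable_bandRow hV hα L j e b
    change Measurable fun θ => (bandMult V j θ : ℂ)⁻¹ *
      (1 / (2 * Complex.I * ((cornerSign e * freq V j θ : ℝ) : ℂ))) * bandRow V L j e b θ
    fun_prop

lemma exists_norm_hat_le (hα : α < -(d : ℝ) / 2) (L : PhaseSpace d n α →L[ℝ] ℝ) :
    ∃ H, ∀ i θ, ‖hat L i θ‖ ≤ H := by
  have hi : ∀ i, 0 ≤ ∑' z, ‖(coef L z i : ℂ)‖ := fun i => tsum_nonneg fun _ => norm_nonneg _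
  exact ⟨∑ i, ∑' z, ‖(coef L z i : ℂ)‖, fun i θ =>
    (norm_fourierSum_le (summable_norm_coef hα L i) θ).trans
      (Finset.single_le_sum (f := fun i => ∑' z, ‖(coef L z i : ℂ)‖) (fun i _ => hi i)
        (Finset.mem_univ i))⟩

/-- The constant is independent of `L`; for coordinate functionals `H = 1` is admissible at every
site, which later gives moment bounds uniform in space. -/
lemma exists_norm_bandRow_le (hV : Admissible V) : ∃ C, 0 ≤ C ∧
    ∀ (L : PhaseSpace d n α →L[ℝ] ℝ) (H : ℝ), (∀ i θ, ‖hat L i θ‖ ≤ H) →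
      ∀ j e b θ, ‖bandRow V L j e b θ‖ ≤ C * H := by
  obtain ⟨B, -, hB⟩ := hV.exists_freq_upper
  refine ⟨∑ _a : Fin n, (1 + |B|), by positivity, fun L H hhat j e b θ => ?_⟩
  rw [Finset.sum_mul]
  refine (norm_sum_le _ _).trans (Finset.sum_le_sum fun a _ => ?_)
  have hH0 : 0 ≤ H := (norm_nonneg _).trans (hhat (Sum.inl a) θ)
  rw [norm_mul, ← mul_one ((1 + |B|) * H), add_mul, one_mul]
  refine mul_le_mul ((norm_add_le _ _).trans (add_le_add (hhat _ _) ?_))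
    (hV.norm_bandProj_le j θ a b) (norm_nonneg _) (by positivity)
  rw [norm_mul, norm_mul, Complex.norm_I, one_mul, Complex.norm_real, norm_mul]
  have h1 : ‖cornerSign e‖ = 1 := by rcases cornerSign_eq e with h | h <;> simp [h]
  rw [h1, one_mul, Real.norm_of_nonneg (hV.freq_pos j θ).le]
  exact mul_le_mul ((hB j θ).trans (le_abs_self B)) (hhat _ _) (norm_nonneg _) (abs_nonneg _)

lemma exists_norm_bandPart_le (hV : Admissible V) : ∃ C, 0 ≤ C ∧
    ∀ (L : PhaseSpace d n α →L[ℝ] ℝ) (H : ℝ), (∀ i θ, ‖hat L i θ‖ ≤ H) →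
      ∀ j e i θ, ‖bandPart V L j e i θ‖ ≤ C * H := by
  obtain ⟨C, hC0, hC⟩ := exists_norm_bandRow_le (α := α) hV
  obtain ⟨δ, hδ, hfreq⟩ := hV.exists_freq_lower
  refine ⟨(1 + δ⁻¹) * C, by positivity, fun L H hH j e i θ => ?_⟩
  rw [mul_assoc]
  have hm : ‖(bandMult V j θ : ℂ)⁻¹‖ ≤ 1 := by
    rw [norm_inv, Complex.norm_natCast]
    exact inv_le_one_of_one_le₀ (by exact_mod_cast bandMult_pos j θ)
  have h1 : ‖cornerSign e‖ = 1 := by rcases cornerSign_eq e with h | h <;> simp [h]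
  rcases i with b | b
  · simp only [bandPart, Sum.elim_inl]
    rw [norm_mul, norm_mul]
    refine mul_le_mul ?_ (hC L H hH j e b θ) (norm_nonneg _) (by positivity)
    have h2 : ‖(1 / 2 : ℂ)‖ ≤ 1 := by norm_num
    have h3 : (0 : ℝ) < δ⁻¹ := by positivity
    nlinarith [norm_nonneg (bandMult V j θ : ℂ)⁻¹, norm_nonneg (1 / 2 : ℂ)]
  · simp only [bandPart, Sum.elim_inr]
    rw [norm_mul, norm_mul]
    refine mul_le_mul ?_ (hC L H hH j e b θ) (norm_nonneg _) (by positivity)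
    have h2 : ‖(1 / (2 * Complex.I * ((cornerSign e * freq V j θ : ℝ) : ℂ)) : ℂ)‖ ≤ δ⁻¹ := by
      rw [norm_div, norm_one, norm_mul, norm_mul, Complex.norm_I, Complex.norm_real, norm_mul, h1,
        Real.norm_of_nonneg (hV.freq_pos j θ).le, one_div]
      refine inv_anti₀ hδ ?_
      have := hfreq j θ
      simp
      linarith
    nlinarith [norm_nonneg (bandMult V j θ : ℂ)⁻¹,
      norm_nonneg (1 / (2 * Complex.I * ((cornerSign e * freq V j θ : ℝ) : ℂ)) : ℂ)]

lemma exists_bandPart_bound (hV : Admissible V) (hα : α < -(d : ℝ) / 2)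
    (L : PhaseSpace d n α →L[ℝ] ℝ) : ∃ C, 0 ≤ C ∧ ∀ j e i θ, ‖bandPart V L j e i θ‖ ≤ C := by
  obtain ⟨C, hC0, hC⟩ := exists_norm_bandPart_le (α := α) hV
  obtain ⟨H, hH⟩ := exists_norm_hat_le hα L
  exact ⟨C * |H|, by positivity, hC L |H| fun i θ => (hH i θ).trans (le_abs_self H)⟩

end PhaseSpace

end

section

/-! ### The limit of the covariance -/

variable {d n k : ℕ} {α : ℝ} {V : Lattice d → Matrix (Fin n) (Fin n) ℝ}

/-- No differentiability is assumed: `deriv` with its default value 0 is measurable in a parameter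
for jointly continuous functions. -/
lemma measurable_pderiv {f : (Fin d → ℝ) → ℝ} (hf : Continuous f) (l : Fin d) :
    Measurable (pderiv l f) := by
  have hc : Continuous fun q : (Fin d → ℝ) × ℝ => f (Function.update q.1 l q.2) :=
    hf.comp (continuous_fst.update l continuous_snd)
  have h : Measurable fun q : (Fin d → ℝ) × ℝ => deriv (fun s => f (Function.update q.1 l s)) q.2 :=
    measurable_deriv_with_param (f := fun θ s => f (Function.update θ l s)) hc
  have h2 : Measurable fun θ : Fin d → ℝ => (θ, θ l) := measurable_id.prodMk (measurable_pi_apply l)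
  exact h.comp h2

lemma Admissible.measurable_pderiv_freq (hV : Admissible V) (l : Fin d) (j : Fin n) :
    Measurable (pderiv l (freq V j)) := measurable_pderiv (hV.continuous_freq j) l

lemma Admissible.torusPeriodic_freq (_hV : Admissible V) (j : Fin n) : TorusPeriodic (freq V j) :=
  fun θ k => freq_periodic V j θ k

lemma haarTorus_ae {P : (Fin d → ℝ) → Prop} (h : ∀ᵐ θ, P θ) : ∀ᵐ θ ∂haarTorus d, P θ :=
  haarTorus_absolutelyContinuous.ae_le h

lemma Admissible.hasVelocity (hV : Admissible V) (j : Fin n) (e : Fin 2) (l : Fin d) :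
    HasVelocity (fun θ => cornerSign e * freq V j θ) l
      (fun θ => cornerSign e * pderiv l (freq V j) θ) where
  continuous := continuous_const.mul (hV.continuous_freq j)
  periodic := fun θ k => by simp only [hV.torusPeriodic_freq j θ k]
  measurable := (hV.measurable_pderiv_freq l j).const_mul _
  hasDerivAt := by
    filter_upwards [haarTorus_ae hV.ae_notMem_crossingSet] with θ hθ
    exact (hV.hasDerivAt_freq hθ l j).const_mul _

/-- The quasi-momenta for which the group velocity of the mode `±ω_j` points into a corner. -/
def bandQuadrant (hk : k ≤ d) (V : Lattice d → Matrix (Fin n) (Fin n) ℝ) (c : Corner k) (j : Fin n)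
    (e : Fin 2) (θ : Fin d → ℝ) : ℝ :=
  quadrant c (fun i θ => cornerSign e * pderiv (Fin.castLE hk i) (freq V j) θ) θ

lemma quadrant_eq_zero_or_one (c : Corner k) (p : Fin k → (Fin d → ℝ) → ℝ) (θ : Fin d → ℝ) :
    quadrant c p θ = 0 ∨ quadrant c p θ = 1 := by
  unfold quadrant
  refine Finset.prod_induction _ (fun r : ℝ => r = 0 ∨ r = 1) ?_ (Or.inr rfl) ?_
  · rintro a b (rfl | rfl) (rfl | rfl) <;> simp
  · intro i _
    split_ifs <;> simp

lemma Admissible.measurable_bandQuadrant (hk : k ≤ d) (hV : Admissible V) (c : Corner k) (j : Fin n)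
    (e : Fin 2) : Measurable (bandQuadrant hk V c j e) := by
  change Measurable fun θ => ∏ i : Fin k, if cornerSign (c i) * (cornerSign e *
    pderiv (Fin.castLE hk i) (freq V j) θ) < 0 then (1 : ℝ) else 0
  refine Finset.measurable_prod _ fun i _ => Measurable.ite ?_ measurable_const measurable_const
  exact measurableSet_lt (((hV.measurable_pderiv_freq _ j).const_mul _).const_mul _) measurable_const

lemma tendsto_sqMass_sum {ι : Type*} (S : Finset ι) {φ : ι → ℝ → Lattice d → ℂ}
    (h : ∀ i ∈ S, Tendsto (fun t => sqMass (φ i t)) atTop (𝓝 0)) :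
    Tendsto (fun t => sqMass (∑ i ∈ S, φ i t)) atTop (𝓝 0) := by
  classical
  induction S using Finset.induction_on with
  | empty => simp [sqMass]
  | insert i S hi ih =>
    have h1 := h i (Finset.mem_insert_self i S)
    have h2 := ih fun j hj => h j (Finset.mem_insert_of_mem hj)
    simp only [Finset.sum_insert hi]
    refine tendsto_of_tendsto_of_tendsto_of_le_of_le tendsto_const_nhds ?_ (fun _ => bot_le)
      fun t => sqMass_add_le _ _
    have e : ∀ {f : ℝ → ENNReal}, Tendsto f atTop (𝓝 0) → Tendsto (fun t => 2 * f t) atTop (𝓝 0) :=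
      fun hf => by simpa using ENNReal.Tendsto.const_mul hf (Or.inr ENNReal.ofNat_ne_top)
    simpa using (e h1).add (e h2)

lemma fourierCoef_add {f g : (Fin d → ℝ) → ℂ} (hf : MemLp f 2 (haarTorus d))
    (hg : MemLp g 2 (haarTorus d)) : fourierCoef (f + g) = fourierCoef f + fourierCoef g := by
  have h := fun z => fourierCoef_sub (hf.add hg) hg z
  funext z
  rw [Pi.add_apply, ← sub_eq_iff_eq_add, ← h z, add_sub_cancel_right]

lemma fourierCoef_sum {ι : Type*} (S : Finset ι) {f : ι → (Fin d → ℝ) → ℂ}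
    (hf : ∀ i, MemLp (f i) 2 (haarTorus d)) :
    fourierCoef (∑ i ∈ S, f i) = ∑ i ∈ S, fourierCoef (f i) := by
  classical
  induction S using Finset.induction_on with
  | empty => funext z; simp [fourierCoef]
  | insert i S hi ih =>
    rw [Finset.sum_insert hi, Finset.sum_insert hi, fourierCoef_add (hf i) (memLp_finsetSum' S fun i _ => hf i),
      ih]

/-- Integrability of bounded sesquilinear expressions in square integrable functions. -/
lemma integrable_mul_mul_conj {a b D : (Fin d → ℝ) → ℂ} {B : ℝ} (hDm : Measurable D)
    (hD : ∀ θ, ‖D θ‖ ≤ B) (ha : MemLp a 2 (haarTorus d)) (hb : MemLp b 2 (haarTorus d)) :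
    Integrable (fun θ => a θ * D θ * starRingEnd ℂ (b θ)) (haarTorus d) := by
  have h1 : Integrable (fun θ => D θ * (a θ * starRingEnd ℂ (b θ))) (haarTorus d) :=
    (ha.integrable_mul (show MemLp (fun θ => starRingEnd ℂ (b θ)) 2 (haarTorus d) from hb.star)).bdd_mul
      (c := B) hDm.aestronglyMeasurable (ae_of_all _ hD)
  refine h1.congr (ae_of_all _ fun θ => ?_)
  simp only
  ring

/-- `L²` approximations may be used in bounded sesquilinear integrals. -/
lemma tendsto_integral_mul_mul_conj {f F f' F' : ℝ → (Fin d → ℝ) → ℂ} {D : (Fin d → ℝ) → ℂ}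
    (hf : ∀ t, MemLp (f t) 2 (haarTorus d)) (hf' : ∀ t, MemLp (f' t) 2 (haarTorus d))
    (hFm : ∀ t, MemLp (F t) 2 (haarTorus d)) (hFm' : ∀ t, MemLp (F' t) 2 (haarTorus d))
    {C C' B : ℝ} (hF : ∀ t θ, ‖F t θ‖ ≤ C) (hF' : ∀ t θ, ‖F' t θ‖ ≤ C')
    (hDm : Measurable D) (hD : ∀ θ, ‖D θ‖ ≤ B)
    (h : Tendsto (fun t => ∫⁻ θ, ‖f t θ - F t θ‖ₑ ^ 2 ∂haarTorus d) atTop (𝓝 0))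
    (h' : Tendsto (fun t => ∫⁻ θ, ‖f' t θ - F' t θ‖ₑ ^ 2 ∂haarTorus d) atTop (𝓝 0)) :
    Tendsto (fun t => ∫ θ, f t θ * D θ * starRingEnd ℂ (f' t θ) ∂haarTorus d -
      ∫ θ, F t θ * D θ * starRingEnd ℂ (F' t θ) ∂haarTorus d) atTop (𝓝 0) := by
  have hint := fun {a b : (Fin d → ℝ) → ℂ} => integrable_mul_mul_conj (a := a) (b := b) hDm hD
  have hcs : ∀ {a b : (Fin d → ℝ) → ENNReal}, AEMeasurable a (haarTorus d) →
      AEMeasurable b (haarTorus d) → ∫⁻ θ, a θ * b θ ∂haarTorus d ≤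
      (∫⁻ θ, a θ ^ 2 ∂haarTorus d) ^ (1 / 2 : ℝ) * (∫⁻ θ, b θ ^ 2 ∂haarTorus d) ^ (1 / 2 : ℝ) := by
    intro a b ha hb
    have := ENNReal.lintegral_mul_le_Lp_mul_Lq (haarTorus d) Real.HolderConjugate.two_two ha hb
    simpa using this
  set X := fun t => (∫⁻ θ, ‖f t θ - F t θ‖ₑ ^ 2 ∂haarTorus d) ^ (1 / 2 : ℝ) with hX
  set X' := fun t => (∫⁻ θ, ‖f' t θ - F' t θ‖ₑ ^ 2 ∂haarTorus d) ^ (1 / 2 : ℝ) with hX'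
  have hX0 : Tendsto X atTop (𝓝 0) := by
    simpa [hX] using h.ennrpow_const (1 / 2 : ℝ)
  have hX0' : Tendsto X' atTop (𝓝 0) := by
    simpa [hX'] using h'.ennrpow_const (1 / 2 : ℝ)
  have hb : ∀ t, ‖∫ θ, f t θ * D θ * starRingEnd ℂ (f' t θ) ∂haarTorus d -
      ∫ θ, F t θ * D θ * starRingEnd ℂ (F' t θ) ∂haarTorus d‖ₑ ≤
      ENNReal.ofReal B * (X t * X' t + X t * ENNReal.ofReal C' + ENNReal.ofReal C * X' t) := by
    intro t
    have m1 : AEMeasurable (fun θ => ‖f t θ - F t θ‖ₑ) (haarTorus d) :=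
      ((hf t).1.sub (hFm t).1).enorm
    have m2 : AEMeasurable (fun θ => ‖f' t θ - F' t θ‖ₑ) (haarTorus d) :=
      ((hf' t).1.sub (hFm' t).1).enorm
    rw [← integral_sub (hint (hf t) (hf' t)) (hint (hFm t) (hFm' t))]
    refine (enorm_integral_le_lintegral_enorm _).trans ?_
    have hpt : ∀ θ, ‖f t θ * D θ * starRingEnd ℂ (f' t θ) - F t θ * D θ * starRingEnd ℂ (F' t θ)‖ₑ ≤
        ENNReal.ofReal B * (‖f t θ - F t θ‖ₑ * ‖f' t θ - F' t θ‖ₑ +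
          ‖f t θ - F t θ‖ₑ * ENNReal.ofReal C' + ENNReal.ofReal C * ‖f' t θ - F' t θ‖ₑ) := by
      intro θ
      -- The difference of the products is written through the two errors only, so that every term
      -- is bounded by Cauchy–Schwarz in terms of `X` and `X'` and the uniform bounds of `F` and
      -- `F'`.
      have e : f t θ * D θ * starRingEnd ℂ (f' t θ) - F t θ * D θ * starRingEnd ℂ (F' t θ) =
          D θ * ((f t θ - F t θ) * starRingEnd ℂ (f' t θ - F' t θ) +
            (f t θ - F t θ) * starRingEnd ℂ (F' t θ) + F t θ * starRingEnd ℂ (f' t θ - F' t θ)) := by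
        rw [map_sub]; ring
      rw [e, enorm_mul]
      have hconj : ∀ w : ℂ, ‖starRingEnd ℂ w‖ₑ = ‖w‖ₑ := fun w => by
        rw [← ofReal_norm, RCLike.norm_conj, ofReal_norm]
      have hle : ∀ {w : ℂ} {r : ℝ}, ‖w‖ ≤ r → ‖w‖ₑ ≤ ENNReal.ofReal r := fun hw => by
        rw [← ofReal_norm]; exact ENNReal.ofReal_le_ofReal hw
      refine mul_le_mul' (hle (hD θ)) ?_
      refine (enorm_add_le _ _).trans (add_le_add ((enorm_add_le _ _).trans (add_le_add ?_ ?_)) ?_)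
      · rw [enorm_mul, hconj]
      · rw [enorm_mul, hconj]
        exact mul_le_mul' le_rfl (hle (hF' t θ))
      · rw [enorm_mul, hconj]
        exact mul_le_mul' (hle (hF t θ)) le_rfl
    refine (lintegral_mono hpt).trans ?_
    rw [lintegral_const_mul' _ _ ENNReal.ofReal_ne_top]
    refine mul_le_mul' le_rfl ?_
    have m3 : AEMeasurable (fun θ => ‖f t θ - F t θ‖ₑ * ‖f' t θ - F' t θ‖ₑ) (haarTorus d) :=
      m1.mul m2
    have m4 : AEMeasurable (fun θ => ‖f t θ - F t θ‖ₑ * ‖f' t θ - F' t θ‖ₑ +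
      ‖f t θ - F t θ‖ₑ * ENNReal.ofReal C') (haarTorus d) := m3.add (m1.mul_const _)
    rw [lintegral_add_left' m4, lintegral_add_left' m3,
      lintegral_mul_const' _ _ ENNReal.ofReal_ne_top, lintegral_const_mul' _ _ ENNReal.ofReal_ne_top]
    have hone : ∀ {a : (Fin d → ℝ) → ENNReal}, AEMeasurable a (haarTorus d) →
        ∫⁻ θ, a θ ∂haarTorus d ≤ (∫⁻ θ, a θ ^ 2 ∂haarTorus d) ^ (1 / 2 : ℝ) := fun {a} ha => by
      have := hcs ha (aemeasurable_const (b := (1 : ENNReal)))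
      simpa using this
    gcongr
    · exact hcs m1 m2
    · exact hone m1
    · exact hone m2
  rw [tendsto_zero_iff_enorm_tendsto_zero]
  refine tendsto_of_tendsto_of_tendsto_of_le_of_le tendsto_const_nhds ?_ (fun _ => bot_le) hb
  have t1 : Tendsto (fun t => X t * X' t) atTop (𝓝 0) := by
    simpa using ENNReal.Tendsto.mul hX0 (Or.inr ENNReal.zero_ne_top) hX0' (Or.inr ENNReal.zero_ne_top)
  have t2 : Tendsto (fun t => X t * ENNReal.ofReal C') atTop (𝓝 0) := by
    simpa using ENNReal.Tendsto.mul_const hX0 (Or.inr ENNReal.ofReal_ne_top)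
  have t3 : Tendsto (fun t => ENNReal.ofReal C * X' t) atTop (𝓝 0) := by
    simpa using ENNReal.Tendsto.const_mul hX0' (Or.inr ENNReal.ofReal_ne_top)
  simpa using ENNReal.Tendsto.const_mul ((t1.add t2).add t3) (Or.inr (ENNReal.ofReal_ne_top (r := B)))

end

section

/-! ### The quadratic form of the Gibbs measure -/

variable {d n k : ℕ} {α : ℝ} {V : Lattice d → Matrix (Fin n) (Fin n) ℝ}

/-- The matrix `V̂(θ)^{-1} ⊕ 1`. -/
def gibbsWeight (V : Lattice d → Matrix (Fin n) (Fin n) ℝ) (θ : Fin d → ℝ) :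
    Matrix (Fin n ⊕ Fin n) (Fin n ⊕ Fin n) ℂ := Matrix.fromBlocks (Vhat V θ)⁻¹ 0 0 1

/-- The sesquilinear form `a V̂(θ)^{-1} b^* ⊕ a b^*`. -/
def gibbsForm (V : Lattice d → Matrix (Fin n) (Fin n) ℝ) (θ : Fin d → ℝ)
    (a b : Fin n ⊕ Fin n → ℂ) : ℂ :=
  ∑ i, ∑ j, a i * gibbsWeight V θ i j * starRingEnd ℂ (b j)

/-- In the spectral decomposition the inverse is the sum of the projections weighted by `ω_j⁻²` and
by inverse multiplicities, and `ω_j ≥ δ`. -/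
lemma Admissible.exists_inv_bound (hV : Admissible V) :
    ∃ B, 0 ≤ B ∧ ∀ θ a b, ‖(Vhat V θ)⁻¹ a b‖ ≤ B := by
  obtain ⟨δ, hδ, hfreq⟩ := hV.exists_freq_lower
  refine ⟨∑ _j : Fin n, (δ ^ 2)⁻¹, by positivity, fun θ a b => ?_⟩
  have h : (Vhat V θ)⁻¹ = ∑ j, (bandMult V j θ : ℂ)⁻¹ • (((freq V j θ ^ 2 : ℝ) : ℂ)⁻¹ • bandProj V j θ) := by
    simp_rw [← hV.inv_mul_bandProj, ← Matrix.mul_smul]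
    rw [← Finset.mul_sum, hV.sum_bandProj, Matrix.mul_one]
  rw [h, Matrix.sum_apply]
  refine (norm_sum_le _ _).trans (Finset.sum_le_sum fun j _ => ?_)
  simp only [Matrix.smul_apply, smul_eq_mul, norm_mul, norm_inv, Complex.norm_natCast,
    Complex.norm_real]
  have h1 : ((bandMult V j θ : ℝ))⁻¹ ≤ 1 := inv_le_one_of_one_le₀ (by exact_mod_cast bandMult_pos j θ)
  have h2 : ‖freq V j θ ^ 2‖⁻¹ ≤ (δ ^ 2)⁻¹ := by
    rw [Real.norm_of_nonneg (sq_nonneg _)]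
    exact inv_anti₀ (by positivity) (pow_le_pow_left₀ hδ.le (hfreq j θ) 2)
  have h3 := hV.norm_bandProj_le j θ a b
  calc (bandMult V j θ : ℝ)⁻¹ * (‖freq V j θ ^ 2‖⁻¹ * ‖bandProj V j θ a b‖)
      ≤ 1 * ((δ ^ 2)⁻¹ * 1) := by gcongr
    _ = (δ ^ 2)⁻¹ := by ring

lemma Admissible.continuous_inv (hV : Admissible V) : Continuous fun θ => (Vhat V θ)⁻¹ :=
  continuous_iff_continuousAt.mpr fun θ => by
    have h : IsUnit (Vhat V θ).det := isUnit_iff_ne_zero.mpr (hV.det_ne_zero θ)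
    simp_rw [Matrix.inv_def]
    have h1 : ContinuousAt (fun θ => Ring.inverse (Vhat V θ).det) θ := by
      simp_rw [Ring.inverse_eq_inv']
      exact (hV.continuous_Vhat.matrix_det.continuousAt).inv₀ (hV.det_ne_zero θ)
    exact h1.smul hV.continuous_Vhat.matrix_adjugate.continuousAt

lemma Admissible.exists_gibbsWeight_bound (hV : Admissible V) : ∃ B, 0 ≤ B ∧ ∀ i j,
    (Continuous fun θ => gibbsWeight V θ i j) ∧
    ∀ θ, ‖gibbsWeight V θ i j‖ ≤ B := by
  obtain ⟨B, hB0, hB⟩ := hV.exists_inv_bound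
  refine ⟨B + 1, by positivity, fun i j => ?_⟩
  unfold gibbsWeight
  rcases i with a | a <;> rcases j with b | b
  · exact ⟨(continuous_apply_apply a b).comp hV.continuous_inv, fun θ => by
      simpa using (hB θ a b).trans (by linarith)⟩
  · exact ⟨by simpa using continuous_const, fun θ => by simpa using by linarith⟩
  · exact ⟨by simpa using continuous_const, fun θ => by simpa using by linarith⟩
  · refine ⟨by simpa using continuous_const, fun θ => ?_⟩
    rw [Matrix.fromBlocks_apply₂₂, Matrix.one_apply]
    split_ifs <;> simp <;> linarith

lemma gibbsForm_eq (θ : Fin d → ℝ) (a b : Fin n ⊕ Fin n → ℂ) :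
    gibbsForm V θ a b = ∑ x, ∑ y, a (Sum.inl x) * (Vhat V θ)⁻¹ x y * starRingEnd ℂ (b (Sum.inl y)) +
      ∑ x, a (Sum.inr x) * starRingEnd ℂ (b (Sum.inr x)) := by
  rw [gibbsForm]
  simp [gibbsWeight, Fintype.sum_sum_type, Matrix.one_apply]

lemma gibbsForm_sum {ι ι' : Type*} (S : Finset ι) (S' : Finset ι') (θ : Fin d → ℝ)
    (a : ι → Fin n ⊕ Fin n → ℂ) (b : ι' → Fin n ⊕ Fin n → ℂ) :
    gibbsForm V θ (fun i => ∑ s ∈ S, a s i) (fun i => ∑ s ∈ S', b s i) =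
      ∑ s ∈ S, ∑ s' ∈ S', gibbsForm V θ (a s) (b s') := by
  have hl : ∀ b, gibbsForm V θ (fun i => ∑ s ∈ S, a s i) b = ∑ s ∈ S, gibbsForm V θ (a s) b := by
    intro b
    simp only [gibbsForm, Finset.sum_mul]
    exact (Finset.sum_congr rfl fun i _ => Finset.sum_comm).trans Finset.sum_comm
  have hr : ∀ a, gibbsForm V θ a (fun i => ∑ s ∈ S', b s i) = ∑ s ∈ S', gibbsForm V θ a (b s) := by
    intro a
    simp only [gibbsForm, map_sum, Finset.mul_sum]
    exact (Finset.sum_congr rfl fun i _ => Finset.sum_comm).trans Finset.sum_comm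
  rw [hl]
  exact Finset.sum_congr rfl fun s _ => hr _

lemma gibbsForm_smul (θ : Fin d → ℝ) (r s : ℂ) (a b : Fin n ⊕ Fin n → ℂ) :
    gibbsForm V θ (fun i => r * a i) (fun i => s * b i) = r * starRingEnd ℂ s * gibbsForm V θ a b := by
  simp only [gibbsForm, Finset.mul_sum, map_mul]
  refine Finset.sum_congr rfl fun i _ => Finset.sum_congr rfl fun j _ => ?_
  ring

lemma Admissible.bandProj_mul_inv (hV : Admissible V) (j : Fin n) (θ : Fin d → ℝ) :
    bandProj V j θ * (Vhat V θ)⁻¹ = ((freq V j θ ^ 2 : ℝ) : ℂ)⁻¹ • bandProj V j θ := by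
  have h := congrArg Matrix.conjTranspose (hV.inv_mul_bandProj j θ)
  rw [Matrix.conjTranspose_mul, Matrix.conjTranspose_smul, hV.bandProj_conjTranspose,
    Matrix.conjTranspose_nonsing_inv, (hV.isHermitian θ).eq] at h
  rw [h, star_inv₀]
  congr 2
  exact Complex.conj_ofReal _

lemma Admissible.bandProj_congr (_hV : Admissible V) {i j : Fin n} {θ : Fin d → ℝ}
    (h : freq V i θ = freq V j θ) : bandProj V i θ = bandProj V j θ :=
  Diagonalizes.specProj_congr _ (by rw [h])

lemma bandMult_congr {i j : Fin n} {θ : Fin d → ℝ} (h : freq V i θ = freq V j θ) :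
    bandMult V i θ = bandMult V j θ := by
  simp only [bandMult, multiplicity', h]

namespace PhaseSpace

lemma bandRow_congr (hV : Admissible V) (L : PhaseSpace d n α →L[ℝ] ℝ) {i j : Fin n}
    {θ : Fin d → ℝ} (h : freq V i θ = freq V j θ) (e : Fin 2) (b : Fin n) :
    bandRow V L i e b θ = bandRow V L j e b θ := by
  rw [bandRow, bandRow, h, hV.bandProj_congr h]

lemma sum_bandRow_mul_inv (hV : Admissible V) (L : PhaseSpace d n α →L[ℝ] ℝ) (j : Fin n) (e : Fin 2)
    (θ : Fin d → ℝ) (y : Fin n) : ∑ x, bandRow V L j e x θ * (Vhat V θ)⁻¹ x y =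
      ((freq V j θ ^ 2 : ℝ) : ℂ)⁻¹ * bandRow V L j e y θ := by
  have h := fun a => congrFun (congrFun (hV.bandProj_mul_inv j θ) a) y
  simp only [Matrix.mul_apply, Matrix.smul_apply, smul_eq_mul] at h
  simp only [bandRow, Finset.sum_mul]
  rw [Finset.sum_comm, Finset.mul_sum]
  refine Finset.sum_congr rfl fun a _ => ?_
  rw [mul_left_comm, ← h a, Finset.mul_sum]
  exact Finset.sum_congr rfl fun x _ => by ring

lemma sum_bandRow_mul_conj (hV : Admissible V) (L L' : PhaseSpace d n α →L[ℝ] ℝ) {j j' : Fin n}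
    (e e' : Fin 2) {θ : Fin d → ℝ} (h : freq V j θ ≠ freq V j' θ) :
    ∑ x, bandRow V L j e x θ * starRingEnd ℂ (bandRow V L' j' e' x θ) = 0 := by
  have h0 := fun a c => congrFun (congrFun (hV.bandProj_mul j j' θ) a) c
  simp only [if_neg h, Matrix.mul_apply, Matrix.zero_apply] at h0
  simp only [bandRow, map_sum, Finset.sum_mul, Finset.mul_sum, map_mul, hV.conj_bandProj]
  rw [Finset.sum_comm]
  refine Finset.sum_eq_zero fun a _ => ?_
  rw [Finset.sum_comm]
  refine Finset.sum_eq_zero fun c _ => ?_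
  rw [← mul_zero ((hat L (Sum.inl c) θ + Complex.I * ((cornerSign e * freq V j θ : ℝ) : ℂ) *
    hat L (Sum.inr c) θ) * starRingEnd ℂ (hat L' (Sum.inl a) θ + Complex.I *
    ((cornerSign e' * freq V j' θ : ℝ) : ℂ) * hat L' (Sum.inr a) θ)), ← h0 c a, Finset.mul_sum]
  refine Finset.sum_congr rfl fun x _ => ?_
  ring

/-- Different normal modes are orthogonal with respect to the Gibbs form. -/
lemma gibbsForm_bandPart (hV : Admissible V) (L L' : PhaseSpace d n α →L[ℝ] ℝ) (j j' : Fin n)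
    (e e' : Fin 2) (θ : Fin d → ℝ) :
    gibbsForm V θ (fun i => bandPart V L j e i θ) (fun i => bandPart V L' j' e' i θ) =
      if freq V j θ = freq V j' θ ∧ e = e' then (bandMult V j θ : ℂ)⁻¹ ^ 2 *
        (((2 * freq V j θ ^ 2 : ℝ) : ℂ)⁻¹ *
        ∑ b, bandRow V L j e b θ * starRingEnd ℂ (bandRow V L' j e b θ)) else 0 := by
  have hω : (freq V j θ : ℂ) ≠ 0 := Complex.ofReal_ne_zero.mpr (hV.freq_pos j θ).ne'
  set S := ∑ x, bandRow V L j e x θ * starRingEnd ℂ (bandRow V L' j' e' x θ) with hS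
  -- The displacement part contributes `1/(4ω_j²)` because `V̂⁻¹` acts on the band as `ω_j⁻²`; the
  -- velocity part contributes `1/(4 s ω_j s' ω_{j'})` with `s`, `s'` the signs of the two modes.
  have hform : gibbsForm V θ (fun i => bandPart V L j e i θ) (fun i => bandPart V L' j' e' i θ) =
      (bandMult V j θ : ℂ)⁻¹ * (bandMult V j' θ : ℂ)⁻¹ * (1 / 4 * ((freq V j θ ^ 2 : ℝ) : ℂ)⁻¹ +
        1 / (4 * ((cornerSign e * freq V j θ : ℝ) : ℂ) * ((cornerSign e' * freq V j' θ : ℝ) : ℂ))) * S := by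
    rw [gibbsForm_eq, mul_add, add_mul]
    congr 1
    · rw [Finset.sum_comm]
      have : ∀ y, ∑ x, bandPart V L j e (Sum.inl x) θ * (Vhat V θ)⁻¹ x y *
          starRingEnd ℂ (bandPart V L' j' e' (Sum.inl y) θ) =
          (bandMult V j θ : ℂ)⁻¹ * (bandMult V j' θ : ℂ)⁻¹ * (1 / 4 * ((freq V j θ ^ 2 : ℝ) : ℂ)⁻¹) *
            (bandRow V L j e y θ * starRingEnd ℂ (bandRow V L' j' e' y θ)) := by
        intro y
        have h := sum_bandRow_mul_inv hV L j e θ y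
        rw [← Finset.sum_mul]
        have h2 : ∑ x, bandPart V L j e (Sum.inl x) θ * (Vhat V θ)⁻¹ x y =
            (bandMult V j θ : ℂ)⁻¹ * (1 / 2) * (((freq V j θ ^ 2 : ℝ) : ℂ)⁻¹ * bandRow V L j e y θ) := by
          rw [← h, Finset.mul_sum]
          refine Finset.sum_congr rfl fun x _ => ?_
          simp only [bandPart, Sum.elim_inl]
          ring
        rw [h2]
        simp only [bandPart, Sum.elim_inl, map_mul, map_inv₀, Complex.conj_natCast, map_div₀, map_one,
          Complex.conj_ofNat]
        ring
      rw [Finset.sum_congr rfl fun y _ => this y, ← Finset.mul_sum]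
    · rw [hS, Finset.mul_sum]
      refine Finset.sum_congr rfl fun x _ => ?_
      simp only [bandPart, Sum.elim_inr, map_mul, map_inv₀, Complex.conj_natCast, map_div₀, map_one,
        Complex.conj_ofNat, Complex.conj_I, Complex.conj_ofReal]
      have hI : (Complex.I)⁻¹ * (-Complex.I)⁻¹ = 1 := by
        rw [← mul_inv]; simp
      simp only [one_div, mul_inv]
      linear_combination ((bandMult V j θ : ℂ)⁻¹ * (2 : ℂ)⁻¹ *
        (((cornerSign e * freq V j θ : ℝ) : ℂ)⁻¹) * bandRow V L j e x θ * ((bandMult V j' θ : ℂ)⁻¹ *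
        (2 : ℂ)⁻¹ * (((cornerSign e' * freq V j' θ : ℝ) : ℂ)⁻¹) *
        starRingEnd ℂ (bandRow V L' j' e' x θ))) * hI
  rw [hform]
  by_cases h : freq V j θ = freq V j' θ
  · rw [← bandMult_congr h, ← h]
    by_cases he : e = e'
    · subst he
      rw [if_pos ⟨rfl, rfl⟩]
      have hS' : S = ∑ b, bandRow V L j e b θ * starRingEnd ℂ (bandRow V L' j e b θ) := by
        rw [hS]
        exact Finset.sum_congr rfl fun b _ => by rw [bandRow_congr hV L' h]
      rw [← hS']
      have hs : (cornerSign e : ℂ) * cornerSign e = 1 := by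
        rcases cornerSign_eq e with h | h <;> simp [h]
      have hs0 : (cornerSign e : ℂ) ≠ 0 := left_ne_zero_of_mul_eq_one hs
      have : 1 / (4 * ((cornerSign e * freq V j θ : ℝ) : ℂ) * ((cornerSign e * freq V j θ : ℝ) : ℂ)) =
          1 / 4 * ((freq V j θ ^ 2 : ℝ) : ℂ)⁻¹ := by
        push_cast
        have : (4 : ℂ) * (cornerSign e * freq V j θ) * (cornerSign e * freq V j θ) =
          4 * freq V j θ ^ 2 := by linear_combination (4 * (freq V j θ : ℂ) ^ 2) * hs
        rw [this]
        field_simp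
      rw [this]
      push_cast
      field_simp
      ring
    -- Same frequency, opposite signs: the two contributions cancel exactly. This equipartition
    -- between potential and kinetic parts is why the Gibbs covariance produces no terms oscillating
    -- with `2ω_j`.
    · rw [if_neg (fun h => he h.2)]
      have hs : (cornerSign e : ℂ) * cornerSign e' = -1 := by
        fin_cases e <;> fin_cases e' <;> simp_all [cornerSign]
      have : 1 / (4 * ((cornerSign e * freq V j θ : ℝ) : ℂ) * ((cornerSign e' * freq V j θ : ℝ) : ℂ)) =
          -(1 / 4 * ((freq V j θ ^ 2 : ℝ) : ℂ)⁻¹) := by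
        push_cast
        have : (4 : ℂ) * (cornerSign e * freq V j θ) * (cornerSign e' * freq V j θ) =
          -(4 * freq V j θ ^ 2) := by linear_combination (4 * (freq V j θ : ℂ) ^ 2) * hs
        rw [this]
        field_simp
      rw [this, add_neg_cancel, mul_zero, zero_mul]
  · rw [if_neg (fun h' => h h'.1), hS, sum_bandRow_mul_conj hV L L' e e' h, mul_zero]

end PhaseSpace

end

section

/-! ### The covariance of the evolved state -/

variable {d n k : ℕ} {α : ℝ} {V : Lattice d → Matrix (Fin n) (Fin n) ℝ}

lemma IsCutoff.exists_abs_cutoffProd_le {a : ℝ} {ζ : Fin 2 → ℤ → ℝ} (hζ : IsCutoff a ζ) (hk : k ≤ d) :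
    ∃ Z, ∀ (c : Corner k) x, |cutoffProd hk ζ c x| ≤ Z := by
  obtain ⟨Z, hZ1, hZ⟩ := hζ.exists_bound
  refine ⟨∏ _i : Fin k, Z, fun c x => ?_⟩
  rw [cutoffProd, Finset.abs_prod]
  exact Finset.prod_le_prod (fun _ _ => abs_nonneg _) fun i _ => hZ _ _

lemma abs_bandQuadrant_le (hk : k ≤ d) (c : Corner k) (j : Fin n) (e : Fin 2) (θ : Fin d → ℝ) :
    ‖(bandQuadrant hk V c j e θ : ℂ)‖ ≤ 1 := by
  rcases quadrant_eq_zero_or_one c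
    (fun i θ => cornerSign e * pderiv (Fin.castLE hk i) (freq V j) θ) θ with h | h <;>
  simp [bandQuadrant, h]

lemma Admissible.bandQuadrant_congr (hV : Admissible V) (hk : k ≤ d) (c : Corner k) {i j : Fin n}
    (e : Fin 2) {θ : Fin d → ℝ} (hθ : θ ∉ crossingSet V) (h : freq V i θ = freq V j θ) :
    bandQuadrant hk V c i e θ = bandQuadrant hk V c j e θ := by
  simp only [bandQuadrant, quadrant, hV.pderiv_congr hθ h]

namespace PhaseSpace

/-- The normal modes of an evolved functional that move into the corner `c`. -/
def wavePart (hk : k ≤ d) (V : Lattice d → Matrix (Fin n) (Fin n) ℝ) (c : Corner k)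
    (L : PhaseSpace d n α →L[ℝ] ℝ) (t : ℝ) (i : Fin n ⊕ Fin n) (θ : Fin d → ℝ) : ℂ :=
  ∑ q : Fin n × Fin 2, osc (fun θ => cornerSign q.2 * freq V q.1 θ) t
    (fun θ => (bandQuadrant hk V c q.1 q.2 θ : ℂ) * bandPart V L q.1 q.2 i θ) θ

/-- The contribution of the corner `c` to the limit covariance, in Fourier variables. -/
def limForm (hk : k ≤ d) (V : Lattice d → Matrix (Fin n) (Fin n) ℝ) (c : Corner k)
    (L L' : PhaseSpace d n α →L[ℝ] ℝ) (θ : Fin d → ℝ) : ℂ :=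
  ∑ q : Fin n × Fin 2, (bandQuadrant hk V c q.1 q.2 θ : ℂ) * ((bandMult V q.1 θ : ℂ)⁻¹ *
    (((2 * freq V q.1 θ ^ 2 : ℝ) : ℂ)⁻¹ *
      ∑ b, bandRow V L q.1 q.2 b θ * starRingEnd ℂ (bandRow V L' q.1 q.2 b θ)))

lemma memLp_bandPart (hV : Admissible V) (hα : α < -(d : ℝ) / 2) (L : PhaseSpace d n α →L[ℝ] ℝ)
    (j : Fin n) (e : Fin 2) (i : Fin n ⊕ Fin n) : MemLp (bandPart V L j e i) 2 (haarTorus d) := by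
  obtain ⟨C, -, hC⟩ := exists_bandPart_bound hV hα L
  exact memLp_of_bound (measurable_bandPart hV hα L j e i).aestronglyMeasurable (hC j e i)

lemma memLp_quadrant_mul_bandPart (hk : k ≤ d) (hV : Admissible V) (hα : α < -(d : ℝ) / 2)
    (c : Corner k) (L : PhaseSpace d n α →L[ℝ] ℝ) (j : Fin n) (e : Fin 2) (i : Fin n ⊕ Fin n) :
    MemLp (fun θ => (bandQuadrant hk V c j e θ : ℂ) * bandPart V L j e i θ) 2 (haarTorus d) := by
  have h1 := hV.measurable_bandQuadrant hk c j e
  refine (memLp_bandPart hV hα L j e i).of_le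
    ((Complex.measurable_ofReal.comp h1).mul (measurable_bandPart hV hα L j e i)).aestronglyMeasurable
    (ae_of_all _ fun θ => ?_)
  rw [norm_mul]
  exact mul_le_of_le_one_left (norm_nonneg _) (abs_bandQuadrant_le hk c j e θ)

lemma memLp_wavePart (hk : k ≤ d) (hV : Admissible V) (hα : α < -(d : ℝ) / 2) (c : Corner k)
    (L : PhaseSpace d n α →L[ℝ] ℝ) (t : ℝ) (i : Fin n ⊕ Fin n) :
    MemLp (wavePart hk V c L t i) 2 (haarTorus d) :=
  memLp_finsetSum _ fun q _ => memLp_osc (continuous_const.mul (hV.continuous_freq q.1)) t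
    (memLp_quadrant_mul_bandPart hk hV hα c L q.1 q.2 i)

lemma exists_wavePart_bound (hk : k ≤ d) (hV : Admissible V) (hα : α < -(d : ℝ) / 2) (c : Corner k)
    (L : PhaseSpace d n α →L[ℝ] ℝ) : ∃ C, ∀ t i θ, ‖wavePart hk V c L t i θ‖ ≤ C := by
  obtain ⟨C, hC0, hC⟩ := exists_bandPart_bound hV hα L
  refine ⟨∑ _q : Fin n × Fin 2, C, fun t i θ => ?_⟩
  refine (norm_sum_le _ _).trans (Finset.sum_le_sum fun q _ => ?_)
  rw [norm_osc, norm_mul]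
  exact (mul_le_of_le_one_left (norm_nonneg _) (abs_bandQuadrant_le hk c q.1 q.2 θ)).trans
    (hC q.1 q.2 i θ)

lemma memLp_hat (hα : α < -(d : ℝ) / 2) (L : PhaseSpace d n α →L[ℝ] ℝ) (i : Fin n ⊕ Fin n) :
    MemLp (hat L i) 2 (haarTorus d) := memLp_fourierSum (summable_norm_coef hα L i)

/-- The part of the evolved functional that lives on the corner `c` is asymptotically made of the
normal modes that move into this corner. -/
lemma tendsto_hat_sub_wavePart (hk : k ≤ d) (hV : Admissible V) (hα : α < -(d : ℝ) / 2) {a : ℝ}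
    {ζ : Fin 2 → ℤ → ℝ} (hζ : IsCutoff a ζ) (c : Corner k) {Z : ℝ}
    (hm : ∀ x, |cutoffProd hk ζ c x| ≤ Z) (L : PhaseSpace d n α →L[ℝ] ℝ) (i : Fin n ⊕ Fin n) :
    Tendsto (fun t => ∫⁻ θ, ‖hat ((L.comp (propagator V α t)).comp (mulOp (cutoffProd hk ζ c) Z hm)) i θ -
      wavePart hk V c L t i θ‖ₑ ^ 2 ∂haarTorus d) atTop (𝓝 0) := by
  have h1 : ∀ q : Fin n × Fin 2, Tendsto (fun t => sqMass ((fun z => (cutoffProd hk ζ c z : ℂ) *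
      fourierCoef (osc (fun θ => cornerSign q.2 * freq V q.1 θ) t (bandPart V L q.1 q.2 i)) z) -
      fourierCoef (osc (fun θ => cornerSign q.2 * freq V q.1 θ) t fun θ =>
        (bandQuadrant hk V c q.1 q.2 θ : ℂ) * bandPart V L q.1 q.2 i θ))) atTop (𝓝 0) := fun q => by
    refine tendsto_cutoffProd hk (fun p => hV.hasVelocity q.1 q.2 (Fin.castLE hk p)) (fun p => ?_) hζ c
      (memLp_bandPart hV hα L q.1 q.2 i)
    filter_upwards [haarTorus_ae (hV.ae_pderiv_ne_zero (Fin.castLE hk p) q.1)] with θ hθ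
    refine mul_ne_zero ?_ hθ
    rcases cornerSign_eq q.2 with h | h <;> simp [h]
  refine (tendsto_sqMass_sum Finset.univ fun q _ => h1 q).congr fun t => ?_
  have hK := memLp_hat hα ((L.comp (propagator V α t)).comp (mulOp (cutoffProd hk ζ c) Z hm)) i
  have hW := memLp_wavePart hk hV hα c L t i
  -- By Parseval the `L²` distance on the torus equals the squared `ℓ²` distance of the
  -- coefficients, where the cut-off is plain multiplication and `tendsto_cutoffProd` applies to
  -- each mode.
  refine Eq.trans ?_ (tsum_enorm_fourierCoef_sq (hK.sub hW))
  unfold sqMass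
  congr 1
  funext z
  congr 2
  refine Eq.trans ?_ (fourierCoef_sub hK hW z).symm
  have e1 : fourierCoef (hat ((L.comp (propagator V α t)).comp (mulOp (cutoffProd hk ζ c) Z hm)) i) z =
      cutoffProd hk ζ c z * fourierCoef (hat (L.comp (propagator V α t)) i) z := by
    unfold hat
    rw [fourierCoef_fourierSum (summable_norm_coef hα _ i),
      fourierCoef_fourierSum (summable_norm_coef hα _ i), coef_mulOp, Complex.ofReal_mul]
  have e2 : hat (L.comp (propagator V α t)) i = ∑ q : Fin n × Fin 2,
      osc (fun θ => cornerSign q.2 * freq V q.1 θ) t (bandPart V L q.1 q.2 i) := by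
    funext θ
    rw [hat_propagator hV hα, Finset.sum_apply, Fintype.sum_prod_type]
  have e3 : wavePart hk V c L t i = ∑ q : Fin n × Fin 2,
      osc (fun θ => cornerSign q.2 * freq V q.1 θ) t
        (fun θ => (bandQuadrant hk V c q.1 q.2 θ : ℂ) * bandPart V L q.1 q.2 i θ) := by
    funext θ
    rw [Finset.sum_apply]; rfl
  have hc : ∀ q : Fin n × Fin 2, Continuous fun θ => cornerSign q.2 * freq V q.1 θ := fun q =>
    continuous_const.mul (hV.continuous_freq q.1)
  have f1 := fourierCoef_sum Finset.univ (f := fun q : Fin n × Fin 2 =>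
      osc (fun θ => cornerSign q.2 * freq V q.1 θ) t (bandPart V L q.1 q.2 i)) fun q =>
    memLp_osc (hc q) t (memLp_bandPart hV hα L q.1 q.2 i)
  have f2 := fourierCoef_sum Finset.univ (f := fun q : Fin n × Fin 2 =>
      osc (fun θ => cornerSign q.2 * freq V q.1 θ) t
        (fun θ => (bandQuadrant hk V c q.1 q.2 θ : ℂ) * bandPart V L q.1 q.2 i θ)) fun q =>
    memLp_osc (hc q) t (memLp_quadrant_mul_bandPart hk hV hα c L q.1 q.2 i)
  rw [e1, e2, e3, f1, f2]
  simp only [Finset.sum_apply, Pi.sub_apply, Finset.sum_sub_distrib, Finset.mul_sum]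

/-- The Gibbs form of the wave parts does not depend on time. -/
lemma gibbsForm_wavePart (hk : k ≤ d) (hV : Admissible V) (c : Corner k)
    (L L' : PhaseSpace d n α →L[ℝ] ℝ) (t : ℝ) {θ : Fin d → ℝ} (hθ : θ ∉ crossingSet V) :
    gibbsForm V θ (fun i => wavePart hk V c L t i θ) (fun i => wavePart hk V c L' t i θ) =
      limForm hk V c L L' θ := by
  have e : ∀ L : PhaseSpace d n α →L[ℝ] ℝ, (fun i => wavePart hk V c L t i θ) = fun i =>
      ∑ q : Fin n × Fin 2, (Complex.exp (Complex.I * ((t * (cornerSign q.2 * freq V q.1 θ) : ℝ) : ℂ)) *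
        (bandQuadrant hk V c q.1 q.2 θ : ℂ)) * bandPart V L q.1 q.2 i θ := fun L => by
    funext i
    refine Finset.sum_congr rfl fun q _ => ?_
    simp only [osc, mul_assoc]
  rw [e L, e L', gibbsForm_sum, limForm]
  refine Finset.sum_congr rfl fun q _ => ?_
  obtain ⟨j, e⟩ := q
  simp only [gibbsForm_smul, gibbsForm_bandPart hV]
  set X := ((2 * freq V j θ ^ 2 : ℝ) : ℂ)⁻¹ *
      ∑ b, bandRow V L j e b θ * starRingEnd ℂ (bandRow V L' j e b θ)
  -- Only pairs with equal frequency and equal sign survive. For them the phases are conjugate and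
  -- cancel, and the velocity indicators coincide, so their product is the indicator itself.
  have hq : ∀ q' : Fin n × Fin 2,
      Complex.exp (Complex.I * ((t * (cornerSign e * freq V j θ) : ℝ) : ℂ)) *
        (bandQuadrant hk V c j e θ : ℂ) * starRingEnd ℂ
          (Complex.exp (Complex.I * ((t * (cornerSign q'.2 * freq V q'.1 θ) : ℝ) : ℂ)) *
            (bandQuadrant hk V c q'.1 q'.2 θ : ℂ)) *
        (if freq V j θ = freq V q'.1 θ ∧ e = q'.2 then (bandMult V j θ : ℂ)⁻¹ ^ 2 * X else 0) =
      if freq V j θ = freq V q'.1 θ ∧ e = q'.2 then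
        (bandQuadrant hk V c j e θ : ℂ) * ((bandMult V j θ : ℂ)⁻¹ ^ 2 * X) else 0 := by
    intro q'
    split_ifs with h
    · rw [← h.2, ← h.1, ← hV.bandQuadrant_congr hk c e hθ h.1, map_mul, Complex.conj_ofReal]
      have h1 := Complex.mul_conj' (Complex.exp (Complex.I * ((t * (cornerSign e * freq V j θ) : ℝ) : ℂ)))
      rw [norm_exp_I_mul] at h1
      have h2 : (bandQuadrant hk V c j e θ : ℂ) * (bandQuadrant hk V c j e θ : ℂ) =
          bandQuadrant hk V c j e θ := by
        rcases quadrant_eq_zero_or_one c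
          (fun i θ => cornerSign e * pderiv (Fin.castLE hk i) (freq V j) θ) θ with h | h <;>
        simp [bandQuadrant, h]
      have h3 : ∀ x y z w : ℂ, x * y * (z * y) * w = (x * z) * (y * y) * w := fun x y z w => by ring
      rw [h3, h1, h2]
      simp
    · rw [mul_zero]
  rw [Finset.sum_congr rfl fun q' _ => hq q', Fintype.sum_prod_type]
  have hs : ∀ j', ∑ e', (if freq V j θ = freq V j' θ ∧ e = e' then
      (bandQuadrant hk V c j e θ : ℂ) * ((bandMult V j θ : ℂ)⁻¹ ^ 2 * X) else 0) =
      if freq V j' θ ^ 2 = freq V j θ ^ 2 then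
        (bandQuadrant hk V c j e θ : ℂ) * ((bandMult V j θ : ℂ)⁻¹ ^ 2 * X) else 0 := by
    intro j'
    by_cases h : freq V j θ = freq V j' θ
    · simp [h]
    · have h' : ¬ freq V j' θ ^ 2 = freq V j θ ^ 2 := fun h2 => h (hV.freq_sq_inj.mp h2).symm
      simp [h, h']
  have hm0 : (bandMult V j θ : ℂ) ≠ 0 := Nat.cast_ne_zero.mpr (bandMult_pos j θ).ne'
  -- Exactly `bandMult` indices `j'` share the frequency of `j`, which cancels one of the two
  -- inverse multiplicities.
  rw [Finset.sum_congr rfl fun j' _ => hs j', ← Finset.sum_filter, Finset.sum_const, nsmul_eq_mul]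
  change (bandMult V j θ : ℂ) * _ = _
  field_simp

lemma integral_gibbsForm (hV : Admissible V) {f g : Fin n ⊕ Fin n → (Fin d → ℝ) → ℂ}
    (hf : ∀ i, MemLp (f i) 2 (haarTorus d)) (hg : ∀ i, MemLp (g i) 2 (haarTorus d)) :
    ∫ θ, gibbsForm V θ (fun i => f i θ) (fun i => g i θ) ∂haarTorus d =
      ∑ i, ∑ j, ∫ θ, f i θ * gibbsWeight V θ i j * starRingEnd ℂ (g j θ) ∂haarTorus d := by
  obtain ⟨B, -, hB⟩ := hV.exists_gibbsWeight_bound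
  have hi := fun i j => integrable_mul_mul_conj (hB i j).1.measurable (hB i j).2 (hf i) (hg j)
  simp only [gibbsForm]
  rw [integral_finsetSum _ fun i _ => integrable_finsetSum _ fun j _ => hi i j]
  exact Finset.sum_congr rfl fun i _ => integral_finsetSum _ fun j _ => hi i j

/-- The covariance of the evolved state converges. -/
lemma tendsto_integral_gibbsForm (hk : k ≤ d) (hV : Admissible V) (hα : α < -(d : ℝ) / 2) {a : ℝ}
    {ζ : Fin 2 → ℤ → ℝ} (hζ : IsCutoff a ζ) (c : Corner k) {Z : ℝ}
    (hm : ∀ x, |cutoffProd hk ζ c x| ≤ Z) (L L' : PhaseSpace d n α →L[ℝ] ℝ) :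
    Tendsto (fun t => ∫ θ, gibbsForm V θ
      (fun i => hat ((L.comp (propagator V α t)).comp (mulOp (cutoffProd hk ζ c) Z hm)) i θ)
      (fun i => hat ((L'.comp (propagator V α t)).comp (mulOp (cutoffProd hk ζ c) Z hm)) i θ)
        ∂haarTorus d) atTop (𝓝 (∫ θ, limForm hk V c L L' θ ∂haarTorus d)) := by
  obtain ⟨B, -, hB⟩ := hV.exists_gibbsWeight_bound
  obtain ⟨C, hC⟩ := exists_wavePart_bound hk hV hα c L
  obtain ⟨C', hC'⟩ := exists_wavePart_bound hk hV hα c L'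
  -- For the wave parts the integral is already constant in time, so only the vanishing `L²` error
  -- of the approximation has to be controlled.
  have h0 : ∀ t, ∫ θ, gibbsForm V θ (fun i => wavePart hk V c L t i θ)
      (fun i => wavePart hk V c L' t i θ) ∂haarTorus d = ∫ θ, limForm hk V c L L' θ ∂haarTorus d := by
    intro t
    refine integral_congr_ae ?_
    filter_upwards [haarTorus_ae hV.ae_notMem_crossingSet] with θ hθ
    exact gibbsForm_wavePart hk hV c L L' t hθ
  rw [← tendsto_sub_nhds_zero_iff]
  have h1 := fun i j => tendsto_integral_mul_mul_conj
    (f := fun t => hat ((L.comp (propagator V α t)).comp (mulOp (cutoffProd hk ζ c) Z hm)) i)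
    (f' := fun t => hat ((L'.comp (propagator V α t)).comp (mulOp (cutoffProd hk ζ c) Z hm)) j)
    (F := fun t => wavePart hk V c L t i) (F' := fun t => wavePart hk V c L' t j)
    (fun t => memLp_hat hα _ i) (fun t => memLp_hat hα _ j) (fun t => memLp_wavePart hk hV hα c L t i)
    (fun t => memLp_wavePart hk hV hα c L' t j) (fun t => hC t i) (fun t => hC' t j)
    (hB i j).1.measurable (hB i j).2 (tendsto_hat_sub_wavePart hk hV hα hζ c hm L i)
    (tendsto_hat_sub_wavePart hk hV hα hζ c hm L' j)
  have h2 := tendsto_finsetSum Finset.univ fun i _ => tendsto_finsetSum Finset.univ fun j _ => h1 i j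
  simp only [Finset.sum_const_zero] at h2
  refine h2.congr fun t => ?_
  rw [← h0 t, integral_gibbsForm hV (fun i => memLp_hat hα _ i) (fun i => memLp_hat hα _ i),
    integral_gibbsForm hV (fun i => memLp_wavePart hk hV hα c L t i)
      (fun i => memLp_wavePart hk hV hα c L' t i)]
  simp only [Finset.sum_sub_distrib]

end PhaseSpace

end

section

/-! ### Covariances under the Gibbs measure -/

variable {d n k : ℕ} {α : ℝ} {V : Lattice d → Matrix (Fin n) (Fin n) ℝ}

lemma fourierSum_eq (φ : Lattice d → ℂ) (θ : Fin d → ℝ) :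
    fourierSum φ θ = ∑' z, Complex.exp (-(Complex.I * (pair z θ : ℂ))) * φ z := by
  rw [fourierSum, expSeries]
  refine tsum_congr fun z => ?_
  congr 2
  simp [pair]

lemma continuous_exp_neg_pair (z : Lattice d) :
    Continuous fun θ : Fin d → ℝ => Complex.exp (-(Complex.I * (pair z θ : ℂ))) := by
  unfold pair
  fun_prop

/-- A Fourier series may be integrated term by term. -/
lemma hasSum_integral_fourierSum_mul {φ : Lattice d → ℂ} (hφ : Summable fun z => ‖φ z‖)
    {h : (Fin d → ℝ) → ℂ} (hh : Integrable h (haarTorus d)) :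
    HasSum (fun z => φ z * ∫ θ, Complex.exp (-(Complex.I * (pair z θ : ℂ))) * h θ ∂haarTorus d)
      (∫ θ, fourierSum φ θ * h θ ∂haarTorus d) := by
  have hi : ∀ z, Integrable (fun θ => Complex.exp (-(Complex.I * (pair z θ : ℂ))) * h θ)
      (haarTorus d) := fun z =>
    hh.bdd_mul (c := 1) (continuous_exp_neg_pair z).aestronglyMeasurable
      (ae_of_all _ fun θ => (PhaseSpace.norm_exp_neg_I_mul _).le)
  have h1 := hasSum_integral_of_summable_integral_norm
    (F := fun z θ => φ z * (Complex.exp (-(Complex.I * (pair z θ : ℂ))) * h θ))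
    (fun z => (hi z).const_mul (φ z)) (by
      simp only [norm_mul, PhaseSpace.norm_exp_neg_I_mul, one_mul, integral_const_mul]
      exact hφ.mul_right _)
  simp only [integral_const_mul] at h1
  convert! h1 using 2
  funext θ
  rw [fourierSum_eq, ← tsum_mul_right]
  exact tsum_congr fun z => by ring

lemma hasSum_integral_mul_conj_fourierSum {φ : Lattice d → ℂ} (hφ : Summable fun z => ‖φ z‖)
    {h : (Fin d → ℝ) → ℂ} (hh : Integrable h (haarTorus d)) :
    HasSum (fun z => starRingEnd ℂ (φ z) *
      ∫ θ, h θ * Complex.exp (Complex.I * (pair z θ : ℂ)) ∂haarTorus d)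
      (∫ θ, h θ * starRingEnd ℂ (fourierSum φ θ) ∂haarTorus d) := by
  have hh' : Integrable (fun θ => starRingEnd ℂ (h θ)) (haarTorus d) :=
    (LinearIsometryEquiv.integrable_comp_iff Complex.conjLIE).mpr hh
  have h1 := Complex.hasSum_conj'.mpr (hasSum_integral_fourierSum_mul hφ hh')
  simp only [map_mul, ← integral_conj] at h1
  convert! h1 using 2 with z
  · congr 1
    refine integral_congr_ae (ae_of_all _ fun θ => ?_)
    simp only [map_mul, Complex.conj_conj, ← Complex.exp_conj, map_neg, Complex.conj_I,
      Complex.conj_ofReal, neg_mul, neg_neg]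
    ring
  · funext θ
    rw [Complex.conj_conj, mul_comm]

namespace PhaseSpace

/-- The second moments of a Gibbs measure at two sites. -/
lemma integral_coord_mul_coord {T : ℝ} {μ : Measure (PhaseSpace d n α)} (hμ : IsGibbs V T μ)
    (x y : Lattice d) (i j : Fin n ⊕ Fin n) :
    ((∫ Y, coord x i Y * coord y j Y ∂μ : ℝ) : ℂ) =
      T * ∫ θ, Complex.exp (-(Complex.I * (pair (x - y) θ : ℂ))) * gibbsWeight V θ i j ∂haarTorus d := by
  rcases i with a | a <;> rcases j with b | b
  · simp only [coord_inl, gibbsWeight, Matrix.fromBlocks_apply₁₁]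
    rw [hμ.corr_uu, invVhatKernel, integral_haarTorus, Complex.real_smul]
    push_cast
    rfl
  · simp only [coord_inl, coord_inr, gibbsWeight, Matrix.fromBlocks_apply₁₂, Matrix.zero_apply,
      mul_zero, integral_zero]
    rw [hμ.corr_uv, Complex.ofReal_zero]
  · simp only [coord_inl, coord_inr, gibbsWeight, Matrix.fromBlocks_apply₂₁, Matrix.zero_apply,
      mul_zero, integral_zero]
    rw [← Complex.ofReal_zero, ← hμ.corr_uv y x b a]
    simp only [mul_comm]
  · simp only [coord_inr, gibbsWeight, Matrix.fromBlocks_apply₂₂]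
    rw [hμ.corr_vv, integral_mul_const]
    have h : ∫ θ, Complex.exp (-(Complex.I * (pair (x - y) θ : ℂ))) ∂haarTorus d =
        if x = y then 1 else 0 := by
      have h1 := integral_exp_pair (y - x)
      have h2 : ∀ θ : Fin d → ℝ, -(Complex.I * (pair (x - y) θ : ℂ)) = Complex.I * (pair (y - x) θ : ℂ) := by
        intro θ
        rw [sub_pair, sub_pair]
        push_cast
        ring
      simp only [h2, h1, sub_eq_zero, eq_comm]
    rw [h, Matrix.one_apply]
    by_cases h1 : x = y <;> by_cases h2 : a = b <;> simp [h1, h2]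

/-- The covariance of a Gibbs measure. -/
lemma integral_mul_of_isGibbs (hV : Admissible V) (hα : α < -(d : ℝ) / 2) {T : ℝ}
    {μ : Measure (PhaseSpace d n α)} (hμ : IsGibbs V T μ) (L L' : PhaseSpace d n α →L[ℝ] ℝ) :
    ((∫ Y, L Y * L' Y ∂μ : ℝ) : ℂ) =
      T * ∫ θ, gibbsForm V θ (fun i => hat L i θ) (fun i => hat L' i θ) ∂haarTorus d := by
  have := hμ.gaussian
  obtain ⟨B, -, hB⟩ := hV.exists_gibbsWeight_bound
  have hid : MemLp (id : PhaseSpace d n α → PhaseSpace d n α) 2 μ := IsGaussian.memLp_two_id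
  have hsm : ∀ M : PhaseSpace d n α →L[ℝ] ℝ, Integrable (fun Y => M Y • Y) μ := fun M => by
    have h1 : MemLp (fun Y => M Y) 2 μ := IsGaussian.memLp_dual μ M 2 (by norm_num)
    exact memLp_one_iff_integrable.mp (hid.smul h1)
  -- Applying a functional to the Bochner integral of `M Y • Y` gives a covariance. Expanding that
  -- functional in coordinates is then the convergent expansion `hasSum_coef` at one phase point,
  -- and no separate interchange of sum and expectation is needed.
  set W : (PhaseSpace d n α →L[ℝ] ℝ) → PhaseSpace d n α := fun M => ∫ Y, M Y • Y ∂μ with hW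
  have hLW : ∀ N M : PhaseSpace d n α →L[ℝ] ℝ, N (W M) = ∫ Y, M Y * N Y ∂μ := fun N M => by
    rw [hW, ← N.integral_comp_comm (hsm M)]
    simp only [map_smul, smul_eq_mul]
  set A : Lattice d → Fin n ⊕ Fin n → Fin n ⊕ Fin n → (Fin d → ℝ) → ℂ := fun z i j θ =>
    Complex.exp (-(Complex.I * (pair z θ : ℂ))) * gibbsWeight V θ i j with hA
  have hwi : ∀ i j, Integrable (fun θ => gibbsWeight V θ i j) (haarTorus d) := fun i j =>
    Integrable.of_bound (hB i j).1.aestronglyMeasurable B (ae_of_all _ (hB i j).2)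
  have hAi : ∀ z i j, Integrable (A z i j) (haarTorus d) := fun z i j =>
    (hwi i j).bdd_mul (c := 1) (continuous_exp_neg_pair z).aestronglyMeasurable
      (ae_of_all _ fun θ => (norm_exp_neg_I_mul _).le)
  have h1 : ∀ z i, ((∫ Y, coord z i Y * L' Y ∂μ : ℝ) : ℂ) =
      T * ∑ j, ∫ θ, A z i j θ * starRingEnd ℂ (hat L' j θ) ∂haarTorus d := by
    intro z i
    have e := hasSum_coef L' (W (coord z i))
    rw [hLW, ← Complex.hasSum_ofReal] at e
    refine e.unique ?_
    refine ((hasSum_sum (s := Finset.univ) fun j _ =>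
      hasSum_integral_mul_conj_fourierSum (summable_norm_coef hα L' j) (hAi z i j)).mul_left
        (T : ℂ)).congr_fun fun y => ?_
    push_cast
    rw [Finset.mul_sum]
    refine Finset.sum_congr rfl fun j _ => ?_
    rw [hLW, integral_coord_mul_coord hμ, Complex.conj_ofReal, mul_left_comm]
    congr 2
    refine integral_congr_ae (ae_of_all _ fun θ => ?_)
    simp only [hA]
    rw [mul_right_comm, ← Complex.exp_add, sub_pair]
    congr 2
    push_cast
    ring
  have h2 := hasSum_coef L (W L')
  rw [hLW, ← Complex.hasSum_ofReal] at h2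
  have h3 : ∫ Y, L Y * L' Y ∂μ = ∫ Y, L' Y * L Y ∂μ := by simp only [mul_comm]
  rw [h3]
  refine h2.unique ?_
  rw [integral_gibbsForm hV (fun i => memLp_hat hα L i) (fun i => memLp_hat hα L' i)]
  have h4 : ∀ i j, HasSum (fun z => (coef L z i : ℂ) *
      ∫ θ, Complex.exp (-(Complex.I * (pair z θ : ℂ))) * (gibbsWeight V θ i j *
        starRingEnd ℂ (hat L' j θ)) ∂haarTorus d)
      (∫ θ, hat L i θ * (gibbsWeight V θ i j * starRingEnd ℂ (hat L' j θ)) ∂haarTorus d) := fun i j => by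
    refine hasSum_integral_fourierSum_mul (summable_norm_coef hα L i) ?_
    have hc : MemLp (fun θ => starRingEnd ℂ (hat L' j θ)) 2 (haarTorus d) := (memLp_hat hα L' j).star
    exact (hc.integrable one_le_two).bdd_mul (c := B) (hB i j).1.aestronglyMeasurable
      (ae_of_all _ (hB i j).2)
  have h5 := (hasSum_sum (s := Finset.univ) fun i _ => hasSum_sum (s := Finset.univ) fun j _ =>
    h4 i j).mul_left (T : ℂ)
  simp only [← mul_assoc] at h5
  refine h5.congr_fun fun z => ?_
  push_cast
  rw [Finset.mul_sum]
  refine Finset.sum_congr rfl fun i _ => ?_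
  have h6 : ∫ Y, L' Y * coord z i Y ∂μ = ∫ Y, coord z i Y * L' Y ∂μ := by simp only [mul_comm]
  rw [hLW, h6, h1 z i, Finset.mul_sum, Finset.mul_sum, Finset.mul_sum]
  refine Finset.sum_congr rfl fun j _ => ?_
  simp only [hA]
  ring

/-- A Gibbs measure is centred. -/
lemma integral_eq_zero_of_isGibbs {T : ℝ} {μ : Measure (PhaseSpace d n α)} (hμ : IsGibbs V T μ)
    (L : PhaseSpace d n α →L[ℝ] ℝ) : ∫ Y, L Y ∂μ = 0 := by
  have := hμ.gaussian
  have h : ∫ Y, Y ∂μ = 0 := by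
    refine ext_coord fun x i => ?_
    rw [← IsGaussian.integral_dual (coord x i), map_zero]
    rcases i with a | a
    · exact hμ.mean_u x a
    · exact hμ.mean_v x a
  rw [IsGaussian.integral_dual L, h, map_zero]

end PhaseSpace

end

section

/-! ### The evolved state -/

variable {d n k : ℕ} {α : ℝ} {V : Lattice d → Matrix (Fin n) (Fin n) ℝ}

/-- The initial state `Y₀` made of independent Gibbs states `Y_c`. -/
structure IsInitialState (hk : k ≤ d) (V : Lattice d → Matrix (Fin n) (Fin n) ℝ) (T : Corner k → ℝ)
    (ζ : Fin 2 → ℤ → ℝ) {Ω : Type*} [MeasurableSpace Ω] (P : Measure Ω)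
    (Y : Corner k → Ω → PhaseSpace d n α) (Y₀ : Ω → PhaseSpace d n α) : Prop where
  measurable : ∀ c, Measurable (Y c)
  indep : iIndepFun Y P
  gibbs : ∀ c, IsGibbs V (T c) (P.map (Y c))
  u_eq : ∀ w x, (Y₀ w).u x = ∑ c, cutoffProd hk ζ c x • (Y c w).u x
  v_eq : ∀ w x, (Y₀ w).v x = ∑ c, cutoffProd hk ζ c x • (Y c w).v x

lemma integral_norm_sq_le {f : (Fin d → ℝ) → ℂ} (hf : MemLp f 2 (haarTorus d)) {R : ℝ} (hR : 0 ≤ R)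
    (h : ∫⁻ θ, ‖f θ‖ₑ ^ 2 ∂haarTorus d ≤ ENNReal.ofReal R) : ∫ θ, ‖f θ‖ ^ 2 ∂haarTorus d ≤ R := by
  rw [integral_eq_lintegral_of_nonneg_ae (ae_of_all _ fun _ => sq_nonneg _) (hf.1.norm.pow 2)]
  refine ENNReal.toReal_le_of_le_ofReal hR (le_trans (le_of_eq ?_) h)
  refine lintegral_congr fun θ => ?_
  rw [ENNReal.ofReal_pow (norm_nonneg _), ofReal_norm]

namespace PhaseSpace

lemma coef_coord (x z : Lattice d) (i j : Fin n ⊕ Fin n) :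
    coef (coord (α := α) x i) z j = if z = x ∧ j = i then 1 else 0 := by
  have h : coef (coord (α := α) x i) z j = Sum.elim
      ((Pi.single z (siteBasis j) : Lattice d → Site n × Site n) x).1
      ((Pi.single z (siteBasis j) : Lattice d → Site n × Site n) x).2 i := rfl
  rw [h]
  by_cases hz : z = x
  · subst hz
    rw [Pi.single_eq_same]
    rcases i with a | a <;> rcases j with b | b <;> simp [siteBasis, Pi.single_apply, eq_comm]
  · rw [Pi.single_eq_of_ne (Ne.symm hz)]
    rcases i with a | a <;> simp [hz]

lemma hat_coord (x : Lattice d) (i j : Fin n ⊕ Fin n) (θ : Fin d → ℝ) :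
    hat (coord (α := α) x i) j θ =
      if j = i then Complex.exp (-(Complex.I * (pair x θ : ℂ))) else 0 := by
  rw [hat, fourierSum_eq, tsum_eq_single x]
  · rw [coef_coord]
    by_cases h : j = i <;> simp [h]
  · intro z hz
    rw [coef_coord]
    simp [hz]

lemma norm_hat_coord_le (x : Lattice d) (i j : Fin n ⊕ Fin n) (θ : Fin d → ℝ) :
    ‖hat (coord (α := α) x i) j θ‖ ≤ 1 := by
  rw [hat_coord]
  split_ifs
  · exact (norm_exp_neg_I_mul _).le
  · simp

/-- The restriction of an evolved functional to a corner. -/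
def cornerFun (hk : k ≤ d) (V : Lattice d → Matrix (Fin n) (Fin n) ℝ) {ζ : Fin 2 → ℤ → ℝ} {Z : ℝ}
    (hZ : ∀ (c : Corner k) x, |cutoffProd hk ζ c x| ≤ Z) (c : Corner k) (t : ℝ)
    (L : PhaseSpace d n α →L[ℝ] ℝ) : PhaseSpace d n α →L[ℝ] ℝ :=
  (L.comp (propagator V α t)).comp (mulOp (cutoffProd hk ζ c) Z (hZ c))

/-- The restrictions of the evolved coordinates are bounded in `ℓ²`, uniformly in space and time. -/
lemma exists_integral_norm_sq_cornerFun_le (hk : k ≤ d) (hV : Admissible V) (hα : α < -(d : ℝ) / 2)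
    {ζ : Fin 2 → ℤ → ℝ} {Z : ℝ} (hZ : ∀ (c : Corner k) x, |cutoffProd hk ζ c x| ≤ Z) :
    ∃ R, ∀ c t x i j,
      ∫ θ, ‖hat (cornerFun hk V hZ c t (coord (α := α) x i)) j θ‖ ^ 2 ∂haarTorus d ≤ R := by
  obtain ⟨C, hC0, hC⟩ := exists_norm_bandPart_le (α := α) hV
  set D := ∑ _j : Fin n, ∑ _e : Fin 2, C * 1 with hD
  have hD0 : 0 ≤ D := by positivity
  refine ⟨Z ^ 2 * D ^ 2, fun c t x i j => ?_⟩
  set L := coord (α := α) x i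
  refine integral_norm_sq_le (memLp_hat hα _ j) (by positivity) ?_
  rw [← tsum_enorm_fourierCoef_sq (memLp_hat hα _ j), ENNReal.ofReal_mul (sq_nonneg Z)]
  have h1 : ∀ z, fourierCoef (hat (cornerFun hk V hZ c t L) j) z =
      (cutoffProd hk ζ c z : ℂ) * fourierCoef (hat (L.comp (propagator V α t)) j) z := fun z => by
    unfold hat
    rw [fourierCoef_fourierSum (summable_norm_coef hα _ j),
      fourierCoef_fourierSum (summable_norm_coef hα _ j), cornerFun, coef_mulOp, Complex.ofReal_mul]
  simp only [h1]
  refine (sqMass_mul_le (hZ c) _).trans (mul_le_mul' le_rfl ?_)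
  refine (tsum_enorm_fourierCoef_sq (memLp_hat hα _ j)).trans_le ?_
  -- Evolution only multiplies the modes by phases, so this bound depends neither on the time nor on
  -- the site.
  have h2 : ∀ θ, ‖hat (L.comp (propagator V α t)) j θ‖ ≤ D := fun θ => by
    rw [hat_propagator hV hα]
    refine (norm_sum_le _ _).trans (Finset.sum_le_sum fun b _ => ?_)
    refine (norm_sum_le _ _).trans (Finset.sum_le_sum fun e _ => ?_)
    rw [norm_osc]
    exact hC L 1 (norm_hat_coord_le x i) b e j θ
  calc ∫⁻ θ, ‖hat (L.comp (propagator V α t)) j θ‖ₑ ^ 2 ∂haarTorus d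
      ≤ ∫⁻ _θ, ENNReal.ofReal (D ^ 2) ∂haarTorus d := lintegral_mono fun θ => by
        rw [← ofReal_norm, ← ENNReal.ofReal_pow (norm_nonneg _)]
        exact ENNReal.ofReal_le_ofReal (pow_le_pow_left₀ (norm_nonneg _) (h2 θ) 2)
    _ = ENNReal.ofReal (D ^ 2) := by simp

lemma norm_gibbsForm_self_le {B : ℝ} {θ : Fin d → ℝ} (hB : ∀ i j, ‖gibbsWeight V θ i j‖ ≤ B)
    (a : Fin n ⊕ Fin n → ℂ) :
    ‖gibbsForm V θ a a‖ ≤ ∑ i, |B| * Fintype.card (Fin n ⊕ Fin n) * ‖a i‖ ^ 2 := by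
  have h1 : ‖gibbsForm V θ a a‖ ≤ |B| * (∑ i, ‖a i‖) ^ 2 := by
    rw [sq, Finset.sum_mul_sum, Finset.mul_sum]
    refine (norm_sum_le _ _).trans (Finset.sum_le_sum fun i _ => ?_)
    rw [Finset.mul_sum]
    refine (norm_sum_le _ _).trans (Finset.sum_le_sum fun j _ => ?_)
    rw [norm_mul, norm_mul, RCLike.norm_conj, mul_comm ‖a i‖, mul_assoc]
    exact mul_le_mul_of_nonneg_right ((hB i j).trans (le_abs_self B)) (by positivity)
  refine h1.trans ?_
  rw [← Finset.mul_sum, mul_assoc]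
  exact mul_le_mul_of_nonneg_left (sq_sum_le_card_mul_sum_sq (s := Finset.univ)) (abs_nonneg B)

/-- The limit covariance. -/
def limCov (hk : k ≤ d) (V : Lattice d → Matrix (Fin n) (Fin n) ℝ) (T : Corner k → ℝ)
    (L L' : PhaseSpace d n α →L[ℝ] ℝ) : ℝ :=
  (∑ c, (T c : ℂ) * ∫ θ, limForm hk V c L L' θ ∂haarTorus d).re

end PhaseSpace

open PhaseSpace

namespace IsInitialState

variable {hk : k ≤ d} {T : Corner k → ℝ} {ζ : Fin 2 → ℤ → ℝ} {Ω : Type*} [MeasurableSpace Ω]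
  {P : Measure Ω} {Y : Corner k → Ω → PhaseSpace d n α} {Y₀ : Ω → PhaseSpace d n α}

lemma eq_sum (h : IsInitialState hk V T ζ P Y Y₀) {Z : ℝ}
    (hZ : ∀ (c : Corner k) x, |cutoffProd hk ζ c x| ≤ Z) (w : Ω) :
    Y₀ w = ∑ c, mulOp (cutoffProd hk ζ c) Z (hZ c) (Y c w) := by
  refine PhaseSpace.ext (fun x => ?_) fun x => ?_
  · rw [h.u_eq, ← uCLM_apply, map_sum]
    exact Finset.sum_congr rfl fun c _ => by rw [uCLM_apply, mulOp_u]
  · rw [h.v_eq, ← vCLM_apply, map_sum]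
    exact Finset.sum_congr rfl fun c _ => by rw [vCLM_apply, mulOp_v]

lemma apply_propagator (h : IsInitialState hk V T ζ P Y Y₀) {Z : ℝ}
    (hZ : ∀ (c : Corner k) x, |cutoffProd hk ζ c x| ≤ Z) (t : ℝ) (L : PhaseSpace d n α →L[ℝ] ℝ) (w : Ω) :
    L (propagator V α t (Y₀ w)) = ∑ c, cornerFun hk V hZ c t L (Y c w) := by
  rw [h.eq_sum hZ, map_sum, map_sum]
  rfl

/-- The initial state is a finite sum of bounded linear images of independent Gaussian elements. -/
lemma hasGaussianLaw (h : IsInitialState hk V T ζ P Y Y₀) {a : ℝ} (hζ : IsCutoff a ζ) :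
    HasGaussianLaw Y₀ P := by
  obtain ⟨Z, hZ⟩ := hζ.exists_abs_cutoffProd_le hk
  have h1 : ∀ c, HasGaussianLaw (fun w => mulOp (cutoffProd hk ζ c) Z (hZ c) (Y c w)) P := fun c =>
    HasGaussianLaw.map_fun (⟨(h.gibbs c).gaussian⟩ : HasGaussianLaw (Y c) P) _
  have h2 : iIndepFun (fun c w => mulOp (cutoffProd hk ζ c) Z (hZ c) (Y c w)) P :=
    h.indep.comp (fun c => mulOp (cutoffProd hk ζ c) Z (hZ c)) fun c =>
      (mulOp (cutoffProd hk ζ c) Z (hZ c)).continuous.measurable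
  have h3 := iIndepFun.hasGaussianLaw_fun_sum h1 h2
  have h4 : Y₀ = fun w => ∑ c, mulOp (cutoffProd hk ζ c) Z (hZ c) (Y c w) := funext (h.eq_sum hZ)
  rw [h4]
  exact h3

lemma measurable_initial (h : IsInitialState hk V T ζ P Y Y₀) {a : ℝ} (hζ : IsCutoff a ζ) :
    Measurable Y₀ := by
  obtain ⟨Z, hZ⟩ := hζ.exists_abs_cutoffProd_le hk
  have h4 : Y₀ = fun w => ∑ c, mulOp (cutoffProd hk ζ c) Z (hZ c) (Y c w) := funext (h.eq_sum hZ)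
  rw [h4]
  exact Finset.measurable_sum _ fun c _ =>
    (mulOp (cutoffProd hk ζ c) Z (hZ c)).continuous.measurable.comp (h.measurable c)

lemma memLp_apply (h : IsInitialState hk V T ζ P Y Y₀) (c : Corner k) (L : PhaseSpace d n α →L[ℝ] ℝ) :
    MemLp (fun w => L (Y c w)) 2 P := by
  have h1 : HasGaussianLaw (fun w => L (Y c w)) P :=
    HasGaussianLaw.map_fun (⟨(h.gibbs c).gaussian⟩ : HasGaussianLaw (Y c) P) L
  exact h1.memLp_two

lemma integral_apply (h : IsInitialState hk V T ζ P Y Y₀) (c : Corner k)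
    (L : PhaseSpace d n α →L[ℝ] ℝ) : ∫ w, L (Y c w) ∂P = 0 := by
  rw [← integral_eq_zero_of_isGibbs (h.gibbs c) L,
    integral_map (h.measurable c).aemeasurable L.continuous.aestronglyMeasurable]

/-- The covariance of the evolved state. -/
lemma integral_mul_propagator (h : IsInitialState hk V T ζ P Y Y₀) (hV : Admissible V)
    (hα : α < -(d : ℝ) / 2) {Z : ℝ} (hZ : ∀ (c : Corner k) x, |cutoffProd hk ζ c x| ≤ Z) (t : ℝ)
    (L L' : PhaseSpace d n α →L[ℝ] ℝ) :
    ∫ w, L (propagator V α t (Y₀ w)) * L' (propagator V α t (Y₀ w)) ∂P =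
      (∑ c, (T c : ℂ) * ∫ θ, gibbsForm V θ (fun i => hat (cornerFun hk V hZ c t L) i θ)
        (fun i => hat (cornerFun hk V hZ c t L') i θ) ∂haarTorus d).re := by
  have hint : ∀ c c' : Corner k, ∀ M M' : PhaseSpace d n α →L[ℝ] ℝ,
      Integrable (fun w => M (Y c w) * M' (Y c' w)) P := fun c c' M M' =>
    (h.memLp_apply c M).integrable_mul (h.memLp_apply c' M')
  -- Different reservoirs are independent and centred, so the double sum over corners reduces to its
  -- diagonal.
  have h1 : ∀ c c' : Corner k, ∀ M M' : PhaseSpace d n α →L[ℝ] ℝ, c ≠ c' →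
      ∫ w, M (Y c w) * M' (Y c' w) ∂P = 0 := fun c c' M M' hc => by
    have hi : IndepFun (fun w => M (Y c w)) (fun w => M' (Y c' w)) P :=
      (h.indep.indepFun hc).comp M.continuous.measurable M'.continuous.measurable
    rw [hi.integral_fun_mul_eq_mul_integral (h.memLp_apply c M).1 (h.memLp_apply c' M').1,
      h.integral_apply, zero_mul]
  simp only [h.apply_propagator hZ, Finset.sum_mul_sum]
  rw [integral_finsetSum _ fun c _ => integrable_finsetSum _ fun c' _ => hint c c' _ _, Complex.re_sum]
  refine Finset.sum_congr rfl fun c _ => ?_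
  rw [integral_finsetSum _ fun c' _ => hint c c' _ _, Finset.sum_eq_single c
    (fun c' _ hc => h1 c c' _ _ (Ne.symm hc)) (fun hc => absurd (Finset.mem_univ c) hc),
    ← integral_mul_of_isGibbs hV hα (h.gibbs c), Complex.ofReal_re,
    integral_map (h.measurable c).aemeasurable (by
      exact ((cornerFun hk V hZ c t L).continuous.mul
        (cornerFun hk V hZ c t L').continuous).aestronglyMeasurable)]

lemma tendsto_integral_mul (h : IsInitialState hk V T ζ P Y Y₀) (hV : Admissible V)
    (hα : α < -(d : ℝ) / 2) {a : ℝ} (hζ : IsCutoff a ζ) (L L' : PhaseSpace d n α →L[ℝ] ℝ) :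
    Tendsto (fun t => ∫ w, L (propagator V α t (Y₀ w)) * L' (propagator V α t (Y₀ w)) ∂P) atTop
      (𝓝 (limCov hk V T L L')) := by
  obtain ⟨Z, hZ⟩ := hζ.exists_abs_cutoffProd_le hk
  simp only [h.integral_mul_propagator hV hα hZ]
  refine (Complex.continuous_re.tendsto _).comp ?_
  exact tendsto_finsetSum _ fun c _ =>
    (tendsto_integral_gibbsForm hk hV hα hζ c (hZ c) L L').const_mul _

/-- The second moments of the evolved state are bounded uniformly in space and time. -/
lemma exists_integral_sq_le (h : IsInitialState hk V T ζ P Y Y₀) (hV : Admissible V)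
    (hα : α < -(d : ℝ) / 2) {a : ℝ} (hζ : IsCutoff a ζ) :
    ∃ C, ∀ t x i, ∫ w, coord x i (propagator V α t (Y₀ w)) ^ 2 ∂P ≤ C := by
  obtain ⟨Z, hZ⟩ := hζ.exists_abs_cutoffProd_le hk
  obtain ⟨R, hR⟩ := exists_integral_norm_sq_cornerFun_le hk hV hα hZ
  obtain ⟨B, -, hB⟩ := hV.exists_gibbsWeight_bound
  refine ⟨∑ c, |T c| * ∑ _i : Fin n ⊕ Fin n, |B| * Fintype.card (Fin n ⊕ Fin n) * R, fun t x i => ?_⟩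
  simp only [sq]
  rw [h.integral_mul_propagator hV hα hZ]
  refine (Complex.re_le_norm _).trans ((norm_sum_le _ _).trans (Finset.sum_le_sum fun c _ => ?_))
  rw [norm_mul, Complex.norm_real]
  refine mul_le_mul_of_nonneg_left ?_ (abs_nonneg _)
  have hi : ∀ j, Integrable (fun θ => |B| * Fintype.card (Fin n ⊕ Fin n) *
      ‖hat (cornerFun hk V hZ c t (coord (α := α) x i)) j θ‖ ^ 2) (haarTorus d) := fun j =>
    ((memLp_two_iff_integrable_sq_norm (memLp_hat hα _ j).1).mp (memLp_hat hα _ j)).const_mul _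
  refine (norm_integral_le_of_norm_le (integrable_finsetSum _ fun j _ => hi j) (ae_of_all _ fun θ =>
    norm_gibbsForm_self_le (fun i j => (hB i j).2 θ) _)).trans ?_
  rw [integral_finsetSum _ fun j _ => hi j]
  refine Finset.sum_le_sum fun j _ => ?_
  rw [integral_const_mul]
  exact mul_le_mul_of_nonneg_left (hR c t x i j) (by positivity)

end IsInitialState

end

section

/-! ### Weak convergence of the evolved state -/

section GaussianLimit

variable {E : Type*} [NormedAddCommGroup E] [NormedSpace ℝ E] [MeasurableSpace E] [BorelSpace E]

lemma continuous_charFunDual (L : StrongDual ℝ E) :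
    Continuous fun μ : ProbabilityMeasure E => charFunDual (μ : Measure E) L := by
  refine continuous_iff_continuousAt.mpr fun μ => ?_
  exact (ProbabilityMeasure.tendsto_iff_forall_integral_rclike_tendsto ℂ).mp
    (tendsto_id (x := 𝓝 μ)) (BoundedContinuousFunction.probCharDual L)

/-- A tight family whose characteristic functions converge pointwise converges weakly. -/
lemma exists_tendsto_of_charFunDual [CompleteSpace E] [SecondCountableTopology E]
    {ν : ℝ → ProbabilityMeasure E} {φ : StrongDual ℝ E → ℂ}
    (ht : IsTightMeasureSet {((μ : ProbabilityMeasure E) : Measure E) | μ ∈ Set.range ν})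
    (hφ : ∀ L, Tendsto (fun t => charFunDual (ν t : Measure E) L) atTop (𝓝 (φ L))) :
    ∃ μ : ProbabilityMeasure E, Tendsto ν atTop (𝓝 μ) ∧ ∀ L, charFunDual (μ : Measure E) L = φ L := by
  -- Prokhorov's theorem. A cluster point exists, and every cluster point has the characteristic
  -- functional `φ`, hence they all coincide and the family converges.
  have hK := isCompact_closure_of_isTightMeasureSet ht
  have hmem : ∀ t, ν t ∈ closure (Set.range ν) := fun t => subset_closure ⟨t, rfl⟩
  have hcl : ∀ μ : ProbabilityMeasure E, MapClusterPt μ atTop ν →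
      ∀ L, charFunDual (μ : Measure E) L = φ L := by
    intro μ hμ L
    have h1 := hμ.continuousAt_comp (continuous_charFunDual L).continuousAt
    have h2 : ClusterPt (charFunDual (μ : Measure E) L) (𝓝 (φ L)) := ClusterPt.mono h1 (hφ L)
    exact eq_of_nhds_neBot h2
  obtain ⟨μ, -, hμ⟩ := hK (f := map ν atTop)
    (le_principal_iff.mpr (Eventually.of_forall hmem : ∀ᶠ t in atTop, ν t ∈ closure (Set.range ν)))
  refine ⟨μ, hK.tendsto_nhds_of_unique_mapClusterPt (Eventually.of_forall hmem) fun μ' _ hμ' => ?_,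
    hcl μ hμ⟩
  have h1 : charFunDual (μ' : Measure E) = charFunDual (μ : Measure E) := funext fun L => by
    rw [hcl μ' hμ' L, hcl μ hμ L]
  have h2 : (μ' : Measure E) = μ :=
    have := μ'.2
    have := μ.2
    Measure.ext_of_charFunDual h1
  exact Subtype.ext h2

/-- The characteristic function of a centred Gaussian measure determines the law of the
functionals. -/
lemma map_eq_gaussianReal_of_charFunDual {μ : Measure E} [IsProbabilityMeasure μ]
    {σ : StrongDual ℝ E → ℝ} (hσ : ∀ L, 0 ≤ σ L) (hs : ∀ (r : ℝ) L, σ (r • L) = r ^ 2 * σ L)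
    (h : ∀ L, charFunDual μ L = Complex.exp (-(σ L : ℂ) / 2)) (L : StrongDual ℝ E) :
    μ.map L = gaussianReal 0 (σ L).toNNReal := by
  have : IsProbabilityMeasure (μ.map L) := Measure.isProbabilityMeasure_map L.continuous.aemeasurable
  refine Measure.ext_of_charFun (funext fun r => ?_)
  rw [charFun_map_eq_charFunDual_smul, h, charFun_gaussianReal, hs, Real.coe_toNNReal _ (hσ L)]
  congr 1
  push_cast
  ring

end GaussianLimit

variable {d n k : ℕ} {α : ℝ} {V : Lattice d → Matrix (Fin n) (Fin n) ℝ}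

/-- A summable negative power tends to zero, and every negative power is a positive power of it. -/
lemma tendsto_jap_rpow {s : ℝ} (hs : s < 0) :
    Tendsto (fun x : Lattice d => jap x ^ s) cofinite (𝓝 0) := by
  have hd : (0 : ℝ) < d + 1 := by positivity
  have h1 := (summable_jap_rpow (d := d) (s := -(d + 1)) (by linarith)).tendsto_cofinite_zero
  have h2 := h1.rpow_const (p := -s / (d + 1)) (Or.inr (div_nonneg (by linarith) hd.le))
  rw [Real.zero_rpow (div_pos (by linarith) hd).ne'] at h2
  refine h2.congr fun x => ?_
  rw [← Real.rpow_mul (jap_pos x).le]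
  congr 1
  field_simp

namespace PhaseSpace

/-- Multiplication by a sequence that tends to zero is a compact operator. -/
lemma isCompactOperator_mulOp {m : Lattice d → ℝ} {Z : ℝ} (hm : ∀ x, |m x| ≤ Z)
    (h0 : Tendsto m cofinite (𝓝 0)) :
    IsCompactOperator (mulOp (n := n) (α := α) m Z hm) := by
  -- `F S` multiplies by `m` restricted to the finite set `S` and has finite rank; its distance in
  -- norm to the full operator is at most the supremum of `|m|` off `S`.
  set F : Finset (Lattice d) → PhaseSpace d n α →L[ℝ] PhaseSpace d n α := fun S =>
    ∑ z ∈ S, ∑ i, m z • (coord z i).smulRight (point z (siteBasis i)) with hF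
  have hFc : ∀ S, IsCompactOperator (F S) := by
    have hsum : ∀ {ι : Type _} (S : Finset ι) (G : ι → PhaseSpace d n α →L[ℝ] PhaseSpace d n α),
        (∀ i, IsCompactOperator (G i)) →
          IsCompactOperator (∑ i ∈ S, G i : PhaseSpace d n α →L[ℝ] PhaseSpace d n α) := by
      intro ι S G hG
      classical
      induction S using Finset.induction_on with
      | empty => exact isCompactOperator_zero
      | insert i S hi ih =>
        rw [Finset.sum_insert hi]
        exact (hG i).add ih
    refine fun S => hsum S (fun z => ∑ i, m z • (coord z i).smulRight (point z (siteBasis i)))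
      fun z => hsum Finset.univ (fun i => m z • (coord z i).smulRight (point z (siteBasis i))) fun i => ?_
    have h1 : IsCompactOperator (coord (α := α) z i) :=
      isCompactOperator_of_locallyCompactSpace_dom (coord z i)
    have h2 := h1.clm_comp (m z • (ContinuousLinearMap.id ℝ ℝ).smulRight
      (point (α := α) z (siteBasis i)))
    exact h2
  have hFx : ∀ S Y x j, coord x j (F S Y) = (S : Set (Lattice d)).indicator m x * coord x j Y := by
    intro S Y x j
    have h1 : coord x j (F S Y) = ∑ z ∈ S, ∑ i, m z * (coord z i Y *
        coord x j (point z (siteBasis i) : PhaseSpace d n α)) := by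
      simp only [hF, sum_apply, map_sum, smul_apply,
        ContinuousLinearMap.smulRight_apply, map_smul, smul_eq_mul]
    have h2 : ∀ z i, coord x j (point z (siteBasis i) : PhaseSpace d n α) =
      if z = x ∧ i = j then 1 else 0 := fun z i => coef_coord x z j i
    rw [h1]
    simp only [h2, ite_and, mul_ite, mul_one, mul_zero]
    classical
    by_cases hx : x ∈ S
    · rw [Set.indicator_of_mem (Finset.mem_coe.mpr hx), Finset.sum_eq_single x]
      · simp
      · intro z _ hz
        simp [hz]
      · exact fun h => absurd hx h
    · rw [Set.indicator_of_notMem (fun h => hx (Finset.mem_coe.mp h)), zero_mul]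
      refine Finset.sum_eq_zero fun z hz => ?_
      have : z ≠ x := fun h => hx (h ▸ hz)
      simp [this]
  refine isCompactOperator_of_tendsto (l := atTop) (F := F) ?_ (Eventually.of_forall hFc)
  rw [Metric.tendsto_nhds]
  intro ε hε
  have hfin := h0.eventually (Metric.ball_mem_nhds (0 : ℝ) (half_pos hε))
  rw [Filter.eventually_cofinite] at hfin
  filter_upwards [eventually_ge_atTop hfin.toFinset] with S hS
  have hb : ∀ x, |(S : Set (Lattice d)).indicator m x - m x| ≤ ε / 2 := fun x => by
    classical
    by_cases hx : x ∈ S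
    · rw [Set.indicator_of_mem (Finset.mem_coe.mpr hx), sub_self, abs_zero]
      exact (half_pos hε).le
    · rw [Set.indicator_of_notMem (fun h => hx (Finset.mem_coe.mp h)), zero_sub, abs_neg]
      by_contra hc
      refine hx (hS (hfin.mem_toFinset.mpr fun h => hc ?_))
      simpa using (Metric.mem_ball.mp h).le
  have he : F S - mulOp m Z hm = mulOp _ _ hb := by
    ext1 Y
    refine ext_coord fun x j => ?_
    rw [sub_apply, map_sub, hFx]
    rcases j with a | a <;> simp [sub_mul]
  rw [dist_eq_norm, he]
  exact (norm_mulOp_le _ _ hb).trans_lt (half_lt_self hε)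

lemma norm_sq_add_norm_sq (Y : PhaseSpace d n α) (x : Lattice d) :
    ‖Y.u x‖ ^ 2 + ‖Y.v x‖ ^ 2 = ∑ i, coord x i Y ^ 2 := by
  rw [Fintype.sum_sum_type, EuclideanSpace.norm_sq_eq, EuclideanSpace.norm_sq_eq]
  simp only [Real.norm_eq_abs, sq_abs, coord_inl, coord_inr]

/-- The bounded sets of `H_β` are relatively compact in `H_α` for `α < β`. -/
lemma exists_isCompact_of_rpow {β : ℝ} (hβ : α < β) {R : ℝ} (hR : 0 ≤ R) :
    ∃ K : Set (PhaseSpace d n α), IsCompact K ∧ ∀ Y,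
      ∑' x, ENNReal.ofReal (jap x ^ (2 * β) * ∑ i, coord x i Y ^ 2) ≤ ENNReal.ofReal (R ^ 2) → Y ∈ K := by
  have hm : ∀ x : Lattice d, |jap x ^ (α - β)| ≤ 1 := fun x => by
    rw [abs_of_nonneg (Real.rpow_nonneg (jap_pos x).le _)]
    exact Real.rpow_le_one_of_one_le_of_nonpos (one_le_jap x) (by linarith)
  have hc := isCompactOperator_mulOp (n := n) (α := α) hm (tendsto_jap_rpow (by linarith))
  obtain ⟨K, hK, hsub⟩ := IsCompactOperator.image_closedBall_subset_compact
    (f := (mulOp (n := n) (α := α) (fun x => jap x ^ (α - β)) 1 hm).toLinearMap) hc R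
  refine ⟨K, hK, fun Y hY => hsub ?_⟩
  have hnn : ∀ x, 0 ≤ jap x ^ (2 * β) * ∑ i, coord x i Y ^ 2 := fun x =>
    mul_nonneg (Real.rpow_nonneg (jap_pos x).le _) (Finset.sum_nonneg fun i _ => sq_nonneg _)
  have hs : Summable fun x => jap x ^ (2 * β) * ∑ i, coord x i Y ^ 2 := by
    have h1 : ∑' x, ENNReal.ofReal (jap x ^ (2 * β) * ∑ i, coord x i Y ^ 2) ≠ ⊤ :=
      ne_top_of_le_ne_top ENNReal.ofReal_ne_top hY
    exact (ENNReal.summable_toReal h1).congr fun x => ENNReal.toReal_ofReal (hnn x)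
  have he : ∀ x, jap x ^ (2 * α) * (‖jap x ^ (β - α) • Y.u x‖ ^ 2 + ‖jap x ^ (β - α) • Y.v x‖ ^ 2) =
      jap x ^ (2 * β) * ∑ i, coord x i Y ^ 2 := fun x => by
    rw [← norm_sq_add_norm_sq, norm_smul, norm_smul, mul_pow, mul_pow, ← mul_add, ← mul_assoc,
      Real.norm_of_nonneg (Real.rpow_nonneg (jap_pos x).le _), ← Real.rpow_natCast,
      ← Real.rpow_mul (jap_pos x).le, ← Real.rpow_add (jap_pos x)]
    congr 2
    push_cast
    ring
  -- The rescaled point `⟨x⟩^{β-α} Y` lies in the ball of radius `R` of H_α, and `Y` is its image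
  -- under the compact multiplication by `⟨x⟩^{α-β}`.
  set W : PhaseSpace d n α := mk (fun x => (jap x ^ (β - α) • Y.u x, jap x ^ (β - α) • Y.v x))
    (hs.congr fun x => (he x).symm) with hW
  refine ⟨W, ?_, ?_⟩
  · rw [mem_closedBall_zero_iff]
    refine le_of_sq_le_sq ?_ hR
    rw [norm_sq]
    have h1 : ∀ x, jap x ^ (2 * α) * (‖W.u x‖ ^ 2 + ‖W.v x‖ ^ 2) =
      jap x ^ (2 * β) * ∑ i, coord x i Y ^ 2 := he
    rw [tsum_congr h1]
    rw [← ENNReal.ofReal_tsum_of_nonneg hnn hs] at hY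
    exact (ENNReal.ofReal_le_ofReal_iff (by positivity)).mp hY
  · have h1 : ∀ x : Lattice d, jap x ^ (α - β) * jap x ^ (β - α) = 1 := fun x => by
      rw [← Real.rpow_add (jap_pos x)]
      simp
    refine PhaseSpace.ext (fun x => ?_) fun x => ?_
    · change jap x ^ (α - β) • jap x ^ (β - α) • Y.u x = Y.u x
      rw [smul_smul, h1, one_smul]
    · change jap x ^ (α - β) • jap x ^ (β - α) • Y.v x = Y.v x
      rw [smul_smul, h1, one_smul]

/-- Probability measures on `H_α` with uniformly bounded second moments of the coordinates are
tight. -/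
lemma isTightMeasureSet_of_integral_sq_le (hα : α < -(d : ℝ) / 2) {S : Set (Measure (PhaseSpace d n α))}
    {C : ℝ} (hC : ∀ μ ∈ S, ∀ x i, Integrable (fun Y => coord x i Y ^ 2) μ ∧
      ∫ Y, coord x i Y ^ 2 ∂μ ≤ C) : IsTightMeasureSet S := by
  rw [isTightMeasureSet_iff_exists_isCompact_measure_compl_le]
  intro ε hε
  -- The exponent `β` leaves room on both sides: `β < -d/2` makes the expected `H_β` norm squared
  -- finite and `α < β` makes the embedding compact.
  obtain ⟨β, hαβ, hβ⟩ := exists_between hα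
  set M : ENNReal := ∑' x : Lattice d, ENNReal.ofReal (jap x ^ (2 * β) * ∑ _i : Fin n ⊕ Fin n, |C|)
    with hM
  have hMtop : M ≠ ⊤ := by
    rw [hM, ← ENNReal.ofReal_tsum_of_nonneg (fun x => mul_nonneg (Real.rpow_nonneg (jap_pos x).le _)
      (by positivity)) ((summable_jap_rpow (by linarith)).mul_right _)]
    exact ENNReal.ofReal_ne_top
  obtain ⟨R, hR0, hR⟩ : ∃ R : ℝ, 0 < R ∧ M / ENNReal.ofReal (R ^ 2) ≤ ε := by
    rcases eq_or_ne ε ⊤ with rfl | hεt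
    · exact ⟨1, one_pos, le_top⟩
    -- Markov's inequality asks for `M / R² ≤ ε`; `R² = M / ε + 1` satisfies this and is positive
    -- also when `M = 0`.
    · refine ⟨√(M.toReal / ε.toReal + 1), Real.sqrt_pos.mpr (by positivity), ?_⟩
      have he : 0 < ε.toReal := ENNReal.toReal_pos hε.ne' hεt
      rw [Real.sq_sqrt (by positivity)]
      refine ENNReal.div_le_of_le_mul ?_
      rw [← ENNReal.ofReal_toReal hMtop, ← ENNReal.ofReal_toReal hεt,
        ← ENNReal.ofReal_mul (by positivity)]
      refine ENNReal.ofReal_le_ofReal ?_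
      rw [ENNReal.toReal_ofReal (by positivity), ENNReal.toReal_ofReal (by positivity)]
      field_simp
      linarith
  obtain ⟨K, hK, hKm⟩ := exists_isCompact_of_rpow (d := d) (n := n) hαβ hR0.le
  refine ⟨K, hK, fun μ hμ => ?_⟩
  set f : PhaseSpace d n α → ENNReal := fun Y =>
    ∑' x, ENNReal.ofReal (jap x ^ (2 * β) * ∑ i, coord x i Y ^ 2) with hf
  have hfx : ∀ x, Measurable fun Y : PhaseSpace d n α =>
      ENNReal.ofReal (jap x ^ (2 * β) * ∑ i, coord x i Y ^ 2) := fun x => by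
    have : ∀ i, Measurable (coord (n := n) (α := α) x i) := fun i => (coord x i).continuous.measurable
    fun_prop
  have hfm : Measurable f := Measurable.tsum hfx
  have hint : ∫⁻ Y, f Y ∂μ ≤ M := by
    rw [hf, lintegral_tsum fun x => (hfx x).aemeasurable]
    refine ENNReal.tsum_le_tsum fun x => ?_
    have hi : Integrable (fun Y => jap x ^ (2 * β) * ∑ i, coord x i Y ^ 2) μ :=
      (integrable_finsetSum _ fun i _ => (hC μ hμ x i).1).const_mul _
    rw [← ofReal_integral_eq_lintegral_ofReal hi (ae_of_all _ fun Y =>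
      mul_nonneg (Real.rpow_nonneg (jap_pos x).le _) (Finset.sum_nonneg fun i _ => sq_nonneg _)),
      integral_const_mul, integral_finsetSum _ fun i _ => (hC μ hμ x i).1]
    refine ENNReal.ofReal_le_ofReal (mul_le_mul_of_nonneg_left ?_ (Real.rpow_nonneg (jap_pos x).le _))
    exact Finset.sum_le_sum fun i _ => (hC μ hμ x i).2.trans (le_abs_self C)
  calc μ Kᶜ ≤ μ {Y | ENNReal.ofReal (R ^ 2) ≤ f Y} := measure_mono fun Y hY => by
        by_contra hc
        exact hY (hKm Y (not_le.mp hc).le)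
    _ ≤ (∫⁻ Y, f Y ∂μ) / ENNReal.ofReal (R ^ 2) := meas_ge_le_lintegral_div hfm.aemeasurable
        (ENNReal.ofReal_pos.mpr (by positivity)).ne' ENNReal.ofReal_ne_top
    _ ≤ ε := (ENNReal.div_le_div_right hint _).trans hR

end PhaseSpace

end

section

/-! ### The limit state -/

open PhaseSpace

variable {d n k : ℕ} {α : ℝ} {V : Lattice d → Matrix (Fin n) (Fin n) ℝ}

lemma integral_add_sq {Ω : Type*} [MeasurableSpace Ω] {P : Measure Ω} {f g : Ω → ℝ}
    (hf : MemLp f 2 P) (hg : MemLp g 2 P) :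
    ∫ w, (f w + g w) ^ 2 ∂P = ∫ w, f w ^ 2 ∂P + 2 * ∫ w, f w * g w ∂P + ∫ w, g w ^ 2 ∂P := by
  have h1 : Integrable (fun w => 2 * (f w * g w)) P := (hf.integrable_mul hg).const_mul 2
  have h2 : Integrable (fun w => f w ^ 2 + 2 * (f w * g w)) P := hf.integrable_sq.add h1
  rw [← integral_const_mul, ← integral_add hf.integrable_sq h1, ← integral_add h2 hg.integrable_sq]
  refine integral_congr_ae (ae_of_all _ fun w => ?_)
  simp only
  ring

namespace IsInitialState

variable {hk : k ≤ d} {T : Corner k → ℝ} {ζ : Fin 2 → ℤ → ℝ} {Ω : Type*} [MeasurableSpace Ω]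
  {P : Measure Ω} {Y : Corner k → Ω → PhaseSpace d n α} {Y₀ : Ω → PhaseSpace d n α}
  {a : ℝ}

/-- The algebraic properties of `limCov` are inherited from the covariances at finite times by
uniqueness of limits, which avoids working with its Fourier formula. -/
lemma limCov_smul (h : IsInitialState hk V T ζ P Y Y₀) (hV : Admissible V) (hα : α < -(d : ℝ) / 2)
    (hζ : IsCutoff a ζ) (r : ℝ) (L : PhaseSpace d n α →L[ℝ] ℝ) :
    limCov hk V T (r • L) (r • L) = r ^ 2 * limCov hk V T L L := by
  refine tendsto_nhds_unique (h.tendsto_integral_mul hV hα hζ (r • L) (r • L)) ?_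
  refine ((h.tendsto_integral_mul hV hα hζ L L).const_mul (r ^ 2)).congr fun t => ?_
  rw [← integral_const_mul]
  refine integral_congr_ae (ae_of_all _ fun w => ?_)
  simp only [smul_apply, smul_eq_mul]
  ring

lemma limCov_self_nonneg (h : IsInitialState hk V T ζ P Y Y₀) (hV : Admissible V)
    (hα : α < -(d : ℝ) / 2) (hζ : IsCutoff a ζ) (L : PhaseSpace d n α →L[ℝ] ℝ) :
    0 ≤ limCov hk V T L L :=
  ge_of_tendsto' (h.tendsto_integral_mul hV hα hζ L L) fun _ =>
    integral_nonneg fun _ => mul_self_nonneg _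

/-- Composition with the propagator shifts time by `s`, which does not change the limit. This is the
stationarity of the limit state. -/
lemma limCov_comp_propagator (h : IsInitialState hk V T ζ P Y Y₀) (hV : Admissible V)
    (hα : α < -(d : ℝ) / 2) (hζ : IsCutoff a ζ) (s : ℝ) (L : PhaseSpace d n α →L[ℝ] ℝ) :
    limCov hk V T (L.comp (propagator V α s)) (L.comp (propagator V α s)) = limCov hk V T L L := by
  refine tendsto_nhds_unique (h.tendsto_integral_mul hV hα hζ _ _) ?_
  refine ((h.tendsto_integral_mul hV hα hζ L L).comp (tendsto_atTop_add_const_left atTop s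
    tendsto_id)).congr fun t => ?_
  simp only [Function.comp_apply, id, propagator_add, ContinuousLinearMap.comp_apply]

lemma memLp_propagator (h : IsInitialState hk V T ζ P Y Y₀) (hζ : IsCutoff a ζ) (t : ℝ)
    (L : PhaseSpace d n α →L[ℝ] ℝ) : MemLp (fun w => L (propagator V α t (Y₀ w))) 2 P :=
  ((h.hasGaussianLaw hζ).map_fun (L.comp (propagator V α t))).memLp_two

lemma limCov_add (h : IsInitialState hk V T ζ P Y Y₀) (hV : Admissible V) (hα : α < -(d : ℝ) / 2)
    (hζ : IsCutoff a ζ) (L L' : PhaseSpace d n α →L[ℝ] ℝ) :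
    limCov hk V T (L + L') (L + L') =
      limCov hk V T L L + 2 * limCov hk V T L L' + limCov hk V T L' L' := by
  refine tendsto_nhds_unique (h.tendsto_integral_mul hV hα hζ (L + L') (L + L')) ?_
  refine (((h.tendsto_integral_mul hV hα hζ L L).add
    ((h.tendsto_integral_mul hV hα hζ L L').const_mul 2)).add
    (h.tendsto_integral_mul hV hα hζ L' L')).congr fun t => ?_
  simp only [← sq, add_apply]
  exact (integral_add_sq (h.memLp_propagator hζ t L) (h.memLp_propagator hζ t L')).symm

lemma measurable_propagator (h : IsInitialState hk V T ζ P Y Y₀) (hζ : IsCutoff a ζ) (t : ℝ) :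
    Measurable fun w => propagator V α t (Y₀ w) :=
  (propagator V α t).continuous.measurable.comp (h.measurable_initial hζ)

lemma integral_propagator (h : IsInitialState hk V T ζ P Y Y₀) (hζ : IsCutoff a ζ) (t : ℝ)
    (L : PhaseSpace d n α →L[ℝ] ℝ) : ∫ w, L (propagator V α t (Y₀ w)) ∂P = 0 := by
  have := h.indep.isProbabilityMeasure
  obtain ⟨Z, hZ⟩ := hζ.exists_abs_cutoffProd_le hk
  simp only [h.apply_propagator hZ]
  rw [integral_finsetSum _ fun c _ => (h.memLp_apply c _).integrable one_le_two]
  exact Finset.sum_eq_zero fun c _ => h.integral_apply c _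

/-- The characteristic function of the evolved state. -/
lemma charFunDual_map (h : IsInitialState hk V T ζ P Y Y₀) (hζ : IsCutoff a ζ) (t : ℝ)
    (L : PhaseSpace d n α →L[ℝ] ℝ) :
    charFunDual (P.map fun w => propagator V α t (Y₀ w)) L = Complex.exp
      (-((∫ w, L (propagator V α t (Y₀ w)) * L (propagator V α t (Y₀ w)) ∂P : ℝ) : ℂ) / 2) := by
  have hg : IsGaussian (P.map fun w => propagator V α t (Y₀ w)) :=
    ((h.hasGaussianLaw hζ).map_fun (propagator V α t)).isGaussian_map
  have hm := (h.measurable_propagator hζ t).aemeasurable (μ := P)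
  have h0 : ∫ Z, L Z ∂(P.map fun w => propagator V α t (Y₀ w)) = 0 := by
    rw [integral_map hm L.continuous.aestronglyMeasurable, h.integral_propagator hζ]
  rw [IsGaussian.charFunDual_eq, integral_complex_ofReal, h0, variance_of_integral_eq_zero L.continuous.aemeasurable h0,
    integral_map hm (by exact (L.continuous.pow 2).aestronglyMeasurable)]
  simp only [sq]
  congr 1
  simp
  ring

lemma integral_sq_of_map_eq {E : Type*} [NormedAddCommGroup E] [NormedSpace ℝ E] [MeasurableSpace E]
    [BorelSpace E] {μ : Measure E} {L : StrongDual ℝ E} {v : ℝ} (hv : 0 ≤ v)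
    (h : μ.map L = gaussianReal 0 v.toNNReal) : ∫ Z, L Z ^ 2 ∂μ = v := by
  have h1 := variance_id_gaussianReal (μ := 0) (v := v.toNNReal)
  rw [variance_of_integral_eq_zero aemeasurable_id (by simp [integral_id_gaussianReal])] at h1
  rw [Real.coe_toNNReal _ hv, ← h, integral_map L.continuous.aemeasurable
    (by exact (continuous_id.pow 2).aestronglyMeasurable)] at h1
  exact h1

/-- The law of the evolved state converges weakly to a stationary Gaussian measure with the
covariance `limCov`. -/
lemma exists_limit (h : IsInitialState hk V T ζ P Y Y₀) (hV : Admissible V)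
    (hα : α < -(d : ℝ) / 2) (hζ : IsCutoff a ζ) :
    ∃ μ : Measure (PhaseSpace d n α), IsProbabilityMeasure μ ∧ IsGaussian μ ∧
      (∀ f : BoundedContinuousFunction (PhaseSpace d n α) ℝ,
        Tendsto (fun t : ℝ => ∫ w, f (propagator V α t (Y₀ w)) ∂P) atTop (𝓝 (∫ Z, f Z ∂μ))) ∧
      (∀ t : ℝ, μ.map (propagator V α t) = μ) ∧
      ∀ L L' : PhaseSpace d n α →L[ℝ] ℝ, ∫ Z, L Z * L' Z ∂μ = limCov hk V T L L' := by
  have := h.indep.isProbabilityMeasure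
  have hm := fun t => (h.measurable_propagator hζ t).aemeasurable (μ := P)
  set ν : ℝ → ProbabilityMeasure (PhaseSpace d n α) := fun t =>
    ⟨P.map fun w => propagator V α t (Y₀ w), Measure.isProbabilityMeasure_map (hm t)⟩ with hν
  have ht : IsTightMeasureSet {((μ : ProbabilityMeasure (PhaseSpace d n α)) : Measure (PhaseSpace d n α)) |
      μ ∈ Set.range ν} := by
    obtain ⟨C, hC⟩ := h.exists_integral_sq_le hV hα hζ
    refine isTightMeasureSet_of_integral_sq_le hα (C := C) ?_
    rintro _ ⟨_, ⟨t, rfl⟩, rfl⟩ x i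
    have hc : AEStronglyMeasurable (fun Y => coord (α := α) x i Y ^ 2)
        (P.map fun w => propagator V α t (Y₀ w)) :=
      ((coord x i).continuous.pow 2).aestronglyMeasurable
    change Integrable _ (P.map fun w => propagator V α t (Y₀ w)) ∧
      ∫ Y, coord x i Y ^ 2 ∂(P.map fun w => propagator V α t (Y₀ w)) ≤ C
    refine ⟨(integrable_map_measure hc (hm t)).mpr (h.memLp_propagator hζ t (coord x i)).integrable_sq, ?_⟩
    rw [integral_map (hm t) hc]
    exact hC t x i
  have hφ : ∀ L, Tendsto (fun t => charFunDual (ν t : Measure (PhaseSpace d n α)) L) atTop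
      (𝓝 (Complex.exp (-(limCov hk V T L L : ℂ) / 2))) := fun L => by
    have h1 : Continuous fun r : ℝ => Complex.exp (-(r : ℂ) / 2) := by fun_prop
    refine ((h1.tendsto _).comp (h.tendsto_integral_mul hV hα hζ L L)).congr fun t => ?_
    exact (h.charFunDual_map hζ t L).symm
  obtain ⟨μ, hμ, hchar⟩ := exists_tendsto_of_charFunDual ht hφ
  have hnn := h.limCov_self_nonneg hV hα hζ
  have hmap := map_eq_gaussianReal_of_charFunDual (μ := (μ : Measure (PhaseSpace d n α)))
    (σ := fun L => limCov hk V T L L) hnn (h.limCov_smul hV hα hζ) hchar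
  have hG : IsGaussian (μ : Measure (PhaseSpace d n α)) :=
    isGaussian_of_map_eq_gaussianReal fun L => ⟨0, _, hmap L⟩
  have hsq : ∀ L, ∫ Z, L Z ^ 2 ∂(μ : Measure (PhaseSpace d n α)) = limCov hk V T L L := fun L =>
    integral_sq_of_map_eq (hnn L) (hmap L)
  refine ⟨μ, inferInstance, hG, fun f => ?_, fun t => ?_, fun L L' => ?_⟩
  · refine (ProbabilityMeasure.tendsto_iff_forall_integral_tendsto.mp hμ f).congr fun t => ?_
    exact integral_map (hm t) f.continuous.aestronglyMeasurable
  · have : IsProbabilityMeasure ((μ : Measure (PhaseSpace d n α)).map (propagator V α t)) :=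
      Measure.isProbabilityMeasure_map (propagator V α t).continuous.aemeasurable
    refine Measure.ext_of_charFunDual (funext fun L => ?_)
    rw [_root_.MeasureTheory.charFunDual_map, hchar, hchar, h.limCov_comp_propagator hV hα hζ]
  -- Weak convergence alone does not give convergence of second moments. The quadratic ones are read
  -- off from the Gaussian characteristic functional, and polarization yields the mixed ones.
  · have hL : ∀ M : PhaseSpace d n α →L[ℝ] ℝ, MemLp M 2 (μ : Measure (PhaseSpace d n α)) := fun M =>
      IsGaussian.memLp_dual _ M 2 (by norm_num)
    have h1 : ∫ Z, (L + L') Z ^ 2 ∂(μ : Measure (PhaseSpace d n α)) =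
        ∫ Z, L Z ^ 2 ∂(μ : Measure (PhaseSpace d n α)) +
        2 * ∫ Z, L Z * L' Z ∂(μ : Measure (PhaseSpace d n α)) +
        ∫ Z, L' Z ^ 2 ∂(μ : Measure (PhaseSpace d n α)) := integral_add_sq (hL L) (hL L')
    have h2 := h.limCov_add hV hα hζ L L'
    rw [hsq, hsq, hsq] at h1
    linarith

end IsInitialState

end

section

/-! ### The mean energy current -/

open PhaseSpace

variable {d n k : ℕ} {α : ℝ} {V : Lattice d → Matrix (Fin n) (Fin n) ℝ}

/-- The indicator of the bonds that cross the hyperplane from below. -/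
def exitInd (m p : ℤ) : ℝ := if m ≤ -1 ∧ 0 ≤ p then 1 else 0

/-- The indicator of the bonds that cross the hyperplane from above. -/
def entryInd (m p : ℤ) : ℝ := if 0 ≤ m ∧ p ≤ -1 then 1 else 0

lemma hasSum_indicator_Icc (a b : ℤ) :
    HasSum (fun m : ℤ => if m ∈ Finset.Icc a b then (1 : ℝ) else 0) (b + 1 - a).toNat := by
  have h : HasSum (fun m : ℤ => if m ∈ Finset.Icc a b then (1 : ℝ) else 0)
      (∑ m ∈ Finset.Icc a b, if m ∈ Finset.Icc a b then (1 : ℝ) else 0) :=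
    hasSum_sum_of_ne_finset_zero fun m hm => if_neg hm
  rw [Finset.sum_congr rfl fun m hm => if_pos hm] at h
  simpa using h

/-- Here `r` is the `l`-component of the displacement from `y` to `x' + m e_l`, so that `y_l = m -
r`. The bond is counted for `r ≤ m ≤ -1`, that is `max(-r, 0)` times. -/
lemma hasSum_exitInd (r : ℤ) : HasSum (fun m => exitInd m (m - r)) ((-r).toNat : ℝ) := by
  have h := hasSum_indicator_Icc r (-1)
  rw [show (-1 : ℤ) + 1 - r = -r by ring] at h
  refine h.congr_fun fun m => ?_
  simp only [exitInd, Finset.mem_Icc]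
  congr 1
  exact propext (by omega)

lemma hasSum_entryInd (r : ℤ) : HasSum (fun m => entryInd m (m - r)) (r.toNat : ℝ) := by
  have h := hasSum_indicator_Icc 0 (r - 1)
  rw [show r - 1 + 1 - 0 = r by ring] at h
  refine h.congr_fun fun m => ?_
  simp only [entryInd, Finset.mem_Icc]
  congr 1
  exact propext (by omega)

lemma exitInd_nonneg (m p : ℤ) : 0 ≤ exitInd m p := by unfold exitInd; split_ifs <;> norm_num

lemma entryInd_nonneg (m p : ℤ) : 0 ≤ entryInd m p := by unfold entryInd; split_ifs <;> norm_num

/-- The two orientations together weight a displacement by `-r`; this linear factor is what becomes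
the derivative of `V̂`. -/
lemma toNat_neg_sub_toNat (r : ℤ) : ((-r).toNat : ℝ) - (r.toNat : ℝ) = -r := by
  have h : ((-r).toNat : ℤ) - (r.toNat : ℤ) = -r := by omega
  exact_mod_cast h

lemma toNat_neg_le_abs (r : ℤ) : ((-r).toNat : ℝ) ≤ |(r : ℝ)| := by
  have h : ((-r).toNat : ℤ) ≤ |r| := by
    have := neg_le_abs r; have := abs_nonneg r; omega
  exact_mod_cast h

lemma toNat_le_abs (r : ℤ) : (r.toNat : ℝ) ≤ |(r : ℝ)| := by
  have h : (r.toNat : ℤ) ≤ |r| := by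
    have := le_abs_self r; have := abs_nonneg r; omega
  exact_mod_cast h

/-- The displacement along a bond between the half-line above and below `x'` and the lattice. -/
def bondVec (l : Fin d) (x' : Lattice d) (q : ℤ × Lattice d) : Lattice d := x' + Pi.single l q.1 - q.2

/-- The number of bonds with a given displacement that cross the hyperplane. -/
lemma hasSum_bond {ind : ℤ → ℤ → ℝ} {N : ℤ → ℝ} (h0 : ∀ m p, 0 ≤ ind m p)
    (hN : ∀ r, HasSum (fun m => ind m (m - r)) (N r)) (l : Fin d) {x' : Lattice d} (hx : x' l = 0)
    {g : Lattice d → ℝ} (hg : Summable fun z => N (z l) * |g z|) :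
    HasSum (fun q : ℤ × Lattice d => ind q.1 (q.2 l) * g (bondVec l x' q)) (∑' z, N (z l) * g z) := by
  -- The endpoint `y` is exchanged for the displacement `z = x' + m e_l - y`. For fixed `z` the sum
  -- over `m` then counts the bonds, which uses `x' l = 0`.
  set e : ℤ × Lattice d ≃ ℤ × Lattice d :=
    Equiv.prodShear (Equiv.refl ℤ) fun m => Equiv.subLeft (x' + Pi.single l m) with he
  set f : ℤ × Lattice d → ℝ := fun q => ind q.1 (q.2 l) * g (bondVec l x' q) with hf
  have hfe : ∀ q : Lattice d × ℤ, f (e q.swap) = ind q.2 (q.2 - q.1 l) * g q.1 := by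
    rintro ⟨z, m⟩
    have h1 : e (m, z) = (m, x' + Pi.single l m - z) := rfl
    simp only [Prod.swap_prod_mk, h1, hf, bondVec, sub_sub_cancel]
    simp [hx]
  have habs : Summable fun q : Lattice d × ℤ => ind q.2 (q.2 - q.1 l) * |g q.1| := by
    rw [summable_prod_of_nonneg fun q => mul_nonneg (h0 _ _) (abs_nonneg _)]
    refine ⟨fun z => ((hN (z l)).mul_right |g z|).summable, ?_⟩
    simp only [((hN _).mul_right _).tsum_eq]
    exact hg
  have hs : Summable fun q : Lattice d × ℤ => ind q.2 (q.2 - q.1 l) * g q.1 := by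
    refine Summable.of_norm (habs.congr fun q => ?_)
    rw [norm_mul, Real.norm_of_nonneg (h0 _ _), Real.norm_eq_abs]
  have h1 := hs.hasSum.prod_fiberwise fun z => (hN (z l)).mul_right (g z)
  have h2 : HasSum (fun q : Lattice d × ℤ => f (e q.swap)) (∑' z, N (z l) * g z) := by
    rw [h1.tsum_eq]
    exact hs.hasSum.congr_fun hfe
  exact (((Equiv.prodComm _ _).trans e).hasSum_iff (f := f)).mp h2

lemma summable_bond {ind : ℤ → ℤ → ℝ} {N : ℤ → ℝ} (h0 : ∀ m p, 0 ≤ ind m p)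
    (hN : ∀ r, HasSum (fun m => ind m (m - r)) (N r)) (hN1 : ∀ r : ℤ, N r ≤ |(r : ℝ)|) (l : Fin d)
    {x' : Lattice d} (hx : x' l = 0) {g : Lattice d → ℝ} (hg : Summable fun z => |(z l : ℝ)| * |g z|) :
    Summable fun q : ℤ × Lattice d => ind q.1 (q.2 l) * g (bondVec l x' q) :=
  (hasSum_bond h0 hN l hx (hg.of_nonneg_of_le
    (fun z => mul_nonneg ((hN (z l)).nonneg fun _ => h0 _ _) (abs_nonneg _)) fun _ =>
      mul_le_mul_of_nonneg_right (hN1 _) (abs_nonneg _))).summable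

lemma integrable_tsum_of_summable_integral_norm {ι Ω : Type*} [Countable ι] [MeasurableSpace Ω]
    {P : Measure Ω} {F : ι → Ω → ℝ} (hm : ∀ i, Measurable (F i)) (hi : ∀ i, Integrable (F i) P)
    (hs : Summable fun i => ∫ w, ‖F i w‖ ∂P) : Integrable (fun w => ∑' i, F i w) P := by
  refine ⟨(Measurable.tsum hm).aestronglyMeasurable, ?_⟩
  refine (lintegral_mono fun w => enorm_tsum_le_tsum_enorm).trans_lt ?_
  rw [lintegral_tsum fun i => (hm i).enorm.aemeasurable]
  have h1 : ∀ i, ∫⁻ w, ‖F i w‖ₑ ∂P = ENNReal.ofReal (∫ w, ‖F i w‖ ∂P) := fun i =>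
    (ofReal_integral_norm_eq_lintegral_enorm (hi i)).symm
  simp only [h1]
  rw [← ENNReal.ofReal_tsum_of_nonneg (fun i => integral_nonneg fun _ => norm_nonneg _) hs]
  exact ENNReal.ofReal_lt_top

/-- A random phase point whose coordinates have bounded second moments. -/
structure HasMomentBound {Ω : Type*} [MeasurableSpace Ω] (P : Measure Ω) (X : Ω → PhaseSpace d n α)
    (C : ℝ) : Prop where
  measurable : Measurable X
  memLp : ∀ x i, MemLp (fun w => coord x i (X w)) 2 P
  le : ∀ x i, ∫ w, coord x i (X w) ^ 2 ∂P ≤ C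

/-- The mean energy exchange along a bond. -/
def bondMean (V : Lattice d → Matrix (Fin n) (Fin n) ℝ) (l : Fin d) (x' : Lattice d)
    (R : Lattice d → Lattice d → Fin n → Fin n → ℝ) (q : ℤ × Lattice d) : ℝ :=
  ∑ a, ∑ b, V (bondVec l x' q) a b * R (x' + Pi.single l q.1) q.2 a b

lemma abs_bondMean_le {l : Fin d} {x' : Lattice d} {R : Lattice d → Lattice d → Fin n → Fin n → ℝ}
    {C : ℝ} (hR : ∀ x y a b, |R x y a b| ≤ C) (q : ℤ × Lattice d) :
    |bondMean V l x' R q| ≤ ∑ a, ∑ b, |V (bondVec l x' q) a b| * C := by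
  refine (Finset.abs_sum_le_sum_abs _ _).trans (Finset.sum_le_sum fun a _ => ?_)
  refine (Finset.abs_sum_le_sum_abs _ _).trans (Finset.sum_le_sum fun b _ => ?_)
  rw [abs_mul]
  exact mul_le_mul_of_nonneg_left (hR _ _ _ _) (abs_nonneg _)

lemma Admissible.summable_coord_mul (hV : Admissible V) (l : Fin d) (a b : Fin n) :
    Summable fun z => |(z l : ℝ)| * |V z a b| :=
  (hV.expDecay a b).summable_len1.of_nonneg_of_le
    (fun z => mul_nonneg (abs_nonneg _) (abs_nonneg _)) fun z => by
      rw [Complex.norm_real, Real.norm_eq_abs]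
      exact mul_le_mul_of_nonneg_right (abs_le_len1 z l) (abs_nonneg _)

lemma Admissible.summable_bondBound (hV : Admissible V) (l : Fin d) (C : ℝ) :
    Summable fun z => |(z l : ℝ)| * |∑ a, ∑ b, |V z a b| * C| := by
  have h1 : Summable fun z => ∑ a, ∑ b, (|(z l : ℝ)| * |V z a b|) * |C| :=
    summable_sum fun a _ => summable_sum fun b _ => (hV.summable_coord_mul l a b).mul_right _
  refine h1.of_nonneg_of_le (fun z => by positivity) fun z => ?_
  have h2 : |∑ a, ∑ b, |V z a b| * C| ≤ ∑ a, ∑ b, |V z a b| * |C| := by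
    refine (Finset.abs_sum_le_sum_abs _ _).trans (Finset.sum_le_sum fun a _ => ?_)
    refine (Finset.abs_sum_le_sum_abs _ _).trans (Finset.sum_le_sum fun b _ => ?_)
    rw [abs_mul, abs_abs]
  refine (mul_le_mul_of_nonneg_left h2 (abs_nonneg _)).trans_eq ?_
  simp only [Finset.mul_sum, mul_assoc]

namespace HasMomentBound

variable {Ω : Type*} [MeasurableSpace Ω] {P : Measure Ω} {X : Ω → PhaseSpace d n α} {C : ℝ}

lemma integrable_mul (h : HasMomentBound P X C) (x y : Lattice d) (i j : Fin n ⊕ Fin n) :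
    Integrable (fun w => coord x i (X w) * coord y j (X w)) P := (h.memLp x i).integrable_mul (h.memLp y j)

lemma integral_abs_mul_le (h : HasMomentBound P X C) (x y : Lattice d) (i j : Fin n ⊕ Fin n) :
    ∫ w, |coord x i (X w) * coord y j (X w)| ∂P ≤ C := by
  have h1 : ∫ w, |coord x i (X w) * coord y j (X w)| ∂P ≤
      ∫ w, (1 / 2 * coord x i (X w) ^ 2 + 1 / 2 * coord y j (X w) ^ 2) ∂P := by
    refine integral_mono (h.integrable_mul x y i j).abs
      (((h.memLp x i).integrable_sq.const_mul _).add ((h.memLp y j).integrable_sq.const_mul _))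
      fun w => ?_
    simp only
    rw [abs_mul]
    nlinarith [sq_nonneg (|coord x i (X w)| - |coord y j (X w)|), sq_abs (coord x i (X w)),
      sq_abs (coord y j (X w))]
  rw [integral_add ((h.memLp x i).integrable_sq.const_mul _) ((h.memLp y j).integrable_sq.const_mul _),
    integral_const_mul, integral_const_mul] at h1
  linarith [h.le x i, h.le y j]

lemma abs_integral_mul_le (h : HasMomentBound P X C) (x y : Lattice d) (i j : Fin n ⊕ Fin n) :
    |∫ w, coord x i (X w) * coord y j (X w) ∂P| ≤ C :=
  (abs_integral_le_integral_abs).trans (h.integral_abs_mul_le x y i j)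

lemma inner_eq (M : Matrix (Fin n) (Fin n) ℝ) (x y : Lattice d) (Z : PhaseSpace d n α) :
    inner ℝ (Z.v x) (Matrix.toEuclideanLin M (Z.u y)) =
      ∑ a, ∑ b, M a b * (coord x (Sum.inr a) Z * coord y (Sum.inl b) Z) := by
  rw [PiLp.inner_apply]
  refine Finset.sum_congr rfl fun a _ => ?_
  have h : (Matrix.toEuclideanLin M (Z.u y)) a = ∑ b, M a b * Z.u y b := rfl
  rw [h, real_inner_eq_re_inner, RCLike.inner_apply]
  simp only [coord_inr, coord_inl, Finset.sum_mul, map_sum]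
  refine Finset.sum_congr rfl fun b _ => ?_
  simp
  ring

/-- The energy exchange along the bonds of one orientation has a mean value. -/
lemma integrable_tsum_bond (h : HasMomentBound P X C) (hV : Admissible V) (l : Fin d) {x' : Lattice d}
    (hx : x' l = 0) {ind : ℤ → ℤ → ℝ} {N : ℤ → ℝ} (h0 : ∀ m p, 0 ≤ ind m p)
    (hN : ∀ r, HasSum (fun m => ind m (m - r)) (N r)) (hN1 : ∀ r : ℤ, N r ≤ |(r : ℝ)|) :
    Integrable (fun w => ∑' q : ℤ × Lattice d, ind q.1 (q.2 l) * inner ℝ ((X w).v (x' + Pi.single l q.1))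
      (Matrix.toEuclideanLin (V (bondVec l x' q)) ((X w).u q.2))) P ∧
    ∫ w, ∑' q : ℤ × Lattice d, ind q.1 (q.2 l) * inner ℝ ((X w).v (x' + Pi.single l q.1))
      (Matrix.toEuclideanLin (V (bondVec l x' q)) ((X w).u q.2)) ∂P =
      ∑' q : ℤ × Lattice d, ind q.1 (q.2 l) * bondMean V l x' (fun x y a b =>
        ∫ w, coord x (Sum.inr a) (X w) * coord y (Sum.inl b) (X w) ∂P) q := by
  set F : ℤ × Lattice d → Ω → ℝ := fun q w => ind q.1 (q.2 l) *
    inner ℝ ((X w).v (x' + Pi.single l q.1)) (Matrix.toEuclideanLin (V (bondVec l x' q)) ((X w).u q.2))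
    with hF
  have hFe : ∀ q, F q = fun w => ind q.1 (q.2 l) * ∑ a, ∑ b, V (bondVec l x' q) a b *
      (coord (x' + Pi.single l q.1) (Sum.inr a) (X w) * coord q.2 (Sum.inl b) (X w)) := fun q => by
    funext w
    simp only [hF, inner_eq]
  have hi' : ∀ q, Integrable (fun w => ∑ a, ∑ b, V (bondVec l x' q) a b *
      (coord (x' + Pi.single l q.1) (Sum.inr a) (X w) * coord q.2 (Sum.inl b) (X w))) P := fun q =>
    integrable_finsetSum _ fun a _ => integrable_finsetSum _ fun b _ =>
      (h.integrable_mul _ _ _ _).const_mul _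
  have hi : ∀ q, Integrable (F q) P := fun q => by rw [hFe]; exact (hi' q).const_mul _
  have hm : ∀ q, Measurable (F q) := fun q => by
    rw [hFe]
    have hc : ∀ x i, Measurable fun w => coord x i (X w) := fun x i =>
      (coord x i).continuous.measurable.comp h.measurable
    fun_prop
  have hs : Summable fun q => ∫ w, ‖F q w‖ ∂P := by
    refine (summable_bond h0 hN hN1 l hx (hV.summable_bondBound l C)).of_nonneg_of_le
      (fun q => integral_nonneg fun _ => norm_nonneg _) fun q => ?_
    rw [hFe]
    simp only [norm_mul, Real.norm_of_nonneg (h0 _ _), integral_const_mul]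
    refine mul_le_mul_of_nonneg_left ?_ (h0 _ _)
    have hi2 : ∀ a b, Integrable (fun w => |V (bondVec l x' q) a b| *
      |coord (x' + Pi.single l q.1) (Sum.inr a) (X w) * coord q.2 (Sum.inl b) (X w)|) P := fun a b =>
        (h.integrable_mul _ _ _ _).abs.const_mul _
    have h1 : ∫ w, ‖∑ a, ∑ b, V (bondVec l x' q) a b *
      (coord (x' + Pi.single l q.1) (Sum.inr a) (X w) * coord q.2 (Sum.inl b) (X w))‖ ∂P ≤
      ∫ w, ∑ a, ∑ b, |V (bondVec l x' q) a b| *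
      |coord (x' + Pi.single l q.1) (Sum.inr a) (X w) * coord q.2 (Sum.inl b) (X w)| ∂P := by
      refine integral_mono (hi' q).norm (integrable_finsetSum _ fun a _ =>
        integrable_finsetSum _ fun b _ => hi2 a b) fun w => ?_
      simp only [Real.norm_eq_abs]
      refine (Finset.abs_sum_le_sum_abs _ _).trans (Finset.sum_le_sum fun a _ => ?_)
      refine (Finset.abs_sum_le_sum_abs _ _).trans (Finset.sum_le_sum fun b _ => ?_)
      rw [abs_mul]
    refine h1.trans ?_
    rw [integral_finsetSum _ fun a _ => integrable_finsetSum _ fun b _ => hi2 a b]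
    refine Finset.sum_le_sum fun a _ => ?_
    rw [integral_finsetSum _ fun b _ => hi2 a b]
    refine Finset.sum_le_sum fun b _ => ?_
    rw [integral_const_mul]
    exact mul_le_mul_of_nonneg_left (h.integral_abs_mul_le _ _ _ _) (abs_nonneg _)
  refine ⟨integrable_tsum_of_summable_integral_norm hm hi hs, ?_⟩
  rw [← (hasSum_integral_of_summable_integral_norm hi hs).tsum_eq]
  refine tsum_congr fun q => ?_
  rw [hFe, integral_const_mul, bondMean]
  congr 1
  have hab : ∀ a b, Integrable (fun w => V (bondVec l x' q) a b *
      (coord (x' + Pi.single l q.1) (Sum.inr a) (X w) * coord q.2 (Sum.inl b) (X w))) P := fun a b =>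
    (h.integrable_mul _ _ _ _).const_mul _
  rw [integral_finsetSum _ fun a _ => integrable_finsetSum _ fun b _ => hab a b]
  refine Finset.sum_congr rfl fun a _ => ?_
  rw [integral_finsetSum _ fun b _ => hab a b]
  exact Finset.sum_congr rfl fun b _ => integral_const_mul _ _

lemma current_eq (l : Fin d) (x' : Lattice d) (Z : PhaseSpace d n α) :
    current V l x' Z = 1 / 2 * ((∑' q : ℤ × Lattice d, exitInd q.1 (q.2 l) *
      inner ℝ (Z.v (x' + Pi.single l q.1)) (Matrix.toEuclideanLin (V (bondVec l x' q)) (Z.u q.2))) -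
      ∑' q : ℤ × Lattice d, entryInd q.1 (q.2 l) *
      inner ℝ (Z.v (x' + Pi.single l q.1)) (Matrix.toEuclideanLin (V (bondVec l x' q)) (Z.u q.2))) := by
  simp only [current, exitInd, entryInd, bondVec, ite_mul, one_mul, zero_mul]

/-- The mean energy current. -/
lemma integrable_current (h : HasMomentBound P X C) (hV : Admissible V) (l : Fin d) {x' : Lattice d}
    (hx : x' l = 0) : Integrable (fun w => current V l x' (X w)) P ∧
    ∫ w, current V l x' (X w) ∂P = 1 / 2 *
      ((∑' q : ℤ × Lattice d, exitInd q.1 (q.2 l) * bondMean V l x' (fun x y a b =>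
        ∫ w, coord x (Sum.inr a) (X w) * coord y (Sum.inl b) (X w) ∂P) q) -
      ∑' q : ℤ × Lattice d, entryInd q.1 (q.2 l) * bondMean V l x' (fun x y a b =>
        ∫ w, coord x (Sum.inr a) (X w) * coord y (Sum.inl b) (X w) ∂P) q) := by
  obtain ⟨h1, e1⟩ := h.integrable_tsum_bond hV l hx exitInd_nonneg hasSum_exitInd toNat_neg_le_abs
  obtain ⟨h2, e2⟩ := h.integrable_tsum_bond hV l hx entryInd_nonneg hasSum_entryInd toNat_le_abs
  simp only [current_eq]
  refine ⟨(h1.sub h2).const_mul _, ?_⟩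
  rw [integral_const_mul, integral_sub h1 h2, e1, e2]

end HasMomentBound

/-- The mean exchange converges together with the covariances. -/
lemma tendsto_tsum_bondMean (hV : Admissible V) (l : Fin d) {x' : Lattice d} (hx : x' l = 0)
    {ind : ℤ → ℤ → ℝ} {N : ℤ → ℝ} (h0 : ∀ m p, 0 ≤ ind m p)
    (hN : ∀ r, HasSum (fun m => ind m (m - r)) (N r)) (hN1 : ∀ r : ℤ, N r ≤ |(r : ℝ)|) {C : ℝ}
    {R : ℝ → Lattice d → Lattice d → Fin n → Fin n → ℝ} {R' : Lattice d → Lattice d → Fin n → Fin n → ℝ}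
    (hR : ∀ t x y a b, |R t x y a b| ≤ C)
    (hlim : ∀ x y a b, Tendsto (fun t => R t x y a b) atTop (𝓝 (R' x y a b))) :
    Tendsto (fun t => ∑' q : ℤ × Lattice d, ind q.1 (q.2 l) * bondMean V l x' (R t) q) atTop
      (𝓝 (∑' q : ℤ × Lattice d, ind q.1 (q.2 l) * bondMean V l x' R' q)) := by
  -- A displacement `z` occurs at most `|z_l|` times and `|z_l| |V(z)|` is summable, so `C |V|`
  -- dominates the sum over all bonds.
  refine tendsto_tsum_of_dominated_convergence
    (summable_bond h0 hN hN1 l hx (hV.summable_bondBound l C)) (fun q => ?_)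
    (Eventually.of_forall fun t q => ?_)
  · exact (tendsto_finsetSum _ fun a _ => tendsto_finsetSum _ fun b _ =>
      (hlim _ _ a b).const_mul _).const_mul _
  · rw [norm_mul, Real.norm_of_nonneg (h0 _ _)]
    exact mul_le_mul_of_nonneg_left (abs_bondMean_le (hR t) q) (h0 _ _)

/-- The sum over the bonds for translation invariant covariances. -/
lemma tsum_bondMean (hV : Admissible V) (l : Fin d) {x' : Lattice d} (hx : x' l = 0) {C : ℝ}
    {r : Lattice d → Fin n → Fin n → ℝ} (hr : ∀ z a b, |r z a b| ≤ C) :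
    (∑' q : ℤ × Lattice d, exitInd q.1 (q.2 l) * bondMean V l x' (fun x y => r (x - y)) q) -
      ∑' q : ℤ × Lattice d, entryInd q.1 (q.2 l) * bondMean V l x' (fun x y => r (x - y)) q =
      ∑ a, ∑ b, -∑' z, (z l : ℝ) * V z a b * r z a b := by
  set g : Lattice d → ℝ := fun z => ∑ a, ∑ b, V z a b * r z a b with hg
  have hgs : Summable fun z => |(z l : ℝ)| * |g z| := by
    refine (hV.summable_bondBound l C).of_nonneg_of_le (fun z => by positivity) fun z => ?_
    refine mul_le_mul_of_nonneg_left (le_trans ?_ (le_abs_self _)) (abs_nonneg _)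
    refine (Finset.abs_sum_le_sum_abs _ _).trans (Finset.sum_le_sum fun a _ => ?_)
    refine (Finset.abs_sum_le_sum_abs _ _).trans (Finset.sum_le_sum fun b _ => ?_)
    rw [abs_mul]
    exact mul_le_mul_of_nonneg_left (hr _ _ _) (abs_nonneg _)
  have hNs : ∀ {N : ℤ → ℝ}, (∀ r, 0 ≤ N r) → (∀ r : ℤ, N r ≤ |(r : ℝ)|) →
      Summable fun z : Lattice d => N (z l) * |g z| := fun hN0 hN1 =>
    hgs.of_nonneg_of_le (fun z => mul_nonneg (hN0 _) (abs_nonneg _)) fun z =>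
      mul_le_mul_of_nonneg_right (hN1 _) (abs_nonneg _)
  have hNs' : ∀ {N : ℤ → ℝ}, (∀ r, 0 ≤ N r) → (∀ r : ℤ, N r ≤ |(r : ℝ)|) →
      Summable fun z : Lattice d => N (z l) * g z := fun hN0 hN1 =>
    Summable.of_norm ((hNs hN0 hN1).congr fun z => by
      rw [norm_mul, Real.norm_of_nonneg (hN0 _), Real.norm_eq_abs])
  have p1 : ∀ r : ℤ, (0 : ℝ) ≤ ((-r).toNat : ℝ) := fun r => Nat.cast_nonneg _
  have p2 : ∀ r : ℤ, (0 : ℝ) ≤ (r.toNat : ℝ) := fun r => Nat.cast_nonneg _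
  have e1 := hasSum_bond exitInd_nonneg hasSum_exitInd l hx (hNs p1 toNat_neg_le_abs)
  have e2 := hasSum_bond entryInd_nonneg hasSum_entryInd l hx (hNs p2 toNat_le_abs)
  have e3 : ∀ q : ℤ × Lattice d, bondMean V l x' (fun x y => r (x - y)) q = g (bondVec l x' q) :=
    fun q => rfl
  simp only [e3]
  -- Translation invariance lets both orientations be summed over displacements, after which the
  -- counts `max(-z_l, 0)` and `max(z_l, 0)` are subtracted.
  rw [e1.tsum_eq, e2.tsum_eq, ← (hNs' p1 toNat_neg_le_abs).tsum_sub (hNs' p2 toNat_le_abs)]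
  have hs : ∀ a b, Summable fun z : Lattice d => (z l : ℝ) * V z a b * r z a b := fun a b => by
    refine Summable.of_norm (((hV.summable_coord_mul l a b).mul_right C).of_nonneg_of_le
      (fun z => norm_nonneg _) fun z => ?_)
    rw [Real.norm_eq_abs, abs_mul, abs_mul]
    exact mul_le_mul_of_nonneg_left (hr _ _ _) (by positivity)
  simp only [← tsum_neg]
  have h4 := hasSum_sum (s := Finset.univ) fun a _ => hasSum_sum (s := Finset.univ) fun b _ =>
    (hs a b).neg.hasSum
  rw [← h4.tsum_eq]
  refine tsum_congr fun z => ?_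
  rw [← sub_mul, toNat_neg_sub_toNat, hg]
  simp only [Finset.mul_sum]
  refine Finset.sum_congr rfl fun a _ => Finset.sum_congr rfl fun b _ => ?_
  ring

end

section

/-! ### The current of the limiting state -/

open PhaseSpace

variable {d n k : ℕ} {α : ℝ} {V : Lattice d → Matrix (Fin n) (Fin n) ℝ}

/-- Both products are expanded over subsets. Terms of even size agree and cancel, terms of odd size
have opposite signs and double. -/
lemma prod_half_sub_prod_half (x : Fin k → ℝ) :
    ∏ i, (1 - x i) / 2 - ∏ i, (1 + x i) / 2 =
      -2 * ((2 : ℝ) ^ k)⁻¹ * ∑ P : Finset (Fin k) with Odd P.card, ∏ p ∈ P, x p := by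
  have h1 : ∀ P : Finset (Fin k), ∏ p ∈ P, -x p = (-1) ^ P.card * ∏ p ∈ P, x p := fun P => by
    rw [Finset.prod_neg]
  rw [Finset.prod_div_distrib, Finset.prod_div_distrib]
  simp only [sub_eq_add_neg (1 : ℝ), Finset.prod_one_add, Finset.powerset_univ, h1]
  rw [← sub_div, ← Finset.sum_sub_distrib, Finset.sum_filter, div_eq_mul_inv]
  simp only [Finset.prod_const, Finset.card_univ, Fintype.card_fin]
  rw [mul_comm, mul_comm (-2 : ℝ), mul_assoc]
  congr 1
  rw [Finset.mul_sum]
  refine Finset.sum_congr rfl fun P _ => ?_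
  split_ifs with h
  · rw [h.neg_one_pow]; ring
  · rw [(Nat.not_odd_iff_even.mp h).neg_one_pow]; ring

/-- The number of the two modes `±ω_j` whose group velocity points into the corner, counted with
sign. -/
def signedQuadrant (hk : k ≤ d) (V : Lattice d → Matrix (Fin n) (Fin n) ℝ) (c : Corner k) (j : Fin n)
    (θ : Fin d → ℝ) : ℝ := ∑ e : Fin 2, cornerSign e * bandQuadrant hk V c j e θ

/-- For nonzero derivatives the indicator in each direction is half of one minus the product of the
three signs of mode, corner and derivative; the two modes differ by `x ↦ -x` in
`prod_half_sub_prod_half`. -/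
lemma signedQuadrant_eq (hk : k ≤ d) (c : Corner k) (j : Fin n) {θ : Fin d → ℝ}
    (hθ : ∀ i : Fin k, pderiv (Fin.castLE hk i) (freq V j) θ ≠ 0) :
    signedQuadrant hk V c j θ = -2 * ((2 : ℝ) ^ k)⁻¹ * ∑ P : Finset (Fin k) with Odd P.card,
      ((∏ p ∈ P, cornerSign (c p)) * ∏ p ∈ P, Real.sign (pderiv (Fin.castLE hk p) (freq V j) θ)) := by
  have key : ∀ (i : Fin k) (e : Fin 2), (if cornerSign (c i) * (cornerSign e *
      pderiv (Fin.castLE hk i) (freq V j) θ) < 0 then (1 : ℝ) else 0) =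
      (1 - cornerSign e * (cornerSign (c i) * Real.sign (pderiv (Fin.castLE hk i) (freq V j) θ))) / 2 := by
    intro i e
    rcases lt_or_gt_of_ne (hθ i) with h | h <;> rcases cornerSign_eq e with he | he <;>
      rcases cornerSign_eq (c i) with hc | hc <;>
      simp [he, hc, h, h.le, Real.sign_of_neg, Real.sign_of_pos]
  simp only [signedQuadrant, bandQuadrant, quadrant, key, Fin.sum_univ_two, ← Finset.prod_mul_distrib]
  rw [← prod_half_sub_prod_half]
  simp [cornerSign]
  ring

lemma Admissible.measurable_signedQuadrant (hV : Admissible V) (hk : k ≤ d) (c : Corner k) (j : Fin n) :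
    Measurable (signedQuadrant hk V c j) :=
  Finset.measurable_sum _ fun e _ => (hV.measurable_bandQuadrant hk c j e).const_mul _

lemma abs_signedQuadrant_le (hk : k ≤ d) (c : Corner k) (j : Fin n) (θ : Fin d → ℝ) :
    |signedQuadrant hk V c j θ| ≤ 2 := by
  have h : ∀ e, |cornerSign e * bandQuadrant hk V c j e θ| ≤ 1 := fun e => by
    have h1 := abs_bandQuadrant_le (V := V) hk c j e θ
    rw [Complex.norm_real, Real.norm_eq_abs] at h1
    rcases cornerSign_eq e with h | h <;> simpa [h] using h1
  refine (Finset.abs_sum_le_sum_abs _ _).trans ((Finset.sum_le_sum fun e _ => h e).trans_eq ?_)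
  simp

/-- The symbol of the covariance of velocities and displacements in the limiting state. -/
def currentSymbol (hk : k ≤ d) (V : Lattice d → Matrix (Fin n) (Fin n) ℝ) (c : Corner k) (a b : Fin n)
    (θ : Fin d → ℝ) : ℂ :=
  ∑ j, (bandMult V j θ : ℂ)⁻¹ * (((2 * freq V j θ : ℝ) : ℂ)⁻¹ *
    (Complex.I * (signedQuadrant hk V c j θ : ℂ) * bandProj V j θ a b))

lemma bandRow_coord_inr (x : Lattice d) (a : Fin n) (j : Fin n) (e : Fin 2) (b : Fin n) (θ : Fin d → ℝ) :
    bandRow V (coord (α := α) x (Sum.inr a)) j e b θ =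
      Complex.I * ((cornerSign e * freq V j θ : ℝ) : ℂ) * Complex.exp (-(Complex.I * (pair x θ : ℂ))) *
        bandProj V j θ a b := by
  simp [bandRow, hat_coord]

lemma bandRow_coord_inl (x : Lattice d) (a : Fin n) (j : Fin n) (e : Fin 2) (b : Fin n) (θ : Fin d → ℝ) :
    bandRow V (coord (α := α) x (Sum.inl a)) j e b θ =
      Complex.exp (-(Complex.I * (pair x θ : ℂ))) * bandProj V j θ a b := by
  simp [bandRow, hat_coord]

/-- The velocity row carries the factor `i s ω_j` and the displacement row does not. The sign `s`
thus survives in the sum over the two modes and the factors `ω_j` partly cancel; the site dependence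
is only through `x - y`. -/
lemma limForm_coord (hk : k ≤ d) (hV : Admissible V) (c : Corner k) (x y : Lattice d) (a b : Fin n)
    (θ : Fin d → ℝ) :
    limForm hk V c (coord (α := α) x (Sum.inr a)) (coord y (Sum.inl b)) θ =
      Complex.exp (-(Complex.I * (pair (x - y) θ : ℂ))) * currentSymbol hk V c a b θ := by
  have hexp : Complex.exp (-(Complex.I * (pair x θ : ℂ))) *
      starRingEnd ℂ (Complex.exp (-(Complex.I * (pair y θ : ℂ)))) =
      Complex.exp (-(Complex.I * (pair (x - y) θ : ℂ))) := by
    rw [← Complex.exp_conj, ← Complex.exp_add, sub_pair]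
    congr 1
    simp
    ring
  have hproj : ∀ j, ∑ i, bandProj V j θ a i * starRingEnd ℂ (bandProj V j θ b i) = bandProj V j θ a b :=
    fun j => by
      simp only [hV.conj_bandProj]
      rw [← Matrix.mul_apply, hV.bandProj_mul, if_pos rfl]
  have hsum : ∀ j e, ∑ i, bandRow V (coord (α := α) x (Sum.inr a)) j e i θ *
      starRingEnd ℂ (bandRow V (coord (α := α) y (Sum.inl b)) j e i θ) =
      Complex.I * ((cornerSign e * freq V j θ : ℝ) : ℂ) *
        (Complex.exp (-(Complex.I * (pair (x - y) θ : ℂ))) * bandProj V j θ a b) := fun j e => by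
    rw [← hproj j, ← hexp, Finset.mul_sum, Finset.mul_sum]
    refine Finset.sum_congr rfl fun i _ => ?_
    rw [bandRow_coord_inr, bandRow_coord_inl, map_mul]
    ring
  simp only [limForm, hsum, Fintype.sum_prod_type, currentSymbol, signedQuadrant, Finset.mul_sum]
  refine Finset.sum_congr rfl fun j _ => ?_
  have hω : ((freq V j θ : ℝ) : ℂ) ≠ 0 := Complex.ofReal_ne_zero.mpr (hV.freq_pos j θ).ne'
  push_cast
  rw [Fin.sum_univ_two, Fin.sum_univ_two]
  field_simp

lemma Admissible.integrable_currentSymbol (hV : Admissible V) (hk : k ≤ d) (c : Corner k) (a b : Fin n) :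
    Integrable (currentSymbol hk V c a b) (haarTorus d) := by
  obtain ⟨δ, hδ, hlow⟩ := hV.exists_freq_lower
  refine integrable_finsetSum _ fun j _ => ?_
  have h1 := hV.measurable_signedQuadrant hk c j
  have h2 := hV.measurable_bandProj j a b
  have h3 := hV.measurable_freq j
  have h4 := hV.measurable_bandMult j
  refine Integrable.of_bound (C := 1 * ((2 * δ)⁻¹ * (2 * 1))) (by fun_prop) (ae_of_all _ fun θ => ?_)
  rw [norm_mul, norm_mul, norm_mul, norm_mul, norm_inv, norm_inv, Complex.norm_natCast, Complex.norm_real,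
    Complex.norm_I, one_mul, Complex.norm_real, Real.norm_eq_abs, Real.norm_eq_abs,
    abs_of_pos (mul_pos two_pos (hV.freq_pos j θ))]
  have hm : ((bandMult V j θ : ℕ) : ℝ)⁻¹ ≤ 1 :=
    inv_le_one_of_one_le₀ (by exact_mod_cast bandMult_pos j θ)
  have hf : (2 * freq V j θ)⁻¹ ≤ (2 * δ)⁻¹ :=
    inv_anti₀ (by positivity) (mul_le_mul_of_nonneg_left (hlow j θ) zero_le_two)
  have hω : 0 ≤ (2 * freq V j θ)⁻¹ := inv_nonneg.mpr (mul_pos two_pos (hV.freq_pos j θ)).le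
  have hd : 0 ≤ (2 * δ)⁻¹ := by positivity
  exact mul_le_mul hm (mul_le_mul hf (mul_le_mul (abs_signedQuadrant_le hk c j θ)
    (hV.norm_bandProj_le j θ a b) (norm_nonneg _) zero_le_two) (by positivity) hd)
    (by positivity) zero_le_one

/-- The covariance of velocities and displacements in the limiting state is translation invariant. -/
lemma limCov_coord (hk : k ≤ d) (hV : Admissible V) (T : Corner k → ℝ) (x y : Lattice d) (a b : Fin n) :
    limCov hk V T (coord (α := α) x (Sum.inr a)) (coord y (Sum.inl b)) =
      (∑ c, (T c : ℂ) * ∫ θ, Complex.exp (-(Complex.I * (pair (x - y) θ : ℂ))) *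
        currentSymbol hk V c a b θ ∂haarTorus d).re := by
  simp only [limCov, limForm_coord hk hV]

/-- The symmetry `V(-z) = V(z)ᵀ` reverses the sign in the exponential at the price of transposing
the matrix, so the double sum later becomes a trace. -/
lemma Admissible.fourierSum_coord_mul (hV : Admissible V) (l : Fin d) (a b : Fin n) (θ : Fin d → ℝ) :
    fourierSum (fun z => (z l : ℂ) * (V z a b : ℂ)) θ = Complex.I * dVhat V l θ b a := by
  rw [fourierSum_eq, dVhat, Matrix.of_apply, expSeries, ← tsum_mul_left,
    ← (Equiv.neg (Lattice d)).tsum_eq]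
  refine tsum_congr fun z => ?_
  have h : V (-z) a b = V z b a := by rw [hV.symm]; rfl
  simp only [Equiv.neg_apply, h, neg_pair, Pi.neg_apply, Complex.ofReal_neg, mul_neg, neg_neg]
  push_cast
  linear_combination (-Complex.exp (Complex.I * (pair z θ : ℂ)) * (z l : ℂ) * (V z b a : ℂ)) * Complex.I_mul_I

/-- The trace over a band is `bandMult · 2ω_j ∂_lω_j` by Hellmann–Feynman, and the prefactors of the
symbol cancel both `bandMult` and `2ω_j`. -/
lemma Admissible.sum_dVhat_mul_currentSymbol (hV : Admissible V) (hk : k ≤ d) (c : Corner k) (l : Fin d)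
    {θ : Fin d → ℝ} (hθ : θ ∉ crossingSet V) :
    ∑ a, ∑ b, -(Complex.I * dVhat V l θ b a * currentSymbol hk V c a b θ) =
      ((∑ j, signedQuadrant hk V c j θ * pderiv l (freq V j) θ : ℝ) : ℂ) := by
  have h1 : ∀ j, ∑ a, ∑ b, dVhat V l θ b a * bandProj V j θ a b =
      ((bandMult V j θ * (2 * freq V j θ * pderiv l (freq V j) θ) : ℝ) : ℂ) := fun j => by
    rw [← hV.trace_dVhat_mul_bandProj hθ l j, Finset.sum_comm]
    rfl
  have h2 : ∀ j, (signedQuadrant hk V c j θ : ℂ) * (pderiv l (freq V j) θ : ℂ) =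
      (bandMult V j θ : ℂ)⁻¹ * (((2 * freq V j θ : ℝ) : ℂ)⁻¹ * (signedQuadrant hk V c j θ : ℂ)) *
        ∑ a, ∑ b, dVhat V l θ b a * bandProj V j θ a b := fun j => by
    have hω : ((freq V j θ : ℝ) : ℂ) ≠ 0 := Complex.ofReal_ne_zero.mpr (hV.freq_pos j θ).ne'
    have hm : (bandMult V j θ : ℂ) ≠ 0 := Nat.cast_ne_zero.mpr (bandMult_pos j θ).ne'
    rw [h1]
    push_cast
    field_simp
  push_cast
  simp only [h2, currentSymbol, Finset.mul_sum, ← Finset.sum_neg_distrib]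
  refine ((Finset.sum_congr rfl fun a _ => Finset.sum_comm).trans Finset.sum_comm).trans ?_
  refine Finset.sum_congr rfl fun j _ => Finset.sum_congr rfl fun a _ => Finset.sum_congr rfl fun b _ => ?_
  linear_combination (-(bandMult V j θ : ℂ)⁻¹ * ((2 * freq V j θ : ℝ) : ℂ)⁻¹ *
    (signedQuadrant hk V c j θ : ℂ) * dVhat V l θ b a * bandProj V j θ a b) * Complex.I_mul_I


/-- The Lipschitz constant bounds the derivative where it exists, and `deriv` is zero elsewhere, so
the bound holds on the crossing set too. -/
lemma Admissible.exists_abs_pderiv_le (hV : Admissible V) :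
    ∃ K, 0 ≤ K ∧ ∀ l j θ, |pderiv l (freq V j) θ| ≤ K := by
  obtain ⟨K, hK0, hK⟩ := hV.exists_lipschitz
  refine ⟨K, hK0, fun l j θ => ?_⟩
  rw [← Real.norm_eq_abs]
  refine (norm_deriv_le_of_lipschitz (C := K.toNNReal) (LipschitzWith.of_dist_le_mul fun s t => ?_)).trans_eq
    (Real.coe_toNNReal K hK0)
  rw [Real.dist_eq, Real.coe_toNNReal K hK0]
  refine (hK j _ _).trans_eq ?_
  have h : Function.update θ l s - Function.update θ l t = Pi.single l (s - t) := by
    rw [← Function.update_sub]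
    simp [Pi.single]
  rw [h, Pi.norm_single, Real.dist_eq, Real.norm_eq_abs]

/-- Products of bounded measurable factors with a derivative of a dispersion relation. -/
lemma Admissible.integrable_mul_pderiv (hV : Admissible V) (l : Fin d) (j : Fin n)
    {f : (Fin d → ℝ) → ℝ} (hf : Measurable f) {B : ℝ} (hB : ∀ θ, |f θ| ≤ B) :
    Integrable (fun θ => f θ * pderiv l (freq V j) θ) (haarTorus d) := by
  obtain ⟨K, hK0, hK⟩ := hV.exists_abs_pderiv_le
  refine Integrable.of_bound (C := B * K)
    (hf.mul (hV.measurable_pderiv_freq l j)).aestronglyMeasurable (ae_of_all _ fun θ => ?_)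
  rw [Real.norm_eq_abs, abs_mul]
  exact mul_le_mul (hB θ) (hK l j θ) (abs_nonneg _) ((abs_nonneg _).trans (hB θ))

lemma abs_prod_sign_le {ι : Type*} (P : Finset ι) (f : ι → ℝ) : |∏ p ∈ P, Real.sign (f p)| ≤ 1 := by
  rw [Finset.abs_prod]
  refine Finset.prod_le_one (fun _ _ => abs_nonneg _) fun p _ => ?_
  rcases Real.sign_apply_eq (f p) with h | h | h <;> simp [h]

lemma measurable_sign : Measurable Real.sign := by
  unfold Real.sign
  exact Measurable.ite measurableSet_Iio measurable_const
    (Measurable.ite measurableSet_Ioi measurable_const measurable_const)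

/-- The product of the directions of the group velocity along some axes. -/
def signProd (hk : k ≤ d) (V : Lattice d → Matrix (Fin n) (Fin n) ℝ) (j : Fin n) (P : Finset (Fin k))
    (θ : Fin d → ℝ) : ℝ := ∏ p ∈ P, Real.sign (pderiv (Fin.castLE hk p) (freq V j) θ)

lemma Admissible.measurable_signProd (hV : Admissible V) (hk : k ≤ d) (j : Fin n) (P : Finset (Fin k)) :
    Measurable (signProd hk V j P) :=
  Finset.measurable_prod _ fun _ _ => measurable_sign.comp (hV.measurable_pderiv_freq _ j)

lemma coeff_eq (hk : k ≤ d) (l : Fin d) (P : Finset (Fin k)) :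
    coeff hk V l P = ∑ j, ∫ θ, signProd hk V j P θ * pderiv l (freq V j) θ ∂haarTorus d := by
  simp only [coeff, integral_haarTorus, smul_eq_mul, Finset.mul_sum, signProd]

lemma Admissible.integral_signedQuadrant (hV : Admissible V) (hk : k ≤ d) (c : Corner k) (l : Fin d) :
    ∫ θ, ∑ j, signedQuadrant hk V c j θ * pderiv l (freq V j) θ ∂haarTorus d =
      -2 * ((2 : ℝ) ^ k)⁻¹ * ∑ P : Finset (Fin k) with Odd P.card,
        coeff hk V l P * ∏ p ∈ P, cornerSign (c p) := by
  have hi : ∀ j P, Integrable (fun θ => signProd hk V j P θ * pderiv l (freq V j) θ) (haarTorus d) :=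
    fun j P => hV.integrable_mul_pderiv l j (hV.measurable_signProd hk j P)
      fun θ => abs_prod_sign_le P _
  have h1 : ∀ j, ∀ᵐ θ ∂haarTorus d, signedQuadrant hk V c j θ * pderiv l (freq V j) θ =
      -2 * ((2 : ℝ) ^ k)⁻¹ * ∑ P : Finset (Fin k) with Odd P.card,
        (∏ p ∈ P, cornerSign (c p)) * (signProd hk V j P θ * pderiv l (freq V j) θ) := fun j => by
    filter_upwards [ae_all_iff.mpr fun i : Fin k => haarTorus_ae (hV.ae_pderiv_ne_zero (Fin.castLE hk i) j)]
      with θ hθ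
    rw [signedQuadrant_eq hk c j hθ, mul_assoc, Finset.sum_mul]
    simp only [signProd, mul_assoc]
  rw [integral_finsetSum _ fun j _ => hV.integrable_mul_pderiv l j (hV.measurable_signedQuadrant hk c j)
    (abs_signedQuadrant_le hk c j)]
  have h2 : ∀ j, ∫ θ, signedQuadrant hk V c j θ * pderiv l (freq V j) θ ∂haarTorus d =
      -2 * ((2 : ℝ) ^ k)⁻¹ * ∑ P : Finset (Fin k) with Odd P.card, (∏ p ∈ P, cornerSign (c p)) *
        ∫ θ, signProd hk V j P θ * pderiv l (freq V j) θ ∂haarTorus d := fun j => by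
    rw [integral_congr_ae (h1 j), integral_const_mul, integral_finsetSum _ fun P _ => (hi j P).const_mul _]
    simp only [integral_const_mul]
  simp only [h2, coeff_eq, ← Finset.mul_sum]
  rw [Finset.sum_comm]
  congr 1
  refine Finset.sum_congr rfl fun P _ => ?_
  rw [← Finset.mul_sum, mul_comm]

/-- The current carried by the limiting covariance. -/
lemma half_sum_limCov_eq (hk : k ≤ d) (hV : Admissible V) (T : Corner k → ℝ) (l : Fin d) :
    1 / 2 * ∑ a, ∑ b, -∑' z : Lattice d, (z l : ℝ) * V z a b *
      limCov hk V T (coord (α := α) z (Sum.inr a)) (coord 0 (Sum.inl b)) = limitCurrent hk V T l := by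
  have hsum : ∀ a b, Summable fun z : Lattice d => ‖(z l : ℂ) * (V z a b : ℂ)‖ := fun a b =>
    (hV.summable_coord_mul l a b).congr fun z => by
      rw [norm_mul, Complex.norm_real, Complex.norm_intCast, Real.norm_eq_abs]
  have h1 : ∀ a b, HasSum (fun z : Lattice d => (z l : ℝ) * V z a b *
      limCov hk V T (coord (α := α) z (Sum.inr a)) (coord 0 (Sum.inl b)))
      (∑ c, (T c : ℂ) * ∫ θ, Complex.I * dVhat V l θ b a * currentSymbol hk V c a b θ ∂haarTorus d).re := by
    intro a b
    -- The limit covariance consists of Fourier coefficients of the symbol, so the sum over `z`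
    -- becomes the integral of the symbol against `i ∂_lV̂`, term by term.
    have h2 := hasSum_sum (s := Finset.univ) fun c _ => (hasSum_integral_fourierSum_mul (hsum a b)
      (hV.integrable_currentSymbol hk c a b)).mul_left (T c : ℂ)
    simp only [hV.fourierSum_coord_mul] at h2
    refine (Complex.hasSum_re h2).congr_fun fun z => ?_
    rw [limCov_coord hk hV, sub_zero, ← Complex.re_ofReal_mul]
    congr 1
    rw [Finset.mul_sum]
    refine Finset.sum_congr rfl fun c _ => ?_
    push_cast
    ring
  have h3 : ∀ a b c, Integrable (fun θ => -(Complex.I * dVhat V l θ b a * currentSymbol hk V c a b θ))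
      (haarTorus d) := fun a b c => by
    obtain ⟨B, hB⟩ : ∃ B, ∀ θ, ‖Complex.I * dVhat V l θ b a‖ ≤ B := by
      refine ⟨∑' z : Lattice d, ‖(z l : ℂ) * (V z a b : ℂ)‖, fun θ => ?_⟩
      rw [← hV.fourierSum_coord_mul]
      exact norm_fourierSum_le (hsum a b) θ
    refine ((hV.integrable_currentSymbol hk c a b).bdd_mul (c := B) ?_ (ae_of_all _ hB)).neg
    simp only [← hV.fourierSum_coord_mul]
    exact (continuous_fourierSum (hsum a b)).aestronglyMeasurable
  have h4 : ∀ c, ∑ a, ∑ b, -∫ θ, Complex.I * dVhat V l θ b a * currentSymbol hk V c a b θ ∂haarTorus d =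
      ((∫ θ, ∑ j, signedQuadrant hk V c j θ * pderiv l (freq V j) θ ∂haarTorus d : ℝ) : ℂ) := fun c => by
    rw [← integral_complex_ofReal]
    simp only [← integral_neg]
    simp only [← integral_finsetSum _ fun b _ => h3 _ b c]
    rw [← integral_finsetSum _ fun a _ => integrable_finsetSum _ fun b _ => h3 a b c]
    refine integral_congr_ae ?_
    filter_upwards [haarTorus_ae hV.ae_notMem_crossingSet] with θ hθ
    exact hV.sum_dVhat_mul_currentSymbol hk c l hθ
  simp only [(h1 _ _).tsum_eq, ← Complex.neg_re, ← Complex.re_sum, ← Finset.sum_neg_distrib]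
  have h5 : ∑ a, ∑ b, ∑ c, -((T c : ℂ) * ∫ θ, Complex.I * dVhat V l θ b a * currentSymbol hk V c a b θ
      ∂haarTorus d) = ((∑ c, T c * ∫ θ, ∑ j, signedQuadrant hk V c j θ * pderiv l (freq V j) θ
        ∂haarTorus d : ℝ) : ℂ) := by
    refine ((Finset.sum_congr rfl fun a _ => Finset.sum_comm).trans Finset.sum_comm).trans ?_
    push_cast
    refine Finset.sum_congr rfl fun c _ => ?_
    rw [← h4 c, Finset.mul_sum]
    refine Finset.sum_congr rfl fun a _ => ?_
    rw [Finset.mul_sum]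
    exact Finset.sum_congr rfl fun b _ => (mul_neg _ _).symm
  rw [h5, Complex.ofReal_re, limitCurrent, Finset.mul_sum, Finset.mul_sum]
  refine Finset.sum_congr rfl fun c _ => ?_
  rw [hV.integral_signedQuadrant]
  ring

end

section

/-! ### Convergence of the mean energy current -/

open PhaseSpace

variable {d n k : ℕ} {α : ℝ} {V : Lattice d → Matrix (Fin n) (Fin n) ℝ}

namespace IsInitialState

variable {hk : k ≤ d} {T : Corner k → ℝ} {ζ : Fin 2 → ℤ → ℝ} {Ω : Type*} [MeasurableSpace Ω]
  {P : Measure Ω} {Y : Corner k → Ω → PhaseSpace d n α} {Y₀ : Ω → PhaseSpace d n α}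
  {a : ℝ}

lemma exists_hasMomentBound (h : IsInitialState hk V T ζ P Y Y₀) (hV : Admissible V)
    (hα : α < -(d : ℝ) / 2) (hζ : IsCutoff a ζ) :
    ∃ C, ∀ t, HasMomentBound P (fun w => propagator V α t (Y₀ w)) C := by
  obtain ⟨C, hC⟩ := h.exists_integral_sq_le hV hα hζ
  exact ⟨C, fun t => ⟨h.measurable_propagator hζ t, fun x i => h.memLp_propagator hζ t _, hC t⟩⟩

/-- The bond sums with the limiting covariance give the limiting current. -/
lemma half_bond_sum_eq (h : IsInitialState hk V T ζ P Y Y₀) (hV : Admissible V)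
    (hα : α < -(d : ℝ) / 2) (hζ : IsCutoff a ζ) (l : Fin d) {x' : Lattice d} (hx : x' l = 0) :
    1 / 2 * ((∑' q : ℤ × Lattice d, exitInd q.1 (q.2 l) * bondMean V l x' (fun x y a b =>
        limCov hk V T (coord (α := α) x (Sum.inr a)) (coord y (Sum.inl b))) q) -
      ∑' q : ℤ × Lattice d, entryInd q.1 (q.2 l) * bondMean V l x' (fun x y a b =>
        limCov hk V T (coord (α := α) x (Sum.inr a)) (coord y (Sum.inl b))) q) =
      limitCurrent hk V T l := by
  obtain ⟨C, hC⟩ := h.exists_hasMomentBound hV hα hζ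
  -- The moment bound at finite times passes to the limit.
  have hr : ∀ z a b, |limCov hk V T (coord (α := α) z (Sum.inr a)) (coord 0 (Sum.inl b))| ≤ C :=
    fun z a b => le_of_tendsto (h.tendsto_integral_mul hV hα hζ _ _).abs
      (Eventually.of_forall fun t => (hC t).abs_integral_mul_le _ _ _ _)
  have he : (fun (x y : Lattice d) a b => limCov hk V T (coord (α := α) x (Sum.inr a)) (coord y (Sum.inl b))) =
      fun x y a b => limCov hk V T (coord (α := α) (x - y) (Sum.inr a)) (coord 0 (Sum.inl b)) := by
    funext x y a b
    rw [limCov_coord hk hV, limCov_coord hk hV, sub_zero]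
  rw [he, ← half_sum_limCov_eq (α := α) hk hV T l, ← tsum_bondMean hV l hx hr]

theorem tendsto_current (h : IsInitialState hk V T ζ P Y Y₀) (hV : Admissible V)
    (hα : α < -(d : ℝ) / 2) (hζ : IsCutoff a ζ) (l : Fin d) {x' : Lattice d} (hx : x' l = 0) :
    (∀ t, Integrable (fun w => current V l x' (propagator V α t (Y₀ w))) P) ∧
    Tendsto (fun t => ∫ w, current V l x' (propagator V α t (Y₀ w)) ∂P) atTop
      (𝓝 (limitCurrent hk V T l)) := by
  obtain ⟨C, hC⟩ := h.exists_hasMomentBound hV hα hζ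
  refine ⟨fun t => ((hC t).integrable_current hV l hx).1, ?_⟩
  simp only [((hC _).integrable_current hV l hx).2]
  rw [← h.half_bond_sum_eq hV hα hζ l hx]
  have hR : ∀ (t : ℝ) x y a b, |∫ w, coord x (Sum.inr a) (propagator V α t (Y₀ w)) *
      coord y (Sum.inl b) (propagator V α t (Y₀ w)) ∂P| ≤ C := fun t x y a b =>
    (hC t).abs_integral_mul_le _ _ _ _
  exact ((tendsto_tsum_bondMean hV l hx exitInd_nonneg hasSum_exitInd toNat_neg_le_abs hR
    fun x y a b => h.tendsto_integral_mul hV hα hζ _ _).sub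
    (tendsto_tsum_bondMean hV l hx entryInd_nonneg hasSum_entryInd toNat_le_abs hR
    fun x y a b => h.tendsto_integral_mul hV hα hζ _ _)).const_mul _

theorem integral_current_limit (h : IsInitialState hk V T ζ P Y Y₀) (hV : Admissible V)
    (hα : α < -(d : ℝ) / 2) (hζ : IsCutoff a ζ) {μ : Measure (PhaseSpace d n α)} [IsGaussian μ]
    (hμ : ∀ L L' : PhaseSpace d n α →L[ℝ] ℝ, ∫ Z, L Z * L' Z ∂μ = limCov hk V T L L') (l : Fin d)
    {x' : Lattice d} (hx : x' l = 0) :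
    Integrable (current V l x') μ ∧ ∫ Z, current V l x' Z ∂μ = limitCurrent hk V T l := by
  obtain ⟨C, hC⟩ := h.exists_integral_sq_le hV hα hζ
  have hm : HasMomentBound μ id C := by
    refine ⟨measurable_id, fun x i => IsGaussian.memLp_dual μ (coord x i) 2 (by norm_num), fun x i => ?_⟩
    simp only [id, sq, hμ]
    refine le_of_tendsto (h.tendsto_integral_mul hV hα hζ _ _) (Eventually.of_forall fun t => ?_)
    simp only [← sq]
    exact hC t x i
  obtain ⟨h1, h2⟩ := hm.integrable_current hV l hx
  refine ⟨h1, h2.trans ?_⟩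
  simp only [id, hμ]
  exact h.half_bond_sum_eq hV hα hζ l hx

end IsInitialState

end

section

/-! ### The symmetric case -/

open PhaseSpace

variable {d n k : ℕ} {V : Lattice d → Matrix (Fin n) (Fin n) ℝ}

lemma torusPeriodic_pderiv {f : (Fin d → ℝ) → ℝ} (hf : TorusPeriodic f) (l : Fin d) :
    TorusPeriodic (pderiv l f) := by
  intro θ m
  have h : (fun s => f (Function.update (shift2pi θ m) l s)) =
      fun s => f (Function.update θ l (s - 2 * Real.pi * m l)) := by
    funext s
    rw [← hf (Function.update θ l (s - 2 * Real.pi * m l)) m]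
    congr 1
    funext i
    by_cases hi : i = l
    · subst hi; simp [shift2pi]
    · simp [shift2pi, Function.update_of_ne hi]
  rw [pderiv, h, deriv_comp_sub_const (f := fun s => f (Function.update θ l s)), pderiv]
  congr 1
  simp [shift2pi]

lemma EvenIn.pderiv_self {f : (Fin d → ℝ) → ℝ} {i : Fin d} (hf : EvenIn f i) (θ : Fin d → ℝ) :
    pderiv i f (Function.update θ i (-θ i)) = -pderiv i f θ := by
  have h : (fun s => f (Function.update θ i s)) = fun s => f (Function.update θ i (-s)) := by
    funext s
    rw [← hf (Function.update θ i s)]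
    simp
  simp only [pderiv, Function.update_idem, Function.update_self]
  rw [h, deriv_comp_neg (f := fun s => f (Function.update θ i s)), neg_neg, ← h]

lemma EvenIn.pderiv_of_ne {f : (Fin d → ℝ) → ℝ} {i l : Fin d} (hf : EvenIn f i) (hl : l ≠ i)
    (θ : Fin d → ℝ) : pderiv l f (Function.update θ i (-θ i)) = pderiv l f θ := by
  have h : (fun s => f (Function.update (Function.update θ i (-θ i)) l s)) =
      fun s => f (Function.update θ l s) := by
    funext s
    rw [← hf (Function.update θ l s), Function.update_comm hl.symm, Function.update_of_ne hl.symm]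
  rw [pderiv, h, Function.update_of_ne hl, pderiv]

lemma EvenIn.signProd_of_forall_ne {hk : k ≤ d} {j : Fin n} {i : Fin d} (h : EvenIn (freq V j) i)
    {P : Finset (Fin k)} (hi : ∀ p ∈ P, Fin.castLE hk p ≠ i) (θ : Fin d → ℝ) :
    signProd hk V j P (Function.update θ i (-θ i)) = signProd hk V j P θ :=
  Finset.prod_congr rfl fun p hp => by rw [h.pderiv_of_ne (hi p hp)]

lemma EvenIn.signProd_of_mem {hk : k ≤ d} {j : Fin n} {i : Fin k} (h : EvenIn (freq V j) (Fin.castLE hk i))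
    {P : Finset (Fin k)} (hi : i ∈ P) (θ : Fin d → ℝ) :
    signProd hk V j P (Function.update θ (Fin.castLE hk i) (-θ (Fin.castLE hk i))) =
      -signProd hk V j P θ := by
  rw [signProd, signProd, ← Finset.mul_prod_erase _ _ hi, ← Finset.mul_prod_erase _ _ hi, h.pderiv_self,
    Real.sign_neg, neg_mul]
  congr 2
  refine Finset.prod_congr rfl fun p hp => ?_
  rw [h.pderiv_of_ne fun he => (Finset.mem_erase.mp hp).1 (Fin.castLE_injective hk he)]

/-- The contribution of one dispersion relation to a coefficient. -/
def bandCoeff (hk : k ≤ d) (V : Lattice d → Matrix (Fin n) (Fin n) ℝ) (l : Fin d) (P : Finset (Fin k))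
    (j : Fin n) : ℝ := ∫ θ, signProd hk V j P θ * pderiv l (freq V j) θ ∂haarTorus d

lemma Admissible.torusPeriodic_signProd (hV : Admissible V) (hk : k ≤ d) (j : Fin n) (P : Finset (Fin k)) :
    TorusPeriodic (signProd hk V j P) := fun θ m =>
  Finset.prod_congr rfl fun p _ => by rw [torusPeriodic_pderiv (hV.torusPeriodic_freq j)]

/-- A reflection of one coordinate preserves the measure of the torus, so an integrand odd under it
has integral zero. -/
lemma Admissible.bandCoeff_eq_zero_of_neg (hV : Admissible V) (hk : k ≤ d) {l i : Fin d}
    {P : Finset (Fin k)} {j : Fin n}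
    (h : ∀ θ, signProd hk V j P (Function.update θ i (-θ i)) *
      pderiv l (freq V j) (Function.update θ i (-θ i)) = -(signProd hk V j P θ * pderiv l (freq V j) θ)) :
    bandCoeff hk V l P j = 0 := by
  have h1 := integral_haarTorus_neg_coord (f := fun θ => signProd hk V j P θ * pderiv l (freq V j) θ)
    (fun θ m => congrArg₂ (· * ·) (hV.torusPeriodic_signProd hk j P θ m)
      (torusPeriodic_pderiv (hV.torusPeriodic_freq j) l θ m))
    ((hV.measurable_signProd hk j P).mul (hV.measurable_pderiv_freq l j)).stronglyMeasurable i
  simp only [h, integral_neg] at h1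
  rw [bandCoeff]
  linarith

lemma Admissible.bandCoeff_eq_zero_of_forall_ne (hV : Admissible V) (hk : k ≤ d) {l : Fin d}
    {P : Finset (Fin k)} {j : Fin n} (h : EvenIn (freq V j) l) (hl : ∀ p ∈ P, Fin.castLE hk p ≠ l) :
    bandCoeff hk V l P j = 0 :=
  hV.bandCoeff_eq_zero_of_neg hk (i := l) fun θ => by
    rw [h.signProd_of_forall_ne hl, h.pderiv_self, mul_neg]

lemma Admissible.bandCoeff_eq_zero_of_mem (hV : Admissible V) (hk : k ≤ d) {l : Fin d}
    {P : Finset (Fin k)} {j : Fin n} {i : Fin k} (h : EvenIn (freq V j) (Fin.castLE hk i)) (hi : i ∈ P)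
    (hl : l ≠ Fin.castLE hk i) : bandCoeff hk V l P j = 0 :=
  hV.bandCoeff_eq_zero_of_neg hk (i := Fin.castLE hk i) fun θ => by
    rw [h.signProd_of_mem hi, h.pderiv_of_ne hl, neg_mul]

/-- The symmetric difference of `P` and `{l}` has an even number of elements and is not empty; it
therefore contains an element other than `i₀`. Reflection in such a coordinate changes the sign of
exactly one factor of the integrand. -/
lemma exists_mem_symmDiff {P : Finset (Fin k)} (hP : Odd P.card) {l : Fin k} (hPl : P ≠ {l}) (i₀ : Fin k) :
    ∃ i, i ≠ i₀ ∧ (i ∈ P ∧ i ≠ l ∨ i ∉ P ∧ i = l) := by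
  by_contra! hcon
  by_cases hl : l ∈ P
  · have h1 : (P.erase l).card ≤ 1 := by
      rw [Finset.card_le_one]
      have key : ∀ a ∈ P.erase l, a = i₀ := fun a ha => by
        by_contra hne
        exact (Finset.mem_erase.mp ha).1 ((hcon a hne).1 (Finset.mem_erase.mp ha).2)
      intro a ha b hb
      rw [key a ha, key b hb]
    rw [Finset.card_erase_of_mem hl] at h1
    have h2 : P.card = 1 := by
      obtain ⟨m, hm⟩ := hP
      omega
    obtain ⟨x, rfl⟩ := Finset.card_eq_one.mp h2
    rw [Finset.mem_singleton.mp hl] at hPl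
    exact hPl rfl
  · have h1 : l = i₀ := by
      by_contra hne
      exact (hcon l hne).2 hl rfl
    obtain ⟨p, hp⟩ := Finset.card_pos.mp hP.pos
    have hpl : p ≠ l := fun h => hl (h ▸ hp)
    exact hpl ((hcon p (h1 ▸ hpl)).1 hp)

lemma Admissible.bandCoeff_eq_zero_of_evenInAllButOne (hV : Admissible V) (hk : k ≤ d) {l : Fin k}
    {P : Finset (Fin k)} {j : Fin n} (h : EvenInAllButOne hk (freq V j)) (hP : Odd P.card) (hPl : P ≠ {l}) :
    bandCoeff hk V (Fin.castLE hk l) P j = 0 := by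
  obtain ⟨i₀, h⟩ := h
  obtain ⟨i, hi, ⟨hiP, hil⟩ | ⟨hiP, rfl⟩⟩ := exists_mem_symmDiff hP hPl i₀
  · exact hV.bandCoeff_eq_zero_of_mem hk (h i hi) hiP fun he => hil (Fin.castLE_injective hk he).symm
  · exact hV.bandCoeff_eq_zero_of_forall_ne hk (h i hi) fun p hp he =>
      hiP (Fin.castLE_injective hk he ▸ hp)

/-- A factor that does not depend on `θ_l` does not correlate with a derivative in `θ_l`. -/
lemma integral_mul_pderiv_eq_zero {S f : (Fin d → ℝ) → ℝ} {l : Fin d} (hSm : Measurable S)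
    (hSp : TorusPeriodic S) (hS1 : ∀ θ, |S θ| ≤ 1) (hf : Continuous f) (hfp : TorusPeriodic f) {M K : ℝ}
    (hM : ∀ θ, |f θ| ≤ M) (hK : ∀ θ η, |f θ - f η| ≤ K * ‖θ - η‖)
    (hd : ∀ᵐ θ ∂haarTorus d, HasDerivAt (fun s => f (Function.update θ l s)) (pderiv l f θ) (θ l))
    (hinv : ∀ s : ℝ, ∀ᵐ θ ∂haarTorus d, S (θ + Pi.single l s) = S θ) :
    ∫ θ, S θ * pderiv l f θ ∂haarTorus d = 0 := by
  have hfm := hf.measurable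
  have hi : ∀ s : ℝ, Integrable (fun θ => S θ * f (θ + Pi.single l s)) (haarTorus d) := fun s => by
    refine Integrable.of_bound (C := 1 * M)
      (hSm.mul (hfm.comp (measurable_add_const _))).aestronglyMeasurable (ae_of_all _ fun θ => ?_)
    rw [norm_mul]
    exact mul_le_mul (hS1 _) (hM _) (norm_nonneg _) zero_le_one
  -- Translating the whole integrand along `e_l` is free, and `S` does not notice the translation,
  -- so only `f` is moved.
  have h1 : ∀ s : ℝ, ∫ θ, S θ * f (θ + Pi.single l s) ∂haarTorus d = ∫ θ, S θ * f θ ∂haarTorus d :=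
    fun s => by
      rw [← integral_haarTorus_add (f := fun θ => S θ * f θ)
        (fun θ m => congrArg₂ (· * ·) (hSp θ m) (hfp θ m)) (hSm.mul hfm).stronglyMeasurable (Pi.single l s)]
      refine integral_congr_ae ?_
      filter_upwards [hinv s] with θ hθ
      rw [hθ]
  have h2 : ∀ s : ℝ, ∫ θ, S θ * (s⁻¹ * (f (θ + Pi.single l s) - f θ)) ∂haarTorus d = 0 := fun s => by
    have h3 : ∀ θ, S θ * (s⁻¹ * (f (θ + Pi.single l s) - f θ)) =
        s⁻¹ * (S θ * f (θ + Pi.single l s) - S θ * f θ) := fun θ => by ring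
    have hi0 : Integrable (fun θ => S θ * f θ) (haarTorus d) := by simpa using hi 0
    simp only [h3]
    rw [integral_const_mul, integral_sub (hi s) hi0, h1, sub_self, mul_zero]
  -- Integration by parts is replaced by difference quotients with step `1/(m+1)`, dominated by the
  -- Lipschitz constant. Invariance of `S` is needed only almost everywhere for each shift, so its
  -- behaviour on the crossing set is irrelevant.
  have h4 : Tendsto (fun m : ℕ => ∫ θ, S θ * (((1 : ℝ) / (m + 1))⁻¹ *
      (f (θ + Pi.single l ((1 : ℝ) / (m + 1))) - f θ)) ∂haarTorus d)
      atTop (𝓝 (∫ θ, S θ * pderiv l f θ ∂haarTorus d)) := by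
    refine tendsto_integral_of_dominated_convergence (fun _ => 1 * K) (fun m => ?_) (integrable_const _)
      (fun m => ae_of_all _ fun θ => ?_) ?_
    · exact (hSm.mul (((hfm.comp (measurable_add_const _)).sub hfm).const_mul _)).aestronglyMeasurable
    · rw [norm_mul, norm_mul]
      refine mul_le_mul (hS1 _) ?_ (by positivity) zero_le_one
      have h5 := hK (θ + Pi.single l ((1 : ℝ) / (m + 1))) θ
      rw [add_sub_cancel_left, Pi.norm_single] at h5
      have h6 : (0 : ℝ) < ‖(1 : ℝ) / (m + 1)‖ := norm_pos_iff.mpr (by positivity)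
      rw [norm_inv, inv_mul_le_iff₀ h6, mul_comm]
      exact h5
    · filter_upwards [hd] with θ hθ
      refine Tendsto.const_mul _ ?_
      have h5 := hasDerivAt_iff_tendsto_slope_zero.mp hθ
      have h6 : Tendsto (fun m : ℕ => (1 : ℝ) / (m + 1)) atTop (𝓝[≠] 0) :=
        tendsto_nhdsWithin_iff.mpr ⟨tendsto_one_div_add_atTop_nhds_zero_nat,
          Eventually.of_forall fun m => (by positivity : (1 : ℝ) / (m + 1) ≠ 0)⟩
      refine (h5.comp h6).congr fun m => ?_
      simp only [Function.comp, smul_eq_mul, Function.update_eq_self]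
      congr 3
      funext i
      by_cases hi : i = l
      · subst hi; simp
      · simp [Function.update_of_ne hi, Pi.single_eq_of_ne hi]
  simp only [h2] at h4
  exact (tendsto_nhds_unique h4 tendsto_const_nhds)

lemma ae_add_right {p : (Fin d → ℝ) → Prop} (h : ∀ᵐ θ, p θ) (η : Fin d → ℝ) : ∀ᵐ θ, p (θ + η) :=
  (measurePreserving_add_right (volume : Measure (Fin d → ℝ)) η).quasiMeasurePreserving.ae h

lemma Admissible.bandCoeff_eq_zero_of_sign (hV : Admissible V) (hk : k ≤ d) {l : Fin d}
    {P : Finset (Fin k)} {j : Fin n}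
    (h : ∀ p : Fin k, ∃ g : ℝ → ℝ, ∀ θ ∈ (crossingSet V)ᶜ,
      Real.sign (pderiv (Fin.castLE hk p) (freq V j) θ) = g (θ (Fin.castLE hk p)))
    (hl : ∀ p ∈ P, Fin.castLE hk p ≠ l) : bandCoeff hk V l P j = 0 := by
  choose g hg using h
  obtain ⟨K, -, hK⟩ := hV.exists_lipschitz
  obtain ⟨M, -, hM⟩ := hV.exists_freq_upper
  have hM' : ∀ θ, |freq V j θ| ≤ M := fun θ => (abs_of_pos (hV.freq_pos j θ)).trans_le (hM j θ)
  have hS : ∀ θ, |signProd hk V j P θ| ≤ 1 := fun θ => abs_prod_sign_le P _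
  refine integral_mul_pderiv_eq_zero (hV.measurable_signProd hk j P) (hV.torusPeriodic_signProd hk j P)
    hS (hV.continuous_freq j) (hV.torusPeriodic_freq j) hM' (hK j) ?_ fun s => ?_
  · filter_upwards [haarTorus_ae hV.ae_notMem_crossingSet] with θ hθ
    exact hV.hasDerivAt_freq hθ l j
  · have h1 := ae_add_right hV.ae_notMem_crossingSet (Pi.single l s)
    filter_upwards [haarTorus_ae h1, haarTorus_ae hV.ae_notMem_crossingSet] with θ h1 h2
    refine Finset.prod_congr rfl fun p hp => ?_
    rw [hg p _ h1, hg p _ h2, Pi.add_apply, Pi.single_eq_of_ne (hl p hp), add_zero]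

/-- In (a) the case `k = 1` is empty, since the only odd `P` is `{l}`; in (b) the exceptional
variable may be chosen at will. In (c), if `l ∈ P` then `P ≠ {l}` forces at least three elements and
hence `k ≥ 3`, so a reflection works; if `l ∉ P` the sign product does not depend on `θ_l`. -/
lemma SymmetryConditions.bandCoeff_eq_zero {hk : k ≤ d} (h : SymmetryConditions hk V) (hV : Admissible V)
    {l : Fin k} {P : Finset (Fin k)} (hP : Odd P.card) (hPl : P ≠ {l}) (j : Fin n) :
    bandCoeff hk V (Fin.castLE hk l) P j = 0 := by
  have hcard : P.card ≤ k := (Finset.card_le_univ P).trans_eq (Fintype.card_fin k)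
  rcases h with h | h | h
  · refine hV.bandCoeff_eq_zero_of_evenInAllButOne hk ((h j).2 ?_) hP hPl
    by_contra hlt
    have hk1 : k = 1 := by have := l.pos; omega
    subst hk1
    obtain ⟨p, hp⟩ := Finset.card_pos.mp hP.pos
    exact hPl (Finset.eq_singleton_iff_unique_mem.mpr
      ⟨Subsingleton.elim p l ▸ hp, fun x _ => Subsingleton.elim x l⟩)
  · exact hV.bandCoeff_eq_zero_of_evenInAllButOne hk ⟨l, fun i _ => h j i⟩ hP hPl
  · by_cases hl : l ∈ P
    · refine hV.bandCoeff_eq_zero_of_evenInAllButOne hk ((h j).2 (le_trans ?_ hcard)) hP hPl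
      by_contra hlt
      obtain ⟨m, hm⟩ := hP
      obtain ⟨x, rfl⟩ := Finset.card_eq_one.mp (show P.card = 1 by omega)
      exact hPl (by rw [Finset.mem_singleton.mp hl])
    · exact hV.bandCoeff_eq_zero_of_sign hk (h j).1 fun p hp he => hl (Fin.castLE_injective hk he ▸ hp)

/-- No sign factor involves `θ_l` itself. In (a) reflection in `θ_l` reverses only the derivative,
in (b) reflection in any `p ∈ P` reverses only one sign, and in (c) the sign product is constant
along `e_l`. -/
lemma SymmetryConditions.bandCoeff_eq_zero_of_le {hk : k ≤ d} (h : SymmetryConditions hk V)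
    (hV : Admissible V) {l : Fin d} (hl : k ≤ (l : ℕ)) {P : Finset (Fin k)} (hP : Odd P.card) (j : Fin n) :
    bandCoeff hk V l P j = 0 := by
  have hne : ∀ p : Fin k, Fin.castLE hk p ≠ l := fun p he => by
    have := p.isLt
    have := congrArg Fin.val he
    simp at this
    omega
  rcases h with h | h | h
  · exact hV.bandCoeff_eq_zero_of_forall_ne hk ((h j).1 l hl) fun p _ => hne p
  · obtain ⟨p, hp⟩ := Finset.card_pos.mp hP.pos
    exact hV.bandCoeff_eq_zero_of_mem hk (h j p) hp (hne p).symm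
  · exact hV.bandCoeff_eq_zero_of_sign hk (h j).1 fun p _ => hne p

lemma coeff_eq_sum_bandCoeff (hk : k ≤ d) (l : Fin d) (P : Finset (Fin k)) :
    coeff hk V l P = ∑ j, bandCoeff hk V l P j := coeff_eq hk l P

lemma sign_mul_self_eq_abs (r : ℝ) : Real.sign r * r = |r| := by
  rcases lt_trichotomy r 0 with h | rfl | h
  · rw [Real.sign_of_neg h, abs_of_neg h, neg_one_mul]
  · simp
  · rw [Real.sign_of_pos h, abs_of_pos h, one_mul]

lemma coeffDiag_eq (l : Fin d) : coeffDiag V l = ∑ j, ∫ θ, |pderiv l (freq V j) θ| ∂haarTorus d := by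
  simp only [coeffDiag, integral_haarTorus, smul_eq_mul, Finset.mul_sum]

lemma coeff_singleton (hk : k ≤ d) (l : Fin k) : coeff hk V (Fin.castLE hk l) {l} =
    coeffDiag V (Fin.castLE hk l) := by
  simp only [coeff, coeffDiag, Finset.prod_singleton, sign_mul_self_eq_abs]

/-- A vanishing integral of `|∂_lω_j|` would force the derivative to vanish almost everywhere,
against the dispersion hypothesis; `1 ≤ n` provides at least one band. -/
lemma Admissible.coeffDiag_pos (hV : Admissible V) (hn : 1 ≤ n) (l : Fin d) : 0 < coeffDiag V l := by
  rw [coeffDiag_eq]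
  obtain ⟨K, -, hK⟩ := hV.exists_abs_pderiv_le
  refine Finset.sum_pos (fun j _ => ?_) ⟨⟨0, hn⟩, Finset.mem_univ _⟩
  refine lt_of_le_of_ne (integral_nonneg fun _ => abs_nonneg _) fun h0 => ?_
  have hi : Integrable (fun θ => |pderiv l (freq V j) θ|) (haarTorus d) :=
    (Integrable.of_bound (C := K) (hV.measurable_pderiv_freq l j).aestronglyMeasurable
      (ae_of_all _ fun θ => hK l j θ)).abs
  have h1 := (integral_eq_zero_iff_of_nonneg (fun _ => abs_nonneg _) hi).mp h0.symm
  have h2 : ∀ᵐ _θ ∂haarTorus d, False := by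
    filter_upwards [h1, haarTorus_ae (hV.ae_pderiv_ne_zero l j)] with θ h3 h4
    exact h4 (abs_eq_zero.mp h3)
  exact h2.exists.elim fun _ h => h

/-- Only `P = {l}` survives, with coefficient `c_l`; the remaining corner sign splits the sum over
corners into the two faces `n_l = 2` and `n_l = 1`. -/
lemma SymmetryConditions.limitCurrent_eq {hk : k ≤ d} (h : SymmetryConditions hk V) (hV : Admissible V)
    (T : Corner k → ℝ) (l : Fin k) : limitCurrent hk V T (Fin.castLE hk l) =
      -coeffDiag V (Fin.castLE hk l) * ((2 : ℝ) ^ k)⁻¹ * (faceSum T l 1 - faceSum T l 0) := by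
  have h1 : ∀ c : Corner k, ∑ P : Finset (Fin k) with Odd P.card,
      coeff hk V (Fin.castLE hk l) P * ∏ p ∈ P, cornerSign (c p) =
      coeffDiag V (Fin.castLE hk l) * cornerSign (c l) := fun c => by
    rw [Finset.sum_eq_single {l}]
    · rw [coeff_singleton, Finset.prod_singleton]
    · intro P hP hPl
      rw [coeff_eq_sum_bandCoeff, Finset.sum_eq_zero fun j _ =>
        h.bandCoeff_eq_zero hV (Finset.mem_filter.mp hP).2 hPl j, zero_mul]
    · intro hne
      exact absurd (Finset.mem_filter.mpr ⟨Finset.mem_univ _, by simp⟩) hne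
  have h2 : faceSum T l 1 - faceSum T l 0 = ∑ c : Corner k, T c * cornerSign (c l) := by
    rw [faceSum, faceSum, Finset.sum_filter, Finset.sum_filter, ← Finset.sum_sub_distrib]
    refine Finset.sum_congr rfl fun c _ => ?_
    rcases Fin.exists_fin_two.mp ⟨c l, rfl⟩ with hc | hc <;> simp [show c l = _ from hc, cornerSign]
  simp only [limitCurrent, h1, h2, Finset.mul_sum]
  exact Finset.sum_congr rfl fun c _ => by ring

lemma SymmetryConditions.limitCurrent_eq_zero {hk : k ≤ d} (h : SymmetryConditions hk V)
    (hV : Admissible V) (T : Corner k → ℝ) {l : Fin d} (hl : k ≤ (l : ℕ)) : limitCurrent hk V T l = 0 := by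
  rw [limitCurrent, Finset.sum_eq_zero, mul_zero]
  intro c _
  rw [Finset.sum_eq_zero, mul_zero]
  intro P hP
  rw [coeff_eq_sum_bandCoeff, Finset.sum_eq_zero fun j _ =>
    h.bandCoeff_eq_zero_of_le hV hl (Finset.mem_filter.mp hP).2 j, zero_mul]

end

end HarmonicCrystal

end

/-! ### The main theorem, assembled after replacing the flow by the propagator. -/

theorem mainTheorem4 {d n k : ℕ} (hn : 1 ≤ n) (hk1 : 1 ≤ k) (hk : k ≤ d)
    {α : ℝ} (hα : α < -(d : ℝ) / 2)
    (V : HarmonicCrystal.Lattice d → Matrix (Fin n) (Fin n) ℝ)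
    (hV : HarmonicCrystal.Admissible V)
    (T : HarmonicCrystal.Corner k → ℝ) (hT : ∀ c, 0 < T c)
    {a : ℝ} (ha : 0 < a) (ζ : Fin 2 → ℤ → ℝ) (hζ : HarmonicCrystal.IsCutoff a ζ)
    {Ω : Type*} [MeasurableSpace Ω] (P : Measure Ω) [IsProbabilityMeasure P]
    -- the independent reservoirs
    (Y : HarmonicCrystal.Corner k → Ω → HarmonicCrystal.PhaseSpace d n α)
    (hYm : ∀ c, Measurable (Y c)) (hYi : iIndepFun Y P)
    (hYg : ∀ c, HarmonicCrystal.IsGibbs V (T c) (P.map (Y c)))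
    -- the initial state
    (Y₀ : Ω → HarmonicCrystal.PhaseSpace d n α)
    (hu : ∀ w x, (Y₀ w).u x = ∑ c, HarmonicCrystal.cutoffProd hk ζ c x • (Y c w).u x)
    (hv : ∀ w x, (Y₀ w).v x = ∑ c, HarmonicCrystal.cutoffProd hk ζ c x • (Y c w).v x) :
    -- convergence of the mean energy current
    (∀ (l : Fin d) (x' : HarmonicCrystal.Lattice d), x' l = 0 →
      (∀ t : ℝ, Integrable
        (fun w => HarmonicCrystal.current V l x' (HarmonicCrystal.flow V t (Y₀ w))) P) ∧
      Tendsto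
        (fun t : ℝ => ∫ w, HarmonicCrystal.current V l x' (HarmonicCrystal.flow V t (Y₀ w)) ∂P)
        atTop (𝓝 (HarmonicCrystal.limitCurrent hk V T l))) ∧
    -- the stationary state that carries this current
    (∃ μ : Measure (HarmonicCrystal.PhaseSpace d n α),
      IsProbabilityMeasure μ ∧ IsGaussian μ ∧
      (∀ f : BoundedContinuousFunction (HarmonicCrystal.PhaseSpace d n α) ℝ,
        Tendsto (fun t : ℝ => ∫ w, f (HarmonicCrystal.flow V t (Y₀ w)) ∂P)
          atTop (𝓝 (∫ Z, f Z ∂μ))) ∧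
      (∀ t : ℝ, μ.map (HarmonicCrystal.flow V t) = μ) ∧
      ∀ (l : Fin d) (x' : HarmonicCrystal.Lattice d), x' l = 0 →
        Integrable (HarmonicCrystal.current V l x') μ ∧
        ∫ Z, HarmonicCrystal.current V l x' Z ∂μ = HarmonicCrystal.limitCurrent hk V T l) ∧
    -- the formula under the symmetry conditions; heat flows from hot to cold
    (HarmonicCrystal.SymmetryConditions hk V →
      (∀ l : Fin k,
        0 < HarmonicCrystal.coeffDiag V (Fin.castLE hk l) ∧
        HarmonicCrystal.limitCurrent hk V T (Fin.castLE hk l) =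
          -HarmonicCrystal.coeffDiag V (Fin.castLE hk l) * ((2 : ℝ) ^ k)⁻¹ *
            (HarmonicCrystal.faceSum T l 1 - HarmonicCrystal.faceSum T l 0) ∧
        (HarmonicCrystal.faceSum T l 0 < HarmonicCrystal.faceSum T l 1 →
          HarmonicCrystal.limitCurrent hk V T (Fin.castLE hk l) < 0) ∧
        (HarmonicCrystal.faceSum T l 1 < HarmonicCrystal.faceSum T l 0 →
          0 < HarmonicCrystal.limitCurrent hk V T (Fin.castLE hk l))) ∧
      ∀ l : Fin d, k ≤ (l : ℕ) → HarmonicCrystal.limitCurrent hk V T l = 0) := by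
  have hstate : HarmonicCrystal.IsInitialState hk V T ζ P Y Y₀ := ⟨hYm, hYi, hYg, hu, hv⟩
  have hα0 : α < 0 := hα.trans_le (by
    have : (0 : ℝ) ≤ d := Nat.cast_nonneg d
    linarith)
  have hflow : ∀ t, HarmonicCrystal.flow V t = HarmonicCrystal.propagator V α t := fun t =>
    hV.flow_eq hα0 t
  simp only [hflow]
  refine ⟨fun l x' hx => hstate.tendsto_current hV hα hζ l hx, ?_, fun hS => ⟨fun l => ?_, fun l hl =>
    hS.limitCurrent_eq_zero hV T hl⟩⟩
  · obtain ⟨μ, h1, h2, h3, h4, h5⟩ := hstate.exists_limit hV hα hζ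
    exact ⟨μ, h1, h2, h3, h4, fun l x' hx => hstate.integral_current_limit hV hα hζ h5 l hx⟩
  · have hpos := hV.coeffDiag_pos hn (Fin.castLE hk l)
    have h2k : (0 : ℝ) < ((2 : ℝ) ^ k)⁻¹ := by positivity
    have heq := hS.limitCurrent_eq hV T l
    refine ⟨hpos, heq, fun hlt => ?_, fun hlt => ?_⟩
    · rw [heq, neg_mul, neg_mul, neg_neg_iff_pos]
      exact mul_pos (mul_pos hpos h2k) (sub_pos.mpr hlt)
    · rw [heq, neg_mul, neg_mul, ← mul_neg, neg_sub]
      exact mul_pos (mul_pos hpos h2k) (sub_pos.mpr hlt)
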